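/- Let $M$ be a smooth manifold and $A\to M$ a Lie algebroid with anchor $\rho$. Let $\partial:C\to E$ be a homomorphism of smooth vector bundles over $M$ and let $(\nabla^E,\nabla^C,\omega)$ be a $2$-term representation up to homotopy of $A$ on $\mathcal E=(\partial:C\to E)$: $\nabla^E,\nabla^C$ are $A$-connections and $\omega\in\Omega^2(A,\mathrm{Hom}(E,C))$, with $\partial\circ\nabla^C=\nabla^E\circ\partial$, $\partial\circ\omega=\omega^E$, $\omega\circ\partial=\omega^C$ and $\nabla\omega=0$, where $\omega^E,\omega^C$ denote the curvatures $[\nabla_\alpha,\nabla_\beta]-\nabla_{[\alpha,\beta]}$. Put $I=[0,1]$. An $A$-path from $x$ to $y$ is a Lie algebroid morphism $a\,dt:TI\to A$ whose base path goes from $x$ to $y$. An $A$-homotopy $\sigma:a_0\Rightarrow a_1$ between $A$-paths from $x$ to $y$ is a Lie algebroid morphism $\sigma=a\,dt+b\,ds:TI^2\to A$ that restricts to $a_0\,dt$ at $s=0$ and to $a_1\,dt$ at $s=1$, with $b=0$ at $t=0,1$; it is thin if $\wedge^2\sigma=0$. Let $P_1(A)$ be the set of $A$-paths modulo thin homotopy.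 Let $P_2(A)$ be the set of $A$-homotopies modulo $3$-homotopy, that is, modulo the equivalence relation generated by Lie algebroid morphisms $H=H_1\,dt+H_2\,ds+H_3\,du:TI^3\to A$ joining the $A$-homotopies $(H_1\,dt+H_2\,ds)|_{u=0}$ and $(H_1\,dt+H_2\,ds)|_{u=1}$, with $H_3=0$ at $t=0,1$, and whose restrictions to the faces $s=0$ and $s=1$ are thin homotopies. The source and target of a path are denoted by $s,t$; for $\sigma:a_0\Rightarrow a_1$ put $s_V(\sigma)=a_0$, $t_V(\sigma)=a_1$, $s_H=s\circ s_V$, $t_H=t\circ s_V$. Products $a_1\cdot a_0$ of composable paths and horizontal products $\sigma'\bullet_H\sigma$ are given by concatenation in $t$ (first $a_0$, resp. $\sigma$), vertical products $\sigma'\bullet_V\sigma$ by concatenation in $s$ (first $\sigma$), of representatives whose concatenation is smooth. The unit path at $x$ is $1_x=0_x\,dt$, and $a^{-1}(t)=-a(1-t)$; the vertical unit at $a$ is $1^V_a=a(t)\,dt+0\,ds$, $\sigma^{-1_V}=a(t,1-s)\,dt-b(t,1-s)\,ds$, and $\sigma^{-1_H}=-a(1-t,s)\,dt+b(1-t,s)\,ds$.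 For an $A$-path $a$ from $x$ to $y$ let $\mathrm{hol}^E_a:E_x\to E_y$ and $\mathrm{hol}^C_a:C_x\to C_y$ be the parallel transports of $\nabla^E$ and $\nabla^C$ along $a$, and for an $A$-homotopy $\sigma=a\,dt+b\,ds$ over $\gamma:I^2\to M$ between paths from $x$ to $y$ put $$\mathrm{hol}(\sigma)=\int_0^1\!\!\int_0^1 \mathrm{hol}^C_{a^s_{1,t}}\circ\omega(a,b)_{\gamma(t,s)}\circ\mathrm{hol}^E_{a^s_{t,0}}\,dt\,ds\in\mathrm{Hom}(E_x,C_y),$$ where $a^s_{t',t}$ is the path $a(\cdot,s)\,dt$ followed from time $t$ to time $t'$. Then the following formulas, applied to representatives, are well defined and define a strict $2$-groupoid $2\text{-}P(A)\ltimes\mathcal E$, that is: $1$-morphisms form a groupoid over objects, $2$-morphisms form a groupoid over $1$-morphisms (vertically) and over objects (horizontally), and horizontal composition is compatible with vertical sources, targets and units and satisfies the interchange law with vertical composition. * Objects: the total space of $E$. * $1$-morphisms: $t^*C\oplus s^*E$ over $P_1(A)$, i.e. triples $(c,a,e)$ with $a\in P_1(A)$, $c\in C_{t(a)}$, $e\in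 E_{s(a)}$, with $\tilde s(c,a,e)=e$, $\tilde t(c,a,e)=\mathrm{hol}^E_a(e)+\partial c$, unit $(0,1_x,e)$ at $e\in E_x$, $(c_1,a_1,e_1)\cdot(c_0,a_0,e_0)=(c_1+\mathrm{hol}^C_{a_1}(c_0),a_1\cdot a_0,e_0)$ when $e_1=\mathrm{hol}^E_{a_0}(e_0)+\partial c_0$, and $(c,a,e)^{-1}=(-\mathrm{hol}^C_{a^{-1}}(c),a^{-1},\mathrm{hol}^E_a(e)+\partial c)$. * $2$-morphisms: $t_H^*C\oplus s_H^*E$ over $P_2(A)$, i.e. triples $(c,\sigma,e)$ with $\sigma\in P_2(A)$, $c\in C_{t_H(\sigma)}$, $e\in E_{s_H(\sigma)}$. * Vertical structure: $\tilde s_V(c,\sigma,e)=(c,s_V(\sigma),e)$, $\tilde t_V(c,\sigma,e)=(c-\mathrm{hol}(\sigma)e,t_V(\sigma),e)$, unit $(c,1^V_a,e)$ at $(c,a,e)$, $(c_2,\sigma_2,e_2)\bullet_V(c_1,\sigma_1,e_1)=(c_1,\sigma_2\bullet_V\sigma_1,e_1)$ when $\tilde s_V(c_2,\sigma_2,e_2)=\tilde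 t_V(c_1,\sigma_1,e_1)$, and $(c,\sigma,e)^{-1_V}=(c-\mathrm{hol}(\sigma)e,\sigma^{-1_V},e)$. * Horizontal structure: $\tilde s_H(c,\sigma,e)=e$, $\tilde t_H(c,\sigma,e)=\mathrm{hol}^E_{s_V(\sigma)}(e)+\partial c$, unit $(0,0_x\,dt+0_x\,ds,e)$ at $e\in E_x$, $(c,\sigma,e)\bullet_H(b,\tau,f)=(c+\mathrm{hol}^C_{s_V(\sigma)}(b),\sigma\bullet_H\tau,f)$ when $e=\mathrm{hol}^E_{s_V(\tau)}(f)+\partial b$, and $(c,\sigma,e)^{-1_H}=(-\mathrm{hol}^C_{s_V(\sigma)^{-1}}(c),\sigma^{-1_H},\mathrm{hol}^E_{s_V(\sigma)}(e)+\partial c)$. Moreover this is the only strict $2$-groupoid structure on these sets satisfying these formulas. -/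

import Mathlib

open Bundle Manifold Set
open scoped ContDiff

noncomputable section

namespace TwoGroupoid

/-! ### Strict 2-groupoids -/

/-- A groupoid with set of arrows `G` over the set of objects `X`; `comp g h` is `g · h`, "first `h`,
then `g`", and is defined when `src g = tgt h`. -/
structure GroupoidOn (X G : Type*) where
  src : G → X
  tgt : G → X
  one : X → G
  inv : G → G
  comp : (g h : G) → src g = tgt h → G
  src_one : ∀ x, src (one x) = x
  tgt_one : ∀ x, tgt (one x) = x
  src_comp : ∀ g h p, src (comp g h p) = src h
  tgt_comp : ∀ g h p, tgt (comp g h p) = tgt g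
  src_inv : ∀ g, src (inv g) = tgt g
  tgt_inv : ∀ g, tgt (inv g) = src g
  assoc : ∀ f g h p q p' q', comp (comp f g p) h q = comp f (comp g h p') q'
  one_comp : ∀ g p, comp (one (tgt g)) g p = g
  comp_one : ∀ g p, comp g (one (src g)) p = g
  inv_comp : ∀ g p, comp (inv g) g p = one (src g)
  comp_inv : ∀ g p, comp g (inv g) p = one (tgt g)

/-- A strict 2-groupoid with set of objects `G₀`, of 1-morphisms `G₁`, and of 2-morphisms `G₂`:
`G₁` is a groupoid over `G₀`, while `G₂` is a groupoid over `G₁` (vertically) and over `G₀`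
(horizontally), and horizontal composition is functorial for the vertical structure. -/
structure Strict2Groupoid (G₀ G₁ G₂ : Type*) where
  cells : GroupoidOn G₀ G₁
  vert : GroupoidOn G₁ G₂
  horiz : GroupoidOn G₀ G₂
  horiz_src : ∀ σ, horiz.src σ = cells.src (vert.src σ)
  horiz_src' : ∀ σ, horiz.src σ = cells.src (vert.tgt σ)
  horiz_tgt : ∀ σ, horiz.tgt σ = cells.tgt (vert.src σ)
  horiz_tgt' : ∀ σ, horiz.tgt σ = cells.tgt (vert.tgt σ)
  vert_src_comp : ∀ σ τ p q,
    vert.src (horiz.comp σ τ p) = cells.comp (vert.src σ) (vert.src τ) q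
  vert_tgt_comp : ∀ σ τ p q,
    vert.tgt (horiz.comp σ τ p) = cells.comp (vert.tgt σ) (vert.tgt τ) q
  horiz_one : ∀ x, horiz.one x = vert.one (cells.one x)
  horiz_comp_one : ∀ g h p q,
    horiz.comp (vert.one g) (vert.one h) p = vert.one (cells.comp g h q)
  interchange : ∀ σ₄ σ₃ σ₂ σ₁ p q r p' q' r',
    horiz.comp (vert.comp σ₄ σ₃ p) (vert.comp σ₂ σ₁ q) r
      = vert.comp (horiz.comp σ₄ σ₂ p') (horiz.comp σ₃ σ₁ q') r'

/-! ### Sections of vector bundles, Lie algebroids, connections -/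

section Bundles

variable {EM : Type*} [NormedAddCommGroup EM] [NormedSpace ℝ EM]
  {M : Type*} [TopologicalSpace M] [ChartedSpace EM M]

/-- Smooth sections of a vector bundle `V → M` with model fibre `F`. -/
abbrev Sec (EM : Type*) [NormedAddCommGroup EM] [NormedSpace ℝ EM]
    {M : Type*} [TopologicalSpace M] [ChartedSpace EM M]
    (F : Type*) [NormedAddCommGroup F] [NormedSpace ℝ F]
    (V : M → Type*) [TopologicalSpace (TotalSpace F V)]
    [∀ x, TopologicalSpace (V x)] [FiberBundle F V] : Type _ :=
  ContMDiffSection 𝓘(ℝ, EM) F ∞ V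

/-- Smooth sections of the dual bundle `V* → M`. -/
abbrev DualSec (EM : Type*) [NormedAddCommGroup EM] [NormedSpace ℝ EM]
    {M : Type*} [TopologicalSpace M] [ChartedSpace EM M]
    (F : Type*) [NormedAddCommGroup F] [NormedSpace ℝ F]
    (V : M → Type*) [TopologicalSpace (TotalSpace F V)]
    [∀ x, AddCommGroup (V x)] [∀ x, Module ℝ (V x)]
    [∀ x, TopologicalSpace (V x)] [FiberBundle F V] [VectorBundle ℝ F V] : Type _ :=
  ContMDiffSection 𝓘(ℝ, EM) (F →L[ℝ] ℝ) ∞ (fun x : M => V x →L[ℝ] ℝ)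

/-- The derivative `v(f)` of a function `f` on `M` in the direction of a tangent vector `v`. -/
def dirDeriv (f : M → ℝ) {x : M} (v : TangentSpace 𝓘(ℝ, EM) x) : ℝ :=
  mfderiv 𝓘(ℝ, EM) 𝓘(ℝ, ℝ) f x v

variable {F : Type*} [NormedAddCommGroup F] [NormedSpace ℝ F]
  {V : M → Type*} [TopologicalSpace (TotalSpace F V)]
  [∀ x, AddCommGroup (V x)] [∀ x, Module ℝ (V x)]
  [∀ x, TopologicalSpace (V x)] [FiberBundle F V] [VectorBundle ℝ F V]

/-- The product `f α` of a smooth function and a smooth section. -/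
def fsmul (f : ContMDiffMap 𝓘(ℝ, EM) 𝓘(ℝ, ℝ) M ℝ ∞) (α : Sec EM F V) : Sec EM F V where
  toFun x := f x • α x
  contMDiff_toFun := f.contMDiff.smul_section α.contMDiff

/-- The component in the fibre over `y` of a point of the total space (`0` if the point lies over
another point of the base). -/
def fiberAt (y : M) (p : TotalSpace F V) : V y :=
  open Classical in if h : p.proj = y then h ▸ p.snd else 0

/-- The double integral `∫₀¹∫₀¹ f(t, s) dt ds` of a function with values in a fibre `V y`, computed
through a linear isomorphism of `V y` with the model fibre. -/
def fiberIntegral (F : Type*) [NormedAddCommGroup F] [NormedSpace ℝ F]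
    {V : M → Type*} [TopologicalSpace (TotalSpace F V)]
    [∀ x, AddCommGroup (V x)] [∀ x, Module ℝ (V x)]
    [∀ x, TopologicalSpace (V x)] [FiberBundle F V] [VectorBundle ℝ F V]
    {y : M} (f : ℝ → ℝ → V y) : V y :=
  let T := (trivializationAt F V y).continuousLinearEquivAt ℝ y
    (mem_baseSet_trivializationAt F V y)
  T.symm (∫ s in (0 : ℝ)..1, ∫ t in (0 : ℝ)..1, T (f t s))

end Bundles

section Algebroids

variable {EM : Type*} [NormedAddCommGroup EM] [NormedSpace ℝ EM]
  {M : Type*} [TopologicalSpace M] [ChartedSpace EM M] [IsManifold 𝓘(ℝ, EM) ∞ M]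
  {FA : Type*} [NormedAddCommGroup FA] [NormedSpace ℝ FA]
  {A : M → Type*} [TopologicalSpace (TotalSpace FA A)]
  [∀ x, AddCommGroup (A x)] [∀ x, Module ℝ (A x)]
  [∀ x, TopologicalSpace (A x)] [FiberBundle FA A] [VectorBundle ℝ FA A]

/-- A Lie algebroid structure on the vector bundle `A → M`: an anchor `ρ : A → TM` and a Lie bracket
on `Γ(A)` satisfying the Leibniz rule. -/
structure LieAlgebroid (EM : Type*) [NormedAddCommGroup EM] [NormedSpace ℝ EM]
    {M : Type*} [TopologicalSpace M] [ChartedSpace EM M] [IsManifold 𝓘(ℝ, EM) ∞ M]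
    (FA : Type*) [NormedAddCommGroup FA] [NormedSpace ℝ FA]
    (A : M → Type*) [TopologicalSpace (TotalSpace FA A)]
    [∀ x, AddCommGroup (A x)] [∀ x, Module ℝ (A x)]
    [∀ x, TopologicalSpace (A x)] [FiberBundle FA A] [VectorBundle ℝ FA A] where
  anchor : ContMDiffSection 𝓘(ℝ, EM) (FA →L[ℝ] EM) ∞
    (fun x : M => A x →L[ℝ] TangentSpace 𝓘(ℝ, EM) x)
  bracket : Sec EM FA A → Sec EM FA A → Sec EM FA A
  bracket_add : ∀ α β β', bracket α (β + β') = bracket α β + bracket α β'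
  bracket_antisymm : ∀ α β, bracket α β = - bracket β α
  jacobi : ∀ α β γ,
    bracket α (bracket β γ) + bracket β (bracket γ α) + bracket γ (bracket α β) = 0
  leibniz : ∀ α β (f : ContMDiffMap 𝓘(ℝ, EM) 𝓘(ℝ, ℝ) M ℝ ∞) x,
    bracket α (fsmul f β) x = f x • bracket α β x + dirDeriv f (anchor x (α x)) • β x
  anchor_bracket : ∀ α β (f : ContMDiffMap 𝓘(ℝ, EM) 𝓘(ℝ, ℝ) M ℝ ∞) x,
    dirDeriv f (anchor x (bracket α β x))
      = dirDeriv (fun y => dirDeriv f (anchor y (β y))) (anchor x (α x))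
        - dirDeriv (fun y => dirDeriv f (anchor y (α y))) (anchor x (β x))

/-- An `A`-connection on the vector bundle `V → M`. -/
structure AConnection (L : LieAlgebroid EM FA A)
    (F : Type*) [NormedAddCommGroup F] [NormedSpace ℝ F]
    (V : M → Type*) [TopologicalSpace (TotalSpace F V)]
    [∀ x, AddCommGroup (V x)] [∀ x, Module ℝ (V x)]
    [∀ x, TopologicalSpace (V x)] [FiberBundle F V] [VectorBundle ℝ F V] where
  toFun : Sec EM FA A → Sec EM F V → Sec EM F V
  add_left : ∀ α β e, toFun (α + β) e = toFun α e + toFun β e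
  smul_left : ∀ f α e, toFun (fsmul f α) e = fsmul f (toFun α e)
  add_right : ∀ α e e', toFun α (e + e') = toFun α e + toFun α e'
  leibniz : ∀ α (f : ContMDiffMap 𝓘(ℝ, EM) 𝓘(ℝ, ℝ) M ℝ ∞) e x,
    toFun α (fsmul f e) x = f x • toFun α e x + dirDeriv f (L.anchor x (α x)) • e x

/-- The curvature `[∇_α, ∇_β] - ∇_[α,β]`. -/
def AConnection.curv {L : LieAlgebroid EM FA A}
    {F : Type*} [NormedAddCommGroup F] [NormedSpace ℝ F]
    {V : M → Type*} [TopologicalSpace (TotalSpace F V)]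
    [∀ x, AddCommGroup (V x)] [∀ x, Module ℝ (V x)]
    [∀ x, TopologicalSpace (V x)] [FiberBundle F V] [VectorBundle ℝ F V]
    (D : AConnection L F V) (α β : Sec EM FA A) (e : Sec EM F V) : Sec EM F V :=
  D.toFun α (D.toFun β e) - D.toFun β (D.toFun α e) - D.toFun (L.bracket α β) e

variable {FE : Type*} [NormedAddCommGroup FE] [NormedSpace ℝ FE]
  {E : M → Type*} [TopologicalSpace (TotalSpace FE E)]
  [∀ x, AddCommGroup (E x)] [∀ x, Module ℝ (E x)]
  [∀ x, TopologicalSpace (E x)] [∀ x, IsTopologicalAddGroup (E x)]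
  [∀ x, ContinuousSMul ℝ (E x)] [FiberBundle FE E] [VectorBundle ℝ FE E]
  {FC : Type*} [NormedAddCommGroup FC] [NormedSpace ℝ FC]
  {C : M → Type*} [TopologicalSpace (TotalSpace FC C)]
  [∀ x, AddCommGroup (C x)] [∀ x, Module ℝ (C x)]
  [∀ x, TopologicalSpace (C x)] [∀ x, IsTopologicalAddGroup (C x)]
  [∀ x, ContinuousSMul ℝ (C x)] [FiberBundle FC C] [VectorBundle ℝ FC C]

/-- A smooth homomorphism of vector bundles `C → E` over the identity of `M`. -/
abbrev BundleMap (EM : Type*) [NormedAddCommGroup EM] [NormedSpace ℝ EM]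
    {M : Type*} [TopologicalSpace M] [ChartedSpace EM M]
    (FC : Type*) [NormedAddCommGroup FC] [NormedSpace ℝ FC]
    (C : M → Type*) [TopologicalSpace (TotalSpace FC C)]
    [∀ x, AddCommGroup (C x)] [∀ x, Module ℝ (C x)]
    [∀ x, TopologicalSpace (C x)] [FiberBundle FC C] [VectorBundle ℝ FC C]
    (FE : Type*) [NormedAddCommGroup FE] [NormedSpace ℝ FE]
    (E : M → Type*) [TopologicalSpace (TotalSpace FE E)]
    [∀ x, AddCommGroup (E x)] [∀ x, Module ℝ (E x)]
    [∀ x, TopologicalSpace (E x)] [∀ x, IsTopologicalAddGroup (E x)]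
    [∀ x, ContinuousSMul ℝ (E x)] [FiberBundle FE E] [VectorBundle ℝ FE E] : Type _ :=
  ContMDiffSection 𝓘(ℝ, EM) (FC →L[ℝ] FE) ∞ (fun x : M => C x →L[ℝ] E x)

/-- The image `φ(c)` of a section under a bundle map. -/
def BundleMap.onSec (φ : BundleMap EM FC C FE E) (c : Sec EM FC C) : Sec EM FE E where
  toFun x := φ x (c x)
  contMDiff_toFun := φ.contMDiff.clm_bundle_apply c.contMDiff

/-- An element of `Ω²(A, Hom(E, C))`: an alternating 2-form on each fibre `A_x` with values in
`Hom(E_x, C_x)`, depending smoothly on `x`. -/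
structure HomTwoForm (EM : Type*) [NormedAddCommGroup EM] [NormedSpace ℝ EM]
    {M : Type*} [TopologicalSpace M] [ChartedSpace EM M]
    (FA : Type*) [NormedAddCommGroup FA] [NormedSpace ℝ FA]
    (A : M → Type*) [TopologicalSpace (TotalSpace FA A)]
    [∀ x, AddCommGroup (A x)] [∀ x, Module ℝ (A x)]
    [∀ x, TopologicalSpace (A x)] [FiberBundle FA A] [VectorBundle ℝ FA A]
    (FE : Type*) [NormedAddCommGroup FE] [NormedSpace ℝ FE]
    (E : M → Type*) [TopologicalSpace (TotalSpace FE E)]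
    [∀ x, AddCommGroup (E x)] [∀ x, Module ℝ (E x)]
    [∀ x, TopologicalSpace (E x)] [FiberBundle FE E] [VectorBundle ℝ FE E]
    (FC : Type*) [NormedAddCommGroup FC] [NormedSpace ℝ FC]
    (C : M → Type*) [TopologicalSpace (TotalSpace FC C)]
    [∀ x, AddCommGroup (C x)] [∀ x, Module ℝ (C x)]
    [∀ x, TopologicalSpace (C x)] [∀ x, IsTopologicalAddGroup (C x)]
    [∀ x, ContinuousSMul ℝ (C x)] [FiberBundle FC C] [VectorBundle ℝ FC C] where
  form : ∀ x : M, A x [⋀^Fin 2]→ₗ[ℝ] (E x →L[ℝ] C x)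
  smooth : ∀ α β : Sec EM FA A,
    ContMDiff 𝓘(ℝ, EM) (𝓘(ℝ, EM).prod 𝓘(ℝ, FE →L[ℝ] FC)) ∞
      (fun x => (TotalSpace.mk' (FE →L[ℝ] FC) x (form x ![α x, β x]) :
        TotalSpace (FE →L[ℝ] FC) (fun x : M => E x →L[ℝ] C x)))

/-- The section `ω(α, β)e` of `C`. -/
def HomTwoForm.onSec (w : HomTwoForm EM FA A FE E FC C) (α β : Sec EM FA A) (e : Sec EM FE E) :
    Sec EM FC C where
  toFun x := w.form x ![α x, β x] (e x)
  contMDiff_toFun := (w.smooth α β).clm_bundle_apply e.contMDiff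

/-- A 2-term representation up to homotopy `(∇^E, ∇^C, ω)` of the Lie algebroid `A` on the 2-term
complex `∂ : C → E`. The last condition says that the covariant derivative
`∇ω ∈ Ω³(A, Hom(E, C))` vanishes: the cyclic sum of `∇_α(ω(β, γ)) - ω([α, β], γ)` is zero, with
`∇_α φ = ∇^C_α ∘ φ - φ ∘ ∇^E_α` for `φ` in `Hom(E, C)`. -/
structure RepUpToHomotopy (L : LieAlgebroid EM FA A) (d : BundleMap EM FC C FE E) where
  connE : AConnection L FE E
  connC : AConnection L FC C
  omega : HomTwoForm EM FA A FE E FC C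
  chain : ∀ α c, BundleMap.onSec d (connC.toFun α c) = connE.toFun α (BundleMap.onSec d c)
  d_omega : ∀ α β e, BundleMap.onSec d (omega.onSec α β e) = connE.curv α β e
  omega_d : ∀ α β c, omega.onSec α β (BundleMap.onSec d c) = connC.curv α β c
  closed : ∀ α β γ e,
    (connC.toFun α (omega.onSec β γ e) - omega.onSec β γ (connE.toFun α e)
        - omega.onSec (L.bracket α β) γ e)
      + (connC.toFun β (omega.onSec γ α e) - omega.onSec γ α (connE.toFun β e)
        - omega.onSec (L.bracket β γ) α e)
      + (connC.toFun γ (omega.onSec α β e) - omega.onSec α β (connE.toFun γ e)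
        - omega.onSec (L.bracket γ α) β e) = 0

/-! ### Lie algebroid morphisms `TIⁿ → A`, paths and homotopies -/

/-- The cube `Iⁿ = [0,1]ⁿ`. -/
def cube (n : ℕ) : Set (Fin n → ℝ) := Icc 0 1

/-- A Lie algebroid morphism `TIⁿ → A`, written `∑ᵢ (vec i) dxᵢ` over the base map
`base : Iⁿ → M`; the values outside of the cube play no role. The bracket condition says that pulling
back commutes with the differentials: for each section `θ` of `A*`,
`∂ᵢ⟨θ, vec j⟩ - ∂ⱼ⟨θ, vec i⟩ = (d_A θ)(vec i, vec j)`, where the right hand side is computed by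
extending the vectors `vec i` and `vec j` at the given point to sections `α` and `β`. -/
structure CubeMorphism (L : LieAlgebroid EM FA A) (n : ℕ) where
  base : (Fin n → ℝ) → M
  vec : Fin n → ∀ p : Fin n → ℝ, A (base p)
  base_smooth : ContMDiffOn 𝓘(ℝ, Fin n → ℝ) 𝓘(ℝ, EM) ∞ base (cube n)
  smooth : ∀ i, ContMDiffOn 𝓘(ℝ, Fin n → ℝ) (𝓘(ℝ, EM).prod 𝓘(ℝ, FA)) ∞
    (fun p => TotalSpace.mk' FA (base p) (vec i p)) (cube n)
  anchor_eq : ∀ i, ∀ p ∈ cube n,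
    L.anchor (base p) (vec i p)
      = mfderivWithin 𝓘(ℝ, Fin n → ℝ) 𝓘(ℝ, EM) base (cube n) p (Pi.single i (1 : ℝ) : Fin n → ℝ)
  bracket_eq : ∀ i j, i < j → ∀ p ∈ cube n, ∀ (θ : DualSec EM FA A) (α β : Sec EM FA A),
    α (base p) = vec i p → β (base p) = vec j p →
    fderivWithin ℝ (fun q => θ (base q) (vec j q)) (cube n) p (Pi.single i 1)
        - fderivWithin ℝ (fun q => θ (base q) (vec i q)) (cube n) p (Pi.single j 1)
      = dirDeriv (fun y => θ y (β y)) (L.anchor (base p) (vec i p))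
        - dirDeriv (fun y => θ y (α y)) (L.anchor (base p) (vec j p))
        - θ (base p) (L.bracket α β (base p))

/-- The `i`-th component of a morphism `TIⁿ → A` as a map to the total space of `A`. -/
def CubeMorphism.comp {L : LieAlgebroid EM FA A} {n : ℕ} (σ : CubeMorphism L n) (i : Fin n)
    (p : Fin n → ℝ) : TotalSpace FA A :=
  ⟨σ.base p, σ.vec i p⟩

/-- Fibrewise multiplication by a scalar on the total space. -/
def scale (r : ℝ) (p : TotalSpace FA A) : TotalSpace FA A := ⟨p.proj, r • p.snd⟩

/-- An `A`-path `a dt : TI → A` from `x` to `y`. -/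
structure APath (L : LieAlgebroid EM FA A) (x y : M) where
  mor : CubeMorphism L 1
  source : mor.base 0 = x
  target : mor.base 1 = y

/-- The underlying curve `t ↦ a(t)` in `A`. -/
def APath.curve {L : LieAlgebroid EM FA A} {x y : M} (a : APath L x y) (t : ℝ) :
    TotalSpace FA A :=
  a.mor.comp 0 ![t]

/-- An `A`-homotopy `σ = a dt + b ds : TI² → A` from `a₀ dt` to `a₁ dt`, with coordinates
`![t, s]` on `I²`: it restricts to `a₀ dt` at `s = 0` and to `a₁ dt` at `s = 1`, and `b = 0` at
`t = 0, 1`. -/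
structure AHomotopy {L : LieAlgebroid EM FA A} {x y : M} (a₀ a₁ : APath L x y) where
  mor : CubeMorphism L 2
  source : ∀ t ∈ Icc (0 : ℝ) 1, mor.comp 0 ![t, 0] = a₀.curve t
  target : ∀ t ∈ Icc (0 : ℝ) 1, mor.comp 0 ![t, 1] = a₁.curve t
  left : ∀ s ∈ Icc (0 : ℝ) 1, mor.vec 1 ![0, s] = 0
  right : ∀ s ∈ Icc (0 : ℝ) 1, mor.vec 1 ![1, s] = 0

/-- The coefficient `a(t, s)` of `dt`. -/
def AHomotopy.a {L : LieAlgebroid EM FA A} {x y : M} {a₀ a₁ : APath L x y}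
    (σ : AHomotopy a₀ a₁) (t s : ℝ) : TotalSpace FA A :=
  σ.mor.comp 0 ![t, s]

/-- The coefficient `b(t, s)` of `ds`. -/
def AHomotopy.b {L : LieAlgebroid EM FA A} {x y : M} {a₀ a₁ : APath L x y}
    (σ : AHomotopy a₀ a₁) (t s : ℝ) : TotalSpace FA A :=
  σ.mor.comp 1 ![t, s]

/-- A homotopy is thin if `∧²σ : ∧²TI² → ∧²A` vanishes, that is, `a ∧ b = 0`. -/
def AHomotopy.Thin {L : LieAlgebroid EM FA A} {x y : M} {a₀ a₁ : APath L x y}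
    (σ : AHomotopy a₀ a₁) : Prop :=
  ∀ p ∈ cube 2, ExteriorAlgebra.ιMulti ℝ 2 ![σ.mor.vec 0 p, σ.mor.vec 1 p] = 0

/-- Thin homotopy of `A`-paths from `x` to `y`. -/
def ThinHomotopic {L : LieAlgebroid EM FA A} {x y : M} (a₀ a₁ : APath L x y) : Prop :=
  ∃ σ : AHomotopy a₀ a₁, σ.Thin

/-- The 1-morphisms `x → y` of the Weinstein 2-groupoid: thin homotopy classes of `A`-paths. -/
def P1 (L : LieAlgebroid EM FA A) (x y : M) : Type _ :=
  Quot (ThinHomotopic (L := L) (x := x) (y := y))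

/-- The class of an `A`-path. -/
def APath.cls {L : LieAlgebroid EM FA A} {x y : M} (a : APath L x y) : P1 L x y :=
  Quot.mk _ a

/-- `A`-homotopies between any two `A`-paths from `x` to `y`. -/
structure AnyHomotopy (L : LieAlgebroid EM FA A) (x y : M) where
  src : APath L x y
  tgt : APath L x y
  htpy : AHomotopy src tgt

/-- 3-homotopy `H = H₁ dt + H₂ ds + H₃ du : TI³ → A` between `A`-homotopies, at `u = 0` and `u = 1`
respectively, with `H₃ = 0` at `t = 0, 1`. As paths only matter up to thin homotopy, `σ` and `σ'` are
only required to have thin homotopic sources and targets: the restrictions of `H` to the faces `s = 0`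
and `s = 1` are thin homotopies. (They are the constant ones when `H₃` vanishes on these faces.) -/
def ThreeHomotopic {L : LieAlgebroid EM FA A} {x y : M} (σ σ' : AnyHomotopy L x y) : Prop :=
  ∃ (H : CubeMorphism L 3) (θ₀ : AHomotopy σ.src σ'.src) (θ₁ : AHomotopy σ.tgt σ'.tgt),
    θ₀.Thin ∧ θ₁.Thin ∧
    (∀ t ∈ Icc (0 : ℝ) 1, ∀ s ∈ Icc (0 : ℝ) 1,
      H.comp 0 ![t, s, 0] = σ.htpy.a t s ∧ H.comp 1 ![t, s, 0] = σ.htpy.b t s ∧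
      H.comp 0 ![t, s, 1] = σ'.htpy.a t s ∧ H.comp 1 ![t, s, 1] = σ'.htpy.b t s) ∧
    (∀ s ∈ Icc (0 : ℝ) 1, ∀ u ∈ Icc (0 : ℝ) 1,
      H.vec 2 ![0, s, u] = 0 ∧ H.vec 2 ![1, s, u] = 0) ∧
    (∀ t ∈ Icc (0 : ℝ) 1, ∀ u ∈ Icc (0 : ℝ) 1,
      H.comp 0 ![t, 0, u] = θ₀.a t u ∧ H.comp 2 ![t, 0, u] = θ₀.b t u ∧
      H.comp 0 ![t, 1, u] = θ₁.a t u ∧ H.comp 2 ![t, 1, u] = θ₁.b t u)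

/-- The 2-morphisms of the Weinstein 2-groupoid with horizontal source `x` and horizontal target `y`:
3-homotopy classes of `A`-homotopies. -/
def P2 (L : LieAlgebroid EM FA A) (x y : M) : Type _ :=
  Quot (ThreeHomotopic (L := L) (x := x) (y := y))

/-- The class of an `A`-homotopy. -/
def AHomotopy.cls {L : LieAlgebroid EM FA A} {x y : M} {a₀ a₁ : APath L x y}
    (σ : AHomotopy a₀ a₁) : P2 L x y :=
  Quot.mk _ ⟨a₀, a₁, σ⟩

section Operations

variable {L : LieAlgebroid EM FA A} {x y z : M}

/-- `a` is the unit path `0_x dt`. -/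
def IsUnitPath (a : APath L x x) : Prop :=
  ∀ t ∈ Icc (0 : ℝ) 1, a.curve t = ⟨x, 0⟩

/-- `a'` is the inverse path `-a(1 - t) dt` of `a`. -/
def IsInvPath (a : APath L x y) (a' : APath L y x) : Prop :=
  ∀ t ∈ Icc (0 : ℝ) 1, a'.curve t = scale (-1) (a.curve (1 - t))

/-- `c` is the concatenation `b · a` (first `a`, then `b`). -/
def IsConcat (b : APath L y z) (a : APath L x y) (c : APath L x z) : Prop :=
  (∀ t ∈ Icc (0 : ℝ) (1 / 2), c.curve t = scale 2 (a.curve (2 * t))) ∧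
  (∀ t ∈ Icc (1 / 2 : ℝ) 1, c.curve t = scale 2 (b.curve (2 * t - 1)))

/-- `θ` is the vertical unit `a(t) dt + 0 ds` at `a`. -/
def IsVertUnit (a : APath L x y) (θ : AHomotopy a a) : Prop :=
  ∀ t ∈ Icc (0 : ℝ) 1, ∀ s ∈ Icc (0 : ℝ) 1,
    θ.a t s = a.curve t ∧ θ.b t s = scale 0 (a.curve t)

/-- `σ'` is the vertical inverse `a(t, 1 - s) dt - b(t, 1 - s) ds` of `σ`. -/
def IsVertInv {a₀ a₁ : APath L x y} (σ : AHomotopy a₀ a₁) (σ' : AHomotopy a₁ a₀) : Prop :=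
  ∀ t ∈ Icc (0 : ℝ) 1, ∀ s ∈ Icc (0 : ℝ) 1,
    σ'.a t s = σ.a t (1 - s) ∧ σ'.b t s = scale (-1) (σ.b t (1 - s))

/-- `ρ` is the vertical concatenation of `σ'` and `σ` (first `σ`, then `σ'`). -/
def IsVertConcat {a₀ a₁ a₂ : APath L x y} (σ' : AHomotopy a₁ a₂) (σ : AHomotopy a₀ a₁)
    (ρ : AHomotopy a₀ a₂) : Prop :=
  (∀ t ∈ Icc (0 : ℝ) 1, ∀ s ∈ Icc (0 : ℝ) (1 / 2),
    ρ.a t s = σ.a t (2 * s) ∧ ρ.b t s = scale 2 (σ.b t (2 * s))) ∧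
  (∀ t ∈ Icc (0 : ℝ) 1, ∀ s ∈ Icc (1 / 2 : ℝ) 1,
    ρ.a t s = σ'.a t (2 * s - 1) ∧ ρ.b t s = scale 2 (σ'.b t (2 * s - 1)))

/-- `θ` is the horizontal unit `0_x dt + 0_x ds`. -/
def IsHorizUnit {a₀ a₁ : APath L x x} (θ : AHomotopy a₀ a₁) : Prop :=
  ∀ t ∈ Icc (0 : ℝ) 1, ∀ s ∈ Icc (0 : ℝ) 1, θ.a t s = ⟨x, 0⟩ ∧ θ.b t s = ⟨x, 0⟩

/-- `σ'` is the horizontal inverse `-a(1 - t, s) dt + b(1 - t, s) ds` of `σ`. -/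
def IsHorizInv {a₀ a₁ : APath L x y} {a₀' a₁' : APath L y x}
    (σ : AHomotopy a₀ a₁) (σ' : AHomotopy a₀' a₁') : Prop :=
  ∀ t ∈ Icc (0 : ℝ) 1, ∀ s ∈ Icc (0 : ℝ) 1,
    σ'.a t s = scale (-1) (σ.a (1 - t) s) ∧ σ'.b t s = σ.b (1 - t) s

/-- `ρ` is the horizontal concatenation of `σ'` and `σ` (first `σ`, then `σ'`). -/
def IsHorizConcat {a₀ a₁ : APath L x y} {a₀' a₁' : APath L y z} {c₀ c₁ : APath L x z}
    (σ' : AHomotopy a₀' a₁') (σ : AHomotopy a₀ a₁) (ρ : AHomotopy c₀ c₁) : Prop :=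
  (∀ t ∈ Icc (0 : ℝ) (1 / 2), ∀ s ∈ Icc (0 : ℝ) 1,
    ρ.a t s = scale 2 (σ.a (2 * t) s) ∧ ρ.b t s = σ.b (2 * t) s) ∧
  (∀ t ∈ Icc (1 / 2 : ℝ) 1, ∀ s ∈ Icc (0 : ℝ) 1,
    ρ.a t s = scale 2 (σ'.a (2 * t - 1) s) ∧ ρ.b t s = σ'.b (2 * t - 1) s)

end Operations

/-! ### Holonomy -/

section Holonomy

variable {L : LieAlgebroid EM FA A}
  {F : Type*} [NormedAddCommGroup F] [NormedSpace ℝ F]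
  {V : M → Type*} [TopologicalSpace (TotalSpace F V)]
  [∀ x, AddCommGroup (V x)] [∀ x, Module ℝ (V x)]
  [∀ x, TopologicalSpace (V x)] [FiberBundle F V] [VectorBundle ℝ F V]

/-- `u : I → V` is a parallel section (`∇_a u = 0`) along the curve `a : I → A`. In dual form: for each
section `ξ` of `V*`, `d/dt ⟨ξ, u⟩ = ⟨∇*_a ξ, u⟩`, where `⟨∇*_α ξ, e⟩ = ρ(α)⟨ξ, e⟩ - ⟨ξ, ∇_α e⟩` is
computed by extending `a(t)` and `u(t)` to sections `α` and `e`. -/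
structure IsParallel (D : AConnection L F V) (a : ℝ → TotalSpace FA A)
    (u : ℝ → TotalSpace F V) : Prop where
  proj_eq : ∀ t ∈ Icc (0 : ℝ) 1, (u t).proj = (a t).proj
  smooth : ContMDiffOn 𝓘(ℝ, ℝ) (𝓘(ℝ, EM).prod 𝓘(ℝ, F)) ∞ u (Icc 0 1)
  parallel : ∀ t ∈ Icc (0 : ℝ) 1, ∀ (ξ : DualSec EM F V) (α : Sec EM FA A) (e : Sec EM F V),
    α (a t).proj = (a t).snd → e (u t).proj = (u t).snd →
    derivWithin (fun r => ξ (u r).proj (u r).snd) (Icc 0 1) t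
      = dirDeriv (fun y => ξ y (e y)) (L.anchor (a t).proj (a t).snd)
        - ξ (a t).proj (D.toFun α e (a t).proj)

/-- Parallel transport along `a` from time `t₀` to time `t₁`: the value at `t₁` of the parallel section
with value `p` at `t₀`. -/
def transport (D : AConnection L F V) (a : ℝ → TotalSpace FA A) (t₀ t₁ : ℝ)
    (p : TotalSpace F V) : TotalSpace F V :=
  open Classical in
  if h : ∃ u, IsParallel D a u ∧ u t₀ = p then h.choose t₁ else p

/-- The holonomy `V_x → V_y` along an `A`-path from `x` to `y`. -/
def hol (D : AConnection L F V) {x y : M} (a : APath L x y) (e : V x) : V y :=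
  fiberAt y (transport D a.curve 0 1 ⟨x, e⟩)

end Holonomy

variable {L : LieAlgebroid EM FA A} {d : BundleMap EM FC C FE E}

/-- The holonomy `E_x → C_y` along an `A`-homotopy `σ = a dt + b ds` between paths from `x` to `y`:
`∫₀¹∫₀¹ hol^C_{1,t} ∘ ω(a, b) ∘ hol^E_{t,0} dt ds`, where for each `s` the holonomies are taken along
the curve `t ↦ a(t, s)`. -/
def hol₂ (R : RepUpToHomotopy L d) {x y : M} {a₀ a₁ : APath L x y} (σ : AHomotopy a₀ a₁)
    (e : E x) : C y :=
  fiberIntegral FC fun t s =>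
    fiberAt y (transport R.connC (fun r => σ.a r s) t 1
      ⟨σ.mor.base ![t, s],
        R.omega.form (σ.mor.base ![t, s]) ![σ.mor.vec 0 ![t, s], σ.mor.vec 1 ![t, s]]
          (fiberAt (σ.mor.base ![t, s])
            (transport R.connE (fun r => σ.a r s) 0 t ⟨x, e⟩))⟩)

/-! ### The transformation 2-groupoid -/

/-- The space `t*C ⊕ s*E` over `P₁(A)`: triples `(c, a, e)`. -/
structure Trans1 (L : LieAlgebroid EM FA A) (C E : M → Type*) where
  x : M
  y : M
  c : C y
  a : P1 L x y
  e : E x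

/-- The space `t_H*C ⊕ s_H*E` over `P₂(A)`: triples `(c, σ, e)`. -/
structure Trans2 (L : LieAlgebroid EM FA A) (C E : M → Type*) where
  x : M
  y : M
  c : C y
  σ : P2 L x y
  e : E x

/-- The triple `(c, [a], e)`. -/
def tri1 {x y : M} (c : C y) (a : APath L x y) (e : E x) : Trans1 L C E :=
  ⟨x, y, c, a.cls, e⟩

/-- The triple `(c, [σ], e)`. -/
def tri2 {x y : M} {a₀ a₁ : APath L x y} (c : C y) (σ : AHomotopy a₀ a₁) (e : E x) :
    Trans2 L C E :=
  ⟨x, y, c, σ.cls, e⟩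

/-- `G` is the transformation 2-groupoid `2-P(A) ⋉ ℰ`: its structure maps are given by the defining
formulas, in terms of representatives of the classes in `P₁(A)` and `P₂(A)`. -/
structure IsTransformation (R : RepUpToHomotopy L d)
    (G : Strict2Groupoid (TotalSpace FE E) (Trans1 L C E) (Trans2 L C E)) : Prop where
  src : ∀ {x y : M} (c : C y) (a : APath L x y) (e : E x), G.cells.src (tri1 c a e) = ⟨x, e⟩
  tgt : ∀ {x y : M} (c : C y) (a : APath L x y) (e : E x),
    G.cells.tgt (tri1 c a e) = ⟨y, hol R.connE a e + d y c⟩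
  one : ∀ {x : M} (a : APath L x x) (e : E x), IsUnitPath a →
    G.cells.one ⟨x, e⟩ = tri1 0 a e
  inv : ∀ {x y : M} (c : C y) (a : APath L x y) (a' : APath L y x) (e : E x), IsInvPath a a' →
    G.cells.inv (tri1 c a e) = tri1 (-hol R.connC a' c) a' (hol R.connE a e + d y c)
  comp : ∀ {x y z : M} (c₁ : C z) (a₁ : APath L y z) (e₁ : E y)
    (c₀ : C y) (a₀ : APath L x y) (e₀ : E x) (a : APath L x z), IsConcat a₁ a₀ a →
    ∀ p, G.cells.comp (tri1 c₁ a₁ e₁) (tri1 c₀ a₀ e₀) p = tri1 (c₁ + hol R.connC a₁ c₀) a e₀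
  vert_src : ∀ {x y : M} {a₀ a₁ : APath L x y} (c : C y) (σ : AHomotopy a₀ a₁) (e : E x),
    G.vert.src (tri2 c σ e) = tri1 c a₀ e
  vert_tgt : ∀ {x y : M} {a₀ a₁ : APath L x y} (c : C y) (σ : AHomotopy a₀ a₁) (e : E x),
    G.vert.tgt (tri2 c σ e) = tri1 (c - hol₂ R σ e) a₁ e
  vert_one : ∀ {x y : M} (c : C y) (a : APath L x y) (e : E x) (θ : AHomotopy a a),
    IsVertUnit a θ → G.vert.one (tri1 c a e) = tri2 c θ e
  vert_inv : ∀ {x y : M} {a₀ a₁ : APath L x y} (c : C y) (σ : AHomotopy a₀ a₁)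
    (σ' : AHomotopy a₁ a₀) (e : E x), IsVertInv σ σ' →
    G.vert.inv (tri2 c σ e) = tri2 (c - hol₂ R σ e) σ' e
  vert_comp : ∀ {x y : M} {a₀ a₁ a₂ : APath L x y} (c₂ : C y) (σ₂ : AHomotopy a₁ a₂) (e₂ : E x)
    (c₁ : C y) (σ₁ : AHomotopy a₀ a₁) (e₁ : E x) (σ : AHomotopy a₀ a₂), IsVertConcat σ₂ σ₁ σ →
    ∀ p, G.vert.comp (tri2 c₂ σ₂ e₂) (tri2 c₁ σ₁ e₁) p = tri2 c₁ σ e₁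
  horiz_src : ∀ {x y : M} {a₀ a₁ : APath L x y} (c : C y) (σ : AHomotopy a₀ a₁) (e : E x),
    G.horiz.src (tri2 c σ e) = ⟨x, e⟩
  horiz_tgt : ∀ {x y : M} {a₀ a₁ : APath L x y} (c : C y) (σ : AHomotopy a₀ a₁) (e : E x),
    G.horiz.tgt (tri2 c σ e) = ⟨y, hol R.connE a₀ e + d y c⟩
  horiz_one : ∀ {x : M} {a₀ a₁ : APath L x x} (θ : AHomotopy a₀ a₁) (e : E x), IsHorizUnit θ →
    G.horiz.one ⟨x, e⟩ = tri2 0 θ e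
  horiz_inv : ∀ {x y : M} {a₀ a₁ : APath L x y} {a₀' a₁' : APath L y x} (c : C y)
    (σ : AHomotopy a₀ a₁) (σ' : AHomotopy a₀' a₁') (e : E x), IsHorizInv σ σ' →
    G.horiz.inv (tri2 c σ e) = tri2 (-hol R.connC a₀' c) σ' (hol R.connE a₀ e + d y c)
  horiz_comp : ∀ {x y z : M} {b₀ b₁ : APath L y z} {a₀ a₁ : APath L x y} {c₀ c₁ : APath L x z}
    (c : C z) (σ : AHomotopy b₀ b₁) (e : E y) (b : C y) (τ : AHomotopy a₀ a₁) (f : E x)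
    (ρ : AHomotopy c₀ c₁), IsHorizConcat σ τ ρ →
    ∀ p, G.horiz.comp (tri2 c σ e) (tri2 b τ f) p = tri2 (c + hol R.connC b₀ b) ρ f

end Algebroids

end TwoGroupoid

end

open Bundle Manifold Set
open scoped ContDiff

noncomputable section

namespace TwoGroupoid

open Filter Topology

set_option linter.unusedSectionVars false

/-! ### Frames and tensoriality -/

section Frames

variable {EM : Type*} [NormedAddCommGroup EM] [NormedSpace ℝ EM]
  {M : Type*} [TopologicalSpace M] [ChartedSpace EM M]
  {F : Type*} [NormedAddCommGroup F] [NormedSpace ℝ F]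
  {V : M → Type*} [TopologicalSpace (TotalSpace F V)]
  [∀ x, AddCommGroup (V x)] [∀ x, Module ℝ (V x)]
  [∀ x, TopologicalSpace (V x)] [FiberBundle F V] [VectorBundle ℝ F V]

/-- Smooth functions on `M`. -/
abbrev SmoothFn (EM : Type*) [NormedAddCommGroup EM] [NormedSpace ℝ EM]
    (M : Type*) [TopologicalSpace M] [ChartedSpace EM M] : Type _ :=
  ContMDiffMap 𝓘(ℝ, EM) 𝓘(ℝ, ℝ) M ℝ ∞

theorem sec_sum_apply {ι : Type*} (s : Finset ι) (e : ι → Sec EM F V) (y : M) :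
    (∑ i ∈ s, e i : Sec EM F V) y = ∑ i ∈ s, e i y := by
  rw [← ContMDiffSection.coeAddHom_apply, map_sum]
  simp

theorem dualSec_sum_apply {ι : Type*} (s : Finset ι) (ξ : ι → DualSec EM F V) (y : M) (v : V y) :
    (∑ i ∈ s, ξ i : DualSec EM F V) y v = ∑ i ∈ s, ξ i y v := by
  rw [← ContMDiffSection.coeAddHom_apply, map_sum]
  simp

theorem fsmul_apply (f : SmoothFn EM M) (α : Sec EM F V) (x : M) : fsmul f α x = f x • α x := rfl

/-- A smooth map to the total space of the trivial line bundle is a smooth function. -/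
theorem contMDiffOn_of_trivial {EX X : Type*} [NormedAddCommGroup EX] [NormedSpace ℝ EX]
    [TopologicalSpace X] [ChartedSpace EX X] {s : Set X} {b : X → M} {f : X → ℝ}
    (h : ContMDiffOn 𝓘(ℝ, EX) (𝓘(ℝ, EM).prod 𝓘(ℝ, ℝ)) ∞
      (fun p => TotalSpace.mk' ℝ (E := Bundle.Trivial M ℝ) (b p) (f p)) s) :
    ContMDiffOn 𝓘(ℝ, EX) 𝓘(ℝ, ℝ) ∞ f s :=
  fun p hp => (contMDiffWithinAt_totalSpace.1 (h p hp)).2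

/-- The pairing of a smooth section of the dual bundle with a smooth map to the total space. -/
theorem contMDiffOn_dual_apply {EX X : Type*} [NormedAddCommGroup EX] [NormedSpace ℝ EX]
    [TopologicalSpace X] [ChartedSpace EX X] {s : Set X} {b : X → M} {v : ∀ p, V (b p)}
    (ξ : DualSec EM F V)
    (hb : ContMDiffOn 𝓘(ℝ, EX) 𝓘(ℝ, EM) ∞ b s)
    (hv : ContMDiffOn 𝓘(ℝ, EX) (𝓘(ℝ, EM).prod 𝓘(ℝ, F)) ∞
      (fun p => TotalSpace.mk' F (b p) (v p)) s) :
    ContMDiffOn 𝓘(ℝ, EX) 𝓘(ℝ, ℝ) ∞ (fun p => ξ (b p) (v p)) s :=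
  contMDiffOn_of_trivial (b := b) ((ξ.contMDiff.comp_contMDiffOn hb).clm_bundle_apply hv)

/-- The pairing of a section of the dual bundle with a section. -/
def pairing (ξ : DualSec EM F V) (e : Sec EM F V) : SmoothFn EM M where
  val y := ξ y (e y)
  property := contMDiffOn_univ.1
    (contMDiffOn_dual_apply ξ contMDiffOn_id (contMDiffOn_univ.2 e.contMDiff))

theorem coe_pairing (ξ : DualSec EM F V) (e : Sec EM F V) :
    ⇑(pairing ξ e) = fun y => ξ y (e y) := rfl

@[simp] theorem pairing_apply (ξ : DualSec EM F V) (e : Sec EM F V) (y : M) :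
    pairing ξ e y = ξ y (e y) := rfl

variable [FiniteDimensional ℝ EM] [IsManifold 𝓘(ℝ, EM) ∞ M] [T2Space M]
  [FiniteDimensional ℝ F] [ContMDiffVectorBundle ∞ F V 𝓘(ℝ, EM)]

theorem contMDiffOn_coframe (t : Trivialization F (TotalSpace.proj : TotalSpace F V → M))
    [MemTrivializationAtlas t] (l : F →L[ℝ] ℝ) :
    ContMDiffOn 𝓘(ℝ, EM) (𝓘(ℝ, EM).prod 𝓘(ℝ, F →L[ℝ] ℝ)) ∞
      (fun y => TotalSpace.mk' (F →L[ℝ] ℝ) (E := fun y : M => V y →L[ℝ] ℝ) y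
        (l.comp (t.continuousLinearMapAt ℝ y))) t.baseSet := by
  intro x hx
  have hx' : x ∈ (trivializationAt F V x).baseSet := mem_baseSet_trivializationAt F V x
  refine ContMDiffAt.contMDiffWithinAt ?_
  refine (contMDiffAt_hom_bundle _).2 ⟨contMDiffAt_id, ?_⟩
  have h1 := (contMDiffAt_coordChangeL (IB := 𝓘(ℝ, EM)) (n := ∞) (e := trivializationAt F V x)
    (e' := t) hx' hx)
  have h2 : ContMDiffAt 𝓘(ℝ, EM) 𝓘(ℝ, F →L[ℝ] ℝ) ∞
      (fun b : M => l.comp (((trivializationAt F V x).coordChangeL ℝ t b : F →L[ℝ] F))) x :=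
    ContMDiffAt.clm_comp contMDiffAt_const h1
  apply h2.congr_of_eventuallyEq
  filter_upwards [t.open_baseSet.mem_nhds hx,
    (trivializationAt F V x).open_baseSet.mem_nhds hx'] with b hb hb'
  ext v
  simp [ContinuousLinearMap.inCoordinates, Trivialization.coordChangeL_apply _ _ ⟨hb', hb⟩,
    Trivialization.coe_linearMapAt_of_mem _ hb, Trivialization.symmL_apply _ hb']

/-- Cut off local frame and coframe at a point. -/
theorem exists_localFrame (F : Type*) [NormedAddCommGroup F] [NormedSpace ℝ F]
    (V : M → Type*) [TopologicalSpace (TotalSpace F V)]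
    [∀ x, AddCommGroup (V x)] [∀ x, Module ℝ (V x)]
    [∀ x, TopologicalSpace (V x)] [FiberBundle F V] [VectorBundle ℝ F V]
    [FiniteDimensional ℝ F] [ContMDiffVectorBundle ∞ F V 𝓘(ℝ, EM)] (x : M) :
    ∃ (N : ℕ) (e : Fin N → Sec EM F V) (ξ : Fin N → DualSec EM F V) (g : SmoothFn EM M),
      (∀ᶠ y in 𝓝 x, g y = 1) ∧ (∀ y (v : V y), ∑ i, ξ i y v • e i y = g y • v) ∧
      ∀ i j y, ξ i y (e j y) = if i = j then g y else 0 := by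
  classical
  let t := trivializationAt F V x
  have hx : x ∈ t.baseSet := mem_baseSet_trivializationAt F V x
  let b := Module.finBasis ℝ F
  obtain ⟨f, -, hf⟩ := (SmoothBumpFunction.nhds_basis_tsupport (I := 𝓘(ℝ, EM)) x).mem_iff.1
    (t.open_baseSet.mem_nhds hx)
  let l : Fin (Module.finrank ℝ F) → F →L[ℝ] ℝ := fun i => (b.coord i).toContinuousLinearMap
  have hfs : ContMDiff 𝓘(ℝ, EM) 𝓘(ℝ, ℝ) ∞ f := f.contMDiff
  let e : Fin (Module.finrank ℝ F) → Sec EM F V := fun i =>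
    ⟨fun y => f y • t.localFrame b i y, ContMDiffOn.smul_section_of_tsupport hfs.contMDiffOn
      t.open_baseSet hf (t.contMDiffOn_localFrame_baseSet ∞ b i)⟩
  let ξ : Fin (Module.finrank ℝ F) → DualSec EM F V := fun i =>
    ⟨fun y => f y • (l i).comp (t.continuousLinearMapAt ℝ y),
      ContMDiffOn.smul_section_of_tsupport hfs.contMDiffOn
      t.open_baseSet hf (contMDiffOn_coframe t (l i))⟩
  have he : ∀ i y, e i y = f y • t.localFrame b i y := fun _ _ => rfl
  have hξ : ∀ i y (v : V y), ξ i y v = f y * b.repr (t.continuousLinearMapAt ℝ y v) i :=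
    fun _ _ _ => rfl
  refine ⟨_, e, ξ, ⟨fun y => f y * f y, hfs.mul hfs⟩, ?_, ?_, ?_⟩
  · filter_upwards [f.eventuallyEq_one] with y hy
    simp [hy]
  · intro y v
    by_cases hy : y ∈ t.baseSet
    · have : ∀ i, ξ i y v • e i y = (f y * f y) • t.symmL ℝ y
          (b.repr (t.continuousLinearMapAt ℝ y v) i • b i) := by
        intro i
        rw [hξ, he, t.localFrame_apply_of_mem_baseSet b hy]
        simp only [Trivialization.basisAt, Module.Basis.map_apply, map_smul, smul_smul]
        congr 1
        · ring
        · simp [hy]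
      rw [Finset.sum_congr rfl fun i _ => this i, ← Finset.smul_sum, ← map_sum, b.sum_repr,
        t.symmL_continuousLinearMapAt hy]
      rfl
    · have : f y = 0 := by
        by_contra h
        exact hy (hf (subset_tsupport _ h))
      simp [hξ, this]
  · intro i j y
    by_cases hy : y ∈ t.baseSet
    · rw [hξ, he, t.localFrame_apply_of_mem_baseSet b hy]
      have : t.continuousLinearMapAt ℝ y (t.basisAt b hy j) = b j := by
        have : t.basisAt b hy j = t.symmL ℝ y (b j) := by
          simp [Trivialization.basisAt, hy]
        rw [this, t.continuousLinearMapAt_symmL hy]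
      rw [map_smul, this, map_smul, b.repr_self]
      by_cases hij : j = i
      · simp [hij]
      · simp [Ne.symm hij]
    · have : f y = 0 := by
        by_contra h
        exact hy (hf (subset_tsupport _ h))
      simp [hξ, this]

/-- Every vector extends to a smooth section. -/
theorem exists_section_eq (F : Type*) [NormedAddCommGroup F] [NormedSpace ℝ F]
    {V : M → Type*} [TopologicalSpace (TotalSpace F V)]
    [∀ x, AddCommGroup (V x)] [∀ x, Module ℝ (V x)]
    [∀ x, TopologicalSpace (V x)] [FiberBundle F V] [VectorBundle ℝ F V]
    [FiniteDimensional ℝ F] [ContMDiffVectorBundle ∞ F V 𝓘(ℝ, EM)] {x : M} (v : V x) :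
    ∃ e : Sec EM F V, e x = v := by
  obtain ⟨N, e, ξ, g, hg, h, -⟩ := exists_localFrame (EM := EM) F V x
  refine ⟨∑ i, ξ i x v • e i, ?_⟩
  rw [sec_sum_apply]
  simp only [ContMDiffSection.coe_smul, Pi.smul_apply]
  rw [h, hg.self_of_nhds, one_smul]

/-- Sections of the dual bundle separate the points of a fibre. -/
theorem eq_of_forall_dual (F : Type*) [NormedAddCommGroup F] [NormedSpace ℝ F]
    {V : M → Type*} [TopologicalSpace (TotalSpace F V)]
    [∀ x, AddCommGroup (V x)] [∀ x, Module ℝ (V x)]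
    [∀ x, TopologicalSpace (V x)] [FiberBundle F V] [VectorBundle ℝ F V]
    [FiniteDimensional ℝ F] [ContMDiffVectorBundle ∞ F V 𝓘(ℝ, EM)] {x : M} {v w : V x}
    (hvw : ∀ ξ : DualSec EM F V, ξ x v = ξ x w) : v = w := by
  obtain ⟨N, e, ξ, g, hg, h, -⟩ := exists_localFrame (EM := EM) F V x
  have h1 := h x v
  have h2 := h x w
  simp only [hg.self_of_nhds, one_smul] at h1 h2
  rw [← h1, ← h2]
  simp [hvw]

/-- A function-linear operation on sections depends only on the value of the section. -/
theorem eq_of_functionLinear {W : Type*} [AddCommGroup W] [Module ℝ W] {x : M}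
    (φ : Sec EM F V →+ W) (hφ : ∀ (f : SmoothFn EM M) e, φ (fsmul f e) = f x • φ e)
    {e e' : Sec EM F V} (h : e x = e' x) : φ e = φ e' := by
  obtain ⟨N, s, ξ, g, hg, hs, -⟩ := exists_localFrame (EM := EM) F V x
  have key : ∀ e : Sec EM F V, φ e = ∑ i, ξ i x (e x) • φ (s i) := by
    intro e
    have : fsmul g e = ∑ i, fsmul (pairing (ξ i) e) (s i) := by
      ext y
      simp [sec_sum_apply, fsmul_apply, hs]
    have h2 := congrArg φ this
    rw [hφ, hg.self_of_nhds, one_smul, map_sum] at h2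
    rw [h2]
    exact Finset.sum_congr rfl fun i _ => hφ _ _
  rw [key, key, h]

/-- A family of sections and dual sections reproducing the identity on `S`. -/
structure FrameOn (EM : Type*) [NormedAddCommGroup EM] [NormedSpace ℝ EM]
    {M : Type*} [TopologicalSpace M] [ChartedSpace EM M]
    (F : Type*) [NormedAddCommGroup F] [NormedSpace ℝ F]
    (V : M → Type*) [TopologicalSpace (TotalSpace F V)]
    [∀ x, AddCommGroup (V x)] [∀ x, Module ℝ (V x)]
    [∀ x, TopologicalSpace (V x)] [FiberBundle F V] [VectorBundle ℝ F V] (S : Set M) where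
  N : ℕ
  e : Fin N → Sec EM F V
  ξ : Fin N → DualSec EM F V
  sum_eq : ∀ y ∈ S, ∀ v : V y, ∑ i, ξ i y v • e i y = v

theorem frameOn_union {S T : Set M} (hS : Nonempty (FrameOn EM F V S))
    (hT : Nonempty (FrameOn EM F V T)) : Nonempty (FrameOn EM F V (S ∪ T)) := by
  obtain ⟨⟨m, e, ξ, he⟩⟩ := hS
  obtain ⟨⟨n, e', ξ', he'⟩⟩ := hT
  let η : Fin n → DualSec EM F V := fun k =>
    ξ' k - ∑ i, ⟨fun y => pairing (ξ' k) (e i) y • ξ i y,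
      (pairing (ξ' k) (e i)).contMDiff.smul_section (ξ i).contMDiff⟩
  have hη : ∀ k y (v : V y), η k y v = ξ' k y (v - ∑ i, ξ i y v • e i y) := by
    intro k y v
    simp [η, dualSec_sum_apply, mul_comm]
  refine ⟨⟨m + n, Fin.append e e', Fin.append ξ η, ?_⟩⟩
  intro y hy v
  rw [Fin.sum_univ_add]
  simp only [Fin.append_left, Fin.append_right, hη]
  rcases hy with hy | hy
  · simp [he y hy v]
  · rw [he' y hy]
    abel

theorem exists_frameOn (F : Type*) [NormedAddCommGroup F] [NormedSpace ℝ F]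
    (V : M → Type*) [TopologicalSpace (TotalSpace F V)]
    [∀ x, AddCommGroup (V x)] [∀ x, Module ℝ (V x)]
    [∀ x, TopologicalSpace (V x)] [FiberBundle F V] [VectorBundle ℝ F V]
    [FiniteDimensional ℝ F] [ContMDiffVectorBundle ∞ F V 𝓘(ℝ, EM)] {K : Set M}
    (hK : IsCompact K) : Nonempty (FrameOn EM F V K) := by
  refine hK.induction_on (p := fun S => Nonempty (FrameOn EM F V S)) ?_ ?_ ?_ ?_
  · exact ⟨⟨0, Fin.elim0, Fin.elim0, fun y hy => hy.elim⟩⟩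
  · rintro S T hST ⟨f⟩
    exact ⟨⟨f.N, f.e, f.ξ, fun y hy => f.sum_eq y (hST hy)⟩⟩
  · intro S T hS hT
    exact frameOn_union hS hT
  · intro x _
    obtain ⟨N, e, ξ, g, hg, h, -⟩ := exists_localFrame (EM := EM) F V x
    exact ⟨{y | g y = 1}, mem_nhdsWithin_of_mem_nhds hg, ⟨N, e, ξ, fun y hy v => by
      rw [h, show g y = 1 from hy, one_smul]⟩⟩

end Frames

/-! ### The differential of the Lie algebroid -/

section Differential

variable {EM : Type*} [NormedAddCommGroup EM] [NormedSpace ℝ EM]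
  {M : Type*} [TopologicalSpace M] [ChartedSpace EM M]

theorem dirDeriv_mul (f g : SmoothFn EM M) {x : M} (v : TangentSpace 𝓘(ℝ, EM) x) :
    dirDeriv (fun y => f y * g y) v = f x * dirDeriv g v + dirDeriv f v * g x := by
  have hf : MDifferentiableAt 𝓘(ℝ, EM) 𝓘(ℝ, ℝ) f x := f.contMDiff.mdifferentiable (by simp) x
  have hg : MDifferentiableAt 𝓘(ℝ, EM) 𝓘(ℝ, ℝ) g x := g.contMDiff.mdifferentiable (by simp) x
  have h := (hf.hasMFDerivAt.mul' hg.hasMFDerivAt).mfderiv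
  have h2 := DFunLike.congr_fun h v
  refine Eq.trans h2 ?_
  change f x * dirDeriv g v + _ = _
  rfl

theorem dirDeriv_add (f g : SmoothFn EM M) {x : M} (v : TangentSpace 𝓘(ℝ, EM) x) :
    dirDeriv (fun y => f y + g y) v = dirDeriv f v + dirDeriv g v := by
  have hf : MDifferentiableAt 𝓘(ℝ, EM) 𝓘(ℝ, ℝ) f x := f.contMDiff.mdifferentiable (by simp) x
  have hg : MDifferentiableAt 𝓘(ℝ, EM) 𝓘(ℝ, ℝ) g x := g.contMDiff.mdifferentiable (by simp) x
  have h := (hf.hasMFDerivAt.add hg.hasMFDerivAt).mfderiv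
  exact DFunLike.congr_fun h v

theorem dirDeriv_const (c : ℝ) {x : M} (v : TangentSpace 𝓘(ℝ, EM) x) :
    dirDeriv (fun _ => c) v = 0 := by
  have h := (hasMFDerivAt_const (I := 𝓘(ℝ, EM)) (I' := 𝓘(ℝ, ℝ)) c x).mfderiv
  exact DFunLike.congr_fun h v

theorem dirDeriv_add_right (f : M → ℝ) {x : M} (v w : TangentSpace 𝓘(ℝ, EM) x) :
    dirDeriv f (v + w) = dirDeriv f v + dirDeriv f w := by
  simp only [dirDeriv, map_add]
  rfl

theorem dirDeriv_smul_right (f : M → ℝ) {x : M} (c : ℝ) (v : TangentSpace 𝓘(ℝ, EM) x) :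
    dirDeriv f (c • v) = c * dirDeriv f v := by
  simp only [dirDeriv, map_smul]
  rfl

variable [IsManifold 𝓘(ℝ, EM) ∞ M] [FiniteDimensional ℝ EM] [T2Space M]
  {FA : Type*} [NormedAddCommGroup FA] [NormedSpace ℝ FA] [FiniteDimensional ℝ FA]
  {A : M → Type*} [TopologicalSpace (TotalSpace FA A)]
  [∀ x, AddCommGroup (A x)] [∀ x, Module ℝ (A x)]
  [∀ x, TopologicalSpace (A x)] [FiberBundle FA A] [VectorBundle ℝ FA A]
  [ContMDiffVectorBundle ∞ FA A 𝓘(ℝ, EM)]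

theorem LieAlgebroid.add_bracket (L : LieAlgebroid EM FA A) (α α' β : Sec EM FA A) :
    L.bracket (α + α') β = L.bracket α β + L.bracket α' β := by
  rw [L.bracket_antisymm, L.bracket_add, L.bracket_antisymm α, L.bracket_antisymm α', neg_add]

theorem LieAlgebroid.fsmul_bracket (L : LieAlgebroid EM FA A) (f : SmoothFn EM M)
    (α β : Sec EM FA A) (x : M) :
    L.bracket (fsmul f α) β x
      = f x • L.bracket α β x - dirDeriv f (L.anchor x (β x)) • α x := by
  rw [L.bracket_antisymm, L.bracket_antisymm α]
  simp only [ContMDiffSection.coe_neg, Pi.neg_apply, L.leibniz]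
  simp [sub_eq_add_neg]
  abel

/-- The differential `(d_A θ)(α, β)`. -/
def dForm (L : LieAlgebroid EM FA A) (θ : DualSec EM FA A) (α β : Sec EM FA A) (x : M) : ℝ :=
  dirDeriv (fun y => θ y (β y)) (L.anchor x (α x))
    - dirDeriv (fun y => θ y (α y)) (L.anchor x (β x)) - θ x (L.bracket α β x)

variable (L : LieAlgebroid EM FA A) (θ : DualSec EM FA A)

theorem dForm_swap (α β : Sec EM FA A) (x : M) : dForm L θ α β x = - dForm L θ β α x := by
  simp only [dForm]
  rw [L.bracket_antisymm]
  simp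
  ring

theorem dForm_add_left (α α' β : Sec EM FA A) (x : M) :
    dForm L θ (α + α') β x = dForm L θ α β x + dForm L θ α' β x := by
  have h := dirDeriv_add (pairing θ α) (pairing θ α') (L.anchor x (β x))
  simp only [coe_pairing] at h
  simp only [dForm, L.add_bracket, ContMDiffSection.coe_add, Pi.add_apply, map_add,
    dirDeriv_add_right, h]
  ring

theorem dForm_fsmul_left (f : SmoothFn EM M) (α β : Sec EM FA A) (x : M) :
    dForm L θ (fsmul f α) β x = f x * dForm L θ α β x := by
  have h := dirDeriv_mul f (pairing θ α) (L.anchor x (β x))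
  simp only [coe_pairing] at h
  simp only [dForm, L.fsmul_bracket, fsmul_apply, map_smul, dirDeriv_smul_right, map_sub,
    smul_eq_mul, h]
  ring

theorem dForm_congr {α α' β β' : Sec EM FA A} {x : M} (hα : α x = α' x) (hβ : β x = β' x) :
    dForm L θ α β x = dForm L θ α' β' x := by
  have key : ∀ {α α' : Sec EM FA A} (β : Sec EM FA A), α x = α' x →
      dForm L θ α β x = dForm L θ α' β x := by
    intro α α' β h
    exact eq_of_functionLinear (x := x) (AddMonoidHom.mk' (fun α => dForm L θ α β x)
      fun _ _ => dForm_add_left L θ _ _ _ x) (fun f e => dForm_fsmul_left L θ f e β x) h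
  rw [key β hα, dForm_swap, key α' hβ, ← dForm_swap]

/-- A section through a given vector. -/
def secExt {F : Type*} [NormedAddCommGroup F] [NormedSpace ℝ F]
    {V : M → Type*} [TopologicalSpace (TotalSpace F V)]
    [∀ x, AddCommGroup (V x)] [∀ x, Module ℝ (V x)]
    [∀ x, TopologicalSpace (V x)] [FiberBundle F V] [VectorBundle ℝ F V]
    [FiniteDimensional ℝ F] [ContMDiffVectorBundle ∞ F V 𝓘(ℝ, EM)] {x : M} (v : V x) :
    Sec EM F V := (exists_section_eq F v).choose

@[simp] theorem secExt_apply {F : Type*} [NormedAddCommGroup F] [NormedSpace ℝ F]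
    {V : M → Type*} [TopologicalSpace (TotalSpace F V)]
    [∀ x, AddCommGroup (V x)] [∀ x, Module ℝ (V x)]
    [∀ x, TopologicalSpace (V x)] [FiberBundle F V] [VectorBundle ℝ F V]
    [FiniteDimensional ℝ F] [ContMDiffVectorBundle ∞ F V 𝓘(ℝ, EM)] {x : M} (v : V x) :
    (secExt v : Sec EM F V) x = v := (exists_section_eq F v).choose_spec

/-- `d_A θ` as a bilinear form on the fibre. -/
def dAt (x : M) : A x →ₗ[ℝ] A x →ₗ[ℝ] ℝ :=
  have hl : ∀ v v' w : A x, dForm L θ (secExt (v + v')) (secExt w) x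
      = dForm L θ (secExt v) (secExt w) x + dForm L θ (secExt v') (secExt w) x := by
    intro v v' w
    rw [← dForm_add_left]
    exact dForm_congr L θ (by simp) rfl
  have hs : ∀ (c : ℝ) (v w : A x), dForm L θ (secExt (c • v)) (secExt w) x
      = c * dForm L θ (secExt v) (secExt w) x := by
    intro c v w
    have := dForm_fsmul_left L θ (⟨fun _ => c, contMDiff_const⟩ : SmoothFn EM M)
      (secExt v) (secExt w) x
    refine Eq.trans ?_ this
    exact dForm_congr L θ ((secExt_apply _).trans
      (congrArg (c • ·) (secExt_apply v).symm)) rfl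
  LinearMap.mk₂ ℝ (fun v w => dForm L θ (secExt v) (secExt w) x) hl hs
    (fun v w w' => by
      rw [dForm_swap, hl, neg_add, ← dForm_swap, ← dForm_swap])
    (fun c v w => by
      rw [dForm_swap, hs, dForm_swap, smul_eq_mul]; ring)

theorem dForm_eq_dAt (α β : Sec EM FA A) (x : M) : dForm L θ α β x = dAt L θ x (α x) (β x) :=
  dForm_congr L θ (by simp) (by simp)

theorem dAt_swap (x : M) (v w : A x) : dAt L θ x v w = - dAt L θ x w v :=
  dForm_swap L θ _ _ x

end Differential

/-! ### Cubes -/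

theorem cube_eq_pi (n : ℕ) : cube n = Set.pi univ fun _ => Icc (0 : ℝ) 1 :=
  (Set.pi_univ_Icc 0 1).symm

theorem mem_cube {n : ℕ} {p : Fin n → ℝ} : p ∈ cube n ↔ ∀ i, p i ∈ Icc (0 : ℝ) 1 := by
  simp only [cube_eq_pi, Set.mem_univ_pi]

theorem uniqueDiffOn_cube (n : ℕ) : UniqueDiffOn ℝ (cube n) := by
  rw [cube_eq_pi]
  exact UniqueDiffOn.univ_pi fun _ => uniqueDiffOn_Icc one_pos

theorem isCompact_cube (n : ℕ) : IsCompact (cube n) := by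
  rw [cube_eq_pi]
  exact isCompact_univ_pi fun _ => isCompact_Icc

/-- Smooth maps between cubes. -/
structure CubeMap (m n : ℕ) where
  toFun : (Fin m → ℝ) → (Fin n → ℝ)
  smooth : ContDiff ℝ ∞ toFun
  maps : ∀ p ∈ cube m, toFun p ∈ cube n

instance (m n : ℕ) : CoeFun (CubeMap m n) fun _ => (Fin m → ℝ) → (Fin n → ℝ) := ⟨CubeMap.toFun⟩

/-- The partial derivative `∂ᵢφₖ`. -/
def CubeMap.pd {m n : ℕ} (φ : CubeMap m n) (i : Fin m) (k : Fin n) (p : Fin m → ℝ) : ℝ :=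
  fderiv ℝ φ p (Pi.single i 1) k

theorem CubeMap.differentiable {m n : ℕ} (φ : CubeMap m n) : Differentiable ℝ φ :=
  φ.smooth.differentiable (by simp)

theorem CubeMap.contDiff_pd {m n : ℕ} (φ : CubeMap m n) (i : Fin m) (k : Fin n) :
    ContDiff ℝ ∞ (φ.pd i k) := by
  have h : ContDiff ℝ ∞ (fderiv ℝ φ) := φ.smooth.fderiv_right (by simp)
  have h2 : ContDiff ℝ ∞ fun p => fderiv ℝ φ p (Pi.single i 1) := h.clm_apply contDiff_const
  exact contDiff_pi.1 h2 k

theorem CubeMap.fderiv_pd {m n : ℕ} (φ : CubeMap m n) (i j : Fin m) (k : Fin n) (p : Fin m → ℝ) :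
    fderiv ℝ (φ.pd i k) p (Pi.single j 1) = fderiv ℝ (φ.pd j k) p (Pi.single i 1) := by
  have h : ContDiff ℝ ∞ (fderiv ℝ φ) := φ.smooth.fderiv_right (by simp)
  have hd : DifferentiableAt ℝ (fderiv ℝ φ) p := h.differentiable (by simp) p
  have key : ∀ i j, fderiv ℝ (φ.pd i k) p (Pi.single j 1)
      = fderiv ℝ (fderiv ℝ φ) p (Pi.single j 1) (Pi.single i 1) k := by
    intro i j
    have h1 : HasFDerivAt (fun p => fderiv ℝ φ p (Pi.single i 1))
        ((fderiv ℝ (fderiv ℝ φ) p).flip (Pi.single i 1)) p :=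
      (hd.hasFDerivAt.clm_apply (hasFDerivAt_const (Pi.single i 1) p)).congr_fderiv (by
        ext v; simp)
    have h2 := (hasFDerivAt_pi'.1 h1 k)
    have h3 : fderiv ℝ (φ.pd i k) p = _ := h2.fderiv
    rw [h3]
    rfl
  rw [key, key]
  have hs : IsSymmSndFDerivAt ℝ φ p := φ.smooth.contDiffAt.isSymmSndFDerivAt (by
    simp only [minSmoothness_of_isRCLikeNormedField]; exact WithTop.coe_le_coe.2 (le_top : (2 : ℕ∞) ≤ ⊤))
  rw [hs]

/-- Composition of maps of cubes. -/
def CubeMap.comp {l m n : ℕ} (φ : CubeMap m n) (ψ : CubeMap l m) : CubeMap l n where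
  toFun := φ ∘ ψ
  smooth := φ.smooth.comp ψ.smooth
  maps p hp := φ.maps _ (ψ.maps p hp)

theorem CubeMap.pd_comp {l m n : ℕ} (φ : CubeMap m n) (ψ : CubeMap l m) (i : Fin l) (k : Fin n)
    (p : Fin l → ℝ) : (φ.comp ψ).pd i k p = ∑ j, ψ.pd i j p * φ.pd j k (ψ p) := by
  have h : fderiv ℝ (φ.comp ψ) p = (fderiv ℝ φ (ψ p)).comp (fderiv ℝ ψ p) :=
    fderiv_comp p (φ.differentiable _) (ψ.differentiable _)
  simp only [CubeMap.pd, h, ContinuousLinearMap.comp_apply]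
  conv_lhs => rw [pi_eq_sum_univ' (fderiv ℝ ψ p (Pi.single i 1))]
  simp only [map_sum, map_smul, Finset.sum_apply, Pi.smul_apply, smul_eq_mul]

theorem CubeMap.pd_congr {m n : ℕ} {φ ψ : CubeMap m n} (h : ∀ p ∈ cube m, φ p = ψ p) (i : Fin m)
    (k : Fin n) {p : Fin m → ℝ} (hp : p ∈ cube m) : φ.pd i k p = ψ.pd i k p := by
  have hu := uniqueDiffOn_cube m p hp
  have : fderiv ℝ φ p = fderiv ℝ ψ p := by
    rw [← (φ.differentiable p).fderivWithin hu, ← (ψ.differentiable p).fderivWithin hu]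
    exact fderivWithin_congr h (h p hp)
  simp only [CubeMap.pd, this]

/-- `∂ᵢφₖ` vanishes when `φₖ` does not depend on the `i`-th coordinate. -/
theorem CubeMap.pd_eq_zero {m n : ℕ} (φ : CubeMap m n) (i : Fin m) (k : Fin n) (p : Fin m → ℝ)
    (h : ∀ r, φ (Function.update p i r) k = φ p k) : φ.pd i k p = 0 := by
  have h1 : HasDerivAt (fun r => φ (Function.update p i r))
      (fderiv ℝ φ p (Pi.single i 1)) (p i) := by
    have := (φ.differentiable (Function.update p i (p i))).hasFDerivAt.comp_hasDerivAt (p i)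
      (hasDerivAt_update p i (p i))
    rw [Function.update_eq_self] at this
    exact this
  have h2 := hasDerivAt_pi.1 h1 k
  simp only [h] at h2
  exact h2.unique (hasDerivAt_const _ _)

section Algebroid

variable {EM : Type*} [NormedAddCommGroup EM] [NormedSpace ℝ EM] [FiniteDimensional ℝ EM]
  {M : Type*} [TopologicalSpace M] [ChartedSpace EM M] [IsManifold 𝓘(ℝ, EM) ∞ M] [T2Space M]
  {FA : Type*} [NormedAddCommGroup FA] [NormedSpace ℝ FA] [FiniteDimensional ℝ FA]
  {A : M → Type*} [TopologicalSpace (TotalSpace FA A)]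
  [∀ x, AddCommGroup (A x)] [∀ x, Module ℝ (A x)]
  [∀ x, TopologicalSpace (A x)] [FiberBundle FA A] [VectorBundle ℝ FA A]
  [ContMDiffVectorBundle ∞ FA A 𝓘(ℝ, EM)]

/-! ### Pulling back and gluing morphisms of cubes -/

section Cubes

/-- Linear combinations of smooth maps to the total space over the same base map. -/
theorem contMDiffOn_sum_smul {F : Type*} [NormedAddCommGroup F] [NormedSpace ℝ F]
    {V : M → Type*} [TopologicalSpace (TotalSpace F V)]
    [∀ x, AddCommGroup (V x)] [∀ x, Module ℝ (V x)]
    [∀ x, TopologicalSpace (V x)] [FiberBundle F V] [VectorBundle ℝ F V]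
    {EX X : Type*} [NormedAddCommGroup EX] [NormedSpace ℝ EX]
    [TopologicalSpace X] [ChartedSpace EX X] {s : Set X} {b : X → M} {ι : Type*} [Fintype ι]
    {c : ι → X → ℝ} {v : ι → ∀ p, V (b p)}
    (hb : ContMDiffOn 𝓘(ℝ, EX) 𝓘(ℝ, EM) ∞ b s)
    (hc : ∀ k, ContMDiffOn 𝓘(ℝ, EX) 𝓘(ℝ, ℝ) ∞ (c k) s)
    (hv : ∀ k, ContMDiffOn 𝓘(ℝ, EX) (𝓘(ℝ, EM).prod 𝓘(ℝ, F)) ∞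
      (fun p => TotalSpace.mk' F (b p) (v k p)) s) :
    ContMDiffOn 𝓘(ℝ, EX) (𝓘(ℝ, EM).prod 𝓘(ℝ, F)) ∞
      (fun p => TotalSpace.mk' F (b p) (∑ k, c k p • v k p)) s := by
  intro p hp
  refine contMDiffWithinAt_totalSpace.2 ⟨hb p hp, ?_⟩
  let t := trivializationAt F V (b p)
  have h1 : ContMDiffWithinAt 𝓘(ℝ, EX) 𝓘(ℝ, F) ∞
      (fun q => ∑ k, c k q • (t (TotalSpace.mk' F (b q) (v k q))).2) s p :=
    ContMDiffWithinAt.sum fun k _ =>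
      (hc k p hp).smul (contMDiffWithinAt_totalSpace.1 (hv k p hp)).2
  have hmem : ∀ᶠ q in 𝓝[s] p, b q ∈ t.baseSet :=
    (hb p hp).continuousWithinAt (t.open_baseSet.mem_nhds (mem_baseSet_trivializationAt F V (b p)))
  have key : ∀ q, b q ∈ t.baseSet → (t (TotalSpace.mk' F (b q) (∑ k, c k q • v k q))).2
      = ∑ k, c k q • (t (TotalSpace.mk' F (b q) (v k q))).2 := by
    intro q hq
    have := map_sum (t.linearMapAt ℝ (b q)) (fun k => c k q • v k q) Finset.univ
    simp only [map_smul, t.coe_linearMapAt_of_mem hq] at this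
    exact this
  exact h1.congr_of_eventuallyEq (hmem.mono key)
    (key p (mem_baseSet_trivializationAt F V (b p)))

variable {L : LieAlgebroid EM FA A}

theorem CubeMorphism.contDiffOn_dual {n : ℕ} (κ : CubeMorphism L n) (θ : DualSec EM FA A)
    (i : Fin n) : ContDiffOn ℝ ∞ (fun q => θ (κ.base q) (κ.vec i q)) (cube n) :=
  contMDiffOn_iff_contDiffOn.1 (contMDiffOn_dual_apply θ κ.base_smooth (κ.smooth i))

theorem CubeMorphism.bracket_all {n : ℕ} (κ : CubeMorphism L n) (i j : Fin n) {p : Fin n → ℝ}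
    (hp : p ∈ cube n) (θ : DualSec EM FA A) :
    fderivWithin ℝ (fun q => θ (κ.base q) (κ.vec j q)) (cube n) p (Pi.single i 1)
        - fderivWithin ℝ (fun q => θ (κ.base q) (κ.vec i q)) (cube n) p (Pi.single j 1)
      = dAt L θ (κ.base p) (κ.vec i p) (κ.vec j p) := by
  have key : ∀ i j, i < j →
      fderivWithin ℝ (fun q => θ (κ.base q) (κ.vec j q)) (cube n) p (Pi.single i 1)
        - fderivWithin ℝ (fun q => θ (κ.base q) (κ.vec i q)) (cube n) p (Pi.single j 1)
      = dAt L θ (κ.base p) (κ.vec i p) (κ.vec j p) := by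
    intro i j hij
    rw [κ.bracket_eq i j hij p hp θ (secExt (κ.vec i p)) (secExt (κ.vec j p)) (by simp) (by simp)]
    have := dForm_eq_dAt L θ (secExt (κ.vec i p)) (secExt (κ.vec j p)) (κ.base p)
    simp only [dForm, secExt_apply] at this
    exact this
  rcases lt_trichotomy i j with h | rfl | h
  · exact key i j h
  · have := dAt_swap L θ (κ.base p) (κ.vec i p) (κ.vec i p)
    linarith
  · have := key j i h
    rw [dAt_swap]
    linarith

/-- The bracket condition of a morphism of cubes in terms of `dAt`. -/
theorem bracket_eq_of_dAt (L : LieAlgebroid EM FA A) {x : M} {v w : A x} {r : ℝ}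
    {θ : DualSec EM FA A} (h : r = dAt L θ x v w) (α β : Sec EM FA A) (hα : α x = v)
    (hβ : β x = w) :
    r = dirDeriv (fun y => θ y (β y)) (L.anchor x v) - dirDeriv (fun y => θ y (α y)) (L.anchor x w)
        - θ x (L.bracket α β x) := by
  subst hα hβ
  rw [h, ← dForm_eq_dAt]
  rfl

theorem anchor_pullback {m n : ℕ} (κ : CubeMorphism L n) (φ : CubeMap m n) (i : Fin m)
    {p : Fin m → ℝ} (hp : p ∈ cube m) :
    (∑ k, φ.pd i k p • (L.anchor (κ.base (φ p)) (κ.vec k (φ p)) : EM))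
      = mfderivWithin 𝓘(ℝ, Fin m → ℝ) 𝓘(ℝ, EM) (κ.base ∘ φ) (cube m) p
          (Pi.single i (1 : ℝ) : Fin m → ℝ) := by
  have hu : UniqueMDiffWithinAt 𝓘(ℝ, Fin m → ℝ) (cube m) p :=
    (uniqueDiffOn_cube m p hp).uniqueMDiffWithinAt
  have hφ : MDifferentiableWithinAt 𝓘(ℝ, Fin m → ℝ) 𝓘(ℝ, Fin n → ℝ) φ (cube m) p :=
    (φ.differentiable p).differentiableWithinAt.mdifferentiableWithinAt
  rw [mfderivWithin_comp p ((κ.base_smooth _ (φ.maps p hp)).mdifferentiableWithinAt (by simp)) hφ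
    (fun q hq => φ.maps q hq) hu, mfderivWithin_eq_fderivWithin,
    (φ.differentiable p).fderivWithin (uniqueDiffOn_cube m p hp)]
  have hv : fderiv ℝ φ p (Pi.single i 1) = ∑ k, φ.pd i k p • (Pi.single k 1 : Fin n → ℝ) := by
    conv_lhs => rw [pi_eq_sum_univ' (fderiv ℝ φ p (Pi.single i 1))]
    rfl
  refine Eq.trans ?_ (congrArg (mfderivWithin 𝓘(ℝ, Fin n → ℝ) 𝓘(ℝ, EM) κ.base (cube n) (φ p))
    hv).symm
  refine Eq.trans ?_ (map_sum (mfderivWithin 𝓘(ℝ, Fin n → ℝ) 𝓘(ℝ, EM) κ.base (cube n) (φ p))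
    _ _).symm
  refine Finset.sum_congr rfl fun k _ => ?_
  refine Eq.trans ?_ (map_smul (mfderivWithin 𝓘(ℝ, Fin n → ℝ) 𝓘(ℝ, EM) κ.base (cube n) (φ p))
    _ _).symm
  exact congrArg (φ.pd i k p • ·) (κ.anchor_eq k _ (φ.maps p hp))

theorem fderivWithin_pullback {m n : ℕ} (κ : CubeMorphism L n) (φ : CubeMap m n) (i j : Fin m)
    {p : Fin m → ℝ} (hp : p ∈ cube m) (θ : DualSec EM FA A) :
    fderivWithin ℝ (fun q => θ (κ.base (φ q)) (∑ k, φ.pd j k q • κ.vec k (φ q))) (cube m) p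
        (Pi.single i 1)
      = ∑ k, ∑ l, φ.pd i l p * φ.pd j k p
            * fderivWithin ℝ (fun q => θ (κ.base q) (κ.vec k q)) (cube n) (φ p) (Pi.single l 1)
        + ∑ k, θ (κ.base (φ p)) (κ.vec k (φ p)) * fderiv ℝ (φ.pd j k) p (Pi.single i 1) := by
  have hg : ∀ k, HasFDerivWithinAt (fun q => θ (κ.base (φ q)) (κ.vec k (φ q)))
      ((fderivWithin ℝ (fun q => θ (κ.base q) (κ.vec k q)) (cube n) (φ p)).comp (fderiv ℝ φ p))
      (cube m) p := fun k =>
    (((κ.contDiffOn_dual θ k).differentiableOn (by simp)) _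
      (φ.maps p hp)).hasFDerivWithinAt.comp p (φ.differentiable p).hasFDerivAt.hasFDerivWithinAt
        (fun q hq => φ.maps q hq)
  have hc : ∀ k, HasFDerivWithinAt (φ.pd j k) (fderiv ℝ (φ.pd j k) p) (cube m) p := fun k =>
    ((φ.contDiff_pd j k).differentiable (by simp) p).hasFDerivAt.hasFDerivWithinAt
  have hs := HasFDerivWithinAt.fun_sum (u := Finset.univ) fun k _ => (hc k).mul (hg k)
  have heq : (fun q => θ (κ.base (φ q)) (∑ k, φ.pd j k q • κ.vec k (φ q)))
      = fun q => ∑ k, φ.pd j k q * θ (κ.base (φ q)) (κ.vec k (φ q)) := by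
    ext q
    simp
  rw [heq]
  have hs' := hs.fderivWithin (uniqueDiffOn_cube m p hp)
  refine (DFunLike.congr_fun hs' (Pi.single i 1)).trans ?_
  have hv : fderiv ℝ φ p (Pi.single i 1) = ∑ k, φ.pd i k p • (Pi.single k 1 : Fin n → ℝ) := by
    conv_lhs => rw [pi_eq_sum_univ' (fderiv ℝ φ p (Pi.single i 1))]
    rfl
  simp only [sum_apply, add_apply, smul_apply, ContinuousLinearMap.comp_apply, hv, map_sum, map_smul,
    smul_eq_mul, Finset.sum_add_distrib, Finset.mul_sum]
  congr 1
  refine Finset.sum_congr rfl fun k _ => Finset.sum_congr rfl fun l _ => ?_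
  ring

/-- The pullback of a morphism of cubes along a smooth map of cubes. -/
def CubeMorphism.pull {m n : ℕ} (κ : CubeMorphism L n) (φ : CubeMap m n) : CubeMorphism L m where
  base := κ.base ∘ φ
  vec i p := ∑ k, φ.pd i k p • κ.vec k (φ p)
  base_smooth := κ.base_smooth.comp φ.smooth.contMDiff.contMDiffOn φ.maps
  smooth i := contMDiffOn_sum_smul (κ.base_smooth.comp φ.smooth.contMDiff.contMDiffOn φ.maps)
    (fun k => (φ.contDiff_pd i k).contMDiff.contMDiffOn)
    (fun k => (κ.smooth k).comp φ.smooth.contMDiff.contMDiffOn φ.maps)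
  anchor_eq i p hp := by
    rw [map_sum]
    simp only [map_smul]
    exact anchor_pullback κ φ i hp
  bracket_eq i j _ p hp θ α β hα hβ := by
    refine bracket_eq_of_dAt L ?_ α β hα hβ
    refine (congrArg₂ (· - ·) (fderivWithin_pullback κ φ i j hp θ)
      (fderivWithin_pullback κ φ j i hp θ)).trans ?_
    simp only [Function.comp_apply, map_sum, map_smul, LinearMap.sum_apply, LinearMap.smul_apply,
      smul_eq_mul, φ.fderiv_pd j i, ← κ.bracket_all _ _ (φ.maps p hp) θ, mul_sub,
      Finset.sum_sub_distrib, Finset.mul_sum]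
    rw [add_sub_add_right_eq_sub]
    congr 1
    · refine Finset.sum_congr rfl fun k _ => Finset.sum_congr rfl fun l _ => ?_
      ring
    · rw [Finset.sum_comm]
      refine Finset.sum_congr rfl fun k _ => Finset.sum_congr rfl fun l _ => ?_
      ring

/-- The value of a morphism of cubes at a point. -/
def CubeMorphism.jet {n : ℕ} (κ : CubeMorphism L n) (p : Fin n → ℝ) : Σ x : M, Fin n → A x :=
  ⟨κ.base p, fun i => κ.vec i p⟩

/-- The `i`-th component of a jet. -/
def jetComp {n : ℕ} (i : Fin n) (J : Σ x : M, Fin n → A x) : TotalSpace FA A := ⟨J.1, J.2 i⟩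

theorem CubeMorphism.comp_eq_jet {n : ℕ} (κ : CubeMorphism L n) (i : Fin n) (p : Fin n → ℝ) :
    κ.comp i p = jetComp i (κ.jet p) := rfl

theorem jet_ext {n : ℕ} {J J' : Σ x : M, Fin n → A x} (h0 : J.1 = J'.1)
    (h : ∀ i, (jetComp i J : TotalSpace FA A) = jetComp i J') : J = J' := by
  obtain ⟨x, v⟩ := J
  obtain ⟨y, w⟩ := J'
  obtain rfl : x = y := h0
  congr 1
  ext i
  exact eq_of_heq (TotalSpace.mk.inj (h i)).2

theorem CubeMorphism.jet_ext_of_comp {n : ℕ} {κ κ' : CubeMorphism L (n + 1)} {p q : Fin (n + 1) → ℝ}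
    (h : ∀ i, κ.comp i p = κ'.comp i q) : κ.jet p = κ'.jet q :=
  jet_ext (congrArg TotalSpace.proj (h 0)) h

/-- Being a morphism of cubes is a local property. -/
def CubeMorphism.ofLocal {n : ℕ} (J : (Fin n → ℝ) → Σ x : M, Fin n → A x)
    (hJ : ∀ p ∈ cube n, ∃ κ : CubeMorphism L n, ∀ᶠ q in 𝓝[cube n] p, J q = κ.jet q) :
    CubeMorphism L n where
  base p := (J p).1
  vec i p := (J p).2 i
  base_smooth p hp := by
    obtain ⟨κ, hκ⟩ := hJ p hp
    refine (κ.base_smooth p hp).congr_of_eventuallyEq (hκ.mono fun q hq => ?_) ?_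
    · exact congrArg Sigma.fst hq
    · exact congrArg Sigma.fst (hκ.self_of_nhdsWithin hp)
  smooth i p hp := by
    obtain ⟨κ, hκ⟩ := hJ p hp
    refine (κ.smooth i p hp).congr_of_eventuallyEq (hκ.mono fun q hq => ?_) ?_
    · exact congrArg (jetComp i) hq
    · exact congrArg (jetComp i) (hκ.self_of_nhdsWithin hp)
  anchor_eq i p hp := by
    obtain ⟨κ, hκ⟩ := hJ p hp
    have hp' := hκ.self_of_nhdsWithin hp
    have h1 : (fun q => (J q).1) =ᶠ[𝓝[cube n] p] κ.base := hκ.mono fun q hq => congrArg Sigma.fst hq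
    have h2 := h1.mfderivWithin_eq (I := 𝓘(ℝ, Fin n → ℝ)) (I' := 𝓘(ℝ, EM))
      (congrArg Sigma.fst hp')
    have h3 : (L.anchor (J p).1 ((J p).2 i) : EM) = L.anchor (κ.base p) (κ.vec i p) :=
      congrArg (fun j : Σ x : M, Fin n → A x => (L.anchor j.1 (j.2 i) : EM)) hp'
    refine h3.trans ((κ.anchor_eq i p hp).trans ?_)
    exact (DFunLike.congr_fun h2 _).symm
  bracket_eq i j hij p hp θ α β hα hβ := by
    obtain ⟨κ, hκ⟩ := hJ p hp
    have hp' := hκ.self_of_nhdsWithin hp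
    refine bracket_eq_of_dAt L ?_ α β hα hβ
    have h1 : ∀ k, (fun q => θ (J q).1 ((J q).2 k)) =ᶠ[𝓝[cube n] p]
        fun q => θ (κ.base q) (κ.vec k q) := fun k => hκ.mono fun q hq =>
      congrArg (fun j : Σ x : M, Fin n → A x => θ j.1 (j.2 k)) hq
    rw [(h1 j).fderivWithin_eq ((h1 j).self_of_nhdsWithin hp),
      (h1 i).fderivWithin_eq ((h1 i).self_of_nhdsWithin hp), κ.bracket_all i j hp θ]
    exact (congrArg (fun k : Σ x : M, Fin n → A x => dAt L θ k.1 (k.2 i) (k.2 j)) hp').symm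

@[simp] theorem CubeMorphism.ofLocal_jet {n : ℕ} (J : (Fin n → ℝ) → Σ x : M, Fin n → A x)
    (hJ : ∀ p ∈ cube n, ∃ κ : CubeMorphism L n, ∀ᶠ q in 𝓝[cube n] p, J q = κ.jet q)
    (p : Fin n → ℝ) : (CubeMorphism.ofLocal J hJ).jet p = J p := rfl

/-- The action of a matrix on jets. -/
def jetPull {m n : ℕ} (c : Fin m → Fin n → ℝ) (J : Σ x : M, Fin n → A x) : Σ x : M, Fin m → A x :=
  ⟨J.1, fun i => ∑ k, c i k • J.2 k⟩

theorem CubeMorphism.pull_jet {m n : ℕ} (κ : CubeMorphism L n) (φ : CubeMap m n)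
    (p : Fin m → ℝ) : (κ.pull φ).jet p = jetPull (fun i k => φ.pd i k p) (κ.jet (φ p)) := rfl

theorem jetPull_jetPull {l m n : ℕ} (c : Fin l → Fin m → ℝ) (c' : Fin m → Fin n → ℝ)
    (J : Σ x : M, Fin n → A x) :
    jetPull c (jetPull c' J) = jetPull (fun i k => ∑ j, c i j * c' j k) J := by
  obtain ⟨x, v⟩ := J
  refine congrArg (Sigma.mk x) (funext fun i => ?_)
  change ∑ j, c i j • ∑ k, c' j k • v k = ∑ k, (∑ j, c i j * c' j k) • v k
  simp only [Finset.smul_sum, Finset.sum_smul, smul_smul]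
  rw [Finset.sum_comm]

theorem jetPull_single {n : ℕ} (J : Σ x : M, Fin n → A x) :
    jetPull (fun i k => (Pi.single i 1 : Fin n → ℝ) k) J = J := by
  obtain ⟨x, v⟩ := J
  refine congrArg (Sigma.mk x) (funext fun i => ?_)
  change ∑ k, (Pi.single i 1 : Fin n → ℝ) k • v k = v i
  rw [Finset.sum_eq_single i] <;> simp +contextual

theorem CubeMorphism.pull_pull {l m n : ℕ} (κ : CubeMorphism L n) (φ : CubeMap m n)
    (ψ : CubeMap l m) (p : Fin l → ℝ) :
    ((κ.pull φ).pull ψ).jet p = (κ.pull (φ.comp ψ)).jet p := by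
  simp only [CubeMorphism.pull_jet, jetPull_jetPull, CubeMap.pd_comp]
  rfl

/-- Two morphisms of cubes agree on the cube. -/
def SameOn {n : ℕ} (κ κ' : CubeMorphism L n) : Prop := ∀ p ∈ cube n, κ.jet p = κ'.jet p

theorem SameOn.refl {n : ℕ} (κ : CubeMorphism L n) : SameOn κ κ := fun _ _ => rfl

theorem SameOn.symm {n : ℕ} {κ κ' : CubeMorphism L n} (h : SameOn κ κ') : SameOn κ' κ :=
  fun p hp => (h p hp).symm

theorem SameOn.trans {n : ℕ} {κ κ' κ'' : CubeMorphism L n} (h : SameOn κ κ') (h' : SameOn κ' κ'') :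
    SameOn κ κ'' := fun p hp => (h p hp).trans (h' p hp)

theorem SameOn.pull {m n : ℕ} {κ κ' : CubeMorphism L n} (h : SameOn κ κ') (φ : CubeMap m n) :
    SameOn (κ.pull φ) (κ'.pull φ) := fun p hp => by
  rw [CubeMorphism.pull_jet, CubeMorphism.pull_jet, h _ (φ.maps p hp)]

theorem sameOn_pull_congr {m n : ℕ} (κ : CubeMorphism L n) {φ ψ : CubeMap m n}
    (h : ∀ p ∈ cube m, φ p = ψ p) : SameOn (κ.pull φ) (κ.pull ψ) := fun p hp => by
  simp only [CubeMorphism.pull_jet, fun i k => CubeMap.pd_congr h i k hp, h p hp]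

theorem sameOn_pull_pull {l m n : ℕ} (κ : CubeMorphism L n) (φ : CubeMap m n)
    (ψ : CubeMap l m) : SameOn ((κ.pull φ).pull ψ) (κ.pull (φ.comp ψ)) :=
  fun p _ => κ.pull_pull φ ψ p

/-- If `φ` is the identity on the cube then so is pulling back along `φ`. -/
theorem sameOn_pull_id {n : ℕ} (κ : CubeMorphism L n) {φ : CubeMap n n}
    (h : ∀ p ∈ cube n, φ p = p) : SameOn (κ.pull φ) κ := fun p hp => by
  let ι : CubeMap n n := ⟨id, contDiff_id, fun _ h => h⟩
  have hι : ∀ i k, φ.pd i k p = (Pi.single i 1 : Fin n → ℝ) k := by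
    intro i k
    rw [CubeMap.pd_congr (ψ := ι) h i k hp]
    simp only [CubeMap.pd]
    change fderiv ℝ id p (Pi.single i 1) k = _
    rw [fderiv_id]
    rfl
  rw [CubeMorphism.pull_jet, h p hp]
  simp only [hι, jetPull_single]

end Cubes

/-! ### Gluing -/

/-- A smooth step function which is locally constant outside of `[1/3, 2/3]`. -/
def cut (t : ℝ) : ℝ := Real.smoothTransition (3 * t - 1)

theorem cut_eq_zero {t : ℝ} (h : t ≤ 1 / 3) : cut t = 0 :=
  Real.smoothTransition.zero_of_nonpos (by linarith)

theorem cut_eq_one {t : ℝ} (h : 2 / 3 ≤ t) : cut t = 1 :=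
  Real.smoothTransition.one_of_one_le (by linarith)

theorem cut_mem (t : ℝ) : cut t ∈ Icc (0 : ℝ) 1 :=
  ⟨Real.smoothTransition.nonneg _, Real.smoothTransition.le_one _⟩

theorem contDiff_cut : ContDiff ℝ ∞ cut :=
  Real.smoothTransition.contDiff.comp (by fun_prop)

theorem cut_half : cut (1 / 2) = 1 / 2 := by
  have h : (3 * (1 / 2 : ℝ) - 1) = 1 / 2 := by norm_num
  have h2 : expNegInvGlue (1 / 2) ≠ 0 := (expNegInvGlue.pos_of_pos (by norm_num)).ne'
  rw [cut, h, Real.smoothTransition, show (1 : ℝ) - 1 / 2 = 1 / 2 by norm_num]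
  field_simp
  norm_num

theorem CubeMap.pd_eq_of_hasDerivAt {m n : ℕ} (φ : CubeMap m n) (i : Fin m) (k : Fin n)
    (p : Fin m → ℝ) {c : ℝ} (h : HasDerivAt (fun r => φ (Function.update p i r) k) c (p i)) :
    φ.pd i k p = c := by
  have h1 : HasDerivAt (fun r => φ (Function.update p i r))
      (fderiv ℝ φ p (Pi.single i 1)) (p i) := by
    have := (φ.differentiable (Function.update p i (p i))).hasFDerivAt.comp_hasDerivAt (p i)
      (hasDerivAt_update p i (p i))
    rw [Function.update_eq_self] at this
    exact this
  exact (hasDerivAt_pi.1 h1 k).unique h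

/-- Reparametrization of one coordinate. -/
def reparam {n : ℕ} (i : Fin n) (f : ℝ → ℝ) (hf : ContDiff ℝ ∞ f)
    (hm : ∀ t ∈ Icc (0 : ℝ) 1, f t ∈ Icc (0 : ℝ) 1) : CubeMap n n where
  toFun p := Function.update p i (f (p i))
  smooth := contDiff_pi.2 fun j => by
    by_cases h : j = i
    · subst h
      simp only [Function.update_self]
      exact hf.comp (contDiff_apply ℝ ℝ j)
    · simpa [h] using contDiff_apply ℝ ℝ j
  maps p hp := mem_cube.2 fun j => by
    by_cases h : j = i
    · subst h
      simpa using hm _ (mem_cube.1 hp j)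
    · simpa [h] using mem_cube.1 hp j

theorem reparam_apply {n : ℕ} (i : Fin n) (f : ℝ → ℝ) (hf : ContDiff ℝ ∞ f)
    (hm : ∀ t ∈ Icc (0 : ℝ) 1, f t ∈ Icc (0 : ℝ) 1) (p : Fin n → ℝ) :
    reparam i f hf hm p = Function.update p i (f (p i)) := rfl

theorem pd_reparam {n : ℕ} (i : Fin n) (f : ℝ → ℝ) (hf : ContDiff ℝ ∞ f)
    (hm : ∀ t ∈ Icc (0 : ℝ) 1, f t ∈ Icc (0 : ℝ) 1) (j k : Fin n) (p : Fin n → ℝ) :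
    (reparam i f hf hm).pd j k p
      = if j = k then (if j = i then deriv f (p i) else 1) else 0 := by
  apply CubeMap.pd_eq_of_hasDerivAt
  simp only [reparam_apply]
  by_cases hki : k = i
  · subst hki
    simp only [Function.update_self]
    by_cases hjk : j = k
    · subst hjk
      simpa using (hf.differentiable (by simp) (p j)).hasDerivAt
    · simpa [hjk, Function.update_of_ne (Ne.symm hjk)] using hasDerivAt_const _ _
  · simp only [Function.update_of_ne hki]
    by_cases hjk : j = k
    · subst hjk
      simpa [hki] using hasDerivAt_id' _
    · simpa [hjk, Function.update_of_ne (Ne.symm hjk)] using hasDerivAt_const _ _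

/-- The lower half of a concatenation in the direction `i`. -/
def lo {n : ℕ} (i : Fin n) : CubeMap n n :=
  reparam i (fun t => cut (2 * t)) (contDiff_cut.comp (by fun_prop)) fun _ _ => cut_mem _

/-- The upper half of a concatenation in the direction `i`. -/
def hi {n : ℕ} (i : Fin n) : CubeMap n n :=
  reparam i (fun t => cut (2 * t - 1)) (contDiff_cut.comp (by fun_prop)) fun _ _ => cut_mem _

theorem lo_apply {n : ℕ} (i : Fin n) (p : Fin n → ℝ) :
    lo i p = Function.update p i (cut (2 * p i)) := rfl

theorem hi_apply {n : ℕ} (i : Fin n) (p : Fin n → ℝ) :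
    hi i p = Function.update p i (cut (2 * p i - 1)) := rfl

/-- Two maps which agree on half of the cube have the same derivatives there. -/
theorem CubeMap.pd_congr_half {m n : ℕ} {φ ψ : CubeMap m n} (i : Fin m) {a b : ℝ} (hab : a < b)
    (ha : 0 ≤ a) (hb : b ≤ 1)
    (h : ∀ p ∈ cube m, p i ∈ Icc a b → φ p = ψ p) (j : Fin m)
    (k : Fin n) {p : Fin m → ℝ} (hp : p ∈ cube m) (hpi : p i ∈ Icc a b) :
    φ.pd j k p = ψ.pd j k p := by
  classical
  let S : Set (Fin m → ℝ) := Set.pi univ fun l => if l = i then Icc a b else Icc 0 1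
  have hS : ∀ q, q ∈ S ↔ q ∈ cube m ∧ q i ∈ Icc a b := by
    intro q
    simp only [S, Set.mem_univ_pi, mem_cube]
    constructor
    · intro hq
      have hqi := hq i
      simp only [if_true] at hqi
      refine ⟨fun l => ?_, hqi⟩
      by_cases hl : l = i
      · subst hl
        exact ⟨ha.trans hqi.1, hqi.2.trans hb⟩
      · simpa [hl] using hq l
    · rintro ⟨h1, h2⟩ l
      by_cases hl : l = i
      · subst hl
        simpa using h2
      · simpa [hl] using h1 l
  have hu : UniqueDiffWithinAt ℝ S p := by
    refine UniqueDiffOn.univ_pi (fun l => ?_) p ((hS p).2 ⟨hp, hpi⟩)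
    split_ifs
    · exact uniqueDiffOn_Icc hab
    · exact uniqueDiffOn_Icc one_pos
  have : fderiv ℝ φ p = fderiv ℝ ψ p := by
    rw [← (φ.differentiable p).fderivWithin hu, ← (ψ.differentiable p).fderivWithin hu]
    exact fderivWithin_congr (fun q hq => h q ((hS q).1 hq).1 ((hS q).1 hq).2) (h p hp hpi)
  simp only [CubeMap.pd, this]

section Glue

variable {L : LieAlgebroid EM FA A}

/-- Replace the `i`-th component of a jet by zero. -/
def jetErase {n : ℕ} (i : Fin n) (J : Σ x : M, Fin n → A x) : Σ x : M, Fin n → A x :=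
  ⟨J.1, Function.update J.2 i 0⟩

theorem CubeMorphism.pull_reparam_jet {n : ℕ} (κ : CubeMorphism L n) (i : Fin n) (f : ℝ → ℝ)
    (hf : ContDiff ℝ ∞ f) (hm : ∀ t ∈ Icc (0 : ℝ) 1, f t ∈ Icc (0 : ℝ) 1) {p : Fin n → ℝ}
    (hp : deriv f (p i) = 0) :
    (κ.pull (reparam i f hf hm)).jet p
      = jetErase i (κ.jet (Function.update p i (f (p i)))) := by
  rw [CubeMorphism.pull_jet, reparam_apply]
  simp only [pd_reparam]
  obtain ⟨x, v⟩ := κ.jet (Function.update p i (f (p i)))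
  refine congrArg (Sigma.mk x) (funext fun j => ?_)
  change ∑ k, (if j = k then (if j = i then deriv f (p i) else 1) else 0) • v k = _
  rw [Finset.sum_eq_single j (by simp +contextual [eq_comm]) (by simp), hp]
  by_cases hj : j = i
  · subst hj
    simp
  · simp [hj]

/-- The tangential components of the faces `pᵢ = 1` of `κ₁` and `pᵢ = 0` of `κ₂` agree. -/
def Match {n : ℕ} (i : Fin n) (κ₁ κ₂ : CubeMorphism L n) : Prop :=
  ∀ p ∈ cube n, jetErase i (κ₁.jet (Function.update p i 1))
    = jetErase i (κ₂.jet (Function.update p i 0))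

theorem Match.jet_eq {n : ℕ} {i : Fin n} {κ₁ κ₂ : CubeMorphism L n} (h : Match i κ₁ κ₂)
    {p : Fin n → ℝ} (hp : p ∈ cube n) (h1 : 1 / 3 < p i) (h2 : p i < 2 / 3) :
    (κ₁.pull (lo i)).jet p = (κ₂.pull (hi i)).jet p := by
  have d1 : deriv (fun t => cut (2 * t)) (p i) = 0 := by
    have : (fun t => cut (2 * t)) =ᶠ[𝓝 (p i)] fun _ => 1 := by
      filter_upwards [lt_mem_nhds h1] with t ht
      exact cut_eq_one (by linarith)
    rw [this.deriv_eq]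
    simp
  have d2 : deriv (fun t => cut (2 * t - 1)) (p i) = 0 := by
    have : (fun t => cut (2 * t - 1)) =ᶠ[𝓝 (p i)] fun _ => 0 := by
      filter_upwards [gt_mem_nhds h2] with t ht
      exact cut_eq_zero (by linarith)
    rw [this.deriv_eq]
    simp
  rw [lo, hi, CubeMorphism.pull_reparam_jet _ _ _ _ _ d1,
    CubeMorphism.pull_reparam_jet _ _ _ _ _ d2]
  simp only [cut_eq_one (show 2 / 3 ≤ 2 * p i by linarith),
    cut_eq_zero (show 2 * p i - 1 ≤ 1 / 3 by linarith)]
  exact h p hp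

/-- The concatenation of two morphisms of cubes in the direction `i`. -/
def glue {n : ℕ} (i : Fin n) (κ₁ κ₂ : CubeMorphism L n) (h : Match i κ₁ κ₂) : CubeMorphism L n :=
  CubeMorphism.ofLocal
    (fun p => open Classical in
      if p i ≤ 1 / 2 then (κ₁.pull (lo i)).jet p else (κ₂.pull (hi i)).jet p)
    (fun p hp => by
      have hc : Continuous fun q : Fin n → ℝ => q i := continuous_apply i
      rcases lt_trichotomy (p i) (1 / 2) with h1 | h1 | h1
      · refine ⟨κ₁.pull (lo i), mem_nhdsWithin_of_mem_nhds ?_⟩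
        filter_upwards [hc.continuousAt.eventually (gt_mem_nhds h1)] with q hq
        rw [if_pos hq.le]
      · refine ⟨κ₁.pull (lo i), ?_⟩
        filter_upwards [mem_nhdsWithin_of_mem_nhds (hc.continuousAt.eventually
          (lt_mem_nhds (show 1 / 3 < p i by rw [h1]; norm_num))),
          mem_nhdsWithin_of_mem_nhds (hc.continuousAt.eventually
          (gt_mem_nhds (show p i < 2 / 3 by rw [h1]; norm_num))), self_mem_nhdsWithin] with q h2 h3 h4
        split_ifs with h5
        · rfl
        · exact (h.jet_eq h4 h2 h3).symm
      · refine ⟨κ₂.pull (hi i), mem_nhdsWithin_of_mem_nhds ?_⟩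
        filter_upwards [hc.continuousAt.eventually (lt_mem_nhds h1)] with q hq
        rw [if_neg (not_le.2 hq)])

theorem glue_jet_lo {n : ℕ} {i : Fin n} {κ₁ κ₂ : CubeMorphism L n} (h : Match i κ₁ κ₂)
    {p : Fin n → ℝ} (hp : p i ≤ 1 / 2) : (glue i κ₁ κ₂ h).jet p = (κ₁.pull (lo i)).jet p := by
  simp only [glue, CubeMorphism.ofLocal_jet]
  rw [if_pos hp]

theorem glue_jet_hi {n : ℕ} {i : Fin n} {κ₁ κ₂ : CubeMorphism L n} (h : Match i κ₁ κ₂)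
    {p : Fin n → ℝ} (hp : p ∈ cube n) (hpi : 1 / 2 ≤ p i) :
    (glue i κ₁ κ₂ h).jet p = (κ₂.pull (hi i)).jet p := by
  simp only [glue, CubeMorphism.ofLocal_jet]
  split_ifs with h1
  · have : p i = 1 / 2 := le_antisymm h1 hpi
    exact h.jet_eq hp (by rw [this]; norm_num) (by rw [this]; norm_num)
  · rfl

theorem SameOn.glue {n : ℕ} {i : Fin n} {κ₁ κ₂ κ₁' κ₂' : CubeMorphism L n} (h1 : SameOn κ₁ κ₁')
    (h2 : SameOn κ₂ κ₂') (h : Match i κ₁ κ₂) (h' : Match i κ₁' κ₂') :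
    SameOn (glue i κ₁ κ₂ h) (glue i κ₁' κ₂' h') := by
  intro p hp
  rcases le_total (p i) (1 / 2) with hi | hi
  · rw [glue_jet_lo h hi, glue_jet_lo h' hi]
    exact h1.pull _ p hp
  · rw [glue_jet_hi h hp hi, glue_jet_hi h' hp hi]
    exact h2.pull _ p hp

/-- Concatenations of pullbacks of one morphism. -/
theorem sameOn_glue_pull {m n : ℕ} {i : Fin m} (κ : CubeMorphism L n) {φ₁ φ₂ φ : CubeMap m n}
    (h : Match i (κ.pull φ₁) (κ.pull φ₂))
    (h1 : ∀ p ∈ cube m, p i ≤ 1 / 2 → φ₁ (lo i p) = φ p)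
    (h2 : ∀ p ∈ cube m, 1 / 2 ≤ p i → φ₂ (hi i p) = φ p) :
    SameOn (glue i (κ.pull φ₁) (κ.pull φ₂) h) (κ.pull φ) := by
  intro p hp
  have hpi := mem_cube.1 hp i
  rcases le_total (p i) (1 / 2) with hi | hi
  · rw [glue_jet_lo h hi, κ.pull_pull, κ.pull_jet, κ.pull_jet, ← h1 p hp hi]
    congr 1
    ext j k
    exact CubeMap.pd_congr_half (φ := φ₁.comp (lo i)) i (by norm_num) le_rfl (by norm_num)
      (fun q hq hqi => h1 q hq hqi.2) j k hp ⟨hpi.1, hi⟩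
  · rw [glue_jet_hi h hp hi, κ.pull_pull, κ.pull_jet, κ.pull_jet, ← h2 p hp hi]
    congr 1
    ext j k
    exact CubeMap.pd_congr_half (φ := φ₂.comp (TwoGroupoid.hi i)) i
      (show (1 / 2 : ℝ) < 1 by norm_num) (by norm_num) le_rfl
      (fun q hq hqi => h2 q hq hqi.1) j k hp ⟨hi, hpi.2⟩

/-- Pullbacks preserving one coordinate commute with concatenation. -/
theorem sameOn_pull_glue {m n : ℕ} {i : Fin n} {i' : Fin m} {κ₁ κ₂ : CubeMorphism L n}
    (φ : CubeMap m n) (h1 : ∀ p, φ p i = p i')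
    (h2 : ∀ p r, φ (Function.update p i' r) = Function.update (φ p) i r)
    (h : Match i κ₁ κ₂) (h' : Match i' (κ₁.pull φ) (κ₂.pull φ)) :
    SameOn ((glue i κ₁ κ₂ h).pull φ) (glue i' (κ₁.pull φ) (κ₂.pull φ) h') := by
  intro p hp
  rcases le_total (p i') (1 / 2) with hi | hi
  · rw [CubeMorphism.pull_jet, glue_jet_lo h (by rwa [h1]), ← CubeMorphism.pull_jet,
      glue_jet_lo h' hi, κ₁.pull_pull, κ₁.pull_pull]
    refine sameOn_pull_congr κ₁ (fun q _ => ?_) p hp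
    change lo i (φ q) = φ (lo i' q)
    rw [lo_apply, lo_apply, h2, h1]
  · rw [CubeMorphism.pull_jet, glue_jet_hi h (φ.maps p hp) (by rwa [h1]), ← CubeMorphism.pull_jet,
      glue_jet_hi h' hp hi, κ₂.pull_pull, κ₂.pull_pull]
    refine sameOn_pull_congr κ₂ (fun q _ => ?_) p hp
    change TwoGroupoid.hi i (φ q) = φ (TwoGroupoid.hi i' q)
    rw [hi_apply, hi_apply, h2, h1]

end Glue

/-! ### Faces and boundary conditions -/

theorem update_mem_cube {n : ℕ} {p : Fin n → ℝ} (hp : p ∈ cube n) (i : Fin n) {r : ℝ}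
    (hr : r ∈ Icc (0 : ℝ) 1) : Function.update p i r ∈ cube n :=
  mem_cube.2 fun j => by
    by_cases h : j = i
    · subst h
      simpa using hr
    · simpa [h] using mem_cube.1 hp j

/-- The inclusion of the face `pⱼ = c`. -/
def face {n : ℕ} (j : Fin (n + 1)) (c : ℝ) (hc : c ∈ Icc (0 : ℝ) 1) : CubeMap n (n + 1) where
  toFun p := j.insertNth c p
  smooth := contDiff_pi.2 fun k => by
    refine j.succAboveCases ?_ (fun i => ?_) k
    · simpa using contDiff_const
    · simpa using contDiff_apply ℝ ℝ i
  maps p hp := mem_cube.2 fun k => by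
    refine j.succAboveCases ?_ (fun i => ?_) k
    · simpa using hc
    · simpa using mem_cube.1 hp i

theorem face_apply {n : ℕ} (j : Fin (n + 1)) (c : ℝ) (hc : c ∈ Icc (0 : ℝ) 1) (p : Fin n → ℝ) :
    face j c hc p = j.insertNth c p := rfl

theorem pd_face {n : ℕ} (j : Fin (n + 1)) (c : ℝ) (hc : c ∈ Icc (0 : ℝ) 1) (i : Fin n)
    (k : Fin (n + 1)) (p : Fin n → ℝ) :
    (face j c hc).pd i k p = if k = j.succAbove i then 1 else 0 := by
  apply CubeMap.pd_eq_of_hasDerivAt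
  simp only [face_apply]
  refine j.succAboveCases ?_ (fun l => ?_) k
  · simpa [(Fin.succAbove_ne j i).symm] using hasDerivAt_const _ _
  · simp only [Fin.insertNth_apply_succAbove, Fin.succAbove_right_inj]
    by_cases h : l = i
    · subst h
      simpa using hasDerivAt_id' _
    · simpa [h] using hasDerivAt_const _ _

/-- Forgetting the `j`-th coordinate. -/
def drop {n : ℕ} (j : Fin (n + 1)) : CubeMap (n + 1) n where
  toFun p k := p (j.succAbove k)
  smooth := contDiff_pi.2 fun _ => contDiff_apply ℝ ℝ _
  maps _ hp := mem_cube.2 fun _ => mem_cube.1 hp _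

/-- The affine interpolation between two maps of cubes. -/
def interp {m n : ℕ} (φ ψ : CubeMap m n) : CubeMap (m + 1) n where
  toFun p := (1 - p (Fin.last m)) • φ (drop (Fin.last m) p) + p (Fin.last m) • ψ (drop (Fin.last m) p)
  smooth := by
    have h : ContDiff ℝ ∞ fun p : Fin (m + 1) → ℝ => p (Fin.last m) := contDiff_apply ℝ ℝ _
    exact ((contDiff_const.sub h).smul (φ.smooth.comp (drop _).smooth)).add
      (h.smul (ψ.smooth.comp (drop _).smooth))
  maps p hp := by
    have h := mem_cube.1 hp (Fin.last m)
    have h1 := φ.maps _ ((drop (Fin.last m)).maps p hp)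
    have h2 := ψ.maps _ ((drop (Fin.last m)).maps p hp)
    exact (convex_Icc (0 : Fin n → ℝ) 1) h1 h2 (by linarith [h.2]) h.1 (by ring)

theorem interp_apply {m n : ℕ} (φ ψ : CubeMap m n) (p : Fin (m + 1) → ℝ) (k : Fin n) :
    interp φ ψ p k = (1 - p (Fin.last m)) * φ (drop (Fin.last m) p) k
      + p (Fin.last m) * ψ (drop (Fin.last m) p) k := rfl

section Boundary

variable {L : LieAlgebroid EM FA A}

/-- The pullback to a face forgets one component. -/
theorem pull_face_jet {n : ℕ} (κ : CubeMorphism L (n + 1)) (j : Fin (n + 1)) (c : ℝ)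
    (hc : c ∈ Icc (0 : ℝ) 1) (p : Fin n → ℝ) :
    (κ.pull (face j c hc)).jet p
      = ⟨(κ.jet (j.insertNth c p)).1, fun i => (κ.jet (j.insertNth c p)).2 (j.succAbove i)⟩ := by
  rw [CubeMorphism.pull_jet, face_apply]
  simp only [pd_face]
  obtain ⟨x, v⟩ := κ.jet (j.insertNth c p)
  refine congrArg (Sigma.mk x) (funext fun i => ?_)
  change ∑ k, (if k = j.succAbove i then (1 : ℝ) else 0) • v k = _
  simp

theorem pull_face_comp {n : ℕ} (κ : CubeMorphism L (n + 1)) (j : Fin (n + 1)) (c : ℝ)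
    (hc : c ∈ Icc (0 : ℝ) 1) (i : Fin n) (p : Fin n → ℝ) :
    (κ.pull (face j c hc)).comp i p = κ.comp (j.succAbove i) (j.insertNth c p) := by
  rw [CubeMorphism.comp_eq_jet, pull_face_jet]
  rfl

/-- Derivatives of functions of the base point. -/
theorem CubeMorphism.fderivWithin_base {n : ℕ} (κ : CubeMorphism L n) (f : SmoothFn EM M)
    (i : Fin n) {p : Fin n → ℝ} (hp : p ∈ cube n) :
    fderivWithin ℝ (fun q => f (κ.base q)) (cube n) p (Pi.single i 1)
      = dirDeriv f (L.anchor (κ.base p) (κ.vec i p)) := by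
  have hu : UniqueMDiffWithinAt 𝓘(ℝ, Fin n → ℝ) (cube n) p :=
    (uniqueDiffOn_cube n p hp).uniqueMDiffWithinAt
  have h := mfderiv_comp_mfderivWithin (I := 𝓘(ℝ, Fin n → ℝ)) (I' := 𝓘(ℝ, EM)) (I'' := 𝓘(ℝ, ℝ))
    (g := f) (f := κ.base) p (f.contMDiff.mdifferentiable (by simp) _)
    ((κ.base_smooth p hp).mdifferentiableWithinAt (by simp)) hu
  rw [mfderivWithin_eq_fderivWithin] at h
  refine (DFunLike.congr_fun h (Pi.single i 1)).trans ?_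
  rw [κ.anchor_eq i p hp]
  rfl

theorem CubeMorphism.contDiffOn_base {n : ℕ} (κ : CubeMorphism L n) (f : SmoothFn EM M) :
    ContDiffOn ℝ ∞ (fun q => f (κ.base q)) (cube n) :=
  contMDiffOn_iff_contDiffOn.1 (f.contMDiff.comp_contMDiffOn κ.base_smooth)

/-- The derivative along a coordinate line. -/
theorem hasDerivWithinAt_line {W : Type*} [NormedAddCommGroup W] [NormedSpace ℝ W] {n : ℕ}
    {g : (Fin n → ℝ) → W} {p : Fin n → ℝ} (hp : p ∈ cube n) (i : Fin n)
    (hg : DifferentiableWithinAt ℝ g (cube n) p) :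
    HasDerivWithinAt (fun r => g (Function.update p i r))
      (fderivWithin ℝ g (cube n) p (Pi.single i 1)) (Icc 0 1) (p i) := by
  have h1 : HasFDerivWithinAt g (fderivWithin ℝ g (cube n) p) (cube n)
      (Function.update p i (p i)) := by
    rw [Function.update_eq_self]
    exact hg.hasFDerivWithinAt
  exact h1.comp_hasDerivWithinAt (p i) (hasDerivAt_update p i (p i)).hasDerivWithinAt
    fun r hr => update_mem_cube hp i hr

/-- A function with vanishing derivative along a coordinate line is constant on it. -/
theorem const_on_line {n : ℕ} {g : (Fin n → ℝ) → ℝ} (hg : DifferentiableOn ℝ g (cube n))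
    {p : Fin n → ℝ} (hp : p ∈ cube n) (i : Fin n)
    (h : ∀ r ∈ Icc (0 : ℝ) 1,
      fderivWithin ℝ g (cube n) (Function.update p i r) (Pi.single i 1) = 0)
    {r : ℝ} (hr : r ∈ Icc (0 : ℝ) 1) :
    g (Function.update p i r) = g (Function.update p i 0) := by
  have key : ∀ r ∈ Icc (0 : ℝ) 1,
      HasDerivWithinAt (fun r => g (Function.update p i r)) 0 (Icc 0 1) r := by
    intro r hr
    have hm := update_mem_cube hp i hr
    have := hasDerivWithinAt_line hm i (hg _ hm)
    rw [h r hr] at this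
    simpa using this
  exact constant_of_derivWithin_zero (fun r hr => (key r hr).differentiableWithinAt)
    (fun r hr => (key r ⟨hr.1, hr.2.le⟩).derivWithin (uniqueDiffOn_Icc one_pos r ⟨hr.1, hr.2.le⟩))
    r hr

/-- Smooth functions separate points. -/
theorem eq_of_forall_smoothFn {x y : M} (h : ∀ f : SmoothFn EM M, f x = f y) : x = y := by
  by_contra hne
  obtain ⟨f, -, hf⟩ := (SmoothBumpFunction.nhds_basis_tsupport (I := 𝓘(ℝ, EM)) x).mem_iff.1
    (isOpen_compl_singleton.mem_nhds (show x ∈ ({y}ᶜ : Set M) from hne))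
  have h1 := h ⟨f, f.contMDiff⟩
  have h2 : f x = 1 := f.eq_one
  have h3 : f y = 0 := by
    by_contra h0
    exact hf (subset_tsupport _ h0) rfl
  have h4 : f x = f y := h1
  rw [h2, h3] at h4
  exact one_ne_zero h4

theorem CubeMorphism.base_const {n : ℕ} (κ : CubeMorphism L n) {p : Fin n → ℝ} (hp : p ∈ cube n)
    (i : Fin n) (h : ∀ r ∈ Icc (0 : ℝ) 1, κ.vec i (Function.update p i r) = 0)
    {r : ℝ} (hr : r ∈ Icc (0 : ℝ) 1) :
    κ.base (Function.update p i r) = κ.base (Function.update p i 0) := by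
  refine eq_of_forall_smoothFn (EM := EM) fun f => ?_
  refine const_on_line ((κ.contDiffOn_base f).differentiableOn (by simp)) hp i (fun r hr => ?_) hr
  rw [κ.fderivWithin_base f i (update_mem_cube hp i hr), h r hr, map_zero]
  exact map_zero (mfderiv 𝓘(ℝ, EM) 𝓘(ℝ, ℝ) f _)

/-- If the component in the direction `j` vanishes on the lines through `p` in the directions `i`
and `j`, then the component in the direction `i` vanishes if it does so at one end. -/
theorem CubeMorphism.vec_eq_zero {n : ℕ} (κ : CubeMorphism L n) {p : Fin n → ℝ} (hp : p ∈ cube n)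
    {i j : Fin n}
    (h : ∀ r ∈ Icc (0 : ℝ) 1, ∀ r' ∈ Icc (0 : ℝ) 1,
      κ.vec j (Function.update (Function.update p j r) i r') = 0)
    (h0 : κ.vec i (Function.update p j 0) = 0)
    {r : ℝ} (hr : r ∈ Icc (0 : ℝ) 1) : κ.vec i (Function.update p j r) = 0 := by
  refine eq_of_forall_dual (EM := EM) FA fun θ => ?_
  have hz : ∀ r ∈ Icc (0 : ℝ) 1, κ.vec j (Function.update p j r) = 0 := by
    intro r hr
    have hm := update_mem_cube hp j hr
    have := h r hr _ (mem_cube.1 hm i)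
    rwa [Function.update_eq_self] at this
  have := const_on_line ((κ.contDiffOn_dual θ i).differentiableOn (by simp)) hp j (fun r hr => ?_) hr
  · rw [this, h0]
    simp
  · have hm := update_mem_cube hp j hr
    have hb := κ.bracket_all j i hm θ
    have h3 := hasDerivWithinAt_line hm i ((κ.contDiffOn_dual θ j).differentiableOn (by simp) _ hm)
    have h4 : HasDerivWithinAt (fun r' : ℝ => θ (κ.base (Function.update (Function.update p j r) i r'))
        (κ.vec j (Function.update (Function.update p j r) i r'))) 0 (Icc 0 1)
        (Function.update p j r i) :=
      (hasDerivWithinAt_const _ _ 0).congr (fun r' hr' => by rw [h r hr r' hr']; simp)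
        (by rw [h r hr _ (mem_cube.1 hm i)]; simp)
    have h5 := (uniqueDiffOn_Icc one_pos _ (mem_cube.1 hm i)).eq_deriv _ h3 h4
    rw [h5, hz r hr, map_zero, sub_zero] at hb
    simpa using hb

/-- At the face `p₀ = c` the base map is constant and all but the first component vanish. -/
def BdyAt {n : ℕ} (κ : CubeMorphism L (n + 1)) (c : ℝ) (x : M) : Prop :=
  ∀ p ∈ cube (n + 1), p 0 = c → jetErase 0 (κ.jet p) = ⟨x, 0⟩

theorem jetErase_eq_iff {n : ℕ} {i : Fin n} {J : Σ x : M, Fin n → A x} {x : M} :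
    jetErase i J = ⟨x, 0⟩ ↔ J.1 = x ∧ ∀ k, k ≠ i → J.2 k = 0 := by
  obtain ⟨y, v⟩ := J
  constructor
  · intro h
    obtain ⟨rfl, h2⟩ := Sigma.mk.inj h
    refine ⟨rfl, fun k hk => ?_⟩
    have := congrFun (eq_of_heq h2) k
    simpa [hk] using this
  · rintro ⟨rfl, h⟩
    refine congrArg (Sigma.mk y) (funext fun k => ?_)
    by_cases hk : k = i
    · subst hk
      simp
    · simpa [hk] using h k hk

theorem BdyAt.base {n : ℕ} {κ : CubeMorphism L (n + 1)} {c : ℝ} {x : M} (h : BdyAt κ c x)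
    {p : Fin (n + 1) → ℝ} (hp : p ∈ cube (n + 1)) (h0 : p 0 = c) : κ.base p = x :=
  (jetErase_eq_iff.1 (h p hp h0)).1

theorem BdyAt.vec {n : ℕ} {κ : CubeMorphism L (n + 1)} {c : ℝ} {x : M} (h : BdyAt κ c x)
    {p : Fin (n + 1) → ℝ} (hp : p ∈ cube (n + 1)) (h0 : p 0 = c) {k : Fin (n + 1)} (hk : k ≠ 0) :
    κ.vec k p = 0 :=
  (jetErase_eq_iff.1 (h p hp h0)).2 k hk

theorem BdyAt.congr {n : ℕ} {κ κ' : CubeMorphism L (n + 1)} {c : ℝ} {x : M} (h : BdyAt κ c x)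
    (hs : SameOn κ κ') : BdyAt κ' c x := fun p hp h0 => by
  rw [← hs p hp]
  exact h p hp h0

theorem BdyAt.pull {m n : ℕ} {κ : CubeMorphism L (n + 1)} {c c' : ℝ} {x : M} (h : BdyAt κ c' x)
    (φ : CubeMap (m + 1) (n + 1)) (hφ : ∀ p, p 0 = c → φ p 0 = c') : BdyAt (κ.pull φ) c x := by
  intro p hp h0
  have h1 := jetErase_eq_iff.1 (h (φ p) (φ.maps p hp) (hφ p h0))
  refine jetErase_eq_iff.2 ⟨h1.1, fun i hi => ?_⟩
  change ∑ k, φ.pd i k p • κ.vec k (φ p) = 0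
  refine Finset.sum_eq_zero fun k _ => ?_
  by_cases hk : k = 0
  · subst hk
    rw [φ.pd_eq_zero i 0 p fun r => ?_, zero_smul]
    rw [hφ p h0, hφ _ (by rwa [Function.update_of_ne (Ne.symm hi)])]
  · rw [show κ.vec k (φ p) = 0 from h1.2 k hk, smul_zero]

theorem BdyAt.glue_left {n : ℕ} {κ₁ κ₂ : CubeMorphism L (n + 1)} {x : M}
    (h1 : BdyAt κ₁ 0 x) (h : Match 0 κ₁ κ₂) : BdyAt (glue 0 κ₁ κ₂ h) 0 x := by
  intro p hp h0
  rw [glue_jet_lo h (by rw [h0]; norm_num)]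
  refine h1.pull (lo 0) (fun q hq => ?_) p hp h0
  rw [lo_apply, Function.update_self, hq]
  exact cut_eq_zero (by norm_num)

theorem BdyAt.glue_right {n : ℕ} {κ₁ κ₂ : CubeMorphism L (n + 1)} {x : M}
    (h2 : BdyAt κ₂ 1 x) (h : Match 0 κ₁ κ₂) : BdyAt (glue 0 κ₁ κ₂ h) 1 x := by
  intro p hp h0
  rw [glue_jet_hi h hp (by rw [h0]; norm_num)]
  refine h2.pull (hi 0) (fun q hq => ?_) p hp h0
  rw [hi_apply, Function.update_self, hq]
  exact cut_eq_one (by norm_num)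

/-- The boundary conditions of a family of paths from `x` to `y`. -/
def Bdy {n : ℕ} (κ : CubeMorphism L (n + 1)) (x y : M) : Prop := BdyAt κ 0 x ∧ BdyAt κ 1 y

theorem Bdy.congr {n : ℕ} {κ κ' : CubeMorphism L (n + 1)} {x y : M} (h : Bdy κ x y)
    (hs : SameOn κ κ') : Bdy κ' x y := ⟨h.1.congr hs, h.2.congr hs⟩

theorem Bdy.match_zero {n : ℕ} {κ₁ κ₂ : CubeMorphism L (n + 1)} {x y z : M} (h1 : Bdy κ₁ x y)
    (h2 : Bdy κ₂ y z) : Match 0 κ₁ κ₂ := fun p hp => by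
  rw [h1.2 _ (update_mem_cube hp 0 (by simp)) (by simp),
    h2.1 _ (update_mem_cube hp 0 (by simp)) (by simp)]

theorem Bdy.glue_zero {n : ℕ} {κ₁ κ₂ : CubeMorphism L (n + 1)} {x y z : M} (h1 : Bdy κ₁ x y)
    (h2 : Bdy κ₂ y z) : Bdy (glue 0 κ₁ κ₂ (h1.match_zero h2)) x z :=
  ⟨h1.1.glue_left _, h2.2.glue_right _⟩

theorem Bdy.pull {m n : ℕ} {κ : CubeMorphism L (n + 1)} {x y : M} (h : Bdy κ x y)
    (φ : CubeMap (m + 1) (n + 1)) (h0 : ∀ p, p 0 = 0 → φ p 0 = 0) (h1 : ∀ p, p 0 = 1 → φ p 0 = 1) :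
    Bdy (κ.pull φ) x y := ⟨h.1.pull φ h0, h.2.pull φ h1⟩

end Boundary

/-! ### Thin homotopies and 3-homotopies as cubes -/

section Classes

variable {L : LieAlgebroid EM FA A}

theorem ιMulti_pair {W : Type*} [AddCommGroup W] [Module ℝ W] (v w : W) :
    ExteriorAlgebra.ιMulti ℝ 2 ![v, w] = ExteriorAlgebra.ι ℝ v * ExteriorAlgebra.ι ℝ w := by
  simp [ExteriorAlgebra.ιMulti_apply]

theorem ιMulti_pair_combination {W : Type*} [AddCommGroup W] [Module ℝ W] (v w : W)
    (a b c d : ℝ) :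
    ExteriorAlgebra.ιMulti ℝ 2 ![a • v + b • w, c • v + d • w]
      = (a * d - b * c) • ExteriorAlgebra.ιMulti ℝ 2 ![v, w] := by
  have h : ExteriorAlgebra.ι ℝ w * ExteriorAlgebra.ι ℝ v
      = -(ExteriorAlgebra.ι ℝ v * ExteriorAlgebra.ι ℝ w) :=
    eq_neg_of_add_eq_zero_left (ExteriorAlgebra.ι_add_mul_swap w v)
  simp only [ιMulti_pair, map_add, map_smul, mul_add, add_mul, smul_mul_smul_comm,
    ExteriorAlgebra.ι_sq_zero, h, smul_zero, sub_smul, smul_neg]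
  abel

/-- A jet of a 2-cube is thin if its two vectors are linearly dependent. -/
def ThinJet (J : Σ x : M, Fin 2 → A x) : Prop :=
  ExteriorAlgebra.ιMulti ℝ 2 ![J.2 0, J.2 1] = 0

theorem thinJet_jetPull {J : Σ x : M, Fin 2 → A x} {c : Fin 2 → Fin 2 → ℝ}
    (h : ThinJet J ∨ c 0 0 * c 1 1 - c 0 1 * c 1 0 = 0) : ThinJet (jetPull c J) := by
  obtain ⟨x, v⟩ := J
  change ExteriorAlgebra.ιMulti ℝ 2 ![∑ k, c 0 k • v k, ∑ k, c 1 k • v k] = 0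
  rw [Fin.sum_univ_two, Fin.sum_univ_two, ιMulti_pair_combination]
  rcases h with h | h
  · rw [show ExteriorAlgebra.ιMulti ℝ 2 ![v 0, v 1] = 0 from h, smul_zero]
  · rw [h, zero_smul]

/-- A 2-cube is thin. -/
def ThinCube (κ : CubeMorphism L 2) : Prop := ∀ p ∈ cube 2, ThinJet (κ.jet p)

theorem ThinCube.congr {κ κ' : CubeMorphism L 2} (h : ThinCube κ) (hs : SameOn κ κ') :
    ThinCube κ' := fun p hp => by
  rw [← hs p hp]
  exact h p hp

theorem ThinCube.pull {κ : CubeMorphism L 2} (h : ThinCube κ) (φ : CubeMap 2 2) :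
    ThinCube (κ.pull φ) := fun p hp => by
  rw [CubeMorphism.pull_jet]
  exact thinJet_jetPull (Or.inl (h _ (φ.maps p hp)))

theorem thinCube_pull_of_det {κ : CubeMorphism L 2} (φ : CubeMap 2 2)
    (h : ∀ p ∈ cube 2, φ.pd 0 0 p * φ.pd 1 1 p - φ.pd 0 1 p * φ.pd 1 0 p = 0) :
    ThinCube (κ.pull φ) := fun p hp => by
  rw [CubeMorphism.pull_jet]
  exact thinJet_jetPull (Or.inr (h p hp))

theorem thinCube_pull_one (κ : CubeMorphism L 1) (φ : CubeMap 2 1) : ThinCube (κ.pull φ) :=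
  fun p _ => by
  rw [CubeMorphism.pull_jet]
  obtain ⟨x, v⟩ := κ.jet (φ p)
  change ExteriorAlgebra.ιMulti ℝ 2 ![∑ k, φ.pd 0 k p • v k, ∑ k, φ.pd 1 k p • v k] = 0
  rw [Fin.sum_univ_one, Fin.sum_univ_one]
  simpa only [smul_zero, add_zero, zero_mul, mul_zero, sub_zero, zero_smul] using
    ιMulti_pair_combination (v 0) 0 (φ.pd 0 0 p) 0 (φ.pd 1 0 p) 0

theorem ThinCube.glue {i : Fin 2} {κ₁ κ₂ : CubeMorphism L 2} (h1 : ThinCube κ₁)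
    (h2 : ThinCube κ₂) (h : Match i κ₁ κ₂) : ThinCube (glue i κ₁ κ₂ h) := fun p hp => by
  rcases le_total (p i) (1 / 2) with hi | hi
  · rw [glue_jet_lo h hi]
    exact h1.pull _ p hp
  · rw [glue_jet_hi h hp hi]
    exact h2.pull _ p hp

theorem zero_mem_I : (0 : ℝ) ∈ Icc (0 : ℝ) 1 := by simp

theorem one_mem_I : (1 : ℝ) ∈ Icc (0 : ℝ) 1 := by simp

theorem vec2_mem_cube {t s : ℝ} (ht : t ∈ Icc (0 : ℝ) 1) (hs : s ∈ Icc (0 : ℝ) 1) :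
    ![t, s] ∈ cube 2 := mem_cube.2 fun i => by fin_cases i <;> assumption

theorem vec3_mem_cube {t s u : ℝ} (ht : t ∈ Icc (0 : ℝ) 1) (hs : s ∈ Icc (0 : ℝ) 1)
    (hu : u ∈ Icc (0 : ℝ) 1) : ![t, s, u] ∈ cube 3 :=
  mem_cube.2 fun i => by fin_cases i <;> assumption

theorem vec1_mem_cube {t : ℝ} (ht : t ∈ Icc (0 : ℝ) 1) : ![t] ∈ cube 1 :=
  mem_cube.2 fun i => by fin_cases i; assumption

theorem eq_vec1 (p : Fin 1 → ℝ) : p = ![p 0] := by ext i; fin_cases i; rfl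

theorem eq_vec2 (p : Fin 2 → ℝ) : p = ![p 0, p 1] := by ext i; fin_cases i <;> rfl

theorem eq_vec3 (p : Fin 3 → ℝ) : p = ![p 0, p 1, p 2] := by ext i; fin_cases i <;> rfl

/-- The lower and the upper edge of a square, and the four lateral faces of a 3-cube. -/
def edge₀ : CubeMap 1 2 := face 1 0 zero_mem_I

def edge₁ : CubeMap 1 2 := face 1 1 one_mem_I

theorem edge₀_apply (p : Fin 1 → ℝ) : edge₀ p = ![p 0, 0] := by
  ext i; fin_cases i <;> rfl

theorem edge₁_apply (p : Fin 1 → ℝ) : edge₁ p = ![p 0, 1] := by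
  ext i; fin_cases i <;> rfl

theorem face_one_apply {c : ℝ} (hc : c ∈ Icc (0 : ℝ) 1) (p : Fin 2 → ℝ) :
    (face 1 c hc : CubeMap 2 3) p = ![p 0, c, p 1] := by
  ext i; fin_cases i <;> rfl

theorem face_two_apply {c : ℝ} (hc : c ∈ Icc (0 : ℝ) 1) (p : Fin 2 → ℝ) :
    (face 2 c hc : CubeMap 2 3) p = ![p 0, p 1, c] := by
  ext i; fin_cases i <;> rfl

theorem Bdy.of_one (κ : CubeMorphism L 1) : Bdy κ (κ.base 0) (κ.base 1) := by
  constructor <;> intro p _ h0 <;> refine jetErase_eq_iff.2 ⟨?_, fun k hk => absurd (Fin.eq_zero k) hk⟩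
  · exact congrArg κ.base (by ext i; fin_cases i; exact h0)
  · exact congrArg κ.base (by ext i; fin_cases i; exact h0)

theorem bdy_one_iff {κ : CubeMorphism L 1} {x y : M} :
    Bdy κ x y ↔ κ.base 0 = x ∧ κ.base 1 = y := by
  constructor
  · intro h
    exact ⟨h.1.base (mem_cube.2 fun _ => zero_mem_I) rfl,
      h.2.base (mem_cube.2 fun _ => one_mem_I) rfl⟩
  · rintro ⟨rfl, rfl⟩
    exact Bdy.of_one κ

theorem Bdy.edge₀ {κ : CubeMorphism L 2} {x y : M} (h : Bdy κ x y) : Bdy (κ.pull edge₀) x y :=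
  h.pull _ (fun p hp => by simpa [edge₀_apply] using hp) (fun p hp => by simpa [edge₀_apply] using hp)

theorem Bdy.edge₁ {κ : CubeMorphism L 2} {x y : M} (h : Bdy κ x y) : Bdy (κ.pull edge₁) x y :=
  h.pull _ (fun p hp => by simpa [edge₁_apply] using hp) (fun p hp => by simpa [edge₁_apply] using hp)

/-- The `A`-path given by a morphism `TI → A`. -/
def toPath (κ : CubeMorphism L 1) {x y : M} (h : Bdy κ x y) : APath L x y where
  mor := κ
  source := (bdy_one_iff.1 h).1
  target := (bdy_one_iff.1 h).2

theorem APath.bdy {x y : M} (a : APath L x y) : Bdy a.mor x y := bdy_one_iff.2 ⟨a.source, a.target⟩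

theorem sameOn_edge_iff {κ : CubeMorphism L 2} {κ' : CubeMorphism L 1} {s : ℝ}
    (hs : s ∈ Icc (0 : ℝ) 1) : SameOn (κ.pull (face 1 s hs)) κ'
      ↔ ∀ t ∈ Icc (0 : ℝ) 1, κ.comp 0 ![t, s] = κ'.comp 0 ![t] := by
  have key : ∀ t, (κ.pull (face 1 s hs)).comp 0 ![t] = κ.comp 0 ![t, s] := fun t => by
    rw [pull_face_comp]
    congr 1
    ext i; fin_cases i <;> rfl
  constructor
  · intro h t ht
    rw [← key, CubeMorphism.comp_eq_jet, h _ (vec1_mem_cube ht)]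
    rfl
  · intro h p hp
    refine CubeMorphism.jet_ext_of_comp fun i => ?_
    obtain rfl : i = 0 := Fin.eq_zero i
    rw [eq_vec1 p, key]
    exact h _ (mem_cube.1 hp 0)

theorem AHomotopy.sameOn_edge₀ {x y : M} {a₀ a₁ : APath L x y} (σ : AHomotopy a₀ a₁) :
    SameOn (σ.mor.pull edge₀) a₀.mor := (sameOn_edge_iff zero_mem_I).2 σ.source

theorem AHomotopy.sameOn_edge₁ {x y : M} {a₀ a₁ : APath L x y} (σ : AHomotopy a₀ a₁) :
    SameOn (σ.mor.pull edge₁) a₁.mor := (sameOn_edge_iff one_mem_I).2 σ.target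

theorem AHomotopy.bdy {x y : M} {a₀ a₁ : APath L x y} (σ : AHomotopy a₀ a₁) :
    Bdy σ.mor x y := by
  have key : ∀ c ∈ Icc (0 : ℝ) 1, (∀ s ∈ Icc (0 : ℝ) 1, σ.mor.vec 1 ![c, s] = 0) →
      ∀ z, σ.mor.base ![c, 0] = z → BdyAt σ.mor c z := by
    rintro c hc h z rfl p hp rfl
    refine jetErase_eq_iff.2 ⟨?_, fun k hk => ?_⟩
    · have e : ∀ r, Function.update p 1 r = ![p 0, r] := fun r => by
        ext i; fin_cases i <;> rfl
      have := σ.mor.base_const hp 1 (fun r hr => by rw [e]; exact h r hr) (mem_cube.1 hp 1)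
      rw [Function.update_eq_self, e] at this
      exact this
    · obtain rfl : k = 1 := by revert k; decide
      have := h _ (mem_cube.1 hp 1)
      rwa [← eq_vec2] at this
  refine ⟨key 0 zero_mem_I σ.left x ?_, key 1 one_mem_I σ.right y ?_⟩
  · have := congrArg TotalSpace.proj (σ.source 0 zero_mem_I)
    exact this.trans ((congrArg a₀.mor.base (by ext i; fin_cases i; rfl)).trans a₀.source)
  · have := congrArg TotalSpace.proj (σ.source 1 one_mem_I)
    exact this.trans ((congrArg a₀.mor.base (by ext i; fin_cases i; rfl)).trans a₀.target)

/-- The `A`-homotopy given by a morphism `TI² → A`. -/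
def toHomotopy (κ : CubeMorphism L 2) {x y : M} (h : Bdy κ x y) {a₀ a₁ : APath L x y}
    (h0 : SameOn (κ.pull edge₀) a₀.mor) (h1 : SameOn (κ.pull edge₁) a₁.mor) :
    AHomotopy a₀ a₁ where
  mor := κ
  source := (sameOn_edge_iff zero_mem_I).1 h0
  target := (sameOn_edge_iff one_mem_I).1 h1
  left _ hs := h.1.vec (vec2_mem_cube zero_mem_I hs) rfl (by simp)
  right _ hs := h.2.vec (vec2_mem_cube one_mem_I hs) rfl (by simp)

theorem thinHomotopic_iff {x y : M} {a₀ a₁ : APath L x y} :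
    ThinHomotopic a₀ a₁ ↔ ∃ θ : CubeMorphism L 2, Bdy θ x y ∧ SameOn (θ.pull edge₀) a₀.mor
      ∧ SameOn (θ.pull edge₁) a₁.mor ∧ ThinCube θ := by
  constructor
  · rintro ⟨σ, hσ⟩
    exact ⟨σ.mor, σ.bdy, σ.sameOn_edge₀, σ.sameOn_edge₁, hσ⟩
  · rintro ⟨θ, hB, h0, h1, ht⟩
    exact ⟨toHomotopy θ hB h0 h1, ht⟩

/-- Two 2-cubes are 3-homotopic. -/
def Homotopic₃ (x y : M) (κ κ' : CubeMorphism L 2) : Prop :=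
  ∃ H : CubeMorphism L 3, Bdy H x y ∧
    SameOn (H.pull (face 2 0 zero_mem_I)) κ ∧ SameOn (H.pull (face 2 1 one_mem_I)) κ' ∧
    ThinCube (H.pull (face 1 0 zero_mem_I)) ∧ ThinCube (H.pull (face 1 1 one_mem_I))

theorem sameOn_face_iff {j : Fin 3} {c : ℝ} (hc : c ∈ Icc (0 : ℝ) 1) {H : CubeMorphism L 3}
    {κ : CubeMorphism L 2} : SameOn (H.pull (face j c hc)) κ
      ↔ ∀ p ∈ cube 2, H.comp (j.succAbove 0) (j.insertNth c p) = κ.comp 0 p ∧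
        H.comp (j.succAbove 1) (j.insertNth c p) = κ.comp 1 p := by
  constructor
  · intro h p hp
    rw [← pull_face_comp H j c hc, ← pull_face_comp H j c hc]
    simp only [CubeMorphism.comp_eq_jet, h p hp, and_self]
  · intro h p hp
    refine CubeMorphism.jet_ext_of_comp fun i => ?_
    rw [pull_face_comp]
    fin_cases i
    exacts [(h p hp).1, (h p hp).2]

theorem insertNth_one (c t s : ℝ) : (1 : Fin 3).insertNth (α := fun _ => ℝ) c ![t, s] = ![t, c, s] := by
  ext i; fin_cases i <;> rfl

theorem insertNth_two (c t s : ℝ) : (2 : Fin 3).insertNth (α := fun _ => ℝ) c ![t, s] = ![t, s, c] := by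
  ext i; fin_cases i <;> rfl

theorem pull_face_edge (H : CubeMorphism L 3) {c c' : ℝ} (hc : c ∈ Icc (0 : ℝ) 1)
    (hc' : c' ∈ Icc (0 : ℝ) 1) :
    SameOn ((H.pull (face 1 c hc)).pull (face 1 c' hc'))
      ((H.pull (face 2 c' hc')).pull (face 1 c hc)) :=
  ((sameOn_pull_pull _ _ _).trans (sameOn_pull_congr H fun p _ => by
    ext i; fin_cases i <;> rfl)).trans (sameOn_pull_pull _ _ _).symm

theorem Bdy.face_one {H : CubeMorphism L 3} {x y : M} (h : Bdy H x y) {c : ℝ}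
    (hc : c ∈ Icc (0 : ℝ) 1) : Bdy (H.pull (face 1 c hc)) x y :=
  h.pull _ (fun p hp => by simpa [face_one_apply] using hp)
    (fun p hp => by simpa [face_one_apply] using hp)

theorem Bdy.face_two {H : CubeMorphism L 3} {x y : M} (h : Bdy H x y) {c : ℝ}
    (hc : c ∈ Icc (0 : ℝ) 1) : Bdy (H.pull (face 2 c hc)) x y :=
  h.pull _ (fun p hp => by simpa [face_two_apply] using hp)
    (fun p hp => by simpa [face_two_apply] using hp)

theorem threeHomotopic_iff {x y : M} {σ σ' : AnyHomotopy L x y} :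
    ThreeHomotopic σ σ' ↔ Homotopic₃ x y σ.htpy.mor σ'.htpy.mor := by
  constructor
  · rintro ⟨H, θ₀, θ₁, ht0, ht1, hu, hz, hs⟩
    have f0 : SameOn (H.pull (face 2 0 zero_mem_I)) σ.htpy.mor :=
      (sameOn_face_iff _).2 fun p hp => by
        rw [eq_vec2 p, insertNth_two]
        exact ⟨(hu _ (mem_cube.1 hp 0) _ (mem_cube.1 hp 1)).1,
          (hu _ (mem_cube.1 hp 0) _ (mem_cube.1 hp 1)).2.1⟩
    have f1 : SameOn (H.pull (face 2 1 one_mem_I)) σ'.htpy.mor :=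
      (sameOn_face_iff _).2 fun p hp => by
        rw [eq_vec2 p, insertNth_two]
        exact ⟨(hu _ (mem_cube.1 hp 0) _ (mem_cube.1 hp 1)).2.2.1,
          (hu _ (mem_cube.1 hp 0) _ (mem_cube.1 hp 1)).2.2.2⟩
    have g0 : SameOn (H.pull (face 1 0 zero_mem_I)) θ₀.mor :=
      (sameOn_face_iff _).2 fun p hp => by
        rw [eq_vec2 p, insertNth_one]
        exact ⟨(hs _ (mem_cube.1 hp 0) _ (mem_cube.1 hp 1)).1,
          (hs _ (mem_cube.1 hp 0) _ (mem_cube.1 hp 1)).2.1⟩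
    have g1 : SameOn (H.pull (face 1 1 one_mem_I)) θ₁.mor :=
      (sameOn_face_iff _).2 fun p hp => by
        rw [eq_vec2 p, insertNth_one]
        exact ⟨(hs _ (mem_cube.1 hp 0) _ (mem_cube.1 hp 1)).2.2.1,
          (hs _ (mem_cube.1 hp 0) _ (mem_cube.1 hp 1)).2.2.2⟩
    refine ⟨H, ?_, f0, f1, ThinCube.congr ht0 g0.symm, ThinCube.congr ht1 g1.symm⟩
    have hb : Bdy (H.pull (face 2 0 zero_mem_I)) x y := σ.htpy.bdy.congr f0.symm
    have key : ∀ c ∈ Icc (0 : ℝ) 1,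
        (∀ s ∈ Icc (0 : ℝ) 1, ∀ u ∈ Icc (0 : ℝ) 1, H.vec 2 ![c, s, u] = 0) →
        ∀ z, BdyAt (H.pull (face 2 0 zero_mem_I)) c z → BdyAt H c z := by
      rintro c hc h z hz p hp rfl
      have e2 : ∀ r, Function.update p 2 r = ![p 0, p 1, r] := fun r => by
        ext i; fin_cases i <;> rfl
      have e21 : ∀ r r', Function.update (Function.update p 2 r) 1 r' = ![p 0, r', r] :=
        fun r r' => by ext i; fin_cases i <;> rfl
      have hq : ![p 0, p 1] ∈ cube 2 := vec2_mem_cube hc (mem_cube.1 hp 1)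
      have hj := jetErase_eq_iff.1 (hz _ hq rfl)
      rw [pull_face_jet, insertNth_two] at hj
      refine jetErase_eq_iff.2 ⟨?_, fun k hk => ?_⟩
      · have := H.base_const hp 2 (fun r hr => by
          rw [e2]; exact h _ (mem_cube.1 hp 1) r hr) (mem_cube.1 hp 2)
        rw [Function.update_eq_self, e2] at this
        exact this.trans hj.1
      · rcases (by revert k; decide : k = 1 ∨ k = 2) with rfl | rfl
        · have := H.vec_eq_zero hp (i := 1) (j := 2) (fun r hr r' hr' => by
            rw [e21]; exact h _ hr' r hr) (by rw [e2]; exact hj.2 1 (by simp)) (mem_cube.1 hp 2)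
          rwa [Function.update_eq_self] at this
        · have := h _ (mem_cube.1 hp 1) _ (mem_cube.1 hp 2)
          rwa [← eq_vec3] at this
    exact ⟨key 0 zero_mem_I (fun s hs u hu => (hz s hs u hu).1) x hb.1,
      key 1 one_mem_I (fun s hs u hu => (hz s hs u hu).2) y hb.2⟩
  · rintro ⟨H, hB, f0, f1, t0, t1⟩
    refine ⟨H, toHomotopy (H.pull (face 1 0 zero_mem_I)) (hB.face_one _)
        ((pull_face_edge H _ _).trans ((f0.pull _).trans σ.htpy.sameOn_edge₀))
        ((pull_face_edge H _ _).trans ((f1.pull _).trans σ'.htpy.sameOn_edge₀)),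
      toHomotopy (H.pull (face 1 1 one_mem_I)) (hB.face_one _)
        ((pull_face_edge H _ _).trans ((f0.pull _).trans σ.htpy.sameOn_edge₁))
        ((pull_face_edge H _ _).trans ((f1.pull _).trans σ'.htpy.sameOn_edge₁)),
      t0, t1, fun t ht s hs => ?_, fun s hs u hu => ?_, fun t ht u hu => ?_⟩
    · have h0 := (sameOn_face_iff _).1 f0 _ (vec2_mem_cube ht hs)
      have h1 := (sameOn_face_iff _).1 f1 _ (vec2_mem_cube ht hs)
      rw [insertNth_two] at h0 h1
      exact ⟨h0.1, h0.2, h1.1, h1.2⟩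
    · exact ⟨hB.1.vec (vec3_mem_cube zero_mem_I hs hu) rfl (by simp),
        hB.2.vec (vec3_mem_cube one_mem_I hs hu) rfl (by simp)⟩
    · have h0 := (sameOn_face_iff zero_mem_I).1
        (SameOn.refl (H.pull (face 1 0 zero_mem_I))) _ (vec2_mem_cube ht hu)
      have h1 := (sameOn_face_iff one_mem_I).1
        (SameOn.refl (H.pull (face 1 1 one_mem_I))) _ (vec2_mem_cube ht hu)
      rw [insertNth_one] at h0 h1
      exact ⟨h0.1, h0.2, h1.1, h1.2⟩

end Classes

/-! ### The horizontal groupoid of 3-homotopy classes -/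

theorem CubeMap.hasDerivAt_pd {m n : ℕ} (φ : CubeMap m n) (i : Fin m) (k : Fin n)
    (p : Fin m → ℝ) : HasDerivAt (fun r => φ (Function.update p i r) k) (φ.pd i k p) (p i) := by
  have := (φ.differentiable (Function.update p i (p i))).hasFDerivAt.comp_hasDerivAt (p i)
    (hasDerivAt_update p i (p i))
  rw [Function.update_eq_self] at this
  exact hasDerivAt_pi.1 this k

theorem CubeMap.pd_eq_zero_of_eventually {m n : ℕ} (φ : CubeMap m n) (i : Fin m) (k : Fin n)
    (p : Fin m → ℝ) (h : ∀ᶠ r in 𝓝 (p i), φ (Function.update p i r) k = φ p k) :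
    φ.pd i k p = 0 :=
  φ.pd_eq_of_hasDerivAt i k p ((hasDerivAt_const (p i) (φ p k)).congr_of_eventuallyEq h)

theorem cut_mono : Monotone cut := fun s t h =>
  Real.smoothTransition.monotone (by linarith)

theorem affine_mem {a b t : ℝ} (ha : a ∈ Icc (0 : ℝ) 1) (hb : b ∈ Icc (0 : ℝ) 1)
    (ht : t ∈ Icc (0 : ℝ) 1) : (1 - t) * a + t * b ∈ Icc (0 : ℝ) 1 :=
  convex_Icc 0 1 ha hb (by linarith [ht.2]) ht.1 (by ring)

/-- The affine reparametrization of the `i`-th coordinate which maps `[0,1]` to `[a,b]`. -/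
def aff {n : ℕ} (i : Fin n) {a b : ℝ} (ha : a ∈ Icc (0 : ℝ) 1) (hb : b ∈ Icc (0 : ℝ) 1) :
    CubeMap n n :=
  reparam i (fun t => (1 - t) * a + t * b) (by fun_prop) fun _ ht => affine_mem ha hb ht

theorem aff_apply {n : ℕ} (i : Fin n) {a b : ℝ} (ha : a ∈ Icc (0 : ℝ) 1) (hb : b ∈ Icc (0 : ℝ) 1)
    (p : Fin n → ℝ) : aff i ha hb p = Function.update p i ((1 - p i) * a + p i * b) := rfl

section Horizontal

variable {L : LieAlgebroid EM FA A}

/-- The constant morphism at a point. -/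
def unitCube (L : LieAlgebroid EM FA A) (n : ℕ) (x : M) : CubeMorphism L n where
  base _ := x
  vec _ _ := 0
  base_smooth := contMDiffOn_const
  smooth _ := contMDiffOn_const
  anchor_eq i p _ := by
    rw [map_zero, mfderivWithin_const]
    rfl
  bracket_eq i j _ p _ θ := bracket_eq_of_dAt L (by simp)

theorem SameOn.of_bdyAt {n : ℕ} {κ : CubeMorphism L (n + 1)} {c : ℝ} (hc : c ∈ Icc (0 : ℝ) 1) {x : M}
    (h : BdyAt κ c x) : SameOn (κ.pull (aff 0 hc hc)) (unitCube L (n + 1) x) := by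
  intro p hp
  have e : (fun t : ℝ => (1 - t) * c + t * c) = fun _ => c := by ext t; ring
  rw [aff, CubeMorphism.pull_reparam_jet _ _ _ _ _ (by rw [e]; simp), h _
    (update_mem_cube hp 0 (affine_mem hc hc (mem_cube.1 hp 0))) (by simp; ring)]
  rfl

theorem unitCube_bdyAt (n : ℕ) (x : M) (c : ℝ) : BdyAt (unitCube L (n + 1) x) c x :=
  fun _ _ _ => jetErase_eq_iff.2 ⟨rfl, fun _ _ => rfl⟩

theorem unitCube_bdy (n : ℕ) (x : M) : Bdy (unitCube L (n + 1) x) x x :=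
  ⟨unitCube_bdyAt n x 0, unitCube_bdyAt n x 1⟩

theorem unitCube_pull {m n : ℕ} (x : M) (φ : CubeMap m n) :
    SameOn ((unitCube L n x).pull φ) (unitCube L m x) := fun p _ =>
  congrArg (Sigma.mk x) (funext fun i => by
    change ∑ k, φ.pd i k p • (0 : A x) = 0
    simp)

/-! Classes of cubes. -/

/-- The class in `P₁` of a morphism `TI → A`. -/
def cls1 (κ : CubeMorphism L 1) {x y : M} (h : Bdy κ x y) : P1 L x y := (toPath κ h).cls

/-- The class in `P₂` of a morphism `TI² → A`. -/
def cls2 (κ : CubeMorphism L 2) {x y : M} (h : Bdy κ x y) : P2 L x y :=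
  (toHomotopy κ h (a₀ := toPath _ h.edge₀) (a₁ := toPath _ h.edge₁) (SameOn.refl _)
    (SameOn.refl _)).cls

theorem drop_two_face {c : ℝ} (hc : c ∈ Icc (0 : ℝ) 1) (κ : CubeMorphism L 2) :
    SameOn ((κ.pull (drop 2)).pull (face 2 c hc)) κ :=
  (sameOn_pull_pull _ _ _).trans (sameOn_pull_id _ fun p _ => by ext i; fin_cases i <;> rfl)

theorem drop_one_face {c : ℝ} (hc : c ∈ Icc (0 : ℝ) 1) (κ : CubeMorphism L 1) :
    SameOn ((κ.pull (drop 1)).pull (face 1 c hc)) κ :=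
  (sameOn_pull_pull _ _ _).trans (sameOn_pull_id _ fun p _ => by ext i; fin_cases i; rfl)

theorem Homotopic₃.of_sameOn {x y : M} {κ κ' : CubeMorphism L 2} (h : Bdy κ x y)
    (hs : SameOn κ κ') : Homotopic₃ x y κ κ' := by
  refine ⟨κ.pull (drop 2), h.pull _ (fun _ hp => hp) (fun _ hp => hp), drop_two_face _ κ,
    (drop_two_face _ κ).trans hs, ?_, ?_⟩
  · refine ((thinCube_pull_one (κ.pull edge₀) (drop 1)).congr (sameOn_pull_pull _ _ _)).congr
      (SameOn.trans ?_ (sameOn_pull_pull _ _ _).symm)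
    exact sameOn_pull_congr κ fun p _ => by ext i; fin_cases i <;> rfl
  · refine ((thinCube_pull_one (κ.pull edge₁) (drop 1)).congr (sameOn_pull_pull _ _ _)).congr
      (SameOn.trans ?_ (sameOn_pull_pull _ _ _).symm)
    exact sameOn_pull_congr κ fun p _ => by ext i; fin_cases i <;> rfl

theorem Homotopic₃.cls_eq {x y : M} {κ κ' : CubeMorphism L 2} (h : Homotopic₃ x y κ κ')
    (hB : Bdy κ x y) (hB' : Bdy κ' x y) : cls2 κ hB = cls2 κ' hB' :=
  Quot.sound (threeHomotopic_iff.2 h)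

theorem SameOn.cls_eq {x y : M} {κ κ' : CubeMorphism L 2} (h : SameOn κ κ')
    (hB : Bdy κ x y) (hB' : Bdy κ' x y) : cls2 κ hB = cls2 κ' hB' :=
  (Homotopic₃.of_sameOn hB h).cls_eq hB hB'

theorem AHomotopy.cls_eq {x y : M} {a₀ a₁ : APath L x y} (σ : AHomotopy a₀ a₁) :
    σ.cls = cls2 σ.mor σ.bdy :=
  Quot.sound (threeHomotopic_iff.2 (Homotopic₃.of_sameOn σ.bdy (SameOn.refl _)))

theorem P2.ind {x y : M} {P : P2 L x y → Prop} (h : ∀ κ (hB : Bdy κ x y), P (cls2 κ hB))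
    (g : P2 L x y) : P g := by
  obtain ⟨⟨a, b, σ⟩, rfl⟩ := Quot.exists_rep g
  change P σ.cls
  rw [σ.cls_eq]
  exact h σ.mor σ.bdy

theorem SameOn.cls1_eq {x y : M} {κ κ' : CubeMorphism L 1} (h : SameOn κ κ')
    (hB : Bdy κ x y) (hB' : Bdy κ' x y) : cls1 κ hB = cls1 κ' hB' :=
  Quot.sound (thinHomotopic_iff.2 ⟨κ.pull (drop 1), hB.pull _ (fun _ hp => hp) (fun _ hp => hp),
    drop_one_face _ κ, (drop_one_face _ κ).trans h, thinCube_pull_one _ _⟩)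

theorem P1.ind {x y : M} {P : P1 L x y → Prop} (h : ∀ κ (hB : Bdy κ x y), P (cls1 κ hB))
    (g : P1 L x y) : P g := by
  obtain ⟨a, rfl⟩ := Quot.exists_rep g
  exact h a.mor a.bdy

/-! Invariance under reparametrization. -/

theorem Bdy.pull_of {m n : ℕ} {κ : CubeMorphism L (n + 1)} {c₀ c₁ : ℝ} {x y : M}
    (h0 : BdyAt κ c₀ x) (h1 : BdyAt κ c₁ y) (φ : CubeMap (m + 1) (n + 1))
    (hφ0 : ∀ p, p 0 = 0 → φ p 0 = c₀) (hφ1 : ∀ p, p 0 = 1 → φ p 0 = c₁) : Bdy (κ.pull φ) x y :=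
  ⟨h0.pull φ hφ0, h1.pull φ hφ1⟩

theorem Bdy.aff {n : ℕ} {κ : CubeMorphism L (n + 1)} {a b : ℝ} {x y : M}
    (h0 : BdyAt κ a x) (h1 : BdyAt κ b y) (ha : a ∈ Icc (0 : ℝ) 1) (hb : b ∈ Icc (0 : ℝ) 1) :
    Bdy (κ.pull (aff 0 ha hb)) x y :=
  Bdy.pull_of h0 h1 _ (fun p hp => by simp [aff_apply, hp]) (fun p hp => by simp [aff_apply, hp])

/-- Two pullbacks of a square are 3-homotopic if the affine interpolation is thin on the faces
`s = 0, 1`. -/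
theorem cls2_pull_eq {W : CubeMorphism L 2} {c₀ c₁ : ℝ} {x y : M}
    (h0 : BdyAt W c₀ x) (h1 : BdyAt W c₁ y) (φ ψ : CubeMap 2 2)
    (hφ0 : ∀ p, p 0 = 0 → φ p 0 = c₀) (hφ1 : ∀ p, p 0 = 1 → φ p 0 = c₁)
    (hψ0 : ∀ p, p 0 = 0 → ψ p 0 = c₀) (hψ1 : ∀ p, p 0 = 1 → ψ p 0 = c₁)
    (hφ : ∀ p ∈ cube 2, p 1 = 0 ∨ p 1 = 1 →
      φ.pd 0 0 p * (ψ p 1 - φ p 1) = φ.pd 0 1 p * (ψ p 0 - φ p 0))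
    (hψ : ∀ p ∈ cube 2, p 1 = 0 ∨ p 1 = 1 →
      ψ.pd 0 0 p * (ψ p 1 - φ p 1) = ψ.pd 0 1 p * (ψ p 0 - φ p 0)) :
    cls2 (W.pull φ) (Bdy.pull_of h0 h1 φ hφ0 hφ1)
      = cls2 (W.pull ψ) (Bdy.pull_of h0 h1 ψ hψ0 hψ1) := by
  have key : ∀ c (hc : c ∈ Icc (0 : ℝ) 1), c = 0 ∨ c = 1 →
      ThinCube ((W.pull (interp φ ψ)).pull (face 1 c hc)) := by
    intro c hc hc'
    refine ThinCube.congr (thinCube_pull_of_det ((interp φ ψ).comp (face 1 c hc)) fun p hp => ?_)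
      (sameOn_pull_pull _ _ _).symm
    have e0 : ∀ k, ((interp φ ψ).comp (face 1 c hc)).pd 0 k p
        = (1 - p 1) * φ.pd 0 k ![p 0, c] + p 1 * ψ.pd 0 k ![p 0, c] := fun k => by
      apply CubeMap.pd_eq_of_hasDerivAt
      refine (((φ.hasDerivAt_pd 0 k ![p 0, c]).const_mul (1 - p 1)).add
        ((ψ.hasDerivAt_pd 0 k ![p 0, c]).const_mul (p 1))).congr_of_eventuallyEq
        (Eventually.of_forall fun r => ?_)
      have e : drop (Fin.last 2) (face 1 c hc (Function.update p 0 r))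
          = Function.update ![p 0, c] 0 r := by ext i; fin_cases i <;> rfl
      change interp φ ψ (face 1 c hc (Function.update p 0 r)) k = _
      rw [interp_apply, e]
      rfl
    have e1 : ∀ k, ((interp φ ψ).comp (face 1 c hc)).pd 1 k p
        = ψ ![p 0, c] k - φ ![p 0, c] k := fun k => by
      apply CubeMap.pd_eq_of_hasDerivAt
      have h := (((hasDerivAt_id (p 1)).const_sub 1).mul_const (φ ![p 0, c] k)).add
        ((hasDerivAt_id (p 1)).mul_const (ψ ![p 0, c] k))
      refine (h.congr_deriv (by ring)).congr_of_eventuallyEq (Eventually.of_forall fun r => ?_)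
      have e : drop (Fin.last 2) (face 1 c hc (Function.update p 1 r)) = ![p 0, c] := by
        ext i; fin_cases i <;> rfl
      change interp φ ψ (face 1 c hc (Function.update p 1 r)) k = _
      rw [interp_apply, e]
      rfl
    have hq := vec2_mem_cube (mem_cube.1 hp 0) hc
    rw [e0, e0, e1, e1]
    linear_combination (1 - p 1) * hφ _ hq hc' + p 1 * hψ _ hq hc'
  refine Homotopic₃.cls_eq ⟨W.pull (interp φ ψ), Bdy.pull_of h0 h1 _ (fun p hp => ?_)
    (fun p hp => ?_), ?_, ?_, key 0 _ (Or.inl rfl), key 1 _ (Or.inr rfl)⟩ _ _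
  · rw [interp_apply, hφ0 _ hp, hψ0 _ hp]; ring
  · rw [interp_apply, hφ1 _ hp, hψ1 _ hp]; ring
  · refine (sameOn_pull_pull _ _ _).trans (sameOn_pull_congr W fun p _ => funext fun k => ?_)
    have e : drop (Fin.last 2) (face 2 0 zero_mem_I p) = p := by ext i; fin_cases i <;> rfl
    change interp φ ψ (face 2 0 zero_mem_I p) k = _
    rw [interp_apply, e, show face 2 0 zero_mem_I p (Fin.last 2) = 0 from rfl]
    ring
  · refine (sameOn_pull_pull _ _ _).trans (sameOn_pull_congr W fun p _ => funext fun k => ?_)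
    have e : drop (Fin.last 2) (face 2 1 one_mem_I p) = p := by ext i; fin_cases i <;> rfl
    change interp φ ψ (face 2 1 one_mem_I p) k = _
    rw [interp_apply, e, show face 2 1 one_mem_I p (Fin.last 2) = 1 from rfl]
    ring

theorem Bdy.reparam {W : CubeMorphism L 2} {f : ℝ → ℝ} {x y : M}
    (h0 : BdyAt W (f 0) x) (h1 : BdyAt W (f 1) y) (hf : ContDiff ℝ ∞ f)
    (hm : ∀ t ∈ Icc (0 : ℝ) 1, f t ∈ Icc (0 : ℝ) 1) : Bdy (W.pull (reparam 0 f hf hm)) x y :=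
  Bdy.pull_of h0 h1 _ (fun p hp => by simp [reparam_apply, hp])
    (fun p hp => by simp [reparam_apply, hp])

theorem cls2_reparam_zero {W : CubeMorphism L 2} {f g : ℝ → ℝ} {x y : M}
    (h0 : BdyAt W (f 0) x) (h1 : BdyAt W (f 1) y) (hf : ContDiff ℝ ∞ f) (hg : ContDiff ℝ ∞ g)
    (hmf : ∀ t ∈ Icc (0 : ℝ) 1, f t ∈ Icc (0 : ℝ) 1)
    (hmg : ∀ t ∈ Icc (0 : ℝ) 1, g t ∈ Icc (0 : ℝ) 1) (e0 : g 0 = f 0) (e1 : g 1 = f 1) :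
    cls2 (W.pull (reparam 0 f hf hmf)) (Bdy.reparam h0 h1 hf hmf)
      = cls2 (W.pull (reparam 0 g hg hmg)) (Bdy.reparam (e0 ▸ h0) (e1 ▸ h1) hg hmg) := by
  refine cls2_pull_eq h0 h1 _ _ (fun p hp => ?_) (fun p hp => ?_) (fun p hp => ?_) (fun p hp => ?_)
    (fun p _ _ => ?_) (fun p _ _ => ?_) <;> simp_all [reparam_apply, pd_reparam]

theorem cls2_reparam_zero_id {W : CubeMorphism L 2} {f : ℝ → ℝ} {x y : M} (h : Bdy W x y)
    (hf : ContDiff ℝ ∞ f) (hmf : ∀ t ∈ Icc (0 : ℝ) 1, f t ∈ Icc (0 : ℝ) 1) (e0 : f 0 = 0)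
    (e1 : f 1 = 1) (hB : Bdy (W.pull (reparam 0 f hf hmf)) x y) :
    cls2 (W.pull (reparam 0 f hf hmf)) hB = cls2 W h := by
  rw [cls2_reparam_zero (g := id) (e0.symm ▸ h.1) (e1.symm ▸ h.2) hf contDiff_id hmf (fun _ h => h)
    e0.symm e1.symm]
  exact (sameOn_pull_id _ fun p _ => by simp [reparam_apply]).cls_eq _ _

theorem cls2_reparam_one {W : CubeMorphism L 2} {f g : ℝ → ℝ} {x y : M} (h : Bdy W x y)
    (hf : ContDiff ℝ ∞ f) (hg : ContDiff ℝ ∞ g)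
    (hmf : ∀ t ∈ Icc (0 : ℝ) 1, f t ∈ Icc (0 : ℝ) 1)
    (hmg : ∀ t ∈ Icc (0 : ℝ) 1, g t ∈ Icc (0 : ℝ) 1) (e0 : f 0 = g 0) (e1 : f 1 = g 1)
    (hB : Bdy (W.pull (reparam 1 f hf hmf)) x y) (hB' : Bdy (W.pull (reparam 1 g hg hmg)) x y) :
    cls2 (W.pull (reparam 1 f hf hmf)) hB = cls2 (W.pull (reparam 1 g hg hmg)) hB' := by
  refine cls2_pull_eq h.1 h.2 _ _ (fun p hp => ?_) (fun p hp => ?_) (fun p hp => ?_) (fun p hp => ?_)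
    (fun p _ hp => ?_) (fun p _ hp => ?_)
  iterate 4 simpa [reparam_apply] using hp
  iterate 2 rcases hp with hp | hp <;> simp_all [reparam_apply, pd_reparam]

end Horizontal

section HorizontalLaws

variable {L : LieAlgebroid EM FA A} {x y z w : M}

theorem Homotopic₃.glue {κ₁ κ₁' κ₂ κ₂' : CubeMorphism L 2} (h1 : Homotopic₃ x y κ₁ κ₁')
    (h2 : Homotopic₃ y z κ₂ κ₂') (h : Match 0 κ₁ κ₂) (h' : Match 0 κ₁' κ₂') :
    Homotopic₃ x z (glue 0 κ₁ κ₂ h) (glue 0 κ₁' κ₂' h') := by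
  obtain ⟨H, hB, f0, f1, t0, t1⟩ := h1
  obtain ⟨K, kB, g0, g1, s0, s1⟩ := h2
  have e1 : ∀ c (hc : c ∈ Icc (0 : ℝ) 1),
      SameOn ((TwoGroupoid.glue 0 H K (hB.match_zero kB)).pull (face 1 c hc))
        (TwoGroupoid.glue 0 (H.pull (face 1 c hc)) (K.pull (face 1 c hc))
          ((hB.face_one hc).match_zero (kB.face_one hc))) := fun c hc =>
    sameOn_pull_glue _ (fun p => rfl) (fun p r => by ext i; fin_cases i <;> rfl) _ _
  have e2 : ∀ c (hc : c ∈ Icc (0 : ℝ) 1),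
      SameOn ((TwoGroupoid.glue 0 H K (hB.match_zero kB)).pull (face 2 c hc))
        (TwoGroupoid.glue 0 (H.pull (face 2 c hc)) (K.pull (face 2 c hc))
          ((hB.face_two hc).match_zero (kB.face_two hc))) := fun c hc =>
    sameOn_pull_glue _ (fun p => rfl) (fun p r => by ext i; fin_cases i <;> rfl) _ _
  exact ⟨_, hB.glue_zero kB, (e2 0 _).trans (f0.glue g0 _ _), (e2 1 _).trans (f1.glue g1 _ _),
    (t0.glue s0 _).congr (e1 0 _).symm, (t1.glue s1 _).congr (e1 1 _).symm⟩

/-- The horizontal product `g · h` (first `h`). -/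
def P2.mul (g : P2 L y z) (h : P2 L x y) : P2 L x z :=
  Quot.lift₂ (fun σ τ => cls2 _ (τ.htpy.bdy.glue_zero σ.htpy.bdy))
    (fun σ _ _ hτ => ((threeHomotopic_iff.1 hτ).glue
      (Homotopic₃.of_sameOn σ.htpy.bdy (SameOn.refl _)) _ _).cls_eq _ _)
    (fun _ _ τ hσ => ((Homotopic₃.of_sameOn τ.htpy.bdy (SameOn.refl _)).glue
      (threeHomotopic_iff.1 hσ) _ _).cls_eq _ _) g h

theorem mul_cls2 {κ₁ κ₂ : CubeMorphism L 2} (h1 : Bdy κ₁ x y) (h2 : Bdy κ₂ y z) :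
    P2.mul (cls2 κ₂ h2) (cls2 κ₁ h1) = cls2 (glue 0 κ₁ κ₂ (h1.match_zero h2)) (h1.glue_zero h2) :=
  rfl

/-- The horizontal unit at `x`. -/
def P2.unit (L : LieAlgebroid EM FA A) (x : M) : P2 L x x := cls2 (unitCube L 2 x) (unitCube_bdy 1 x)

/-- Reversal of the `i`-th coordinate. -/
def flip {n : ℕ} (i : Fin n) : CubeMap n n :=
  reparam i (fun t => 1 - t) (by fun_prop) fun t ht => ⟨by linarith [ht.2], by linarith [ht.1]⟩

theorem flip_apply {n : ℕ} (i : Fin n) (p : Fin n → ℝ) :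
    flip i p = Function.update p i (1 - p i) := rfl

theorem Bdy.flip {n : ℕ} {κ : CubeMorphism L (n + 1)} (h : Bdy κ x y) :
    Bdy (κ.pull (flip 0)) y x :=
  Bdy.pull_of h.2 h.1 _ (fun p hp => by simp [flip_apply, hp]) (fun p hp => by simp [flip_apply, hp])

/-- The horizontal inverse. -/
def P2.inv (g : P2 L x y) : P2 L y x :=
  Quot.lift (fun σ => cls2 (σ.htpy.mor.pull (flip 0)) σ.htpy.bdy.flip) (fun σ σ' h => by
    obtain ⟨H, hB, f0, f1, t0, t1⟩ := threeHomotopic_iff.1 h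
    have e1 : ∀ c (hc : c ∈ Icc (0 : ℝ) 1), SameOn ((H.pull (flip 0)).pull (face 1 c hc))
        ((H.pull (face 1 c hc)).pull (flip 0)) := fun c hc =>
      (sameOn_pull_pull _ _ _).trans ((sameOn_pull_congr H fun p _ => by
        ext i; fin_cases i <;> rfl).trans (sameOn_pull_pull _ _ _).symm)
    have e2 : ∀ c (hc : c ∈ Icc (0 : ℝ) 1), SameOn ((H.pull (flip 0)).pull (face 2 c hc))
        ((H.pull (face 2 c hc)).pull (flip 0)) := fun c hc =>
      (sameOn_pull_pull _ _ _).trans ((sameOn_pull_congr H fun p _ => by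
        ext i; fin_cases i <;> rfl).trans (sameOn_pull_pull _ _ _).symm)
    exact Homotopic₃.cls_eq ⟨H.pull (flip 0), hB.flip, (e2 0 _).trans (f0.pull _),
      (e2 1 _).trans (f1.pull _), (t0.pull _).congr (e1 0 _).symm,
      (t1.pull _).congr (e1 1 _).symm⟩ _ _) g

theorem inv_cls2 {κ : CubeMorphism L 2} (h : Bdy κ x y) :
    P2.inv (cls2 κ h) = cls2 (κ.pull (flip 0)) h.flip := rfl

theorem P2.unit_mul (g : P2 L x y) : P2.mul (P2.unit L y) g = g := by
  induction g using P2.ind with | _ κ hB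
  rw [P2.unit, mul_cls2]
  have hf : ContDiff ℝ ∞ fun t : ℝ => cut (2 * t) := contDiff_cut.comp (by fun_prop)
  rw [← cls2_reparam_zero_id hB hf (fun _ _ => cut_mem _)
    (cut_eq_zero (by norm_num)) (cut_eq_one (by norm_num)) (Bdy.reparam
      (by rw [cut_eq_zero (by norm_num)]; exact hB.1) (by rw [cut_eq_one (by norm_num)]; exact hB.2) _ _)]
  have hm : Match 0 (κ.pull (reparam 0 id contDiff_id fun _ h => h))
      (κ.pull (aff 0 one_mem_I one_mem_I)) :=
    Bdy.match_zero (hB.congr (sameOn_pull_id κ fun p _ => by simp [reparam_apply]).symm)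
      (Bdy.aff hB.2 hB.2 _ _)
  refine SameOn.cls_eq (SameOn.trans (SameOn.glue ?_ ?_ _ hm) (sameOn_glue_pull κ hm ?_ ?_)) _ _
  · exact (sameOn_pull_id κ fun p _ => by simp [reparam_apply]).symm
  · exact (SameOn.of_bdyAt one_mem_I hB.2).symm
  · intro p _ _
    simp [lo_apply, reparam_apply]
  · intro p _ hp
    rw [hi_apply, reparam_apply, aff_apply, cut_eq_one (t := 2 * p 0) (by linarith)]
    simp

theorem P2.mul_unit (g : P2 L x y) : P2.mul g (P2.unit L x) = g := by
  induction g using P2.ind with | _ κ hB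
  rw [P2.unit, mul_cls2]
  have hf : ContDiff ℝ ∞ fun t : ℝ => cut (2 * t - 1) := contDiff_cut.comp (by fun_prop)
  rw [← cls2_reparam_zero_id hB hf (fun _ _ => cut_mem _)
    (cut_eq_zero (by norm_num)) (cut_eq_one (by norm_num)) (Bdy.reparam
      (by rw [cut_eq_zero (by norm_num)]; exact hB.1) (by rw [cut_eq_one (by norm_num)]; exact hB.2) _ _)]
  have hm : Match 0 (κ.pull (aff 0 zero_mem_I zero_mem_I))
      (κ.pull (reparam 0 id contDiff_id fun _ h => h)) :=
    Bdy.match_zero (Bdy.aff hB.1 hB.1 _ _)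
      (hB.congr (sameOn_pull_id κ fun p _ => by simp [reparam_apply]).symm)
  refine SameOn.cls_eq (SameOn.trans (SameOn.glue ?_ ?_ _ hm) (sameOn_glue_pull κ hm ?_ ?_)) _ _
  · exact (SameOn.of_bdyAt zero_mem_I hB.1).symm
  · exact (sameOn_pull_id κ fun p _ => by simp [reparam_apply]).symm
  · intro p _ hp
    rw [lo_apply, reparam_apply, aff_apply, cut_eq_zero (t := 2 * p 0 - 1) (by linarith)]
    simp
  · intro p _ _
    simp [hi_apply, reparam_apply]

theorem cut_sub_mem (t : ℝ) : cut (2 * t) - cut (2 * t - 1) ∈ Icc (0 : ℝ) 1 :=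
  ⟨sub_nonneg.2 (cut_mono (by linarith)), by linarith [(cut_mem (2 * t)).2, (cut_mem (2 * t - 1)).1]⟩

theorem contDiff_cut_sub : ContDiff ℝ ∞ fun t => cut (2 * t) - cut (2 * t - 1) :=
  (contDiff_cut.comp (by fun_prop)).sub (contDiff_cut.comp (by fun_prop))

theorem P2.inv_mul (g : P2 L x y) : P2.mul (P2.inv g) g = P2.unit L x := by
  induction g using P2.ind with | _ κ hB
  rw [inv_cls2, mul_cls2]
  have hm : Match 0 (κ.pull (reparam 0 id contDiff_id fun _ h => h)) (κ.pull (flip 0)) :=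
    Bdy.match_zero (hB.congr (sameOn_pull_id κ fun p _ => by simp [reparam_apply]).symm) hB.flip
  have e0 : cut (2 * 0) - cut (2 * 0 - 1) = 0 := by
    rw [cut_eq_zero (by norm_num), cut_eq_zero (by norm_num), sub_zero]
  have e1 : cut (2 * 1) - cut (2 * 1 - 1) = 0 := by
    rw [cut_eq_one (by norm_num), cut_eq_one (by norm_num), sub_self]
  have h0 : BdyAt κ (cut (2 * 0) - cut (2 * 0 - 1)) x := by rw [e0]; exact hB.1
  have h1 : BdyAt κ (cut (2 * 1) - cut (2 * 1 - 1)) x := by rw [e1]; exact hB.1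
  refine Eq.trans (SameOn.cls_eq (κ' := κ.pull (reparam 0 _ contDiff_cut_sub
      fun _ _ => cut_sub_mem _)) (SameOn.trans (SameOn.glue
      (sameOn_pull_id κ fun p _ => by simp [reparam_apply]).symm (SameOn.refl _) _ hm)
      (sameOn_glue_pull κ hm ?_ ?_)) _ (Bdy.reparam h0 h1 _ _)) ?_
  · intro p _ hp
    rw [lo_apply, reparam_apply, reparam_apply, cut_eq_zero (t := 2 * p 0 - 1) (by linarith)]
    simp
  · intro p _ hp
    rw [hi_apply, flip_apply, reparam_apply, cut_eq_one (t := 2 * p 0) (by linarith)]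
    simp
  · rw [cls2_reparam_zero h0 h1 contDiff_cut_sub (contDiff_const (c := (0 : ℝ)))
      (fun _ _ => cut_sub_mem _) (fun _ _ => zero_mem_I) e0.symm e1.symm]
    refine SameOn.cls_eq (SameOn.trans (sameOn_pull_congr κ fun p _ => ?_)
      (SameOn.of_bdyAt zero_mem_I hB.1)) _ _
    simp [aff_apply, reparam_apply]

theorem P2.inv_inv (g : P2 L x y) : P2.inv (P2.inv g) = g := by
  induction g using P2.ind with | _ κ hB
  rw [inv_cls2, inv_cls2]
  exact SameOn.cls_eq ((sameOn_pull_pull _ _ _).trans (sameOn_pull_id _ fun p _ => by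
    change flip 0 (flip 0 p) = p
    simp [flip_apply])) _ _

theorem P2.mul_inv (g : P2 L x y) : P2.mul g (P2.inv g) = P2.unit L y := by
  conv_lhs => rw [← P2.inv_inv g]
  rw [P2.inv_inv (P2.inv g)]
  exact P2.inv_inv g ▸ P2.inv_mul (P2.inv g)

/-- A square which is cut at `t = m` is the product of its two parts. -/
theorem cls2_split {W : CubeMorphism L 2} {m : ℝ} (hm : m ∈ Icc (0 : ℝ) 1) (hB : Bdy W x z)
    (hy : BdyAt W m y) :
    cls2 W hB = P2.mul (cls2 (W.pull (aff 0 hm one_mem_I)) (Bdy.aff hy hB.2 _ _))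
      (cls2 (W.pull (aff 0 zero_mem_I hm)) (Bdy.aff hB.1 hy _ _)) := by
  rw [mul_cls2]
  have hf : ContDiff ℝ ∞ fun t => m * cut (2 * t) + (1 - m) * cut (2 * t - 1) :=
    (contDiff_const.mul (contDiff_cut.comp (by fun_prop))).add
      (contDiff_const.mul (contDiff_cut.comp (by fun_prop)))
  have hmf : ∀ t ∈ Icc (0 : ℝ) 1,
      m * cut (2 * t) + (1 - m) * cut (2 * t - 1) ∈ Icc (0 : ℝ) 1 := fun t _ => by
    have := affine_mem (cut_mem (2 * t - 1)) (cut_mem (2 * t)) hm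
    rwa [add_comm]
  have e0 : m * cut (2 * 0) + (1 - m) * cut (2 * 0 - 1) = 0 := by
    rw [cut_eq_zero (by norm_num), cut_eq_zero (by norm_num)]; ring
  have e1 : m * cut (2 * 1) + (1 - m) * cut (2 * 1 - 1) = 1 := by
    rw [cut_eq_one (by norm_num), cut_eq_one (by norm_num)]; ring
  rw [← cls2_reparam_zero_id hB hf hmf e0 e1
    (Bdy.reparam (by rw [e0]; exact hB.1) (by rw [e1]; exact hB.2) hf hmf)]
  refine SameOn.cls_eq (sameOn_glue_pull W _ ?_ ?_).symm _ _
  · intro p _ hp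
    rw [lo_apply, reparam_apply, aff_apply, cut_eq_zero (t := 2 * p 0 - 1) (by linarith)]
    simp [mul_comm]
  · intro p _ hp
    rw [hi_apply, reparam_apply, aff_apply, cut_eq_one (t := 2 * p 0) (by linarith)]
    simp only [Function.update_self, Function.update_idem]
    congr 1
    ring

theorem sameOn_pull_glue_lo {m n : ℕ} {i : Fin n} {κ₁ κ₂ : CubeMorphism L n} (h : Match i κ₁ κ₂)
    (φ : CubeMap m n) (hφ : ∀ p ∈ cube m, φ p i ≤ 1 / 2) :
    SameOn ((glue i κ₁ κ₂ h).pull φ) (κ₁.pull ((lo i).comp φ)) := fun p hp => by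
  rw [CubeMorphism.pull_jet, glue_jet_lo h (hφ p hp), ← CubeMorphism.pull_jet,
    CubeMorphism.pull_pull]

theorem sameOn_pull_glue_hi {m n : ℕ} {i : Fin n} {κ₁ κ₂ : CubeMorphism L n} (h : Match i κ₁ κ₂)
    (φ : CubeMap m n) (hφ : ∀ p ∈ cube m, 1 / 2 ≤ φ p i) :
    SameOn ((glue i κ₁ κ₂ h).pull φ) (κ₂.pull ((hi i).comp φ)) := fun p hp => by
  rw [CubeMorphism.pull_jet, glue_jet_hi h (φ.maps p hp) (hφ p hp), ← CubeMorphism.pull_jet,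
    CubeMorphism.pull_pull]

theorem BdyAt.glue_lo {n : ℕ} {κ₁ κ₂ : CubeMorphism L (n + 1)} {c : ℝ} (hc : c ≤ 1 / 2)
    (h1 : BdyAt κ₁ (cut (2 * c)) x) (h : Match 0 κ₁ κ₂) : BdyAt (TwoGroupoid.glue 0 κ₁ κ₂ h) c x := by
  intro p hp h0
  rw [glue_jet_lo h (by rw [h0]; exact hc)]
  refine h1.pull (lo 0) (fun q hq => ?_) p hp h0
  rw [lo_apply, Function.update_self, hq]

theorem P2.mul_assoc (g₃ : P2 L z w) (g₂ : P2 L y z) (g₁ : P2 L x y) :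
    P2.mul (P2.mul g₃ g₂) g₁ = P2.mul g₃ (P2.mul g₂ g₁) := by
  induction g₁ using P2.ind with | _ κ₁ h1
  induction g₂ using P2.ind with | _ κ₂ h2
  induction g₃ using P2.ind with | _ κ₃ h3
  have q4 : (1 / 4 : ℝ) ∈ Icc (0 : ℝ) 1 := by constructor <;> norm_num
  have q3 : (1 / 3 : ℝ) ∈ Icc (0 : ℝ) 1 := by constructor <;> norm_num
  have b12 : BdyAt (glue 0 κ₁ κ₂ (h1.match_zero h2)) (1 / 2) y :=
    BdyAt.glue_lo le_rfl (by rw [cut_eq_one (by norm_num)]; exact h1.2) _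
  set W := glue 0 (glue 0 κ₁ κ₂ (h1.match_zero h2)) κ₃ ((h1.glue_zero h2).match_zero h3) with hW
  have hB : Bdy W x w := (h1.glue_zero h2).glue_zero h3
  have b4 : BdyAt W (1 / 4) y :=
    BdyAt.glue_lo (by norm_num) (by
      rw [show (2 * (1 / 4) : ℝ) = 1 / 2 by norm_num, cut_half]; exact b12) _
  have b2 : BdyAt W (1 / 2) z :=
    BdyAt.glue_lo le_rfl (by rw [cut_eq_one (by norm_num)]; exact (h1.glue_zero h2).2) _
  have b3 : BdyAt (W.pull (aff 0 q4 one_mem_I)) (1 / 3) z :=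
    b2.pull _ fun p hp => by rw [aff_apply, Function.update_self, hp]; norm_num
  change _ = cls2 W hB
  rw [cls2_split q4 hB b4, cls2_split q3 _ b3]
  symm
  have cc : ContDiff ℝ ∞ fun t : ℝ => cut (2 * t) := contDiff_cut.comp (by fun_prop)
  congr 1
  · congr 1
    · have hf : ContDiff ℝ ∞ fun t : ℝ => cut (2 * ((1 - ((1 - t) * (1 / 3) + t * 1)) * (1 / 4)
          + ((1 - t) * (1 / 3) + t * 1) * 1) - 1) := contDiff_cut.comp (by fun_prop)
      have e0 : cut (2 * ((1 - ((1 - 0) * (1 / 3) + 0 * 1)) * (1 / 4)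
          + ((1 - 0) * (1 / 3) + 0 * 1) * 1) - 1) = 0 := cut_eq_zero (by norm_num)
      have e1 : cut (2 * ((1 - ((1 - 1) * (1 / 3) + 1 * 1)) * (1 / 4)
          + ((1 - 1) * (1 / 3) + 1 * 1) * 1) - 1) = 1 := cut_eq_one (by norm_num)
      rw [← cls2_reparam_zero_id h3 hf (fun _ _ => cut_mem _) e0 e1
        (Bdy.reparam (by rw [e0]; exact h3.1) (by rw [e1]; exact h3.2) _ _)]
      refine SameOn.cls_eq (((sameOn_pull_pull _ _ _).trans
        (sameOn_pull_glue_hi _ _ fun p hp => ?_)).trans (sameOn_pull_congr _ fun p _ => ?_)) _ _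
      · have := mem_cube.1 hp 0
        change 1 / 2 ≤ aff 0 q4 one_mem_I (aff 0 q3 one_mem_I p) 0
        simp only [aff_apply, Function.update_self]
        linarith [this.1]
      · change hi 0 (aff 0 q4 one_mem_I (aff 0 q3 one_mem_I p)) = _
        simp only [aff_apply, hi_apply, reparam_apply, Function.update_self, Function.update_idem]
    · have hf : ContDiff ℝ ∞ fun t : ℝ => cut (2 * cut (2 * ((1 - ((1 - t) * 0 + t * (1 / 3)))
          * (1 / 4) + ((1 - t) * 0 + t * (1 / 3)) * 1)) - 1) :=
        contDiff_cut.comp ((contDiff_const.mul (contDiff_cut.comp (by fun_prop))).sub contDiff_const)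
      have e0 : cut (2 * cut (2 * ((1 - ((1 - 0) * 0 + 0 * (1 / 3)))
          * (1 / 4) + ((1 - 0) * 0 + 0 * (1 / 3)) * 1)) - 1) = 0 := by
        rw [show (2 * ((1 - ((1 - 0) * 0 + 0 * (1 / 3)))
          * (1 / 4) + ((1 - 0) * 0 + 0 * (1 / 3)) * 1) : ℝ) = 1 / 2 by norm_num, cut_half]
        exact cut_eq_zero (by norm_num)
      have e1 : cut (2 * cut (2 * ((1 - ((1 - 1) * 0 + 1 * (1 / 3)))
          * (1 / 4) + ((1 - 1) * 0 + 1 * (1 / 3)) * 1)) - 1) = 1 := by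
        rw [cut_eq_one (t := 2 * _) (by norm_num)]
        exact cut_eq_one (by norm_num)
      rw [← cls2_reparam_zero_id h2 hf (fun _ _ => cut_mem _) e0 e1
        (Bdy.reparam (by rw [e0]; exact h2.1) (by rw [e1]; exact h2.2) _ _)]
      refine SameOn.cls_eq (((sameOn_pull_pull _ _ _).trans
        (sameOn_pull_glue_lo _ _ fun p hp => ?_)).trans ((sameOn_pull_glue_hi _ _
          fun p hp => ?_).trans (sameOn_pull_congr _ fun p _ => ?_))) _ _
      · have := mem_cube.1 hp 0
        change aff 0 q4 one_mem_I (aff 0 zero_mem_I q3 p) 0 ≤ 1 / 2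
        simp only [aff_apply, Function.update_self]
        linarith [this.2]
      · have := mem_cube.1 hp 0
        change 1 / 2 ≤ lo 0 (aff 0 q4 one_mem_I (aff 0 zero_mem_I q3 p)) 0
        simp only [aff_apply, lo_apply, Function.update_self]
        rw [← cut_half]
        exact cut_mono (by linarith [this.1])
      · change hi 0 (lo 0 (aff 0 q4 one_mem_I (aff 0 zero_mem_I q3 p))) = _
        simp only [aff_apply, hi_apply, lo_apply, reparam_apply, Function.update_self,
          Function.update_idem]
  · have hf : ContDiff ℝ ∞ fun t : ℝ => cut (2 * cut (2 * ((1 - t) * 0 + t * (1 / 4)))) :=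
      contDiff_cut.comp (contDiff_const.mul (contDiff_cut.comp (by fun_prop)))
    have e0 : cut (2 * cut (2 * ((1 - 0) * 0 + 0 * (1 / 4)))) = 0 := by
      rw [cut_eq_zero (t := 2 * ((1 - 0) * 0 + 0 * (1 / 4))) (by norm_num)]
      exact cut_eq_zero (by norm_num)
    have e1 : cut (2 * cut (2 * ((1 - 1) * 0 + 1 * (1 / 4)))) = 1 := by
      rw [show (2 * ((1 - 1) * 0 + 1 * (1 / 4)) : ℝ) = 1 / 2 by norm_num, cut_half]
      exact cut_eq_one (by norm_num)
    rw [← cls2_reparam_zero_id h1 hf (fun _ _ => cut_mem _) e0 e1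
      (Bdy.reparam (by rw [e0]; exact h1.1) (by rw [e1]; exact h1.2) _ _)]
    refine SameOn.cls_eq ((sameOn_pull_glue_lo _ _ fun p hp => ?_).trans ((sameOn_pull_glue_lo _ _
        fun p hp => ?_).trans (sameOn_pull_congr _ fun p _ => ?_))) _ _
    · have := mem_cube.1 hp 0
      simp only [aff_apply, Function.update_self]
      linarith [this.2]
    · have := mem_cube.1 hp 0
      change lo 0 (aff 0 zero_mem_I q4 p) 0 ≤ 1 / 2
      simp only [aff_apply, lo_apply, Function.update_self]
      rw [← cut_half]
      exact cut_mono (by linarith [this.2])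
    · change lo 0 (lo 0 (aff 0 zero_mem_I q4 p)) = _
      simp only [aff_apply, lo_apply, reparam_apply, Function.update_self, Function.update_idem]

end HorizontalLaws

/-! ### Vertical structure -/

/-- The reparametrizations of the two halves of a concatenation. -/
def lf (t : ℝ) : ℝ := cut (2 * t)

def hf (t : ℝ) : ℝ := cut (2 * t - 1)

@[fun_prop]
theorem contDiff_lf : ContDiff ℝ ∞ lf := contDiff_cut.comp (by fun_prop)

@[fun_prop]
theorem contDiff_hf : ContDiff ℝ ∞ hf := contDiff_cut.comp (by fun_prop)

theorem lf_mem (t : ℝ) : lf t ∈ Icc (0 : ℝ) 1 := cut_mem _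

theorem hf_mem (t : ℝ) : hf t ∈ Icc (0 : ℝ) 1 := cut_mem _

theorem lf_eq_one {t : ℝ} (h : 1 / 2 ≤ t) : lf t = 1 := cut_eq_one (by linarith)

theorem hf_eq_zero {t : ℝ} (h : t ≤ 1 / 2) : hf t = 0 := cut_eq_zero (by linarith)

theorem lf_zero : lf 0 = 0 := cut_eq_zero (by norm_num)

theorem hf_one : hf 1 = 1 := cut_eq_one (by norm_num)

theorem lf_one : lf 1 = 1 := lf_eq_one (by norm_num)

theorem hf_zero : hf 0 = 0 := hf_eq_zero (by norm_num)

theorem lf_eventually {f : ℝ → ℝ} {t : ℝ} (hc : ContinuousAt f t) (h : 1 / 2 ≤ f t) :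
    ∀ᶠ r in 𝓝 t, lf (f r) = 1 := by
  filter_upwards [hc.eventually (lt_mem_nhds (show 1 / 3 < f t by linarith))] with r hr
  exact cut_eq_one (by linarith)

theorem hf_eventually {f : ℝ → ℝ} {t : ℝ} (hc : ContinuousAt f t) (h : f t ≤ 1 / 2) :
    ∀ᶠ r in 𝓝 t, hf (f r) = 0 := by
  filter_upwards [hc.eventually (gt_mem_nhds (show f t < 2 / 3 by linarith))] with r hr
  exact cut_eq_zero (by linarith)

/-- A map of squares given by its two components. -/
def sq (f g : ℝ → ℝ → ℝ) (hf : ContDiff ℝ ∞ fun p : Fin 2 → ℝ => f (p 0) (p 1))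
    (hg : ContDiff ℝ ∞ fun p : Fin 2 → ℝ => g (p 0) (p 1))
    (hfm : ∀ t ∈ Icc (0 : ℝ) 1, ∀ s ∈ Icc (0 : ℝ) 1, f t s ∈ Icc (0 : ℝ) 1)
    (hgm : ∀ t ∈ Icc (0 : ℝ) 1, ∀ s ∈ Icc (0 : ℝ) 1, g t s ∈ Icc (0 : ℝ) 1) : CubeMap 2 2 where
  toFun p := ![f (p 0) (p 1), g (p 0) (p 1)]
  smooth := contDiff_pi.2 fun i => by fin_cases i <;> assumption
  maps p hp := vec2_mem_cube (hfm _ (mem_cube.1 hp 0) _ (mem_cube.1 hp 1))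
    (hgm _ (mem_cube.1 hp 0) _ (mem_cube.1 hp 1))

section Vertical

variable {L : LieAlgebroid EM FA A} {x y z w : M}

/-- Change of the second component of a reparametrization of a square. -/
theorem cls2_sq_snd {W : CubeMorphism L 2} {c₀ c₁ : ℝ} (h0 : BdyAt W c₀ x) (h1 : BdyAt W c₁ y)
    {f g g' : ℝ → ℝ → ℝ} (hf : ContDiff ℝ ∞ fun p : Fin 2 → ℝ => f (p 0) (p 1))
    (hg : ContDiff ℝ ∞ fun p : Fin 2 → ℝ => g (p 0) (p 1))
    (hg' : ContDiff ℝ ∞ fun p : Fin 2 → ℝ => g' (p 0) (p 1))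
    (hfm : ∀ t ∈ Icc (0 : ℝ) 1, ∀ s ∈ Icc (0 : ℝ) 1, f t s ∈ Icc (0 : ℝ) 1)
    (hgm : ∀ t ∈ Icc (0 : ℝ) 1, ∀ s ∈ Icc (0 : ℝ) 1, g t s ∈ Icc (0 : ℝ) 1)
    (hgm' : ∀ t ∈ Icc (0 : ℝ) 1, ∀ s ∈ Icc (0 : ℝ) 1, g' t s ∈ Icc (0 : ℝ) 1)
    (f0 : ∀ s, f 0 s = c₀) (f1 : ∀ s, f 1 s = c₁)
    (h : ∀ t ∈ Icc (0 : ℝ) 1, ∀ s, s = 0 ∨ s = 1 →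
      g t s = g' t s ∨ ∀ᶠ r in 𝓝 t, f r s = f t s)
    (hB : Bdy (W.pull (sq f g hf hg hfm hgm)) x y)
    (hB' : Bdy (W.pull (sq f g' hf hg' hfm hgm')) x y) :
    cls2 (W.pull (sq f g hf hg hfm hgm)) hB = cls2 (W.pull (sq f g' hf hg' hfm hgm')) hB' := by
  have key : ∀ (k : ℝ → ℝ → ℝ) hk hkm, ∀ p ∈ cube 2, p 1 = 0 ∨ p 1 = 1 →
      (sq f k hf hk hfm hkm).pd 0 0 p * (sq f g' hf hg' hfm hgm' p 1 - sq f g hf hg hfm hgm p 1)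
        = (sq f k hf hk hfm hkm).pd 0 1 p
          * (sq f g' hf hg' hfm hgm' p 0 - sq f g hf hg hfm hgm p 0) := fun k hk hkm p hp hp1 => by
    rw [show sq f g' hf hg' hfm hgm' p 0 - sq f g hf hg hfm hgm p 0 = 0 from sub_self _, mul_zero]
    rcases h _ (mem_cube.1 hp 0) _ hp1 with h | h
    · rw [show sq f g' hf hg' hfm hgm' p 1 - sq f g hf hg hfm hgm p 1 = 0 from
        sub_eq_zero.2 h.symm, mul_zero]
    · rw [CubeMap.pd_eq_zero_of_eventually _ _ _ _ (by
        filter_upwards [h] with r hr using hr), zero_mul]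
  exact cls2_pull_eq h0 h1 _ _ (fun p hp => (congrArg (f · (p 1)) hp).trans (f0 _))
    (fun p hp => (congrArg (f · (p 1)) hp).trans (f1 _))
    (fun p hp => (congrArg (f · (p 1)) hp).trans (f0 _))
    (fun p hp => (congrArg (f · (p 1)) hp).trans (f1 _)) (key g hg hgm) (key g' hg' hgm')

/-- Change of the first component of a reparametrization of a square. -/
theorem cls2_sq_fst {W : CubeMorphism L 2} {c₀ c₁ : ℝ} (h0 : BdyAt W c₀ x) (h1 : BdyAt W c₁ y)
    {f f' g : ℝ → ℝ → ℝ} (hf : ContDiff ℝ ∞ fun p : Fin 2 → ℝ => f (p 0) (p 1))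
    (hf' : ContDiff ℝ ∞ fun p : Fin 2 → ℝ => f' (p 0) (p 1))
    (hg : ContDiff ℝ ∞ fun p : Fin 2 → ℝ => g (p 0) (p 1))
    (hfm : ∀ t ∈ Icc (0 : ℝ) 1, ∀ s ∈ Icc (0 : ℝ) 1, f t s ∈ Icc (0 : ℝ) 1)
    (hfm' : ∀ t ∈ Icc (0 : ℝ) 1, ∀ s ∈ Icc (0 : ℝ) 1, f' t s ∈ Icc (0 : ℝ) 1)
    (hgm : ∀ t ∈ Icc (0 : ℝ) 1, ∀ s ∈ Icc (0 : ℝ) 1, g t s ∈ Icc (0 : ℝ) 1)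
    (f0 : ∀ s, f 0 s = c₀) (f1 : ∀ s, f 1 s = c₁) (f0' : ∀ s, f' 0 s = c₀) (f1' : ∀ s, f' 1 s = c₁)
    (h : ∀ t ∈ Icc (0 : ℝ) 1, ∀ s, s = 0 ∨ s = 1 →
      f t s = f' t s ∨ ∀ᶠ r in 𝓝 t, g r s = g t s)
    (hB : Bdy (W.pull (sq f g hf hg hfm hgm)) x y)
    (hB' : Bdy (W.pull (sq f' g hf' hg hfm' hgm)) x y) :
    cls2 (W.pull (sq f g hf hg hfm hgm)) hB = cls2 (W.pull (sq f' g hf' hg hfm' hgm)) hB' := by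
  have key : ∀ (k : ℝ → ℝ → ℝ) hk hkm, ∀ p ∈ cube 2, p 1 = 0 ∨ p 1 = 1 →
      (sq k g hk hg hkm hgm).pd 0 0 p * (sq f' g hf' hg hfm' hgm p 1 - sq f g hf hg hfm hgm p 1)
        = (sq k g hk hg hkm hgm).pd 0 1 p
          * (sq f' g hf' hg hfm' hgm p 0 - sq f g hf hg hfm hgm p 0) := fun k hk hkm p hp hp1 => by
    rw [show sq f' g hf' hg hfm' hgm p 1 - sq f g hf hg hfm hgm p 1 = 0 from sub_self _, mul_zero]
    rcases h _ (mem_cube.1 hp 0) _ hp1 with h | h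
    · rw [show sq f' g hf' hg hfm' hgm p 0 - sq f g hf hg hfm hgm p 0 = 0 from
        sub_eq_zero.2 h.symm, mul_zero]
    · rw [CubeMap.pd_eq_zero_of_eventually _ 0 1 _ (by
        filter_upwards [h] with r hr using hr), zero_mul]
  exact cls2_pull_eq h0 h1 _ _ (fun p hp => (congrArg (f · (p 1)) hp).trans (f0 _))
    (fun p hp => (congrArg (f · (p 1)) hp).trans (f1 _))
    (fun p hp => (congrArg (f' · (p 1)) hp).trans (f0' _))
    (fun p hp => (congrArg (f' · (p 1)) hp).trans (f1' _)) (key f hf hfm) (key f' hf' hfm')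

theorem Bdy.sq {W : CubeMorphism L 2} {c₀ c₁ : ℝ} (h0 : BdyAt W c₀ x) (h1 : BdyAt W c₁ y)
    {f g : ℝ → ℝ → ℝ} (hf : ContDiff ℝ ∞ fun p : Fin 2 → ℝ => f (p 0) (p 1))
    (hg : ContDiff ℝ ∞ fun p : Fin 2 → ℝ => g (p 0) (p 1))
    (hfm : ∀ t ∈ Icc (0 : ℝ) 1, ∀ s ∈ Icc (0 : ℝ) 1, f t s ∈ Icc (0 : ℝ) 1)
    (hgm : ∀ t ∈ Icc (0 : ℝ) 1, ∀ s ∈ Icc (0 : ℝ) 1, g t s ∈ Icc (0 : ℝ) 1)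
    (f0 : ∀ s, f 0 s = c₀) (f1 : ∀ s, f 1 s = c₁) : Bdy (W.pull (sq f g hf hg hfm hgm)) x y :=
  Bdy.pull_of h0 h1 _ (fun p hp => (congrArg (f · (p 1)) hp).trans (f0 _))
    (fun p hp => (congrArg (f · (p 1)) hp).trans (f1 _))

theorem half_mem_I : (1 / 2 : ℝ) ∈ Icc (0 : ℝ) 1 := by constructor <;> norm_num

theorem Bdy.reparam_one {W : CubeMorphism L 2} (h : Bdy W x y) {f : ℝ → ℝ} (hf : ContDiff ℝ ∞ f)
    (hm : ∀ t ∈ Icc (0 : ℝ) 1, f t ∈ Icc (0 : ℝ) 1) :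
    Bdy (W.pull (TwoGroupoid.reparam 1 f hf hm)) x y :=
  h.pull _ (fun p hp => by simpa [reparam_apply] using hp)
    (fun p hp => by simpa [reparam_apply] using hp)

theorem Bdy.aff_one {W : CubeMorphism L 2} (h : Bdy W x y) {a b : ℝ} (ha : a ∈ Icc (0 : ℝ) 1)
    (hb : b ∈ Icc (0 : ℝ) 1) : Bdy (W.pull (TwoGroupoid.aff 1 ha hb)) x y :=
  h.reparam_one _ _

/-- A square is the product of its upper half, the inverse of its middle line, and its lower
half. -/
theorem cls2_vsplit {W : CubeMorphism L 2} (hB : Bdy W x y) :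
    cls2 W hB = P2.mul (P2.mul
      (cls2 (W.pull (aff 1 half_mem_I one_mem_I)) (hB.aff_one _ _))
      (P2.inv (cls2 (W.pull (aff 1 half_mem_I half_mem_I)) (hB.aff_one _ _))))
      (cls2 (W.pull (aff 1 zero_mem_I half_mem_I)) (hB.aff_one _ _)) := by
  have cl : Continuous lf := contDiff_lf.continuous
  have ch : Continuous hf := contDiff_hf.continuous
  have f₁ : ContDiff ℝ ∞ fun p : Fin 2 → ℝ => lf (p 0) := by fun_prop
  have g₁ : ContDiff ℝ ∞ fun p : Fin 2 → ℝ => p 1 / 2 + hf (p 0) * ((1 - p 1) / 2) := by fun_prop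
  have g₁' : ContDiff ℝ ∞ fun p : Fin 2 → ℝ => p 1 / 2 := by fun_prop
  have f₃ : ContDiff ℝ ∞ fun p : Fin 2 → ℝ => hf (p 0) := by fun_prop
  have g₃ : ContDiff ℝ ∞ fun p : Fin 2 → ℝ => 1 / 2 + lf (p 0) * (p 1 / 2) := by fun_prop
  have g₃' : ContDiff ℝ ∞ fun p : Fin 2 → ℝ => 1 / 2 + p 1 / 2 := by fun_prop
  have f₂ : ContDiff ℝ ∞ fun p : Fin 2 → ℝ => 1 - p 0 := by fun_prop
  have g₂ : ContDiff ℝ ∞ fun _ : Fin 2 → ℝ => (1 / 2 : ℝ) := by fun_prop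
  have f₂₃ : ContDiff ℝ ∞ fun p : Fin 2 → ℝ => 1 - lf (p 0) + hf (hf (p 0)) := by fun_prop
  have g₂₃ : ContDiff ℝ ∞ fun p : Fin 2 → ℝ => 1 / 2 + lf (hf (p 0)) * (p 1 / 2) := by fun_prop
  have f₄ : ContDiff ℝ ∞ fun p : Fin 2 → ℝ =>
    lf (lf (p 0)) - lf (hf (p 0)) + hf (hf (hf (p 0))) := by fun_prop
  have g₄ : ContDiff ℝ ∞ fun p : Fin 2 → ℝ =>
    p 1 / 2 + hf (lf (p 0)) * ((1 - p 1) / 2) + lf (hf (hf (p 0))) * (p 1 / 2) := by fun_prop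
  have f₅ : ContDiff ℝ ∞ fun p : Fin 2 → ℝ =>
    (1 - p 1) * lf (lf (p 0)) + p 1 * hf (hf (hf (p 0))) := by fun_prop
  have ft : ContDiff ℝ ∞ fun p : Fin 2 → ℝ => p 0 := by fun_prop
  have fs : ContDiff ℝ ∞ fun p : Fin 2 → ℝ => p 1 := by fun_prop
  have mf₁ : ∀ t ∈ Icc (0 : ℝ) 1, ∀ s ∈ Icc (0 : ℝ) 1, lf t ∈ Icc (0 : ℝ) 1 :=
    fun t _ _ _ => lf_mem t
  have mf₃ : ∀ t ∈ Icc (0 : ℝ) 1, ∀ s ∈ Icc (0 : ℝ) 1, hf t ∈ Icc (0 : ℝ) 1 :=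
    fun t _ _ _ => hf_mem t
  have mg₁ : ∀ t ∈ Icc (0 : ℝ) 1, ∀ s ∈ Icc (0 : ℝ) 1,
      s / 2 + hf t * ((1 - s) / 2) ∈ Icc (0 : ℝ) 1 := fun t _ s hs => by
    have := hf_mem t
    constructor
    · nlinarith [hs.1, hs.2, this.1, this.2]
    · nlinarith [hs.1, hs.2, this.1, this.2]
  have mg₁' : ∀ t ∈ Icc (0 : ℝ) 1, ∀ s ∈ Icc (0 : ℝ) 1, s / 2 ∈ Icc (0 : ℝ) 1 :=
    fun t _ s hs => ⟨by linarith [hs.1], by linarith [hs.2]⟩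
  have mg₃ : ∀ t ∈ Icc (0 : ℝ) 1, ∀ s ∈ Icc (0 : ℝ) 1,
      1 / 2 + lf t * (s / 2) ∈ Icc (0 : ℝ) 1 := fun t _ s hs => by
    have := lf_mem t
    constructor
    · nlinarith [hs.1, hs.2, this.1, this.2]
    · nlinarith [hs.1, hs.2, this.1, this.2]
  have mg₃' : ∀ t ∈ Icc (0 : ℝ) 1, ∀ s ∈ Icc (0 : ℝ) 1, 1 / 2 + s / 2 ∈ Icc (0 : ℝ) 1 :=
    fun t _ s hs => ⟨by linarith [hs.1], by linarith [hs.2]⟩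
  have mf₂ : ∀ t ∈ Icc (0 : ℝ) 1, ∀ s ∈ Icc (0 : ℝ) 1, 1 - t ∈ Icc (0 : ℝ) 1 :=
    fun t ht s _ => ⟨by linarith [ht.2], by linarith [ht.1]⟩
  have mg₂ : ∀ t ∈ Icc (0 : ℝ) 1, ∀ s ∈ Icc (0 : ℝ) 1, (1 / 2 : ℝ) ∈ Icc (0 : ℝ) 1 :=
    fun _ _ _ _ => half_mem_I
  have mf₂₃ : ∀ t ∈ Icc (0 : ℝ) 1, ∀ s ∈ Icc (0 : ℝ) 1,
      1 - lf t + hf (hf t) ∈ Icc (0 : ℝ) 1 := fun t _ s _ => by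
    rcases le_total t (1 / 2) with h | h
    · rw [hf_eq_zero h, hf_zero]
      exact ⟨by linarith [(lf_mem t).2], by linarith [(lf_mem t).1]⟩
    · rw [lf_eq_one h]
      simpa using hf_mem (hf t)
  have mg₂₃ : ∀ t ∈ Icc (0 : ℝ) 1, ∀ s ∈ Icc (0 : ℝ) 1,
      1 / 2 + lf (hf t) * (s / 2) ∈ Icc (0 : ℝ) 1 := fun t _ s hs => mg₃ _ (hf_mem t) s hs
  have mf₄ : ∀ t ∈ Icc (0 : ℝ) 1, ∀ s ∈ Icc (0 : ℝ) 1,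
      lf (lf t) - lf (hf t) + hf (hf (hf t)) ∈ Icc (0 : ℝ) 1 := fun t _ s hs => by
    rcases le_total t (1 / 2) with h | h
    · rw [hf_eq_zero h, hf_zero, lf_zero, hf_zero]
      simpa using lf_mem (lf t)
    · rw [lf_eq_one h, lf_one]
      exact mf₂₃ _ (hf_mem t) s hs
  have mg₄ : ∀ t ∈ Icc (0 : ℝ) 1, ∀ s ∈ Icc (0 : ℝ) 1,
      s / 2 + hf (lf t) * ((1 - s) / 2) + lf (hf (hf t)) * (s / 2) ∈ Icc (0 : ℝ) 1 :=
    fun t _ s hs => by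
    rcases le_total t (1 / 2) with h | h
    · rw [hf_eq_zero h, hf_zero, lf_zero, zero_mul, add_zero]
      exact mg₁ _ (lf_mem t) s hs
    · rw [lf_eq_one h, hf_one, show s / 2 + 1 * ((1 - s) / 2) = 1 / 2 by ring]
      exact mg₃ _ (hf_mem (hf t)) s hs
  have mf₅ : ∀ t ∈ Icc (0 : ℝ) 1, ∀ s ∈ Icc (0 : ℝ) 1,
      (1 - s) * lf (lf t) + s * hf (hf (hf t)) ∈ Icc (0 : ℝ) 1 :=
    fun t _ s hs => affine_mem (lf_mem _) (hf_mem _) hs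
  have mft : ∀ t ∈ Icc (0 : ℝ) 1, ∀ s ∈ Icc (0 : ℝ) 1, t ∈ Icc (0 : ℝ) 1 := fun _ h _ _ => h
  have mfs : ∀ t ∈ Icc (0 : ℝ) 1, ∀ s ∈ Icc (0 : ℝ) 1, s ∈ Icc (0 : ℝ) 1 := fun _ _ _ h => h
  -- the three factors
  have B₁ := Bdy.sq hB.1 hB.2 (f := fun t _ => lf t) f₁ g₁ mf₁ mg₁ (fun _ => lf_zero) (fun _ => lf_one)
  have B₂ := Bdy.sq hB.2 hB.1 (f := fun t _ => 1 - t) (g := fun _ _ => 1 / 2) f₂ g₂ mf₂ mg₂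
    (fun _ => sub_zero 1) (fun _ => sub_self 1)
  have B₃ := Bdy.sq hB.1 hB.2 (f := fun t _ => hf t) f₃ g₃ mf₃ mg₃ (fun _ => hf_zero) (fun _ => hf_one)
  have e₁ : cls2 (W.pull (aff 1 zero_mem_I half_mem_I)) (hB.aff_one _ _) = cls2 _ B₁ := by
    rw [cls2_sq_snd hB.1 hB.2 f₁ g₁ g₁' mf₁ mg₁ mg₁' (fun _ => lf_zero) (fun _ => lf_one)
      (fun t _ s _ => ?_) B₁ (Bdy.sq hB.1 hB.2 (f := fun t _ => lf t) _ _ _ _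
        (fun _ => lf_zero) (fun _ => lf_one)),
      cls2_sq_fst hB.1 hB.2 f₁ ft g₁' mf₁ mft mg₁' (fun _ => lf_zero) (fun _ => lf_one)
        (fun _ => rfl) (fun _ => rfl) (fun t _ s _ => Or.inr (Eventually.of_forall fun _ => rfl))
        _ (Bdy.sq hB.1 hB.2 (f := fun t _ => t) _ _ _ _ (fun _ => rfl) (fun _ => rfl))]
    · refine SameOn.cls_eq (sameOn_pull_congr W fun p _ => ?_) _ _
      ext i
      fin_cases i
      · rfl
      · change (1 - p 1) * 0 + p 1 * (1 / 2) = p 1 / 2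
        ring
    · rcases le_total t (1 / 2) with h | h
      · left
        rw [hf_eq_zero h]
        ring
      · right
        filter_upwards [lf_eventually continuousAt_id h] with r hr
        exact hr.trans (lf_eq_one h).symm
  have e₃ : cls2 (W.pull (aff 1 half_mem_I one_mem_I)) (hB.aff_one _ _) = cls2 _ B₃ := by
    rw [cls2_sq_snd hB.1 hB.2 f₃ g₃ g₃' mf₃ mg₃ mg₃' (fun _ => hf_zero) (fun _ => hf_one)
      (fun t _ s _ => ?_) B₃ (Bdy.sq hB.1 hB.2 (f := fun t _ => hf t) _ _ _ _
        (fun _ => hf_zero) (fun _ => hf_one)),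
      cls2_sq_fst hB.1 hB.2 f₃ ft g₃' mf₃ mft mg₃' (fun _ => hf_zero) (fun _ => hf_one)
        (fun _ => rfl) (fun _ => rfl) (fun t _ s _ => Or.inr (Eventually.of_forall fun _ => rfl))
        _ (Bdy.sq hB.1 hB.2 (f := fun t _ => t) _ _ _ _ (fun _ => rfl) (fun _ => rfl))]
    · refine SameOn.cls_eq (sameOn_pull_congr W fun p _ => ?_) _ _
      ext i
      fin_cases i
      · rfl
      · change (1 - p 1) * (1 / 2) + p 1 * 1 = 1 / 2 + p 1 / 2
        ring
    · rcases le_total t (1 / 2) with h | h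
      · right
        filter_upwards [hf_eventually continuousAt_id h] with r hr
        exact hr.trans (hf_eq_zero h).symm
      · left
        rw [lf_eq_one h]
        ring
  have e₂ : P2.inv (cls2 (W.pull (aff 1 half_mem_I half_mem_I)) (hB.aff_one _ _)) = cls2 _ B₂ := by
    rw [inv_cls2]
    refine SameOn.cls_eq ((sameOn_pull_pull _ _ _).trans (sameOn_pull_congr W fun p _ => ?_)) _ _
    ext i
    fin_cases i
    · rfl
    · change (1 - p 1) * (1 / 2) + p 1 * (1 / 2) = 1 / 2
      ring
  rw [e₁, e₂, e₃, mul_cls2 B₂ B₃]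
  have s₂₃ := sameOn_glue_pull W (φ := sq (fun t _ => 1 - lf t + hf (hf t))
    (fun t s => 1 / 2 + lf (hf t) * (s / 2)) f₂₃ g₂₃ mf₂₃ mg₂₃) (B₂.match_zero B₃)
    (fun p _ hp => by
      ext i
      fin_cases i
      · change 1 - lf (p 0) = 1 - lf (p 0) + hf (hf (p 0))
        rw [hf_eq_zero hp, hf_zero, add_zero]
      · change 1 / 2 = 1 / 2 + lf (hf (p 0)) * (p 1 / 2)
        rw [hf_eq_zero hp, lf_zero]
        ring)
    (fun p _ hp => by
      ext i
      fin_cases i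
      · change hf (hf (p 0)) = 1 - lf (p 0) + hf (hf (p 0))
        rw [lf_eq_one hp]
        ring
      · rfl)
  have B₂₃ := (B₂.glue_zero B₃).congr s₂₃
  have B₄ := Bdy.sq hB.1 hB.2 (f := fun t _ => lf (lf t) - lf (hf t) + hf (hf (hf t))) f₄ g₄ mf₄ mg₄
    (fun _ => by simp [lf_zero, hf_zero]) (fun _ => by simp [lf_one, hf_one])
  have B₅ := Bdy.sq hB.1 hB.2 (f := fun t s => (1 - s) * lf (lf t) + s * hf (hf (hf t))) f₅ g₄ mf₅ mg₄
    (fun _ => by simp [lf_zero, hf_zero]) (fun _ => by simp [lf_one, hf_one])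
  have B₆ := Bdy.sq hB.1 hB.2 (f := fun t s => (1 - s) * lf (lf t) + s * hf (hf (hf t))) f₅ fs mf₅ mfs
    (fun _ => by simp [lf_zero, hf_zero]) (fun _ => by simp [lf_one, hf_one])
  have s₁ := sameOn_glue_pull W (φ := sq (fun t _ => lf (lf t) - lf (hf t) + hf (hf (hf t)))
    (fun t s => s / 2 + hf (lf t) * ((1 - s) / 2) + lf (hf (hf t)) * (s / 2)) f₄ g₄ mf₄ mg₄)
    (B₁.match_zero B₂₃)
    (fun p _ hp => by
      ext i
      fin_cases i
      · change lf (lf (p 0)) = lf (lf (p 0)) - lf (hf (p 0)) + hf (hf (hf (p 0)))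
        rw [hf_eq_zero hp, hf_zero, lf_zero, hf_zero]
        ring
      · change p 1 / 2 + hf (lf (p 0)) * ((1 - p 1) / 2)
          = p 1 / 2 + hf (lf (p 0)) * ((1 - p 1) / 2) + lf (hf (hf (p 0))) * (p 1 / 2)
        rw [hf_eq_zero hp, hf_zero, lf_zero]
        ring)
    (fun p _ hp => by
      ext i
      fin_cases i
      · change 1 - lf (hf (p 0)) + hf (hf (hf (p 0)))
          = lf (lf (p 0)) - lf (hf (p 0)) + hf (hf (hf (p 0)))
        rw [lf_eq_one hp, lf_one]
      · change 1 / 2 + lf (hf (hf (p 0))) * (p 1 / 2)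
          = p 1 / 2 + hf (lf (p 0)) * ((1 - p 1) / 2) + lf (hf (hf (p 0))) * (p 1 / 2)
        rw [lf_eq_one hp, hf_one]
        ring)
  rw [s₂₃.cls_eq _ B₂₃, mul_cls2, s₁.cls_eq _ B₄,
    cls2_sq_fst hB.1 hB.2 f₄ f₅ g₄ mf₄ mf₅ mg₄ (fun _ => by simp [lf_zero, hf_zero])
      (fun _ => by simp [lf_one, hf_one]) (fun _ => by simp [lf_zero, hf_zero])
      (fun _ => by simp [lf_one, hf_one]) (fun t _ s hs => ?_) B₄ B₅,
    cls2_sq_snd hB.1 hB.2 f₅ g₄ fs mf₅ mg₄ mfs (fun _ => by simp [lf_zero, hf_zero])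
      (fun _ => by simp [lf_one, hf_one]) (fun t _ s hs => ?_) B₅ B₆,
    cls2_sq_fst hB.1 hB.2 f₅ ft fs mf₅ mft mfs (fun _ => by simp [lf_zero, hf_zero])
      (fun _ => by simp [lf_one, hf_one]) (fun _ => rfl) (fun _ => rfl)
      (fun t _ s hs => Or.inr (Eventually.of_forall fun _ => rfl)) B₆
      (Bdy.sq hB.1 hB.2 (f := fun t _ => t) _ _ _ _ (fun _ => rfl) (fun _ => rfl))]
  · exact SameOn.cls_eq (sameOn_pull_id W fun p _ => by ext i; fin_cases i <;> rfl).symm _ _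
  · rcases hs with rfl | rfl
    · rcases le_total (lf t) (1 / 2) with h | h
      · left
        simp [hf_eq_zero h]
      · right
        filter_upwards [lf_eventually cl.continuousAt h] with r hr
        simp [hr, lf_eq_one h]
    · rcases le_total (hf (hf t)) (1 / 2) with h | h
      · right
        filter_upwards [hf_eventually (ch.comp ch).continuousAt h] with r hr
        simp only [Function.comp_apply] at hr
        simp [hr, hf_eq_zero h]
      · left
        simp [lf_eq_one h]
        norm_num
  · rcases hs with rfl | rfl
    · rcases le_total t (1 / 2) with h | h
      · left
        simp [hf_eq_zero h, hf_zero, lf_zero]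
      · right
        filter_upwards [lf_eventually continuousAt_id h] with r hr
        simp only [id] at hr
        simp [hr, lf_eq_one h]
    · rcases le_total (hf t) (1 / 2) with h | h
      · right
        filter_upwards [hf_eventually ch.continuousAt h] with r hr
        simp [hr, hf_eq_zero h]
      · left
        have ht : 1 / 2 ≤ t := by
          by_contra hlt
          rw [hf_eq_zero (not_le.1 hlt).le] at h
          norm_num at h
        simp [lf_eq_one h, lf_eq_one ht, lf_one]

end Vertical

section VerticalLaws

variable {L : LieAlgebroid EM FA A} {x y z w : M}

/-- The vertical source and target. -/
def P2.src (g : P2 L x y) : P1 L x y :=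
  Quot.lift (fun σ => σ.src.cls) (fun _ _ ⟨_, θ₀, _, h0, _⟩ => Quot.sound ⟨θ₀, h0⟩) g

def P2.tgt (g : P2 L x y) : P1 L x y :=
  Quot.lift (fun σ => σ.tgt.cls) (fun _ _ ⟨_, _, θ₁, _, h1, _⟩ => Quot.sound ⟨θ₁, h1⟩) g

theorem src_cls2 {κ : CubeMorphism L 2} (h : Bdy κ x y) :
    (cls2 κ h).src = cls1 (κ.pull edge₀) h.edge₀ := rfl

theorem tgt_cls2 {κ : CubeMorphism L 2} (h : Bdy κ x y) :
    (cls2 κ h).tgt = cls1 (κ.pull edge₁) h.edge₁ := rfl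

theorem Bdy.drop_one {κ : CubeMorphism L 1} (h : Bdy κ x y) : Bdy (κ.pull (drop 1)) x y :=
  h.pull _ (fun _ hp => hp) (fun _ hp => hp)

/-- The vertical unit. -/
def P1.id (g : P1 L x y) : P2 L x y :=
  Quot.lift (fun a => cls2 (a.mor.pull (drop 1)) a.bdy.drop_one) (fun a a' h => by
    obtain ⟨θ, hB, h0, h1, ht⟩ := thinHomotopic_iff.1 h
    have e : ∀ c (hc : c ∈ Icc (0 : ℝ) 1), SameOn ((θ.pull (drop 1)).pull (face 2 c hc))
        ((θ.pull (face 1 c hc)).pull (drop 1)) := fun c hc =>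
      (sameOn_pull_pull _ _ _).trans ((sameOn_pull_congr θ fun p _ => by
        ext i; fin_cases i <;> rfl).trans (sameOn_pull_pull _ _ _).symm)
    have e' : ∀ c (hc : c ∈ Icc (0 : ℝ) 1), SameOn ((θ.pull (drop 1)).pull (face 1 c hc)) θ :=
      fun c hc => (sameOn_pull_pull _ _ _).trans (sameOn_pull_id θ fun p _ => by
        ext i; fin_cases i <;> rfl)
    exact Homotopic₃.cls_eq ⟨θ.pull (drop 1), hB.pull _ (fun _ hp => hp) (fun _ hp => hp),
      (e 0 _).trans (h0.pull _), (e 1 _).trans (h1.pull _), ht.congr (e' 0 _).symm,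
      ht.congr (e' 1 _).symm⟩ _ _) g

theorem id_cls1 {κ : CubeMorphism L 1} (h : Bdy κ x y) :
    (cls1 κ h).id = cls2 (κ.pull (drop 1)) h.drop_one := rfl

theorem P1.src_id (g : P1 L x y) : g.id.src = g := by
  induction g using P1.ind with | _ κ hB
  exact (drop_one_face zero_mem_I κ).cls1_eq hB.drop_one.edge₀ hB

theorem P1.tgt_id (g : P1 L x y) : g.id.tgt = g := by
  induction g using P1.ind with | _ κ hB
  exact (drop_one_face one_mem_I κ).cls1_eq hB.drop_one.edge₁ hB

theorem P1.id_injective {g h : P1 L x y} (e : g.id = h.id) : g = h := by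
  rw [← g.src_id, e, h.src_id]

/-- The product of paths. -/
def P1.mul (g : P1 L y z) (h : P1 L x y) : P1 L x z := (P2.mul g.id h.id).src

def P1.inv (g : P1 L x y) : P1 L y x := (P2.inv g.id).src

def P1.unit (L : LieAlgebroid EM FA A) (x : M) : P1 L x x := (P2.unit L x).src

theorem mul_cls1 {κ₁ κ₂ : CubeMorphism L 1} (h1 : Bdy κ₁ x y) (h2 : Bdy κ₂ y z) :
    P1.mul (cls1 κ₂ h2) (cls1 κ₁ h1)
      = cls1 (glue 0 κ₁ κ₂ (h1.match_zero h2)) (h1.glue_zero h2) := by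
  refine SameOn.cls1_eq (SameOn.trans (sameOn_pull_glue (i' := 0) _ (fun p => rfl)
    (fun p r => by ext i; fin_cases i <;> rfl) _ (Bdy.match_zero h1.drop_one.edge₀
      h2.drop_one.edge₀)) (SameOn.glue ?_ ?_ _ _)) (h1.drop_one.glue_zero h2.drop_one).edge₀ _
  · exact drop_one_face _ κ₁
  · exact drop_one_face _ κ₂

theorem inv_cls1 {κ : CubeMorphism L 1} (h : Bdy κ x y) :
    P1.inv (cls1 κ h) = cls1 (κ.pull (flip 0)) h.flip :=
  SameOn.cls1_eq ((sameOn_pull_pull _ _ _).trans ((sameOn_pull_pull _ _ _).trans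
    (sameOn_pull_congr κ fun p _ => by ext i; fin_cases i; rfl))) h.drop_one.flip.edge₀ _

theorem unit_eq_cls1 : P1.unit L x = cls1 (unitCube L 1 x) (unitCube_bdy 0 x) :=
  SameOn.cls1_eq (unitCube_pull x _) (unitCube_bdy 1 x).edge₀ _

theorem P1.id_mul (g : P1 L y z) (h : P1 L x y) : (P1.mul g h).id = P2.mul g.id h.id := by
  induction g using P1.ind with | _ κ₂ h2
  induction h using P1.ind with | _ κ₁ h1
  rw [mul_cls1, id_cls1, id_cls1, id_cls1, mul_cls2]
  exact SameOn.cls_eq (sameOn_pull_glue (i' := 0) _ (fun p => rfl)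
    (fun p r => by ext i; fin_cases i; rfl) _ (Bdy.match_zero h1.drop_one h2.drop_one)) _ _

theorem P1.id_inv (g : P1 L x y) : (P1.inv g).id = P2.inv g.id := by
  induction g using P1.ind with | _ κ h
  rw [inv_cls1, id_cls1, id_cls1, inv_cls2]
  exact SameOn.cls_eq ((sameOn_pull_pull _ _ _).trans ((sameOn_pull_congr κ fun p _ => by
    ext i; fin_cases i; rfl).trans (sameOn_pull_pull _ _ _).symm)) _ _

theorem P1.id_unit : (P1.unit L x).id = P2.unit L x := by
  rw [unit_eq_cls1, id_cls1, P2.unit]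
  exact SameOn.cls_eq (unitCube_pull x _) _ _

theorem P2.src_mul (g : P2 L y z) (h : P2 L x y) : (P2.mul g h).src = P1.mul g.src h.src := by
  induction g using P2.ind with | _ κ₂ h2
  induction h using P2.ind with | _ κ₁ h1
  rw [mul_cls2, src_cls2, src_cls2, src_cls2, mul_cls1]
  exact SameOn.cls1_eq (sameOn_pull_glue (i' := 0) _ (fun p => rfl)
    (fun p r => by ext i; fin_cases i <;> rfl) _ _) _ _

theorem P2.tgt_mul (g : P2 L y z) (h : P2 L x y) : (P2.mul g h).tgt = P1.mul g.tgt h.tgt := by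
  induction g using P2.ind with | _ κ₂ h2
  induction h using P2.ind with | _ κ₁ h1
  rw [mul_cls2, tgt_cls2, tgt_cls2, tgt_cls2, mul_cls1]
  exact SameOn.cls1_eq (sameOn_pull_glue (i' := 0) _ (fun p => rfl)
    (fun p r => by ext i; fin_cases i <;> rfl) _ _) _ _

theorem P2.src_inv (g : P2 L x y) : (P2.inv g).src = P1.inv g.src := by
  induction g using P2.ind with | _ κ h
  rw [inv_cls2, src_cls2, src_cls2, inv_cls1]
  exact SameOn.cls1_eq ((sameOn_pull_pull _ _ _).trans ((sameOn_pull_congr κ fun p _ => by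
    ext i; fin_cases i <;> rfl).trans (sameOn_pull_pull _ _ _).symm)) _ _

theorem P2.tgt_inv (g : P2 L x y) : (P2.inv g).tgt = P1.inv g.tgt := by
  induction g using P2.ind with | _ κ h
  rw [inv_cls2, tgt_cls2, tgt_cls2, inv_cls1]
  exact SameOn.cls1_eq ((sameOn_pull_pull _ _ _).trans ((sameOn_pull_congr κ fun p _ => by
    ext i; fin_cases i <;> rfl).trans (sameOn_pull_pull _ _ _).symm)) _ _

/-! Groupoid calculus. -/

theorem P2.inv_mul_cancel_left (g : P2 L y z) (h : P2 L x y) : P2.mul (P2.inv g) (P2.mul g h) = h := by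
  rw [← P2.mul_assoc, P2.inv_mul, P2.unit_mul]

theorem P2.mul_inv_cancel_left (g : P2 L z y) (h : P2 L x y) : P2.mul g (P2.mul (P2.inv g) h) = h := by
  rw [← P2.mul_assoc, P2.mul_inv, P2.unit_mul]

theorem P2.inv_unique {g : P2 L y x} {h : P2 L x y} (e : P2.mul g h = P2.unit L x) :
    g = P2.inv h := by
  rw [← P2.mul_unit g, ← P2.mul_inv h, ← P2.mul_assoc, e, P2.unit_mul]

theorem P2.mul_inv_rev (g : P2 L y z) (h : P2 L x y) :
    P2.inv (P2.mul g h) = P2.mul (P2.inv h) (P2.inv g) := by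
  refine (P2.inv_unique ?_).symm
  rw [P2.mul_assoc, P2.inv_mul_cancel_left, P2.inv_mul]

theorem P1.mul_assoc (g₃ : P1 L z w) (g₂ : P1 L y z) (g₁ : P1 L x y) :
    P1.mul (P1.mul g₃ g₂) g₁ = P1.mul g₃ (P1.mul g₂ g₁) :=
  P1.id_injective (by simp only [P1.id_mul, P2.mul_assoc])

theorem P1.unit_mul (g : P1 L x y) : P1.mul (P1.unit L y) g = g :=
  P1.id_injective (by rw [P1.id_mul, P1.id_unit, P2.unit_mul])

theorem P1.mul_unit (g : P1 L x y) : P1.mul g (P1.unit L x) = g :=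
  P1.id_injective (by rw [P1.id_mul, P1.id_unit, P2.mul_unit])

theorem P1.inv_mul (g : P1 L x y) : P1.mul (P1.inv g) g = P1.unit L x :=
  P1.id_injective (by rw [P1.id_mul, P1.id_unit, P1.id_inv, P2.inv_mul])

theorem P1.mul_inv (g : P1 L x y) : P1.mul g (P1.inv g) = P1.unit L y :=
  P1.id_injective (by rw [P1.id_mul, P1.id_unit, P1.id_inv, P2.mul_inv])

/-- The vertical product `g • h` (first `h`), for `src g = tgt h`. -/
def P2.vmul (g h : P2 L x y) : P2 L x y := P2.mul g (P2.mul (P2.inv h.tgt.id) h)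

/-- The vertical inverse. -/
def P2.vinv (g : P2 L x y) : P2 L x y := P2.mul g.src.id (P2.mul (P2.inv g) g.tgt.id)

theorem P2.src_vmul {g h : P2 L x y} (e : g.src = h.tgt) : (P2.vmul g h).src = h.src := by
  rw [P2.vmul, P2.src_mul, P2.src_mul, P2.src_inv, P1.src_id, e, ← P1.mul_assoc, P1.mul_inv,
    P1.unit_mul]

theorem P2.tgt_vmul (g h : P2 L x y) : (P2.vmul g h).tgt = g.tgt := by
  rw [P2.vmul, P2.tgt_mul, P2.tgt_mul, P2.tgt_inv, P1.tgt_id, P1.inv_mul, P1.mul_unit]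

theorem P2.src_vinv (g : P2 L x y) : (P2.vinv g).src = g.tgt := by
  rw [P2.vinv, P2.src_mul, P2.src_mul, P2.src_inv, P1.src_id, P1.src_id, ← P1.mul_assoc, P1.mul_inv,
    P1.unit_mul]

theorem P2.tgt_vinv (g : P2 L x y) : (P2.vinv g).tgt = g.src := by
  rw [P2.vinv, P2.tgt_mul, P2.tgt_mul, P2.tgt_inv, P1.tgt_id, P1.tgt_id, P1.inv_mul, P1.mul_unit]

theorem P2.vmul_assoc (g₃ g₂ g₁ : P2 L x y) :
    P2.vmul (P2.vmul g₃ g₂) g₁ = P2.vmul g₃ (P2.vmul g₂ g₁) := by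
  rw [P2.vmul, P2.vmul, P2.vmul, P2.tgt_vmul, P2.vmul]
  simp only [P2.mul_assoc]

theorem P2.id_vmul (g : P2 L x y) : P2.vmul g.tgt.id g = g := by
  rw [P2.vmul, P2.mul_inv_cancel_left]

theorem P2.vmul_id (g : P2 L x y) : P2.vmul g g.src.id = g := by
  rw [P2.vmul, P1.tgt_id, P2.inv_mul, P2.mul_unit]

theorem P2.vinv_vmul (g : P2 L x y) : P2.vmul (P2.vinv g) g = g.src.id := by
  simp only [P2.vmul, P2.vinv, P2.mul_assoc, P2.mul_inv_cancel_left, P2.inv_mul, P2.mul_unit]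

theorem P2.vmul_vinv (g : P2 L x y) : P2.vmul g (P2.vinv g) = g.tgt.id := by
  rw [P2.vmul, P2.tgt_vinv, P2.vinv, P2.inv_mul_cancel_left, P2.mul_inv_cancel_left]

theorem id_tgt_aff {W : CubeMorphism L 2} (hB : Bdy W x y) {a b : ℝ} (ha : a ∈ Icc (0 : ℝ) 1)
    (hb : b ∈ Icc (0 : ℝ) 1) : (cls2 (W.pull (aff 1 ha hb)) (hB.aff_one ha hb)).tgt.id
      = cls2 (W.pull (aff 1 hb hb)) (hB.aff_one _ _) := by
  rw [tgt_cls2, id_cls1]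
  refine SameOn.cls_eq ((sameOn_pull_pull _ _ _).trans ((sameOn_pull_pull _ _ _).trans
    (sameOn_pull_congr W fun p _ => ?_))) _ _
  ext i
  fin_cases i
  · rfl
  · change (1 - 1) * a + 1 * b = (1 - p 1) * b + p 1 * b
    ring

theorem id_src_cls2 {W : CubeMorphism L 2} (hB : Bdy W x y) :
    (cls2 W hB).src.id = cls2 (W.pull (aff 1 zero_mem_I zero_mem_I)) (hB.aff_one _ _) := by
  rw [src_cls2, id_cls1]
  refine SameOn.cls_eq ((sameOn_pull_pull _ _ _).trans (sameOn_pull_congr W fun p _ => ?_)) _ _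
  ext i
  fin_cases i
  · rfl
  · change 0 = (1 - p 1) * 0 + p 1 * 0
    ring

theorem id_tgt_cls2 {W : CubeMorphism L 2} (hB : Bdy W x y) :
    (cls2 W hB).tgt.id = cls2 (W.pull (aff 1 one_mem_I one_mem_I)) (hB.aff_one _ _) := by
  rw [tgt_cls2, id_cls1]
  refine SameOn.cls_eq ((sameOn_pull_pull _ _ _).trans (sameOn_pull_congr W fun p _ => ?_)) _ _
  ext i
  fin_cases i
  · rfl
  · change 1 = (1 - p 1) * 1 + p 1 * 1
    ring

theorem cls2_eq_vmul {W : CubeMorphism L 2} (hB : Bdy W x y) :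
    cls2 W hB = P2.vmul (cls2 (W.pull (aff 1 half_mem_I one_mem_I)) (hB.aff_one _ _))
      (cls2 (W.pull (aff 1 zero_mem_I half_mem_I)) (hB.aff_one _ _)) := by
  rw [P2.vmul, id_tgt_aff hB, ← P2.mul_assoc]
  exact cls2_vsplit hB

theorem cls2_reparam_one_id {W : CubeMorphism L 2} (h : Bdy W x y) {f : ℝ → ℝ}
    (hf : ContDiff ℝ ∞ f) (hmf : ∀ t ∈ Icc (0 : ℝ) 1, f t ∈ Icc (0 : ℝ) 1) (e0 : f 0 = 0)
    (e1 : f 1 = 1) : cls2 (W.pull (reparam 1 f hf hmf)) (h.reparam_one _ _) = cls2 W h := by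
  rw [cls2_reparam_one h hf contDiff_id hmf (fun _ h => h) e0 e1 _ (h.reparam_one _ _)]
  exact (sameOn_pull_id _ fun p _ => by simp [reparam_apply]).cls_eq _ _

theorem sameOn_reparam_aff {W : CubeMorphism L 2} {f g : ℝ → ℝ} (hf : ContDiff ℝ ∞ f)
    (hmf : ∀ t ∈ Icc (0 : ℝ) 1, f t ∈ Icc (0 : ℝ) 1) {a b : ℝ} (ha : a ∈ Icc (0 : ℝ) 1)
    (hb : b ∈ Icc (0 : ℝ) 1) (hg : ContDiff ℝ ∞ g) (hmg : ∀ t ∈ Icc (0 : ℝ) 1, g t ∈ Icc (0 : ℝ) 1)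
    (h : ∀ t ∈ Icc (0 : ℝ) 1, f ((1 - t) * a + t * b) = g t) :
    SameOn ((W.pull (reparam 1 f hf hmf)).pull (aff 1 ha hb)) (W.pull (reparam 1 g hg hmg)) := by
  refine (sameOn_pull_pull _ _ _).trans (sameOn_pull_congr W fun p hp => ?_)
  change reparam 1 f hf hmf (aff 1 ha hb p) = _
  rw [aff_apply, reparam_apply, reparam_apply, Function.update_self, Function.update_idem,
    h _ (mem_cube.1 hp 1)]

theorem exists_shift (g : P2 L y z) (h : P2 L x y) :
    ∃ (W : CubeMorphism L 2) (hB : Bdy W x z), cls2 W hB = P2.mul g h ∧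
      cls2 (W.pull (aff 1 half_mem_I one_mem_I)) (hB.aff_one _ _) = P2.mul g.tgt.id h ∧
      cls2 (W.pull (aff 1 zero_mem_I half_mem_I)) (hB.aff_one _ _) = P2.mul g h.src.id := by
  induction g using P2.ind with | _ κ₂ h2
  induction h using P2.ind with | _ κ₁ h1
  rw [id_src_cls2, id_tgt_cls2]
  have key : ∀ {a b : ℝ} (ha : a ∈ Icc (0 : ℝ) 1) (hb : b ∈ Icc (0 : ℝ) 1),
      SameOn ((glue 0 (κ₁.pull (reparam 1 hf contDiff_hf fun t _ => hf_mem t))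
        (κ₂.pull (reparam 1 lf contDiff_lf fun t _ => lf_mem t))
        ((h1.reparam_one _ _).match_zero (h2.reparam_one _ _))).pull (aff 1 ha hb))
        (glue 0 ((κ₁.pull (reparam 1 hf contDiff_hf fun t _ => hf_mem t)).pull (aff 1 ha hb))
          ((κ₂.pull (reparam 1 lf contDiff_lf fun t _ => lf_mem t)).pull (aff 1 ha hb))
          (((h1.reparam_one _ _).aff_one ha hb).match_zero ((h2.reparam_one _ _).aff_one ha hb))) :=
    fun ha hb => sameOn_pull_glue _ (fun p => rfl) (fun p r => by ext i; fin_cases i <;> rfl) _ _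
  have hl : ContDiff ℝ ∞ fun t : ℝ => lf ((1 - t) * 0 + t * (1 / 2)) := by fun_prop
  have hh : ContDiff ℝ ∞ fun t : ℝ => hf ((1 - t) * (1 / 2) + t * 1) := by fun_prop
  refine ⟨_, (h1.reparam_one contDiff_hf fun t _ => hf_mem t).glue_zero
    (h2.reparam_one contDiff_lf fun t _ => lf_mem t), ?_, ?_, ?_⟩
  · rw [← mul_cls2 (h1.reparam_one _ _) (h2.reparam_one _ _), cls2_reparam_one_id h1 _ _ hf_zero hf_one,
      cls2_reparam_one_id h2 _ _ lf_zero lf_one]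
  · rw [(key half_mem_I one_mem_I).cls_eq _ (((h1.reparam_one _ _).aff_one _ _).glue_zero
      ((h2.reparam_one _ _).aff_one _ _)),
      ← mul_cls2 ((h1.reparam_one _ _).aff_one _ _) ((h2.reparam_one _ _).aff_one _ _)]
    congr 1
    · refine SameOn.cls_eq ((sameOn_pull_pull _ _ _).trans (sameOn_pull_congr _ fun p hp => ?_)) _ _
      change reparam 1 lf contDiff_lf (fun t _ => lf_mem t) (aff 1 half_mem_I one_mem_I p) = aff 1 one_mem_I one_mem_I p
      have := mem_cube.1 hp 1
      rw [aff_apply, reparam_apply, aff_apply, Function.update_self, Function.update_idem,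
        lf_eq_one (by linarith [this.1])]
      congr 1
      ring
    · rw [(sameOn_reparam_aff _ _ _ _ hh (fun t _ => hf_mem _) fun t _ => rfl).cls_eq _
        (h1.reparam_one _ _)]
      exact cls2_reparam_one_id h1 _ _ (hf_eq_zero (by norm_num)) (by simp [hf_one])
  · rw [(key zero_mem_I half_mem_I).cls_eq _ (((h1.reparam_one _ _).aff_one _ _).glue_zero
      ((h2.reparam_one _ _).aff_one _ _)),
      ← mul_cls2 ((h1.reparam_one _ _).aff_one _ _) ((h2.reparam_one _ _).aff_one _ _)]
    congr 1
    · rw [(sameOn_reparam_aff _ _ _ _ hl (fun t _ => lf_mem _) fun t _ => rfl).cls_eq _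
        (h2.reparam_one _ _)]
      exact cls2_reparam_one_id h2 _ _ (by simp [lf_zero]) (lf_eq_one (by norm_num))
    · refine SameOn.cls_eq ((sameOn_pull_pull _ _ _).trans (sameOn_pull_congr _ fun p hp => ?_)) _ _
      change reparam 1 hf contDiff_hf (fun t _ => hf_mem t) (aff 1 zero_mem_I half_mem_I p)
        = aff 1 zero_mem_I zero_mem_I p
      have := mem_cube.1 hp 1
      rw [aff_apply, reparam_apply, aff_apply, Function.update_self, Function.update_idem,
        hf_eq_zero (by linarith [this.2])]
      congr 1
      ring

theorem P2.mul_eq_shift (g : P2 L y z) (h : P2 L x y) :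
    P2.mul g h = P2.vmul (P2.mul g.tgt.id h) (P2.mul g h.src.id) := by
  obtain ⟨W, hB, e, e1, e0⟩ := exists_shift g h
  rw [← e, cls2_eq_vmul, e1, e0]

theorem P2.interchange (g₄ g₃ : P2 L y z) (g₂ g₁ : P2 L x y) (h : g₂.src = g₁.tgt) :
    P2.mul (P2.vmul g₄ g₃) (P2.vmul g₂ g₁) = P2.vmul (P2.mul g₄ g₂) (P2.mul g₃ g₁) := by
  have e := P2.mul_eq_shift g₃ g₂
  simp only [P2.vmul, P2.tgt_mul, P1.tgt_id, P1.id_mul, P2.mul_inv_rev, P2.mul_assoc] at e ⊢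
  rw [← P2.mul_assoc g₃, e]
  simp only [P2.mul_assoc, P2.inv_mul_cancel_left, h, P2.mul_inv_cancel_left]

end VerticalLaws

/-! ### Classes of concatenations, units and inverses -/

section Representatives

variable {L : LieAlgebroid EM FA A} {x y z w : M}

theorem scale_one (p : TotalSpace FA A) : scale 1 p = p := by
  cases p
  simp [scale]

theorem scale_scale (r s : ℝ) (p : TotalSpace FA A) : scale r (scale s p) = scale (r * s) p := by
  exact congrArg (TotalSpace.mk p.proj) (smul_smul r s p.snd)

theorem pull_reparam_comp {n : ℕ} (κ : CubeMorphism L n) (i j : Fin n) (f : ℝ → ℝ)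
    (hf : ContDiff ℝ ∞ f) (hm : ∀ t ∈ Icc (0 : ℝ) 1, f t ∈ Icc (0 : ℝ) 1) (p : Fin n → ℝ) :
    (κ.pull (reparam i f hf hm)).comp j p
      = scale (if j = i then deriv f (p i) else 1) (κ.comp j (Function.update p i (f (p i)))) := by
  rw [CubeMorphism.comp_eq_jet, CubeMorphism.comp_eq_jet, CubeMorphism.pull_jet, reparam_apply]
  simp only [pd_reparam]
  obtain ⟨x, v⟩ := κ.jet (Function.update p i (f (p i)))
  refine congrArg (TotalSpace.mk x) ?_
  change ∑ k, (if j = k then (if j = i then deriv f (p i) else 1) else 0) • v k = _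
  rw [Finset.sum_eq_single j (by simp +contextual [eq_comm]) (by simp)]
  simp only [if_true]
  rfl

theorem pull_flip_comp {n : ℕ} (κ : CubeMorphism L n) (i j : Fin n) (p : Fin n → ℝ) :
    (κ.pull (flip i)).comp j p
      = scale (if j = i then -1 else 1) (κ.comp j (Function.update p i (1 - p i))) := by
  refine (pull_reparam_comp κ i j (fun t => 1 - t) (by fun_prop) _ p).trans ?_
  congr 2
  simp

theorem pull_aff_comp {n : ℕ} (κ : CubeMorphism L n) (i j : Fin n) {a b : ℝ}
    (ha : a ∈ Icc (0 : ℝ) 1) (hb : b ∈ Icc (0 : ℝ) 1) (p : Fin n → ℝ) :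
    (κ.pull (aff i ha hb)).comp j p
      = scale (if j = i then b - a else 1)
        (κ.comp j (Function.update p i ((1 - p i) * a + p i * b))) := by
  rw [aff, pull_reparam_comp]
  congr 2
  have : HasDerivAt (fun t : ℝ => (1 - t) * a + t * b) (b - a) (p i) :=
    ((((hasDerivAt_id (p i)).const_sub 1).mul_const a).add
      ((hasDerivAt_id (p i)).mul_const b)).congr_deriv (by ring)
  rw [this.deriv]

theorem pull_drop_one_comp_zero (κ : CubeMorphism L 1) (p : Fin 2 → ℝ) :
    (κ.pull (drop 1)).comp 0 p = κ.comp 0 ![p 0] := by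
  have h : (drop 1 : CubeMap 2 1).pd 0 0 p = 1 :=
    CubeMap.pd_eq_of_hasDerivAt _ _ _ _ (hasDerivAt_id (p 0))
  have e : (drop 1 : CubeMap 2 1) p = ![p 0] := eq_vec1 _
  rw [CubeMorphism.comp_eq_jet, CubeMorphism.comp_eq_jet, CubeMorphism.pull_jet, e]
  obtain ⟨x, v⟩ := κ.jet ![p 0]
  refine congrArg (TotalSpace.mk x) ?_
  change ∑ k, (drop 1 : CubeMap 2 1).pd 0 k p • v k = v 0
  rw [Fin.sum_univ_one, h, one_smul]

theorem pull_drop_one_comp_one (κ : CubeMorphism L 1) (p : Fin 2 → ℝ) :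
    (κ.pull (drop 1)).comp 1 p = scale 0 (κ.comp 0 ![p 0]) := by
  have h : (drop 1 : CubeMap 2 1).pd 1 0 p = 0 :=
    CubeMap.pd_eq_zero _ _ _ _ fun r => rfl
  have e : (drop 1 : CubeMap 2 1) p = ![p 0] := eq_vec1 _
  rw [CubeMorphism.comp_eq_jet, CubeMorphism.comp_eq_jet, CubeMorphism.pull_jet, e]
  obtain ⟨x, v⟩ := κ.jet ![p 0]
  refine congrArg (TotalSpace.mk x) ?_
  change ∑ k, (drop 1 : CubeMap 2 1).pd 1 k p • v k = (0 : ℝ) • v 0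
  rw [Fin.sum_univ_one, h]

theorem sameOn_one_iff {κ κ' : CubeMorphism L 1} :
    SameOn κ κ' ↔ ∀ t ∈ Icc (0 : ℝ) 1, κ.comp 0 ![t] = κ'.comp 0 ![t] := by
  constructor
  · intro h t ht
    rw [CubeMorphism.comp_eq_jet, h _ (vec1_mem_cube ht)]
    rfl
  · intro h p hp
    refine CubeMorphism.jet_ext_of_comp fun i => ?_
    obtain rfl : i = 0 := Fin.eq_zero i
    rw [eq_vec1 p]
    exact h _ (mem_cube.1 hp 0)

theorem sameOn_two_of {κ κ' : CubeMorphism L 2}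
    (h : ∀ t ∈ Icc (0 : ℝ) 1, ∀ s ∈ Icc (0 : ℝ) 1,
      κ.comp 0 ![t, s] = κ'.comp 0 ![t, s] ∧ κ.comp 1 ![t, s] = κ'.comp 1 ![t, s]) :
    SameOn κ κ' := fun p hp => by
  refine CubeMorphism.jet_ext_of_comp fun i => ?_
  rw [eq_vec2 p]
  fin_cases i
  · exact (h _ (mem_cube.1 hp 0) _ (mem_cube.1 hp 1)).1
  · exact (h _ (mem_cube.1 hp 0) _ (mem_cube.1 hp 1)).2

theorem update_vec1 (t r : ℝ) : Function.update ![t] 0 r = ![r] := by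
  ext i; fin_cases i; rfl

theorem update_vec2_zero (t s r : ℝ) : Function.update ![t, s] 0 r = ![r, s] := by
  ext i; fin_cases i <;> rfl

theorem update_vec2_one (t s r : ℝ) : Function.update ![t, s] 1 r = ![t, r] := by
  ext i; fin_cases i <;> rfl

theorem IsUnitPath.cls_eq {a : APath L x x} (h : IsUnitPath a) : a.cls = P1.unit L x := by
  rw [unit_eq_cls1]
  exact SameOn.cls1_eq (κ := a.mor) (κ' := unitCube L 1 x) (sameOn_one_iff.2 h) a.bdy _

theorem IsInvPath.cls_eq {a : APath L x y} {a' : APath L y x} (h : IsInvPath a a') :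
    a'.cls = P1.inv a.cls := by
  change cls1 a'.mor a'.bdy = P1.inv (cls1 a.mor a.bdy)
  rw [inv_cls1]
  refine SameOn.cls1_eq (sameOn_one_iff.2 fun t ht => ?_) _ _
  rw [pull_flip_comp, update_vec1]
  exact h t ht

theorem mem_left_half {t : ℝ} (ht : t ∈ Icc (0 : ℝ) 1) :
    (1 - t) * 0 + t * (1 / 2) ∈ Icc (0 : ℝ) (1 / 2) :=
  ⟨by linarith [ht.1], by linarith [ht.2]⟩

theorem mem_right_half {t : ℝ} (ht : t ∈ Icc (0 : ℝ) 1) :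
    (1 - t) * (1 / 2) + t * 1 ∈ Icc (1 / 2 : ℝ) 1 :=
  ⟨by linarith [ht.1], by linarith [ht.2]⟩

theorem IsHorizConcat.cls_eq {a₀ a₁ : APath L x y} {a₀' a₁' : APath L y z} {c₀ c₁ : APath L x z}
    {σ' : AHomotopy a₀' a₁'} {σ : AHomotopy a₀ a₁} {ρ : AHomotopy c₀ c₁}
    (h : IsHorizConcat σ' σ ρ) : ρ.cls = P2.mul σ'.cls σ.cls := by
  have e1 : SameOn (ρ.mor.pull (aff 0 zero_mem_I half_mem_I)) σ.mor := by
    refine sameOn_two_of fun t ht s hs => ?_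
    have := h.1 _ (mem_left_half ht) s hs
    rw [pull_aff_comp, pull_aff_comp, update_vec2_zero]
    simp only [if_true, if_neg (show (1 : Fin 2) ≠ 0 by simp)]
    have e : 2 * ((1 - t) * 0 + t * (1 / 2)) = t := by ring
    rw [e] at this
    refine ⟨(congrArg _ this.1).trans ?_, (congrArg _ this.2).trans (scale_one _)⟩
    rw [scale_scale]
    norm_num
    exact scale_one _
  have e2 : SameOn (ρ.mor.pull (aff 0 half_mem_I one_mem_I)) σ'.mor := by
    refine sameOn_two_of fun t ht s hs => ?_
    have := h.2 _ (mem_right_half ht) s hs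
    rw [pull_aff_comp, pull_aff_comp, update_vec2_zero]
    simp only [if_true, if_neg (show (1 : Fin 2) ≠ 0 by simp)]
    have e : 2 * ((1 - t) * (1 / 2) + t * 1) - 1 = t := by ring
    rw [e] at this
    refine ⟨(congrArg _ this.1).trans ?_, (congrArg _ this.2).trans (scale_one _)⟩
    rw [scale_scale]
    norm_num
    exact scale_one _
  have hy : BdyAt ρ.mor (1 / 2) y := by
    intro p hp h0
    refine jetErase_eq_iff.2 ?_
    have hs := mem_cube.1 hp 1
    have hm : (1 / 2 : ℝ) ∈ Icc (0 : ℝ) (1 / 2) := ⟨by norm_num, le_rfl⟩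
    have h2 := (h.1 _ hm _ hs).2
    have hb : σ.b (2 * (1 / 2)) (p 1) = ⟨y, 0⟩ := by
      have hq := vec2_mem_cube one_mem_I hs
      rw [show (2 * (1 / 2) : ℝ) = 1 by norm_num]
      have hv := jetErase_eq_iff.1 (σ.bdy.2 _ hq rfl)
      have h3 := hv.2 1 (by simp)
      rw [AHomotopy.b, CubeMorphism.comp_eq_jet]
      revert hv h3
      obtain ⟨x', v⟩ := σ.mor.jet ![1, p 1]
      rintro ⟨rfl, -⟩ h3
      exact congrArg _ h3
    rw [hb] at h2
    have hp' : p = ![1 / 2, p 1] := by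
      rw [← h0]
      exact eq_vec2 p
    rw [AHomotopy.b, ← hp', CubeMorphism.comp_eq_jet] at h2
    refine ⟨congrArg TotalSpace.proj h2, fun k hk => ?_⟩
    obtain rfl : k = 1 := by revert k; decide
    revert h2
    obtain ⟨x', v⟩ := ρ.mor.jet p
    intro h2
    obtain rfl : x' = y := congrArg TotalSpace.proj h2
    exact TotalSpace.mk_injective _ h2
  rw [ρ.cls_eq, σ.cls_eq, σ'.cls_eq, cls2_split half_mem_I ρ.bdy hy]
  exact congrArg₂ P2.mul (e2.cls_eq _ _) (e1.cls_eq _ _)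

theorem IsVertUnit.cls_eq {a : APath L x y} {θ : AHomotopy a a} (h : IsVertUnit a θ) :
    θ.cls = a.cls.id := by
  rw [θ.cls_eq]
  refine SameOn.cls_eq (sameOn_two_of fun t ht s hs => ?_) _ a.bdy.drop_one
  rw [pull_drop_one_comp_zero, pull_drop_one_comp_one]
  exact h t ht s hs

/-- The vertical unit homotopy at a path. -/
def APath.one (a : APath L x y) : AHomotopy a a :=
  toHomotopy (a.mor.pull (drop 1)) a.bdy.drop_one (drop_one_face _ _) (drop_one_face _ _)

theorem APath.one_cls (a : APath L x y) : a.one.cls = a.cls.id := a.one.cls_eq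

theorem APath.one_a (a : APath L x y) (t s : ℝ) : a.one.a t s = a.curve t :=
  pull_drop_one_comp_zero _ _

theorem APath.one_b (a : APath L x y) (t s : ℝ) : a.one.b t s = scale 0 (a.curve t) :=
  pull_drop_one_comp_one _ _

theorem IsConcat.cls_eq {b : APath L y z} {a : APath L x y} {c : APath L x z} (h : IsConcat b a c) :
    c.cls = P1.mul b.cls a.cls := by
  apply P1.id_injective
  rw [P1.id_mul, ← APath.one_cls, ← APath.one_cls, ← APath.one_cls]
  refine IsHorizConcat.cls_eq ⟨fun t ht s hs => ?_, fun t ht s hs => ?_⟩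
  · simp only [APath.one_a, APath.one_b, h.1 t ht, scale_scale, zero_mul, and_self]
  · simp only [APath.one_a, APath.one_b, h.2 t ht, scale_scale, zero_mul, and_self]

theorem IsHorizUnit.cls_eq {a₀ a₁ : APath L x x} {θ : AHomotopy a₀ a₁} (h : IsHorizUnit θ) :
    θ.cls = P2.unit L x := by
  rw [θ.cls_eq]
  exact SameOn.cls_eq (κ := θ.mor) (κ' := unitCube L 2 x) (sameOn_two_of h) _ _

theorem IsHorizInv.cls_eq {a₀ a₁ : APath L x y} {a₀' a₁' : APath L y x}
    {σ : AHomotopy a₀ a₁} {σ' : AHomotopy a₀' a₁'} (h : IsHorizInv σ σ') :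
    σ'.cls = P2.inv σ.cls := by
  rw [σ.cls_eq, σ'.cls_eq, inv_cls2]
  refine SameOn.cls_eq (sameOn_two_of fun t ht s hs => ?_) _ _
  rw [pull_flip_comp, pull_flip_comp, update_vec2_zero]
  exact ⟨(h t ht s hs).1, (h t ht s hs).2.trans (scale_one _).symm⟩

theorem IsVertConcat.cls_eq {a₀ a₁ a₂ : APath L x y} {σ' : AHomotopy a₁ a₂} {σ : AHomotopy a₀ a₁}
    {ρ : AHomotopy a₀ a₂} (h : IsVertConcat σ' σ ρ) : ρ.cls = P2.vmul σ'.cls σ.cls := by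
  rw [ρ.cls_eq, σ.cls_eq, σ'.cls_eq, cls2_eq_vmul]
  refine congrArg₂ P2.vmul (SameOn.cls_eq (sameOn_two_of fun t ht s hs => ?_) _ _)
    (SameOn.cls_eq (sameOn_two_of fun t ht s hs => ?_) _ _)
  · have := h.2 t ht _ (mem_right_half hs)
    rw [pull_aff_comp, pull_aff_comp, update_vec2_one]
    simp only [if_true, if_neg (show (0 : Fin 2) ≠ 1 by simp)]
    rw [show 2 * ((1 - s) * (1 / 2) + s * 1) - 1 = s by ring] at this
    refine ⟨(congrArg _ this.1).trans (scale_one _), (congrArg _ this.2).trans ?_⟩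
    rw [scale_scale]
    norm_num
    exact scale_one _
  · have := h.1 t ht _ (mem_left_half hs)
    rw [pull_aff_comp, pull_aff_comp, update_vec2_one]
    simp only [if_true, if_neg (show (0 : Fin 2) ≠ 1 by simp)]
    rw [show 2 * ((1 - s) * 0 + s * (1 / 2)) = s by ring] at this
    refine ⟨(congrArg _ this.1).trans (scale_one _), (congrArg _ this.2).trans ?_⟩
    rw [scale_scale]
    norm_num
    exact scale_one _

theorem vinv_cls2 {κ : CubeMorphism L 2} (hB : Bdy κ x y) :
    P2.vinv (cls2 κ hB) = cls2 (κ.pull (flip 1)) (hB.reparam_one _ _) := by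
  have hl : ContDiff ℝ ∞ fun s : ℝ => lf (s / 2) := by fun_prop
  have hh : ContDiff ℝ ∞ fun s : ℝ => 1 - hf (1 / 2 + s / 2) := by fun_prop
  have hW := cls2_eq_vmul (hB.reparam_one contDiff_cut_sub fun _ _ => cut_sub_mem _)
  have e1 : cls2 _ ((hB.reparam_one contDiff_cut_sub fun _ _ => cut_sub_mem _).aff_one
      zero_mem_I half_mem_I) = cls2 κ hB := by
    rw [← cls2_reparam_one_id hB hl (fun _ _ => lf_mem _) (by simp [lf_zero])
      (lf_eq_one (by norm_num))]
    refine SameOn.cls_eq (sameOn_reparam_aff _ _ _ _ hl _ fun s hs => ?_) _ _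
    rw [cut_eq_zero (t := 2 * ((1 - s) * 0 + s * (1 / 2)) - 1) (by linarith [hs.2]), lf]
    ring_nf
  have e2 : cls2 _ ((hB.reparam_one contDiff_cut_sub fun _ _ => cut_sub_mem _).aff_one
      half_mem_I one_mem_I) = cls2 (κ.pull (flip 1)) (hB.reparam_one _ _) := by
    have hm : ∀ s ∈ Icc (0 : ℝ) 1, 1 - hf (1 / 2 + s / 2) ∈ Icc (0 : ℝ) 1 := fun s _ =>
      ⟨by linarith [(hf_mem (1 / 2 + s / 2)).2], by linarith [(hf_mem (1 / 2 + s / 2)).1]⟩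
    refine Eq.trans (SameOn.cls_eq (sameOn_reparam_aff _ _ _ _ hh hm fun s hs => ?_) _
      (hB.reparam_one _ _)) (cls2_reparam_one hB _ _ _ _ ?_ ?_ _ _)
    · rw [cut_eq_one (t := 2 * ((1 - s) * (1 / 2) + s * 1)) (by linarith [hs.1]), hf]
      ring_nf
    · rw [hf_eq_zero (by norm_num)]
    · rw [show (1 / 2 + 1 / 2 : ℝ) = 1 by norm_num, hf_one]
  have e3 : cls2 _ (hB.reparam_one contDiff_cut_sub fun _ _ => cut_sub_mem _)
      = (cls2 κ hB).src.id := by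
    rw [id_src_cls2]
    refine cls2_reparam_one hB _ _ _ _ ?_ ?_ _ _
    · rw [cut_eq_zero (by norm_num), cut_eq_zero (by norm_num)]
      ring
    · rw [cut_eq_one (by norm_num), cut_eq_one (by norm_num)]
      ring
  rw [e1, e2, e3, P2.vmul] at hW
  rw [P2.vinv, hW, P2.mul_assoc, P2.mul_assoc, P2.mul_inv_cancel_left, P2.inv_mul, P2.mul_unit]

theorem IsVertInv.cls_eq {a₀ a₁ : APath L x y} {σ : AHomotopy a₀ a₁} {σ' : AHomotopy a₁ a₀}
    (h : IsVertInv σ σ') : σ'.cls = P2.vinv σ.cls := by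
  rw [σ.cls_eq, σ'.cls_eq, vinv_cls2]
  refine SameOn.cls_eq (sameOn_two_of fun t ht s hs => ?_) _ _
  rw [pull_flip_comp, pull_flip_comp, update_vec2_one]
  exact ⟨(h t ht s hs).1.trans (scale_one _).symm, (h t ht s hs).2⟩

theorem src_cls {a₀ a₁ : APath L x y} (σ : AHomotopy a₀ a₁) : σ.cls.src = a₀.cls := rfl

end Representatives

section Volterra

open BoundedContinuousFunction

set_option synthInstance.maxHeartbeats 200000

variable {X : Type*} [NormedAddCommGroup X] [NormedSpace ℝ X] [CompleteSpace X]
  {B : Type*} [NormedAddCommGroup B] [NormedSpace ℝ B]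

/-- The extension of a function on the unit interval which is constant on both sides. -/
def ext01 (g : (Icc (0 : ℝ) 1 →ᵇ X)) (r : ℝ) : X := g (projIcc 0 1 zero_le_one r)

lemma continuous_ext01 (g : (Icc (0 : ℝ) 1 →ᵇ X)) : Continuous (ext01 g) :=
  g.continuous.comp continuous_projIcc

lemma ext01_of_mem (g : (Icc (0 : ℝ) 1 →ᵇ X)) {r : ℝ} (hr : r ∈ Icc (0 : ℝ) 1) :
    ext01 g r = g ⟨r, hr⟩ := by
  rw [ext01, projIcc_of_mem _ hr]

lemma norm_ext01_le (g : (Icc (0 : ℝ) 1 →ᵇ X)) (r : ℝ) : ‖ext01 g r‖ ≤ ‖g‖ :=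
  g.norm_coe_le_norm _

/-- The primitive vanishing at `0`, as a linear operator on continuous functions. -/
def primitive : (Icc (0 : ℝ) 1 →ᵇ X) →L[ℝ] (Icc (0 : ℝ) 1 →ᵇ X) :=
  LinearMap.mkContinuous
    { toFun := fun g => mkOfCompact ⟨fun t => ∫ r in (0 : ℝ)..t, ext01 g r,
        (intervalIntegral.continuous_primitive
          (fun a b => (continuous_ext01 g).intervalIntegrable a b) 0).comp continuous_subtype_val⟩
      map_add' := fun g h => by
        ext t
        simp only [mkOfCompact_apply, ContinuousMap.coe_mk, BoundedContinuousFunction.add_apply]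
        rw [← intervalIntegral.integral_add ((continuous_ext01 g).intervalIntegrable _ _)
          ((continuous_ext01 h).intervalIntegrable _ _)]
        rfl
      map_smul' := fun c g => by
        ext t
        simp only [mkOfCompact_apply, ContinuousMap.coe_mk, BoundedContinuousFunction.smul_apply,
          RingHom.id_apply]
        rw [← intervalIntegral.integral_smul]
        rfl } 1 (fun g => by
      rw [one_mul]
      refine (BoundedContinuousFunction.norm_le (norm_nonneg g)).2 fun t => ?_
      refine (intervalIntegral.norm_integral_le_of_norm_le_const
        (C := ‖g‖) fun r _ => norm_ext01_le g r).trans ?_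
      rw [sub_zero, abs_of_nonneg t.2.1]
      exact mul_le_of_le_one_right (norm_nonneg _) t.2.2)

lemma primitive_apply (g : (Icc (0 : ℝ) 1 →ᵇ X)) (t : Icc (0 : ℝ) 1) :
    primitive g t = ∫ r in (0 : ℝ)..t, ext01 g r := rfl

lemma hasDerivWithinAt_primitive (g : (Icc (0 : ℝ) 1 →ᵇ X)) {t : ℝ} (ht : t ∈ Icc (0 : ℝ) 1) :
    HasDerivWithinAt (ext01 (primitive g)) (ext01 g t) (Icc 0 1) t := by
  have h := (intervalIntegral.integral_hasDerivAt_right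
    ((continuous_ext01 g).intervalIntegrable 0 t)
    ((continuous_ext01 g).stronglyMeasurableAtFilter _ _)
    (continuous_ext01 g).continuousAt).hasDerivWithinAt (s := Icc 0 1)
  refine h.congr (fun r hr => ?_) ?_
  · rw [ext01_of_mem _ hr, primitive_apply]
  · rw [ext01_of_mem _ ht, primitive_apply]

/-- Pointwise application of a family of operators. -/
def mulOp (ap : B →L[ℝ] X →L[ℝ] X) : (Icc (0 : ℝ) 1 →ᵇ B) →L[ℝ] (Icc (0 : ℝ) 1 →ᵇ X) →L[ℝ] (Icc (0 : ℝ) 1 →ᵇ X) :=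
  LinearMap.mkContinuous₂
    (LinearMap.mk₂ ℝ (fun (a : (Icc (0 : ℝ) 1 →ᵇ B)) (y : (Icc (0 : ℝ) 1 →ᵇ X)) => mkOfCompact ⟨fun t => ap (a t) (y t), (ap.continuous.comp a.continuous).clm_apply y.continuous⟩)
      (fun a b y => by ext t; simp) (fun c a y => by ext t; simp)
      (fun a y z => by ext t; simp) (fun c a y => by ext t; simp)) ‖ap‖ (fun a y => by
        refine (BoundedContinuousFunction.norm_le (by positivity)).2 fun t => ?_
        refine (ap.le_opNorm₂ _ _).trans ?_
        gcongr
        · exact a.norm_coe_le_norm t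
        · exact y.norm_coe_le_norm t)

lemma mulOp_apply (ap : B →L[ℝ] X →L[ℝ] X) (a : (Icc (0 : ℝ) 1 →ᵇ B)) (y : (Icc (0 : ℝ) 1 →ᵇ X))
    (t : Icc (0 : ℝ) 1) : mulOp ap a y t = ap (a t) (y t) := rfl

/-- The Volterra operator `y ↦ ∫₀ᵗ a y`, as a linear function of the coefficient `a`. -/
def volterra (ap : B →L[ℝ] X →L[ℝ] X) : (Icc (0 : ℝ) 1 →ᵇ B) →L[ℝ]
    ((Icc (0 : ℝ) 1 →ᵇ X) →L[ℝ] (Icc (0 : ℝ) 1 →ᵇ X)) :=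
  (ContinuousLinearMap.compL ℝ _ _ _ primitive).comp (mulOp ap)

lemma volterra_apply (ap : B →L[ℝ] X →L[ℝ] X) (a : (Icc (0 : ℝ) 1 →ᵇ B)) (y : (Icc (0 : ℝ) 1 →ᵇ X)) :
    volterra ap a y = primitive (mulOp ap a y) := rfl

lemma norm_volterra_pow_apply_le (ap : B →L[ℝ] X →L[ℝ] X) (a : (Icc (0 : ℝ) 1 →ᵇ B)) (n : ℕ)
    (y : (Icc (0 : ℝ) 1 →ᵇ X)) (t : Icc (0 : ℝ) 1) :
    ‖(volterra ap a ^ n) y t‖ ≤ (‖ap‖ * ‖a‖) ^ n * ‖y‖ * ((t : ℝ) ^ n / n.factorial) := by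
  induction n generalizing t with
  | zero => simpa using y.norm_coe_le_norm t
  | succ n ih =>
    rw [pow_succ', mul_apply_eq_comp, volterra_apply, primitive_apply]
    have h1 : ∀ r ∈ Icc (0 : ℝ) t, ‖ext01 (mulOp ap a ((volterra ap a ^ n) y)) r‖
        ≤ ‖ap‖ * ‖a‖ * ((‖ap‖ * ‖a‖) ^ n * ‖y‖ * (r ^ n / n.factorial)) := by
      intro r hr
      have hr' : r ∈ Icc (0 : ℝ) 1 := ⟨hr.1, hr.2.trans t.2.2⟩
      rw [ext01_of_mem _ hr', mulOp_apply]
      refine (ap.le_opNorm₂ _ _).trans ?_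
      gcongr
      · exact a.norm_coe_le_norm _
      · exact ih ⟨r, hr'⟩
    have h2 := intervalIntegral.norm_integral_le_of_norm_le (μ := MeasureTheory.volume) t.2.1
      (Filter.Eventually.of_forall fun r hr => h1 r ⟨hr.1.le, hr.2⟩)
      (Continuous.intervalIntegrable (by fun_prop) _ _)
    refine h2.trans (le_of_eq ?_)
    simp only [intervalIntegral.integral_const_mul, intervalIntegral.integral_div, integral_pow]
    rw [Nat.factorial_succ]
    push_cast
    field_simp
    ring

lemma isUnit_one_sub_volterra (ap : B →L[ℝ] X →L[ℝ] X) (a : (Icc (0 : ℝ) 1 →ᵇ B)) : IsUnit (1 - volterra ap a) := by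
  obtain ⟨n, hn⟩ : ∃ n : ℕ, (‖ap‖ * ‖a‖) ^ n / n.factorial < 1 :=
    ((FloorSemiring.tendsto_pow_div_factorial_atTop (‖ap‖ * ‖a‖)).eventually_lt_const one_pos).exists
  have h1 : ‖volterra ap a ^ n‖ < 1 := by
    refine lt_of_le_of_lt (ContinuousLinearMap.opNorm_le_bound _ (by positivity) fun y => ?_) hn
    refine (BoundedContinuousFunction.norm_le (by positivity)).2 fun t => ?_
    refine (norm_volterra_pow_apply_le ap a n y t).trans ?_
    have : (t : ℝ) ^ n ≤ 1 := pow_le_one₀ t.2.1 t.2.2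
    calc (‖ap‖ * ‖a‖) ^ n * ‖y‖ * ((t : ℝ) ^ n / n.factorial)
        ≤ (‖ap‖ * ‖a‖) ^ n * ‖y‖ * (1 / n.factorial) := by gcongr
      _ = (‖ap‖ * ‖a‖) ^ n / n.factorial * ‖y‖ := by ring
  have h2 : IsUnit (1 - volterra ap a ^ n) :=
    isUnit_one_sub_of_norm_lt_one (R := (Icc (0 : ℝ) 1 →ᵇ X) →L[ℝ] (Icc (0 : ℝ) 1 →ᵇ X)) h1
  rw [← mul_neg_geom_sum] at h2
  exact ((Commute.isUnit_mul_iff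
    (Commute.sum_right _ _ _ fun i _ => (Commute.one_left _).sub_left ((Commute.refl _).pow_right i))).1 h2).1

end Volterra

section InverseOneSub

set_option synthInstance.maxHeartbeats 200000

variable {R : Type*} [NormedRing R] [NormedAlgebra ℝ R] [HasSummableGeomSeries R]

lemma hasDerivWithinAt_ring_inverse {k : ℝ → R} {k' : R} {s : Set ℝ} {r : ℝ}
    (h : HasDerivWithinAt k k' s r) (hk : IsUnit (k r)) :
    HasDerivWithinAt (fun r => Ring.inverse (k r))
      (-(Ring.inverse (k r) * k' * Ring.inverse (k r))) s r := by
  obtain ⟨u, hu⟩ := hk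
  have h1 := hasFDerivAt_ringInverse (𝕜 := ℝ) u
  rw [hu] at h1
  refine (h1.comp_hasDerivWithinAt r h).congr_deriv ?_
  rw [← hu, Ring.inverse_unit]
  simp [ContinuousLinearMap.mulLeftRight_apply]

lemma hasDerivWithinAt_inverse_one_sub {P W : Type*} [NormedAddCommGroup P] [NormedSpace ℝ P]
    [NormedAddCommGroup W] [NormedSpace ℝ W] [CompleteSpace W] (K : P →L[ℝ] W →L[ℝ] W)
    {a : ℝ → P} {a' : P} {s : Set ℝ} {r : ℝ} (h : HasDerivWithinAt a a' s r)
    (hK : IsUnit (1 - K (a r))) (g : W) :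
    HasDerivWithinAt (fun r => Ring.inverse (1 - K (a r)) g)
      (Ring.inverse (1 - K (a r)) (K a' (Ring.inverse (1 - K (a r)) g))) s r := by
  have h2 : HasDerivWithinAt (fun r => 1 - K (a r)) (-K a') s r :=
    (K.hasFDerivAt.comp_hasDerivWithinAt r h).const_sub 1
  have h3 := hasDerivWithinAt_ring_inverse (R := W →L[ℝ] W) h2 hK
  rw [mul_neg, neg_mul, neg_neg] at h3
  have h4 := h3.clm_apply (hasDerivWithinAt_const r s g)
  rw [map_zero, add_zero] at h4
  exact h4

end InverseOneSub

section LinearODE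

open BoundedContinuousFunction

set_option synthInstance.maxHeartbeats 200000

variable {X : Type*} [NormedAddCommGroup X] [NormedSpace ℝ X] [CompleteSpace X]
  {B : Type*} [NormedAddCommGroup B] [NormedSpace ℝ B] (ap : B →L[ℝ] X →L[ℝ] X)

/-- The solution of the integral equation `y = g + ∫₀ᵗ a y`. -/
def resolvent (a : (Icc (0 : ℝ) 1 →ᵇ B)) : (Icc (0 : ℝ) 1 →ᵇ X) →L[ℝ] (Icc (0 : ℝ) 1 →ᵇ X) :=
  Ring.inverse (1 - volterra ap a)

lemma resolvent_eq (a : (Icc (0 : ℝ) 1 →ᵇ B)) (g : (Icc (0 : ℝ) 1 →ᵇ X)) :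
    resolvent ap a g = g + volterra ap a (resolvent ap a g) := by
  have h := congrArg (fun T => T g) (Ring.mul_inverse_cancel _ (isUnit_one_sub_volterra ap a))
  change resolvent ap a g - volterra ap a (resolvent ap a g) = g at h
  exact eq_add_of_sub_eq h

lemma eq_zero_of_eq_volterra (a : (Icc (0 : ℝ) 1 →ᵇ B)) (y : (Icc (0 : ℝ) 1 →ᵇ X))
    (h : y = volterra ap a y) : y = 0 := by
  have h1 := congrArg (fun T => T y) (Ring.inverse_mul_cancel _ (isUnit_one_sub_volterra ap a))
  change resolvent ap a (y - volterra ap a y) = y at h1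
  rw [← h, sub_self, map_zero] at h1
  exact h1.symm

lemma continuous_resolvent : Continuous (resolvent ap) := by
  refine continuous_iff_continuousAt.2 fun a => ?_
  obtain ⟨u, hu⟩ := isUnit_one_sub_volterra ap a
  have h := NormedRing.inverse_continuousAt
    (R := (Icc (0 : ℝ) 1 →ᵇ X) →L[ℝ] (Icc (0 : ℝ) 1 →ᵇ X)) u
  rw [hu] at h
  exact ContinuousAt.comp (f := fun b : Icc (0 : ℝ) 1 →ᵇ B => 1 - volterra ap b) h
    (continuous_const.sub (volterra ap).continuous).continuousAt

lemma hasDerivWithinAt_resolvent {a : ℝ → (Icc (0 : ℝ) 1 →ᵇ B)}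
    {a' : Icc (0 : ℝ) 1 →ᵇ B} {s : Set ℝ} {r : ℝ} (h : HasDerivWithinAt a a' s r)
    (g : Icc (0 : ℝ) 1 →ᵇ X) :
    HasDerivWithinAt (fun r => resolvent ap (a r) g)
      (resolvent ap (a r) (volterra ap a' (resolvent ap (a r) g))) s r :=
  hasDerivWithinAt_inverse_one_sub (volterra ap) h (isUnit_one_sub_volterra ap (a r)) g

/-- A linear differential equation has no non-zero solution vanishing at `0`. -/
lemma eq_zero_of_linear_ode {a : ℝ → B} {y : ℝ → X} (ha : ContinuousOn a (Icc 0 1))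
    (hy : ∀ t ∈ Icc (0 : ℝ) 1, HasDerivWithinAt y (ap (a t) (y t)) (Icc 0 1) t) (h0 : y 0 = 0)
    {t : ℝ} (ht : t ∈ Icc (0 : ℝ) 1) : y t = 0 := by
  have hyc : ContinuousOn y (Icc 0 1) := fun t ht => (hy t ht).continuousWithinAt
  let A : (Icc (0 : ℝ) 1 →ᵇ B) :=
    mkOfCompact ⟨_, continuousOn_iff_continuous_domRestrict.1 ha⟩
  let Y : (Icc (0 : ℝ) 1 →ᵇ X) :=
    mkOfCompact ⟨_, continuousOn_iff_continuous_domRestrict.1 hyc⟩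
  suffices h : Y = 0 from congrArg (fun f : Icc (0 : ℝ) 1 →ᵇ X => f ⟨t, ht⟩) h
  refine eq_zero_of_eq_volterra ap A Y ?_
  ext ⟨t, ht⟩
  rw [volterra_apply, primitive_apply]
  have key : ∫ r in (0 : ℝ)..t, ext01 (mulOp ap A Y) r = y t - y 0 := by
    refine intervalIntegral.integral_eq_sub_of_hasDeriv_right_of_le ht.1
      (hyc.mono (Icc_subset_Icc_right ht.2)) (fun r hr => ?_)
      ((continuous_ext01 _).intervalIntegrable _ _)
    have hr' : r ∈ Icc (0 : ℝ) 1 := ⟨hr.1.le, hr.2.le.trans ht.2⟩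
    rw [ext01_of_mem _ hr']
    exact ((hy r hr').hasDerivAt (Icc_mem_nhds hr.1 (hr.2.trans_le ht.2))).hasDerivWithinAt
  rw [key, h0, sub_zero]
  rfl

/-- The nearest point of the cube. -/
def clamp {n : ℕ} (p : Fin n → ℝ) : Fin n → ℝ := fun i => projIcc (0 : ℝ) 1 zero_le_one (p i)

lemma clamp_mem {n : ℕ} (p : Fin n → ℝ) : clamp p ∈ cube n :=
  mem_cube.2 fun _ => Subtype.coe_prop _

lemma clamp_of_mem {n : ℕ} {p : Fin n → ℝ} (hp : p ∈ cube n) : clamp p = p := by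
  funext i
  rw [clamp, projIcc_of_mem _ (mem_cube.1 hp i)]

lemma continuous_clamp {n : ℕ} : Continuous (clamp (n := n)) :=
  continuous_pi fun i => continuous_subtype_val.comp (continuous_projIcc.comp (continuous_apply i))

variable {n : ℕ} {Y : Type*} [NormedAddCommGroup Y] [NormedSpace ℝ Y]

lemma continuous_clamp_line {f : (Fin (n + 1) → ℝ) → Y} (hf : ContinuousOn f (cube (n + 1))) :
    Continuous fun q : (Fin (n + 1) → ℝ) × Icc (0 : ℝ) 1 =>
      f (Function.update (clamp q.1) 0 (q.2 : ℝ)) := by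
  refine hf.comp_continuous ?_ fun q => update_mem_cube (clamp_mem _) _ q.2.2
  exact (continuous_clamp.comp continuous_fst).update 0 (continuous_subtype_val.comp continuous_snd)

/-- The restrictions of a function on the cube to the lines in the first direction. -/
def lineFamily {f : (Fin (n + 1) → ℝ) → Y} (hf : ContinuousOn f (cube (n + 1))) :
    C(Fin (n + 1) → ℝ, (Icc (0 : ℝ) 1 →ᵇ Y)) where
  toFun p := mkOfCompact (ContinuousMap.curry ⟨_, continuous_clamp_line hf⟩ p)
  continuous_toFun := (ContinuousMap.isometryEquivBoundedOfCompact _ _).continuous.comp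
    (ContinuousMap.curry _).continuous

lemma lineFamily_apply {f : (Fin (n + 1) → ℝ) → Y} (hf : ContinuousOn f (cube (n + 1)))
    {p : Fin (n + 1) → ℝ} (hp : p ∈ cube (n + 1)) (t : Icc (0 : ℝ) 1) :
    lineFamily hf p t = f (Function.update p 0 (t : ℝ)) := by
  change f (Function.update (clamp p) 0 (t : ℝ)) = _
  rw [clamp_of_mem hp]

lemma lineFamily_update {f : (Fin (n + 1) → ℝ) → Y} (hf : ContinuousOn f (cube (n + 1)))
    {p : Fin (n + 1) → ℝ} (hp : p ∈ cube (n + 1)) {r : ℝ} (hr : r ∈ Icc (0 : ℝ) 1) :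
    lineFamily hf (Function.update p 0 r) = lineFamily hf p := by
  ext t
  rw [lineFamily_apply hf hp, lineFamily_apply hf (update_mem_cube hp _ hr),
    Function.update_idem]

lemma hasDerivWithinAt_lineFamily {f g : (Fin (n + 1) → ℝ) → Y} {i : Fin (n + 1)} (hi : i ≠ 0)
    (hf : ContinuousOn f (cube (n + 1))) (hg : ContinuousOn g (cube (n + 1)))
    (h : ∀ p ∈ cube (n + 1),
      HasDerivWithinAt (fun r => f (Function.update p i r)) (g p) (Icc 0 1) (p i))
    {p : Fin (n + 1) → ℝ} (hp : p ∈ cube (n + 1)) :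
    HasDerivWithinAt (fun r => lineFamily hf (Function.update p i r)) (lineFamily hg p)
      (Icc 0 1) (p i) := by
  have hpi : p i ∈ Icc (0 : ℝ) 1 := mem_cube.1 hp i
  have hcont : Continuous fun r => lineFamily hg (Function.update p i r) :=
    (lineFamily hg).continuous.comp (continuous_const.update i continuous_id)
  rw [hasDerivWithinAt_iff_isLittleO, Asymptotics.isLittleO_iff]
  intro c hc
  obtain ⟨δ, hδ, hb⟩ := Metric.continuousAt_iff.1 hcont.continuousAt c hc
  rw [Function.update_eq_self] at hb
  filter_upwards [inter_mem self_mem_nhdsWithin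
    (mem_nhdsWithin_of_mem_nhds (Metric.ball_mem_nhds (p i) hδ))] with r hr
  refine (BoundedContinuousFunction.norm_le (by positivity)).2 fun t => ?_
  have hup : ∀ r' ∈ Icc (0 : ℝ) 1, Function.update p i r' ∈ cube (n + 1) :=
    fun r' hr' => update_mem_cube hp _ hr'
  have hd : ∀ r' ∈ Icc (0 : ℝ) 1 ∩ Metric.ball (p i) δ,
      HasDerivWithinAt (fun r => lineFamily hf (Function.update p i r) t - r • lineFamily hg p t)
        (lineFamily hg (Function.update p i r') t - lineFamily hg p t)
        (Icc (0 : ℝ) 1 ∩ Metric.ball (p i) δ) r' := by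
    intro r' hr'
    have h1 := h (Function.update (Function.update p i r') 0 (t : ℝ))
      (update_mem_cube (hup r' hr'.1) _ t.2)
    rw [Function.update_of_ne hi, Function.update_self] at h1
    have h2 : HasDerivWithinAt (fun r => lineFamily hf (Function.update p i r) t)
        (lineFamily hg (Function.update p i r') t) (Icc (0 : ℝ) 1) r' := by
      rw [lineFamily_apply hg (hup r' hr'.1)]
      refine h1.congr (fun s hs => ?_) ?_
      · rw [lineFamily_apply hf (hup s hs), Function.update_comm hi.symm _ _ (Function.update p i r'),
          Function.update_idem]
      · rw [lineFamily_apply hf (hup r' hr'.1), Function.update_comm hi.symm _ _ (Function.update p i r'),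
          Function.update_idem]
    exact (h2.mono inter_subset_left).sub (((hasDerivAt_id r').smul_const _).congr_deriv
      (one_smul _ _)).hasDerivWithinAt
  have hbd : ∀ r' ∈ Icc (0 : ℝ) 1 ∩ Metric.ball (p i) δ,
      ‖lineFamily hg (Function.update p i r') t - lineFamily hg p t‖ ≤ c := fun r' hr' =>
    (BoundedContinuousFunction.norm_coe_le_norm
      (lineFamily hg (Function.update p i r') - lineFamily hg p) t).trans
      (by rw [← dist_eq_norm]; exact (hb hr'.2).le)
  have := Convex.norm_image_sub_le_of_norm_hasDerivWithin_le hd hbd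
    ((convex_Icc _ _).inter (convex_ball _ _)) ⟨hpi, Metric.mem_ball_self hδ⟩ hr
  simp only [BoundedContinuousFunction.sub_apply, BoundedContinuousFunction.smul_apply] at this ⊢
  refine le_trans (le_of_eq ?_) this
  congr 1
  rw [sub_smul]
  abel

/-- Solutions of linear differential equations in the first variable of a cube, with coefficients
depending differentiably on the other variables: they are differentiable in these variables, and the
derivatives satisfy the differentiated equation. -/
lemma exists_linear_ode {a : (Fin (n + 1) → ℝ) → B}
    {b : Fin (n + 1) → (Fin (n + 1) → ℝ) → B}
    (ha : ContinuousOn a (cube (n + 1))) (hb : ∀ i, ContinuousOn (b i) (cube (n + 1)))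
    (hab : ∀ i, ∀ p ∈ cube (n + 1),
      HasDerivWithinAt (fun r => a (Function.update p i r)) (b i p) (Icc 0 1) (p i)) (y₀ : X) :
    ∃ (y : (Fin (n + 1) → ℝ) → X) (z : Fin (n + 1) → (Fin (n + 1) → ℝ) → X),
      Continuous y ∧ (∀ i, i ≠ 0 → Continuous (z i)) ∧
      (∀ p ∈ cube (n + 1), p 0 = 0 → y p = y₀) ∧
      (∀ i, i ≠ 0 → ∀ p ∈ cube (n + 1), p 0 = 0 → z i p = 0) ∧
      (∀ p ∈ cube (n + 1),
        HasDerivWithinAt (fun r => y (Function.update p 0 r)) (ap (a p) (y p)) (Icc 0 1) (p 0)) ∧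
      (∀ i, i ≠ 0 → ∀ p ∈ cube (n + 1),
        HasDerivWithinAt (fun r => y (Function.update p i r)) (z i p) (Icc 0 1) (p i)) ∧
      (∀ i, i ≠ 0 → ∀ p ∈ cube (n + 1),
        HasDerivWithinAt (fun r => z i (Function.update p 0 r)) (ap (a p) (z i p) + ap (b i p) (y p))
          (Icc 0 1) (p 0)) := by
  let g : (Icc (0 : ℝ) 1 →ᵇ X) := BoundedContinuousFunction.const _ y₀
  let Y : (Fin (n + 1) → ℝ) → (Icc (0 : ℝ) 1 →ᵇ X) := fun p => resolvent ap (lineFamily ha p) g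
  let Z : Fin (n + 1) → (Fin (n + 1) → ℝ) → (Icc (0 : ℝ) 1 →ᵇ X) := fun i p =>
    resolvent ap (lineFamily ha p) (volterra ap (lineFamily (hb i) p) (Y p))
  have hR : Continuous fun p => resolvent ap (lineFamily ha p) :=
    (continuous_resolvent ap).comp (lineFamily ha).continuous
  have hYc : Continuous Y := hR.clm_apply continuous_const
  have hZc : ∀ i, Continuous (Z i) := fun i =>
    hR.clm_apply (((volterra ap).continuous.comp (lineFamily (hb i)).continuous).clm_apply hYc)
  have hev : Continuous fun p : Fin (n + 1) → ℝ => projIcc (0 : ℝ) 1 zero_le_one (p 0) :=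
    continuous_projIcc.comp (continuous_apply 0)
  have hYu : ∀ p ∈ cube (n + 1), ∀ r ∈ Icc (0 : ℝ) 1, Y (Function.update p 0 r) = Y p :=
    fun p hp r hr => by simp only [Y, lineFamily_update ha hp hr]
  have hZu : ∀ i, ∀ p ∈ cube (n + 1), ∀ r ∈ Icc (0 : ℝ) 1,
      Z i (Function.update p 0 r) = Z i p := fun i p hp r hr => by
    simp only [Z, lineFamily_update ha hp hr, lineFamily_update (hb i) hp hr, hYu p hp r hr]
  have hYeq : ∀ p, Y p = g + primitive (mulOp ap (lineFamily ha p) (Y p)) := fun p =>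
    resolvent_eq ap _ _
  have hZeq : ∀ i p, Z i p = primitive (mulOp ap (lineFamily (hb i) p) (Y p)
      + mulOp ap (lineFamily ha p) (Z i p)) := fun i p => by
    rw [map_add]; exact resolvent_eq ap _ _
  have hat : ∀ (f : (Fin (n + 1) → ℝ) → B) (hf : ContinuousOn f (cube (n + 1)))
      (y : (Icc (0 : ℝ) 1 →ᵇ X)), ∀ p ∈ cube (n + 1),
      ext01 (mulOp ap (lineFamily hf p) y) (p 0) = ap (f p) (ext01 y (p 0)) := by
    intro f hf y p hp
    rw [ext01_of_mem _ (mem_cube.1 hp 0), ext01_of_mem _ (mem_cube.1 hp 0), mulOp_apply,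
      lineFamily_apply hf hp, Function.update_eq_self]
  have hp0 : ∀ h : (Icc (0 : ℝ) 1 →ᵇ X), ext01 (primitive h) 0 = 0 := fun h => by
    rw [ext01_of_mem _ zero_mem_I, primitive_apply, intervalIntegral.integral_same]
  refine ⟨fun p => ext01 (Y p) (p 0), fun i p => ext01 (Z i p) (p 0), ?_, ?_, ?_, ?_, ?_, ?_, ?_⟩
  · exact continuous_eval.comp (hYc.prodMk hev)
  · exact fun i _ => continuous_eval.comp ((hZc i).prodMk hev)
  · intro p hp h0
    dsimp only
    rw [h0, hYeq p]
    change y₀ + ext01 (primitive _) 0 = y₀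
    rw [hp0, add_zero]
  · intro i _ p hp h0
    dsimp only
    rw [h0, hZeq i p, hp0]
  · intro p hp
    have h1 := (hasDerivWithinAt_primitive (mulOp ap (lineFamily ha p) (Y p))
      (mem_cube.1 hp 0)).const_add y₀
    rw [hat a ha (Y p) p hp] at h1
    have h2 : ∀ r ∈ Icc (0 : ℝ) 1,
        ext01 (Y (Function.update p 0 r)) (Function.update p 0 r 0)
          = y₀ + ext01 (primitive (mulOp ap (lineFamily ha p) (Y p))) r := fun r hr => by
      rw [hYu p hp r hr, Function.update_self]
      exact congrArg (fun f : Icc (0 : ℝ) 1 →ᵇ X => ext01 f r) (hYeq p)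
    exact h1.congr h2 (h2 _ (mem_cube.1 hp 0))
  · intro i hi p hp
    have h1 := hasDerivWithinAt_resolvent ap (hasDerivWithinAt_lineFamily hi ha (hb i) (hab i) hp) g
    rw [Function.update_eq_self] at h1
    have h2 := ((BoundedContinuousFunction.evalCLM ℝ
      (projIcc (0 : ℝ) 1 zero_le_one (p 0))).hasFDerivAt (x := Y p))
    have h3 := HasFDerivAt.comp_hasDerivWithinAt (p i) (f := fun r => Y (Function.update p i r))
      (by simpa only [Function.update_eq_self] using h2) h1
    refine h3.congr (fun r _ => ?_) ?_
    · dsimp only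
      rw [Function.update_of_ne hi.symm]; rfl
    · dsimp only
      rw [Function.update_of_ne hi.symm]; rfl
  · intro i hi p hp
    have h1 := hasDerivWithinAt_primitive (mulOp ap (lineFamily (hb i) p) (Y p)
      + mulOp ap (lineFamily ha p) (Z i p)) (mem_cube.1 hp 0)
    have h2 : ∀ r ∈ Icc (0 : ℝ) 1,
        ext01 (Z i (Function.update p 0 r)) (Function.update p 0 r 0)
          = ext01 (primitive (mulOp ap (lineFamily (hb i) p) (Y p)
            + mulOp ap (lineFamily ha p) (Z i p))) r := fun r hr => by
      rw [hZu i p hp r hr, Function.update_self, ← hZeq]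
    refine (h1.congr h2 (h2 _ (mem_cube.1 hp 0))).congr_deriv ?_
    rw [add_comm]
    change ext01 (mulOp ap (lineFamily ha p) (Z i p)) (p 0)
      + ext01 (mulOp ap (lineFamily (hb i) p) (Y p)) (p 0) = _
    rw [hat a ha _ p hp, hat (b i) (hb i) _ p hp]

end LinearODE

section MatrixODE

variable {ι : Type*} [Fintype ι]

/-- The action of square matrices on vectors, as a continuous bilinear map. -/
def matAct (ι : Type*) [Fintype ι] : (ι → ι → ℝ) →L[ℝ] (ι → ℝ) →L[ℝ] (ι → ℝ) :=
  LinearMap.mkContinuous₂ (LinearMap.mk₂ ℝ (fun (a : ι → ι → ℝ) (y : ι → ℝ) i => ∑ j, a i j * y j)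
    (fun a b y => by ext i; simp [add_mul, Finset.sum_add_distrib])
    (fun c a y => by ext i; simp [Finset.mul_sum, mul_assoc])
    (fun a y z => by ext i; simp [mul_add, Finset.sum_add_distrib])
    (fun c a y => by ext i; simp [Finset.mul_sum, mul_left_comm])) (Fintype.card ι) (fun a y => by
      refine (pi_norm_le_iff_of_nonneg (by positivity)).2 fun i => ?_
      refine (norm_sum_le _ _).trans ((Finset.sum_le_card_nsmul _ _ (‖a‖ * ‖y‖) fun j _ => ?_).trans
        (le_of_eq ?_))
      · rw [norm_mul]
        gcongr
        · exact (norm_le_pi_norm (a i) j).trans (norm_le_pi_norm a i)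
        · exact norm_le_pi_norm y j
      · rw [nsmul_eq_mul, Finset.card_univ, mul_assoc])

/-- The vanishing of solutions of homogeneous linear systems with zero initial value. -/
lemma eq_zero_of_matrix_ode {a : ι → ι → ℝ → ℝ} {y : ι → ℝ → ℝ}
    (ha : ∀ i j, ContinuousOn (a i j) (Icc 0 1))
    (hy : ∀ i, ∀ t ∈ Icc (0 : ℝ) 1,
      HasDerivWithinAt (y i) (∑ j, a i j t * y j t) (Icc 0 1) t) (h0 : ∀ i, y i 0 = 0)
    {t : ℝ} (ht : t ∈ Icc (0 : ℝ) 1) (i : ι) : y i t = 0 := by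
  have h := eq_zero_of_linear_ode (matAct ι) (a := fun t i j => a i j t) (y := fun t i => y i t)
    (continuousOn_pi.2 fun i => continuousOn_pi.2 fun j => ha i j)
    (fun t ht => hasDerivWithinAt_pi.2 fun i => hy i t ht) (funext h0) ht
  exact congrFun h i

lemma eq_zero_of_matrix_ode_of_eq_zero {a : ι → ι → ℝ → ℝ} {y : ι → ℝ → ℝ}
    (ha : ∀ i j, ContinuousOn (a i j) (Icc 0 1))
    (hy : ∀ i, ∀ t ∈ Icc (0 : ℝ) 1,
      HasDerivWithinAt (y i) (∑ j, a i j t * y j t) (Icc 0 1) t) {t₀ : ℝ}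
    (ht₀ : t₀ ∈ Icc (0 : ℝ) 1) (h0 : ∀ i, y i t₀ = 0)
    {t : ℝ} (ht : t ∈ Icc (0 : ℝ) 1) (i : ι) : y i t = 0 := by
  refine eq_zero_of_matrix_ode ha hy (fun i => ?_) ht i
  have hm : ∀ r ∈ Icc (0 : ℝ) 1, t₀ * (1 - r) ∈ Icc (0 : ℝ) 1 := fun r hr =>
    ⟨mul_nonneg ht₀.1 (by linarith [hr.2]), by nlinarith [ht₀.1, ht₀.2, hr.1, hr.2]⟩
  have hd : ∀ r : ℝ, HasDerivAt (fun r => t₀ * (1 - r)) (-t₀) r := fun r =>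
    (((hasDerivAt_id r).const_sub 1).const_mul t₀).congr_deriv (by ring)
  have key := eq_zero_of_matrix_ode (a := fun i j r => -t₀ * a i j (t₀ * (1 - r)))
    (y := fun i r => y i (t₀ * (1 - r)))
    (fun i j => continuousOn_const.mul ((ha i j).comp
      (by fun_prop : Continuous fun r : ℝ => t₀ * (1 - r)).continuousOn hm))
    (fun i r hr => by
      refine ((hy i _ (hm r hr)).scomp r (hd r).hasDerivWithinAt hm).congr_deriv ?_
      rw [smul_eq_mul, Finset.mul_sum]
      exact Finset.sum_congr rfl fun j _ => by ring)
    (fun i => by simpa using h0 i) one_mem_I i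
  simpa using key

lemma contDiffOn_of_matrix_ode {a : ι → ι → ℝ → ℝ} {y : ι → ℝ → ℝ}
    (ha : ∀ i j, ContDiffOn ℝ ∞ (a i j) (Icc 0 1))
    (hy : ∀ i, ∀ t ∈ Icc (0 : ℝ) 1,
      HasDerivWithinAt (y i) (∑ j, a i j t * y j t) (Icc 0 1) t) (i : ι) :
    ContDiffOn ℝ ∞ (y i) (Icc 0 1) := by
  have hu : UniqueDiffOn ℝ (Icc (0 : ℝ) 1) := uniqueDiffOn_Icc zero_lt_one
  refine contDiffOn_infty.2 fun k => ?_
  induction k generalizing i with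
  | zero => exact contDiffOn_zero.2 fun t ht => (hy i t ht).continuousWithinAt
  | succ k ih =>
    push_cast
    refine (contDiffOn_succ_iff_derivWithin hu).2
      ⟨fun t ht => (hy i t ht).differentiableWithinAt, by simp, ?_⟩
    have h : ContDiffOn ℝ k (fun t => ∑ j, a i j t * y j t) (Icc 0 1) :=
      ContDiffOn.sum fun j _ => ((ha i j).of_le (by exact_mod_cast le_top)).mul (ih j)
    exact h.congr fun t ht => (hy i t ht).derivWithin (hu t ht)

/-- Linear systems on a cube, in the first variable, with smooth coefficients. -/
lemma exists_matrix_ode {n : ℕ} {a : ι → ι → (Fin (n + 1) → ℝ) → ℝ}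
    (ha : ∀ i j, ContDiffOn ℝ ∞ (a i j) (cube (n + 1))) (y₀ : ι → ℝ) :
    ∃ (y : ι → (Fin (n + 1) → ℝ) → ℝ) (z : Fin (n + 1) → ι → (Fin (n + 1) → ℝ) → ℝ),
      (∀ i, Continuous (y i)) ∧ (∀ k, k ≠ 0 → ∀ i, Continuous (z k i)) ∧
      (∀ i, ∀ p ∈ cube (n + 1), p 0 = 0 → y i p = y₀ i) ∧
      (∀ k, k ≠ 0 → ∀ i, ∀ p ∈ cube (n + 1), p 0 = 0 → z k i p = 0) ∧
      (∀ i, ∀ p ∈ cube (n + 1),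
        HasDerivWithinAt (fun r => y i (Function.update p 0 r)) (∑ j, a i j p * y j p)
          (Icc 0 1) (p 0)) ∧
      (∀ k, k ≠ 0 → ∀ i, ∀ p ∈ cube (n + 1),
        HasDerivWithinAt (fun r => y i (Function.update p k r)) (z k i p) (Icc 0 1) (p k)) ∧
      (∀ k, k ≠ 0 → ∀ i, ∀ p ∈ cube (n + 1),
        HasDerivWithinAt (fun r => z k i (Function.update p 0 r))
          (∑ j, a i j p * z k j p
            + ∑ j, fderivWithin ℝ (a i j) (cube (n + 1)) p (Pi.single k 1) * y j p)
          (Icc 0 1) (p 0)) ∧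
      (∀ k, k ≠ 0 → ∀ i, ∀ p ∈ cube (n + 1),
        HasDerivWithinAt
          (fun r => ∑ j, a i j (Function.update p k r) * y j (Function.update p k r))
          (∑ j, a i j p * z k j p
            + ∑ j, fderivWithin ℝ (a i j) (cube (n + 1)) p (Pi.single k 1) * y j p)
          (Icc 0 1) (p k)) := by
  have hb : ∀ k i j, ContinuousOn
      (fun p => fderivWithin ℝ (a i j) (cube (n + 1)) p (Pi.single k 1)) (cube (n + 1)) :=
    fun k i j => ((ha i j).continuousOn_fderivWithin (uniqueDiffOn_cube _) (by simp)).clm_apply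
      continuousOn_const
  obtain ⟨y, z, hy, hz, hy0, hz0, hyt, hyk, hzt⟩ := exists_linear_ode (matAct ι) (n := n)
    (a := fun p i j => a i j p)
    (b := fun k p i j => fderivWithin ℝ (a i j) (cube (n + 1)) p (Pi.single k 1))
    (continuousOn_pi.2 fun i => continuousOn_pi.2 fun j => (ha i j).continuousOn)
    (fun k => continuousOn_pi.2 fun i => continuousOn_pi.2 fun j => hb k i j)
    (fun k p hp => hasDerivWithinAt_pi.2 fun i => hasDerivWithinAt_pi.2 fun j =>
      hasDerivWithinAt_line hp k ((ha i j).differentiableOn (by simp) p hp)) y₀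
  refine ⟨fun i p => y p i, fun k i p => z k p i, ?_, ?_, ?_, ?_, ?_, ?_, ?_, ?_⟩
  · exact fun i => (continuous_apply i).comp hy
  · exact fun k hk i => (continuous_apply i).comp (hz k hk)
  · exact fun i p hp h0 => congrFun (hy0 p hp h0) i
  · exact fun k hk i p hp h0 => congrFun (hz0 k hk p hp h0) i
  · exact fun i p hp => hasDerivWithinAt_pi.1 (hyt p hp) i
  · exact fun k hk i p hp => hasDerivWithinAt_pi.1 (hyk k hk p hp) i
  · exact fun k hk i p hp => hasDerivWithinAt_pi.1 (hzt k hk p hp) i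
  · intro k hk i p hp
    have h := HasDerivWithinAt.fun_sum (u := Finset.univ) fun j (_ : j ∈ Finset.univ) =>
      (hasDerivWithinAt_line hp k ((ha i j).differentiableOn (by simp) p hp)).mul
        (hasDerivWithinAt_pi.1 (hyk k hk p hp) j)
    refine h.congr_deriv ?_
    rw [Function.update_eq_self, Finset.sum_add_distrib, add_comm]

end MatrixODE

section Connection

variable {F : Type*} [NormedAddCommGroup F] [NormedSpace ℝ F] [FiniteDimensional ℝ F]
  {V : M → Type*} [TopologicalSpace (TotalSpace F V)]
  [∀ x, AddCommGroup (V x)] [∀ x, Module ℝ (V x)]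
  [∀ x, TopologicalSpace (V x)] [FiberBundle F V] [VectorBundle ℝ F V]
  [ContMDiffVectorBundle ∞ F V 𝓘(ℝ, EM)]

variable {L : LieAlgebroid EM FA A}

lemma dirDeriv_sum {ι : Type*} (s : Finset ι) (f : ι → SmoothFn EM M) {x : M}
    (v : TangentSpace 𝓘(ℝ, EM) x) :
    dirDeriv (fun y => ∑ i ∈ s, f i y) v = ∑ i ∈ s, dirDeriv (f i) v := by
  classical
  induction s using Finset.induction_on with
  | empty => simpa using dirDeriv_const (0 : ℝ) v
  | insert i s hi ih =>
    rw [Finset.sum_insert hi, ← ih]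
    have h := dirDeriv_add (f i) (∑ j ∈ s, f j) v
    have hs : (⇑(∑ j ∈ s, f j) : M → ℝ) = fun y => ∑ j ∈ s, f j y := by
      funext y
      rw [← ContMDiffMap.coeFnAddMonoidHom_apply, map_sum]
      simp
    rw [hs] at h
    simp only [Finset.sum_insert hi]
    exact h

lemma dirDeriv_congr {f g : M → ℝ} {x : M} (h : f =ᶠ[𝓝 x] g) (v : TangentSpace 𝓘(ℝ, EM) x) :
    dirDeriv f v = dirDeriv g v := by
  rw [dirDeriv, h.mfderiv_eq]
  rfl

/-- The constant functions. -/
def constFn (EM M : Type*) [NormedAddCommGroup EM] [NormedSpace ℝ EM] [TopologicalSpace M]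
    [ChartedSpace EM M] (c : ℝ) : SmoothFn EM M := ContMDiffMap.const c

lemma coe_constFn (c : ℝ) : ⇑(constFn EM M c) = fun _ => c := rfl

lemma csmul_eq_fsmul (c : ℝ) (e : Sec EM F V) : c • e = fsmul (constFn EM M c) e := rfl

variable (D : AConnection L F V)

lemma AConnection.toFun_congr (e : Sec EM F V) {α β : Sec EM FA A} {x : M} (h : α x = β x) :
    D.toFun α e x = D.toFun β e x := by
  let φ : Sec EM FA A →+ V x := AddMonoidHom.mk' (fun α => D.toFun α e x) fun α β => by
    rw [D.add_left]; rfl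
  exact eq_of_functionLinear φ (fun f α => by
    change D.toFun (fsmul f α) e x = f x • D.toFun α e x
    rw [D.smul_left]; rfl) h

/-- The derivative of a section as a linear map on the fibre of `A`. -/
def AConnection.along (e : Sec EM F V) (x : M) : A x →ₗ[ℝ] V x where
  toFun v := D.toFun (secExt v) e x
  map_add' v w := by
    rw [D.toFun_congr e (β := secExt v + secExt w) (by simp), D.add_left]; rfl
  map_smul' c v := by
    rw [D.toFun_congr e (β := c • secExt v) (by simp), csmul_eq_fsmul, D.smul_left]; rfl

lemma AConnection.toFun_apply (α : Sec EM FA A) (e : Sec EM F V) (x : M) :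
    D.toFun α e x = D.along e x (α x) :=
  D.toFun_congr e (by simp)

lemma AConnection.along_add (e e' : Sec EM F V) (x : M) (v : A x) :
    D.along (e + e') x v = D.along e x v + D.along e' x v := by
  change D.toFun _ _ x = D.toFun _ _ x + D.toFun _ _ x
  rw [D.add_right]; rfl

lemma AConnection.along_fsmul (f : SmoothFn EM M) (e : Sec EM F V) (x : M) (v : A x) :
    D.along (fsmul f e) x v = f x • D.along e x v + dirDeriv f (L.anchor x v) • e x := by
  change D.toFun _ _ x = f x • D.toFun _ _ x + _
  rw [D.leibniz, secExt_apply]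

lemma AConnection.along_csmul (c : ℝ) (e : Sec EM F V) (x : M) (v : A x) :
    D.along (c • e) x v = c • D.along e x v := by
  rw [csmul_eq_fsmul, D.along_fsmul]
  rw [coe_constFn, dirDeriv_const, zero_smul, add_zero]

lemma AConnection.along_sum {ι : Type*} (s : Finset ι) (e : ι → Sec EM F V) (x : M) (v : A x) :
    D.along (∑ i ∈ s, e i) x v = ∑ i ∈ s, D.along (e i) x v :=
  map_sum (AddMonoidHom.mk' (fun e => D.along e x v) fun e e' => D.along_add e e' x v) e s

/-- `ρ(v)⟨ξ, e⟩ - ⟨ξ, ∇_v e⟩` as an additive function of the section `e`. -/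
def AConnection.dualSec (ξ : DualSec EM F V) (x : M) (v : A x) : Sec EM F V →+ ℝ :=
  AddMonoidHom.mk' (fun e => dirDeriv (pairing ξ e) (L.anchor x v) - ξ x (D.along e x v))
    fun e e' => by
      have h := dirDeriv_add (pairing ξ e) (pairing ξ e') (L.anchor x v)
      have h2 : (⇑(pairing ξ (e + e')) : M → ℝ) = fun y => pairing ξ e y + pairing ξ e' y := by
        funext y
        simp
      rw [h2, h, D.along_add, map_add]
      ring

lemma AConnection.dualSec_fsmul (ξ : DualSec EM F V) {x : M} (v : A x) (f : SmoothFn EM M)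
    (e : Sec EM F V) : D.dualSec ξ x v (fsmul f e) = f x • D.dualSec ξ x v e := by
  have h := dirDeriv_mul f (pairing ξ e) (L.anchor x v)
  have h2 : (⇑(pairing ξ (fsmul f e)) : M → ℝ) = fun y => f y * pairing ξ e y := by
    funext y
    simp [fsmul_apply]
  change dirDeriv (pairing ξ (fsmul f e)) _ - _ = f x • (dirDeriv _ _ - _)
  rw [h2, h, D.along_fsmul]
  simp only [map_add, map_smul, smul_eq_mul, pairing_apply]
  ring

lemma AConnection.dualSec_congr (ξ : DualSec EM F V) {x : M} (v : A x) {e e' : Sec EM F V}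
    (h : e x = e' x) : D.dualSec ξ x v e = D.dualSec ξ x v e' :=
  eq_of_functionLinear _ (fun f e => D.dualSec_fsmul ξ v f e) h

/-- The derivative of a section of the dual bundle for the dual connection. -/
def AConnection.dualAlong (ξ : DualSec EM F V) (x : M) (v : A x) : V x →ₗ[ℝ] ℝ where
  toFun w := D.dualSec ξ x v (secExt w)
  map_add' w w' := by
    rw [← map_add]
    exact D.dualSec_congr ξ v (by simp)
  map_smul' c w := by
    have h := D.dualSec_fsmul ξ v (constFn EM M c) (secExt w)
    rw [RingHom.id_apply]
    refine Eq.trans ?_ h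
    exact D.dualSec_congr ξ v (by simp [fsmul_apply, coe_constFn])

lemma AConnection.dualAlong_apply (ξ : DualSec EM F V) (e : Sec EM F V) (x : M) (v : A x) :
    D.dualAlong ξ x v (e x) = dirDeriv (pairing ξ e) (L.anchor x v) - ξ x (D.along e x v) :=
  D.dualSec_congr ξ v (by simp)

lemma AConnection.dualAlong_zero (ξ : DualSec EM F V) (x : M) (w : V x) :
    D.dualAlong ξ x 0 w = 0 := by
  have h := D.dualAlong_apply ξ (secExt w) x 0
  rw [secExt_apply, map_zero, map_zero, map_zero, sub_zero] at h
  rw [h]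
  exact map_zero (mfderiv 𝓘(ℝ, EM) 𝓘(ℝ, ℝ) (pairing ξ (secExt w)) x)

end Connection

section Covariant

variable {F : Type*} [NormedAddCommGroup F] [NormedSpace ℝ F] [FiniteDimensional ℝ F]
  {V : M → Type*} [TopologicalSpace (TotalSpace F V)]
  [∀ x, AddCommGroup (V x)] [∀ x, Module ℝ (V x)]
  [∀ x, TopologicalSpace (V x)] [FiberBundle F V] [VectorBundle ℝ F V]
  [ContMDiffVectorBundle ∞ F V 𝓘(ℝ, EM)]

variable {L : LieAlgebroid EM FA A} {n : ℕ} {κ : CubeMorphism L n} {D : AConnection L F V}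
  {i : Fin n} {p : Fin n → ℝ}

/-- `u'` is the derivative `∇ᵢ u` at `p` of the section `u` of the pullback of `V` to the cube. -/
def HasCov (κ : CubeMorphism L n) (D : AConnection L F V) (i : Fin n)
    (u : ∀ p, V (κ.base p)) (p : Fin n → ℝ) (u' : V (κ.base p)) : Prop :=
  ∀ ξ : DualSec EM F V,
    HasDerivWithinAt (fun r => ξ (κ.base (Function.update p i r)) (u (Function.update p i r)))
      (D.dualAlong ξ (κ.base p) (κ.vec i p) (u p) + ξ (κ.base p) u') (Icc 0 1) (p i)

lemma HasCov.unique {u : ∀ p, V (κ.base p)} {u₁ u₂ : V (κ.base p)} (hp : p ∈ cube n)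
    (h₁ : HasCov κ D i u p u₁) (h₂ : HasCov κ D i u p u₂) : u₁ = u₂ := by
  refine eq_of_forall_dual (EM := EM) F fun ξ => ?_
  have hu := uniqueDiffOn_Icc (zero_lt_one (α := ℝ)) (p i) (mem_cube.1 hp i)
  have := hu.eq_deriv _ (h₁ ξ) (h₂ ξ)
  exact add_left_cancel this

lemma HasCov.add {u v : ∀ p, V (κ.base p)} {u' v' : V (κ.base p)} (hu : HasCov κ D i u p u')
    (hv : HasCov κ D i v p v') : HasCov κ D i (fun q => u q + v q) p (u' + v') := fun ξ => by
  simp only [map_add]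
  exact ((hu ξ).add (hv ξ)).congr_deriv (by ring)

lemma HasCov.sub {u v : ∀ p, V (κ.base p)} {u' v' : V (κ.base p)} (hu : HasCov κ D i u p u')
    (hv : HasCov κ D i v p v') : HasCov κ D i (fun q => u q - v q) p (u' - v') := fun ξ => by
  simp only [map_sub]
  exact ((hu ξ).sub (hv ξ)).congr_deriv (by ring)

lemma HasCov.sum {ι : Type*} {s : Finset ι} {u : ι → ∀ p, V (κ.base p)} {u' : ι → V (κ.base p)}
    (hu : ∀ k ∈ s, HasCov κ D i (u k) p (u' k)) :
    HasCov κ D i (fun q => ∑ k ∈ s, u k q) p (∑ k ∈ s, u' k) := fun ξ => by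
  simp only [map_sum]
  refine (HasDerivWithinAt.fun_sum fun k hk => hu k hk ξ).congr_deriv ?_
  rw [Finset.sum_add_distrib]

lemma HasCov.congr {u v : ∀ p, V (κ.base p)} {u' : V (κ.base p)} (hp : p ∈ cube n)
    (hu : HasCov κ D i u p u') (h : ∀ q ∈ cube n, v q = u q) : HasCov κ D i v p u' := fun ξ => by
  rw [h p hp]
  refine (hu ξ).congr (fun r hr => ?_) ?_
  · rw [h _ (update_mem_cube hp i hr)]
  · rw [Function.update_eq_self, h p hp]

lemma HasCov.congr_deriv {u : ∀ p, V (κ.base p)} {u' u'' : V (κ.base p)}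
    (hu : HasCov κ D i u p u') (h : u' = u'') : HasCov κ D i u p u'' := h ▸ hu

lemma hasDerivWithinAt_base (hp : p ∈ cube n) (i : Fin n) (f : SmoothFn EM M) :
    HasDerivWithinAt (fun r => f (κ.base (Function.update p i r)))
      (dirDeriv f (L.anchor (κ.base p) (κ.vec i p))) (Icc 0 1) (p i) := by
  have h := hasDerivWithinAt_line hp i ((κ.contDiffOn_base f).differentiableOn (by simp) p hp)
  rwa [κ.fderivWithin_base f i hp] at h

lemma HasCov.sec (hp : p ∈ cube n) (e : Sec EM F V) :
    HasCov κ D i (fun q => e (κ.base q)) p (D.along e (κ.base p) (κ.vec i p)) := fun ξ => by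
  refine (hasDerivWithinAt_base (κ := κ) hp i (pairing ξ e)).congr_deriv ?_
  rw [D.dualAlong_apply]
  ring

/-- The Leibniz rule for the product of a function on the cube and a section. -/
lemma HasCov.smul {f : (Fin n → ℝ) → ℝ} {f' : ℝ} {u : ∀ p, V (κ.base p)} {u' : V (κ.base p)}
    (hf : HasDerivWithinAt (fun r => f (Function.update p i r)) f' (Icc 0 1) (p i))
    (hu : HasCov κ D i u p u') :
    HasCov κ D i (fun q => f q • u q) p (f' • u p + f p • u') := fun ξ => by
  have h := hf.mul (hu ξ)
  simp only [map_smul, map_add, smul_eq_mul]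
  rw [Function.update_eq_self] at h
  exact h.congr_deriv (by ring)

lemma HasCov.smul_sec {f : (Fin n → ℝ) → ℝ} {f' : ℝ} (hp : p ∈ cube n)
    (hf : HasDerivWithinAt (fun r => f (Function.update p i r)) f' (Icc 0 1) (p i))
    (e : Sec EM F V) :
    HasCov κ D i (fun q => f q • e (κ.base q)) p
      (f' • e (κ.base p) + f p • D.along e (κ.base p) (κ.vec i p)) :=
  HasCov.smul hf (HasCov.sec hp e)

lemma HasCov.zero : HasCov κ D i (fun q => (0 : V (κ.base q))) p 0 := fun ξ => by
  simpa using hasDerivWithinAt_const (p i) (Icc (0 : ℝ) 1) (0 : ℝ)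

lemma exists_frame_nhds (κ : CubeMorphism L n) :
    ∃ S : Set M, (∀ p ∈ cube n, S ∈ 𝓝 (κ.base p)) ∧ Nonempty (FrameOn EM F V S) := by
  have : LocallyCompactSpace M := Manifold.locallyCompact_of_finiteDimensional 𝓘(ℝ, EM)
  obtain ⟨K, hK, hK'⟩ := exists_compact_superset
    ((isCompact_cube n).image_of_continuousOn κ.base_smooth.continuousOn)
  exact ⟨K, fun p hp => mem_interior_iff_mem_nhds.1 (hK' (mem_image_of_mem _ hp)),
    exists_frameOn F V hK⟩

/-- Covariant derivatives commute with bundle maps that intertwine the connections. -/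
lemma HasCov.map {F' : Type*} [NormedAddCommGroup F'] [NormedSpace ℝ F'] [FiniteDimensional ℝ F']
    {V' : M → Type*} [TopologicalSpace (TotalSpace F' V')]
    [∀ x, AddCommGroup (V' x)] [∀ x, Module ℝ (V' x)]
    [∀ x, TopologicalSpace (V' x)] [∀ x, IsTopologicalAddGroup (V' x)]
    [∀ x, ContinuousSMul ℝ (V' x)] [FiberBundle F' V'] [VectorBundle ℝ F' V']
    [ContMDiffVectorBundle ∞ F' V' 𝓘(ℝ, EM)] {D' : AConnection L F' V'}
    (d : BundleMap EM F V F' V')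
    (hd : ∀ α c, BundleMap.onSec d (D.toFun α c) = D'.toFun α (BundleMap.onSec d c))
    {u : ∀ p, V (κ.base p)} {u' : V (κ.base p)} (hp : p ∈ cube n) (hu : HasCov κ D i u p u') :
    HasCov κ D' i (fun q => d (κ.base q) (u q)) p (d (κ.base p) u') := by
  obtain ⟨S, hS, ⟨f⟩⟩ := exists_frame_nhds (F := F) (V := V) κ
  have hsum : ∀ q ∈ cube n, ∑ b, f.ξ b (κ.base q) (u q) • f.e b (κ.base q) = u q := fun q hq =>
    f.sum_eq _ (mem_of_mem_nhds (hS q hq)) _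
  have h1 := HasCov.sum (s := Finset.univ) fun b _ =>
    HasCov.smul_sec (κ := κ) (D := D) (f := fun q => f.ξ b (κ.base q) (u q)) hp (hu (f.ξ b)) (f.e b)
  have h2 := HasCov.sum (s := Finset.univ) fun b _ =>
    HasCov.smul_sec (κ := κ) (D := D') (f := fun q => f.ξ b (κ.base q) (u q)) hp (hu (f.ξ b))
      (BundleMap.onSec d (f.e b))
  refine (h2.congr hp fun q hq => ?_).congr_deriv ?_
  · conv_lhs => rw [← hsum q hq]
    rw [map_sum]
    simp only [map_smul]
    rfl
  · refine Eq.trans ?_ (congrArg (d (κ.base p))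
      ((h1.congr hp fun q hq => (hsum q hq).symm).unique hp hu))
    rw [map_sum]
    refine Finset.sum_congr rfl fun b _ => ?_
    rw [map_add, map_smul, map_smul]
    have h4 := congrArg (fun s : Sec EM F' V' => s (κ.base p)) (hd (secExt (κ.vec i p)) (f.e b))
    change d (κ.base p) (D.toFun _ _ (κ.base p)) = D'.toFun _ _ (κ.base p) at h4
    rw [D.toFun_apply, D'.toFun_apply, secExt_apply] at h4
    rw [h4]
    rfl

variable (κ D) in
lemma contDiffOn_along (ξ : DualSec EM F V) (e : Sec EM F V) (i : Fin n) :
    ContDiffOn ℝ ∞ (fun q => ξ (κ.base q) (D.along e (κ.base q) (κ.vec i q))) (cube n) := by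
  obtain ⟨S, hS, ⟨f⟩⟩ := exists_frame_nhds (F := FA) (V := A) κ
  have h : ContDiffOn ℝ ∞ (fun q => ∑ m, f.ξ m (κ.base q) (κ.vec i q)
      * pairing ξ (D.toFun (f.e m) e) (κ.base q)) (cube n) :=
    ContDiffOn.sum fun m _ => (κ.contDiffOn_dual (f.ξ m) i).mul (κ.contDiffOn_base _)
  refine h.congr fun q hq => ?_
  conv_lhs => rw [← f.sum_eq _ (mem_of_mem_nhds (hS q hq)) (κ.vec i q)]
  simp only [map_sum, map_smul, smul_eq_mul, pairing_apply, D.toFun_apply]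

variable (κ D) in
lemma continuousOn_dualAlong (ξ : DualSec EM F V) (e : Sec EM F V) (i : Fin n) :
    ContinuousOn (fun q => D.dualAlong ξ (κ.base q) (κ.vec i q) (e (κ.base q))) (cube n) := by
  have h1 : ContinuousOn (fun q => fderivWithin ℝ (fun q => pairing ξ e (κ.base q)) (cube n) q
      (Pi.single i 1)) (cube n) :=
    ((κ.contDiffOn_base (pairing ξ e)).continuousOn_fderivWithin (uniqueDiffOn_cube n)
      (by simp)).clm_apply continuousOn_const
  refine (h1.sub (contDiffOn_along κ D ξ e i).continuousOn).congr fun q hq => ?_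
  rw [Pi.sub_apply, D.dualAlong_apply, κ.fderivWithin_base _ i hq]

/-- A parallel section which vanishes at one point of a line vanishes on the line. -/
lemma HasCov.eq_zero_of_eq_zero {u : ∀ p, V (κ.base p)}
    (hp : p ∈ cube n)
    (hu : ∀ r ∈ Icc (0 : ℝ) 1, HasCov κ D i u (Function.update p i r) 0)
    {t₀ : ℝ} (ht₀ : t₀ ∈ Icc (0 : ℝ) 1) (h0 : u (Function.update p i t₀) = 0) : u p = 0 := by
  obtain ⟨S, hS, ⟨f⟩⟩ := exists_frame_nhds (F := F) (V := V) κ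
  have hsum : ∀ q ∈ cube n, ∑ b, f.ξ b (κ.base q) (u q) • f.e b (κ.base q) = u q := fun q hq =>
    f.sum_eq _ (mem_of_mem_nhds (hS q hq)) _
  have hl : ContinuousOn (fun r => Function.update p i r) (Icc (0 : ℝ) 1) :=
    (Continuous.update (f := fun _ : ℝ => p) continuous_const i continuous_id).continuousOn
  let g : Fin f.N → (Fin n → ℝ) → ℝ := fun b q => f.ξ b (κ.base q) (u q)
  have key := eq_zero_of_matrix_ode_of_eq_zero (ι := Fin f.N)
    (a := fun b c r => D.dualAlong (f.ξ b) (κ.base (Function.update p i r))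
      (κ.vec i (Function.update p i r)) (f.e c (κ.base (Function.update p i r))))
    (y := fun b r => g b (Function.update p i r))
    (fun b c => (continuousOn_dualAlong κ D (f.ξ b) (f.e c) i).comp hl
      fun r hr => update_mem_cube hp i hr)
    (fun b r hr => by
      have hq := update_mem_cube hp i hr
      have h : HasDerivWithinAt (fun r' => g b (Function.update (Function.update p i r) i r'))
        _ _ _ := hu r hr (f.ξ b)
      simp only [Function.update_idem, Function.update_self, map_zero, add_zero] at h
      refine h.congr_deriv ?_
      conv_lhs => rw [← hsum _ hq]
      rw [map_sum]
      refine Finset.sum_congr rfl fun c _ => ?_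
      rw [map_smul, smul_eq_mul, mul_comm])
    ht₀ (fun b => by
      change f.ξ b _ (u (Function.update p i t₀)) = 0
      rw [h0, map_zero]) (mem_cube.1 hp i)
  rw [← hsum p hp]
  refine Finset.sum_eq_zero fun b _ => ?_
  have h := key b
  rw [Function.update_eq_self] at h
  change g b p • _ = _
  rw [h, zero_smul]

lemma HasCov.eq_zero {u : ∀ p, V (κ.base p)} (hp : p ∈ cube n)
    (hu : ∀ r ∈ Icc (0 : ℝ) 1, HasCov κ D i u (Function.update p i r) 0)
    (h0 : u (Function.update p i 0) = 0) : u p = 0 :=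
  HasCov.eq_zero_of_eq_zero hp hu ⟨le_rfl, zero_le_one⟩ h0

end Covariant

section Curvature

variable {F : Type*} [NormedAddCommGroup F] [NormedSpace ℝ F] [FiniteDimensional ℝ F]
  {V : M → Type*} [TopologicalSpace (TotalSpace F V)]
  [∀ x, AddCommGroup (V x)] [∀ x, Module ℝ (V x)]
  [∀ x, TopologicalSpace (V x)] [FiberBundle F V] [VectorBundle ℝ F V]
  [ContMDiffVectorBundle ∞ F V 𝓘(ℝ, EM)]

variable {L : LieAlgebroid EM FA A} {n : ℕ} {κ : CubeMorphism L n} {D : AConnection L F V}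
  {i j k : Fin n} {p : Fin n → ℝ} {S : Set M}

/-- The extension of a vector to a section with constant coefficients in a frame. -/
def FrameOn.ext (f : FrameOn EM FA A S) {x : M} (v : A x) : Sec EM FA A :=
  ∑ k, f.ξ k x v • f.e k

lemma FrameOn.ext_apply (f : FrameOn EM FA A S) {x : M} (hx : x ∈ S) (v : A x) :
    f.ext v x = v := by
  rw [FrameOn.ext, sec_sum_apply]
  exact f.sum_eq x hx v

lemma FrameOn.sum_dirDeriv (f : FrameOn EM FA A S) {x : M} (hx : S ∈ 𝓝 x) (v : A x)
    (t : TangentSpace 𝓘(ℝ, EM) x) :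
    ∑ m, dirDeriv (pairing (f.ξ m) (f.ext v)) t • f.e m x = 0 := by
  refine eq_of_forall_dual (EM := EM) FA fun θ => ?_
  rw [map_zero, map_sum]
  have h1 : (⇑(pairing θ (f.ext v)) : M → ℝ) =ᶠ[𝓝 x]
      fun y => ∑ m, (pairing (f.ξ m) (f.ext v) * pairing θ (f.e m) : SmoothFn EM M) y := by
    filter_upwards [hx] with y hy
    rw [pairing_apply]
    conv_lhs => rw [← f.sum_eq y hy (f.ext v y)]
    simp
  have h2 : (⇑(pairing θ (f.ext v)) : M → ℝ)
      = fun y => ∑ m, (constFn EM M (f.ξ m x v) * pairing θ (f.e m) : SmoothFn EM M) y := by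
    funext y
    rw [pairing_apply, FrameOn.ext, sec_sum_apply]
    simp [coe_constFn]
  have h3 : ∀ g h : SmoothFn EM M, dirDeriv (⇑(g * h)) t
      = g x * dirDeriv h t + dirDeriv g t * h x := fun g h => dirDeriv_mul g h t
  have h4 := (dirDeriv_congr h1 t).symm
  rw [h2, dirDeriv_sum, dirDeriv_sum] at h4
  simp only [h3, coe_constFn, dirDeriv_const, Finset.sum_add_distrib, zero_mul,
    add_zero, pairing_apply, f.ext_apply (mem_of_mem_nhds hx)] at h4
  simp only [map_smul, smul_eq_mul]
  linarith

/-- The derivative `∂ᵢ(vec j)` computed in a frame. -/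
def FrameOn.partial (f : FrameOn EM FA A S) (κ : CubeMorphism L n) (i j : Fin n)
    (p : Fin n → ℝ) : A (κ.base p) :=
  ∑ m, fderivWithin ℝ (fun q => f.ξ m (κ.base q) (κ.vec j q)) (cube n) p (Pi.single i 1)
    • f.e m (κ.base p)

lemma FrameOn.partial_sub (f : FrameOn EM FA A S) (hp : p ∈ cube n) (hS : S ∈ 𝓝 (κ.base p)) :
    f.partial κ i j p - f.partial κ j i p
      = -L.bracket (f.ext (κ.vec i p)) (f.ext (κ.vec j p)) (κ.base p) := by
  have hx := mem_of_mem_nhds hS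
  rw [FrameOn.partial, FrameOn.partial, ← Finset.sum_sub_distrib]
  simp only [← sub_smul, κ.bracket_all i j hp]
  have h : ∀ m, dAt L (f.ξ m) (κ.base p) (κ.vec i p) (κ.vec j p)
      = dForm L (f.ξ m) (f.ext (κ.vec i p)) (f.ext (κ.vec j p)) (κ.base p) := fun m => by
    rw [dForm_eq_dAt, f.ext_apply hx, f.ext_apply hx]
  have h1 := f.sum_dirDeriv hS (κ.vec j p) (L.anchor (κ.base p) (κ.vec i p))
  have h2 := f.sum_dirDeriv hS (κ.vec i p) (L.anchor (κ.base p) (κ.vec j p))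
  simp only [coe_pairing] at h1 h2
  simp only [h, dForm, sub_smul, Finset.sum_sub_distrib, f.ext_apply hx]
  rw [h1, h2, f.sum_eq _ hx, sub_self, zero_sub]

/-- The derivative of a tensor evaluated on a component of a morphism. -/
lemma HasCov.tensor (f : FrameOn EM FA A S) (hS : ∀ q ∈ cube n, S ∈ 𝓝 (κ.base q))
    (hp : p ∈ cube n) (τ : ∀ x, A x →ₗ[ℝ] V x) (T : Sec EM FA A → Sec EM F V)
    (hT : ∀ α x, T α x = τ x (α x)) :
    HasCov κ D i (fun q => τ (κ.base q) (κ.vec j q)) p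
      (τ (κ.base p) (f.partial κ i j p)
        + D.along (T (f.ext (κ.vec j p))) (κ.base p) (κ.vec i p)) := by
  have h := HasCov.sum (κ := κ) (D := D) (i := i) (p := p) (s := Finset.univ) fun m _ =>
    HasCov.smul_sec (κ := κ) (D := D) (f := fun q => f.ξ m (κ.base q) (κ.vec j q)) hp
      (hasDerivWithinAt_line hp i ((κ.contDiffOn_dual (f.ξ m) j).differentiableOn (by simp) p hp))
      (T (f.e m))
  refine (h.congr hp fun q hq => ?_).congr_deriv ?_
  · conv_lhs => rw [← f.sum_eq _ (mem_of_mem_nhds (hS q hq)) (κ.vec j q)]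
    simp only [map_sum, map_smul, hT]
  · have hT' : T (f.ext (κ.vec j p))
        = ∑ m, f.ξ m (κ.base p) (κ.vec j p) • T (f.e m) := by
      ext y
      rw [hT, FrameOn.ext, sec_sum_apply, sec_sum_apply, map_sum]
      refine Finset.sum_congr rfl fun m _ => ?_
      change τ y ((_ : ℝ) • f.e m y) = (_ : ℝ) • T (f.e m) y
      rw [map_smul, hT]
    rw [hT', D.along_sum, FrameOn.partial, Finset.sum_add_distrib, map_sum]
    simp only [map_smul, hT, D.along_csmul]

lemma HasCov.tensor₂ (f : FrameOn EM FA A S) (hS : ∀ q ∈ cube n, S ∈ 𝓝 (κ.base q))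
    (hp : p ∈ cube n) (τ : ∀ x, A x →ₗ[ℝ] A x →ₗ[ℝ] V x)
    (T : Sec EM FA A → Sec EM FA A → Sec EM F V) (hT : ∀ α β x, T α β x = τ x (α x) (β x)) :
    HasCov κ D i (fun q => τ (κ.base q) (κ.vec j q) (κ.vec k q)) p
      (τ (κ.base p) (f.partial κ i j p) (κ.vec k p)
        + τ (κ.base p) (κ.vec j p) (f.partial κ i k p)
        + D.along (T (f.ext (κ.vec j p)) (f.ext (κ.vec k p))) (κ.base p) (κ.vec i p)) := by
  have h := HasCov.sum (κ := κ) (D := D) (i := i) (p := p) (s := Finset.univ) fun m _ =>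
    HasCov.smul (κ := κ) (D := D) (f := fun q => f.ξ m (κ.base q) (κ.vec j q))
      (hasDerivWithinAt_line hp i ((κ.contDiffOn_dual (f.ξ m) j).differentiableOn (by simp) p hp))
      (HasCov.tensor (D := D) (i := i) (j := k) f hS hp (fun x => τ x (f.e m x)) (T (f.e m))
        fun α x => hT _ α x)
  refine (h.congr hp fun q hq => ?_).congr_deriv ?_
  · conv_lhs => rw [← f.sum_eq _ (mem_of_mem_nhds (hS q hq)) (κ.vec j q)]
    simp only [map_sum, map_smul, LinearMap.sum_apply, LinearMap.smul_apply]
  · have hT' : T (f.ext (κ.vec j p)) (f.ext (κ.vec k p))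
        = ∑ m, f.ξ m (κ.base p) (κ.vec j p) • T (f.e m) (f.ext (κ.vec k p)) := by
      ext y
      rw [hT, FrameOn.ext, sec_sum_apply, sec_sum_apply, map_sum, LinearMap.sum_apply]
      refine Finset.sum_congr rfl fun m _ => ?_
      change τ y ((_ : ℝ) • f.e m y) _ = (_ : ℝ) • T (f.e m) _ y
      rw [map_smul, hT, LinearMap.smul_apply]
    rw [hT', D.along_sum]
    have hj : τ (κ.base p) (κ.vec j p)
        = ∑ m, f.ξ m (κ.base p) (κ.vec j p) • τ (κ.base p) (f.e m (κ.base p)) := by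
      conv_lhs => rw [← f.sum_eq _ (mem_of_mem_nhds (hS p hp)) (κ.vec j p)]
      simp only [map_sum, map_smul]
    have hi : τ (κ.base p) (f.partial κ i j p) = ∑ m, fderivWithin ℝ
        (fun q => f.ξ m (κ.base q) (κ.vec j q)) (cube n) p (Pi.single i 1)
          • τ (κ.base p) (f.e m (κ.base p)) := by
      simp only [FrameOn.partial, map_sum, map_smul]
    simp only [hi, hj, LinearMap.sum_apply, LinearMap.smul_apply, smul_add,
      Finset.sum_add_distrib, D.along_csmul, add_assoc]

/-- The commutator of the derivatives in two directions is the curvature. -/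
lemma exists_hasCov_comm (f : FrameOn EM FA A S) (hS : ∀ q ∈ cube n, S ∈ 𝓝 (κ.base q))
    (hp : p ∈ cube n) {ι : Type*} [Fintype ι] (e : ι → Sec EM F V)
    {y yi yj : ι → (Fin n → ℝ) → ℝ} {yij : ι → ℝ}
    (hi : ∀ b, HasDerivWithinAt (fun r => y b (Function.update p i r)) (yi b p) (Icc 0 1) (p i))
    (hj : ∀ b, HasDerivWithinAt (fun r => y b (Function.update p j r)) (yj b p) (Icc 0 1) (p j))
    (hij : ∀ b, HasDerivWithinAt (fun r => yj b (Function.update p i r)) (yij b) (Icc 0 1) (p i))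
    (hji : ∀ b, HasDerivWithinAt (fun r => yi b (Function.update p j r)) (yij b) (Icc 0 1) (p j)) :
    ∃ a : V (κ.base p),
      HasCov κ D j (fun q => ∑ b, (yi b q • e b (κ.base q)
        + y b q • D.along (e b) (κ.base q) (κ.vec i q))) p a ∧
      HasCov κ D i (fun q => ∑ b, (yj b q • e b (κ.base q)
        + y b q • D.along (e b) (κ.base q) (κ.vec j q))) p
        (a + ∑ b, y b p • D.curv (f.ext (κ.vec i p)) (f.ext (κ.vec j p)) (e b) (κ.base p)) := by
  have hx := mem_of_mem_nhds (hS p hp)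
  have key : ∀ (i j : Fin n) (yi yj : ι → (Fin n → ℝ) → ℝ),
      (∀ b, HasDerivWithinAt (fun r => y b (Function.update p i r)) (yi b p) (Icc 0 1) (p i)) →
      (∀ b, HasDerivWithinAt (fun r => yj b (Function.update p i r)) (yij b) (Icc 0 1) (p i)) →
      HasCov κ D i (fun q => ∑ b, (yj b q • e b (κ.base q)
        + y b q • D.along (e b) (κ.base q) (κ.vec j q))) p
        (∑ b, ((yij b • e b (κ.base p) + yj b p • D.along (e b) (κ.base p) (κ.vec i p))
          + (yi b p • D.along (e b) (κ.base p) (κ.vec j p)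
            + y b p • (D.along (e b) (κ.base p) (f.partial κ i j p)
              + D.toFun (f.ext (κ.vec i p)) (D.toFun (f.ext (κ.vec j p)) (e b)) (κ.base p))))) := by
    intro i j yi yj hi hij
    refine HasCov.sum fun b _ => (HasCov.smul_sec hp (hij b) (e b)).add
      (HasCov.smul (hi b) ?_)
    have h := HasCov.tensor (D := D) (i := i) (j := j) f hS hp (fun x => D.along (e b) x)
      (fun α => D.toFun α (e b)) fun α x => D.toFun_apply α (e b) x
    rw [D.toFun_apply (f.ext (κ.vec i p)), f.ext_apply hx]
    exact h
  refine ⟨_, key j i yj yi hj hji, (key i j yi yj hi hij).congr_deriv ?_⟩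
  rw [← Finset.sum_add_distrib]
  refine Finset.sum_congr rfl fun b _ => ?_
  have h1 := congrArg (D.along (e b) (κ.base p)) (f.partial_sub (i := i) (j := j) hp (hS p hp))
  rw [map_sub, map_neg, ← D.toFun_apply] at h1
  have h2 : D.curv (f.ext (κ.vec i p)) (f.ext (κ.vec j p)) (e b) (κ.base p)
      = D.toFun (f.ext (κ.vec i p)) (D.toFun (f.ext (κ.vec j p)) (e b)) (κ.base p)
        - D.toFun (f.ext (κ.vec j p)) (D.toFun (f.ext (κ.vec i p)) (e b)) (κ.base p)
        + (D.along (e b) (κ.base p) (f.partial κ i j p)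
          - D.along (e b) (κ.base p) (f.partial κ j i p)) := by
    rw [h1, ← sub_eq_add_neg]
    rfl
  rw [h2]
  module

end Curvature

section Representation

variable {FE : Type*} [NormedAddCommGroup FE] [NormedSpace ℝ FE] [FiniteDimensional ℝ FE]
  {E : M → Type*} [TopologicalSpace (TotalSpace FE E)]
  [∀ x, AddCommGroup (E x)] [∀ x, Module ℝ (E x)] [∀ x, TopologicalSpace (E x)]
  [∀ x, IsTopologicalAddGroup (E x)] [∀ x, ContinuousSMul ℝ (E x)]
  [FiberBundle FE E] [VectorBundle ℝ FE E] [ContMDiffVectorBundle ∞ FE E 𝓘(ℝ, EM)]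
  {FC : Type*} [NormedAddCommGroup FC] [NormedSpace ℝ FC] [FiniteDimensional ℝ FC]
  {C : M → Type*} [TopologicalSpace (TotalSpace FC C)]
  [∀ x, AddCommGroup (C x)] [∀ x, Module ℝ (C x)] [∀ x, TopologicalSpace (C x)]
  [∀ x, IsTopologicalAddGroup (C x)] [∀ x, ContinuousSMul ℝ (C x)]
  [FiberBundle FC C] [VectorBundle ℝ FC C] [ContMDiffVectorBundle ∞ FC C 𝓘(ℝ, EM)]
  {L : LieAlgebroid EM FA A} {d : BundleMap EM FC C FE E}

section Lift

/-- `ω(v, w)ε` as a bilinear function of `v` and `w`. -/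
def HomTwoForm.bilin (Ω : HomTwoForm EM FA A FE E FC C) (x : M) (ε : E x) :
    A x →ₗ[ℝ] A x →ₗ[ℝ] C x :=
  have hs : ∀ v w : A x, Ω.form x ![v, w] = -Ω.form x ![w, v] := fun v w => by
    have h := (Ω.form x).map_swap ![w, v] (show (0 : Fin 2) ≠ 1 by decide)
    rw [← h]
    congr 1
    funext k
    fin_cases k <;> rfl
  LinearMap.mk₂ ℝ (fun v w => Ω.form x ![v, w] ε)
    (fun v v' w => by rw [AlternatingMap.map_vecCons_add]; rfl)
    (fun c v w => by rw [AlternatingMap.map_vecCons_smul]; rfl)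
    (fun v w w' => by
      rw [hs v, AlternatingMap.map_vecCons_add, hs v w, hs v w', neg_add]; rfl)
    (fun c v w => by rw [hs v, AlternatingMap.map_vecCons_smul, hs v w, ← smul_neg]; rfl)

variable (Ω : HomTwoForm EM FA A FE E FC C)

lemma HomTwoForm.bilin_apply (x : M) (ε : E x) (v w : A x) :
    Ω.bilin x ε v w = Ω.form x ![v, w] ε := rfl

lemma HomTwoForm.bilin_swap (x : M) (ε : E x) (v w : A x) :
    Ω.bilin x ε v w = -Ω.bilin x ε w v := by
  have h := (Ω.form x).map_swap ![w, v] (show (0 : Fin 2) ≠ 1 by decide)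
  have h2 : ![w, v] ∘ ⇑(Equiv.swap (0 : Fin 2) 1) = ![v, w] := by
    funext k
    fin_cases k <;> rfl
  rw [h2] at h
  rw [Ω.bilin_apply, Ω.bilin_apply, h]
  rfl

lemma HomTwoForm.onSec_apply (α β : Sec EM FA A) (e : Sec EM FE E) (x : M) :
    Ω.onSec α β e x = Ω.bilin x (e x) (α x) (β x) := rfl

lemma HomTwoForm.bilin_sum {ι : Type*} (s : Finset ι) (x : M) (c : ι → ℝ) (ε : ι → E x)
    (v w : A x) :
    Ω.bilin x (∑ b ∈ s, c b • ε b) v w = ∑ b ∈ s, c b • Ω.bilin x (ε b) v w := by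
  simp only [Ω.bilin_apply, map_sum, map_smul]

variable {n : ℕ}

lemma contDiffOn_bilin (κ : CubeMorphism L n) (ξ : DualSec EM FC C) (e : Sec EM FE E)
    (i j : Fin n) :
    ContDiffOn ℝ ∞ (fun q => ξ (κ.base q)
      (Ω.bilin (κ.base q) (e (κ.base q)) (κ.vec i q) (κ.vec j q))) (cube n) := by
  obtain ⟨S, hS, ⟨f⟩⟩ := exists_frame_nhds (F := FA) (V := A) κ
  have h : ContDiffOn ℝ ∞ (fun q => ∑ m, ∑ l, f.ξ m (κ.base q) (κ.vec i q)
      * (f.ξ l (κ.base q) (κ.vec j q) * pairing ξ (Ω.onSec (f.e m) (f.e l) e) (κ.base q)))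
      (cube n) :=
    ContDiffOn.sum fun m _ => ContDiffOn.sum fun l _ => (κ.contDiffOn_dual (f.ξ m) i).mul
      ((κ.contDiffOn_dual (f.ξ l) j).mul (κ.contDiffOn_base _))
  refine h.congr fun q hq => ?_
  conv_lhs => rw [← f.sum_eq _ (mem_of_mem_nhds (hS q hq)) (κ.vec i q),
    ← f.sum_eq _ (mem_of_mem_nhds (hS q hq)) (κ.vec j q)]
  simp only [map_sum, map_smul, LinearMap.sum_apply, LinearMap.smul_apply, smul_eq_mul,
    pairing_apply, Ω.onSec_apply, Finset.mul_sum]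
  rw [Finset.sum_comm]
  refine Finset.sum_congr rfl fun m _ => Finset.sum_congr rfl fun l _ => ?_
  ring

variable {S : Set M} (R : RepUpToHomotopy L d) (κ : CubeMorphism L (n + 1))

/-- The coefficients of the linear system for a parallel section `u` of `E` and the sections `wᵢ`
of `C` with `∇₀wᵢ = ω(vec 0, vec i)u`, in frames. -/
def liftCoeff (fE : FrameOn EM FE E S) (fC : FrameOn EM FC C S) :
    Fin fE.N ⊕ Fin (n + 1) × Fin fC.N → Fin fE.N ⊕ Fin (n + 1) × Fin fC.N →
      (Fin (n + 1) → ℝ) → ℝ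
  | .inl b, .inl c => fun q => -fE.ξ b (κ.base q) (R.connE.along (fE.e c) (κ.base q) (κ.vec 0 q))
  | .inl _, .inr _ => fun _ => 0
  | .inr b, .inl c => fun q => fC.ξ b.2 (κ.base q)
      (R.omega.bilin (κ.base q) (fE.e c (κ.base q)) (κ.vec 0 q) (κ.vec b.1 q))
  | .inr b, .inr c => fun q => if b.1 = c.1 then
      -fC.ξ b.2 (κ.base q) (R.connC.along (fC.e c.2) (κ.base q) (κ.vec 0 q)) else 0

lemma contDiffOn_liftCoeff (fE : FrameOn EM FE E S) (fC : FrameOn EM FC C S)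
    (b c : Fin fE.N ⊕ Fin (n + 1) × Fin fC.N) :
    ContDiffOn ℝ ∞ (liftCoeff R κ fE fC b c) (cube (n + 1)) := by
  rcases b with b | b <;> rcases c with c | c
  · exact (contDiffOn_along κ R.connE (fE.ξ b) (fE.e c) 0).neg
  · exact contDiffOn_const
  · exact contDiffOn_bilin R.omega κ (fC.ξ b.2) (fE.e c) 0 b.1
  · by_cases h : b.1 = c.1
    · simp only [liftCoeff, h, if_true]
      exact (contDiffOn_along κ R.connC (fC.ξ b.2) (fC.e c.2) 0).neg
    · simp only [liftCoeff, h, if_false]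
      exact contDiffOn_const

/-- The coordinates, in frames, of the parallel section `u` of `E` along a cube with initial value
`e`, and of the sections `wᵢ` of `C` with `∇₀wᵢ = ω(vec 0, vec i)u` which vanish at the start. -/
structure LiftData {x : M} (e : E x) where
  S : Set M
  S_mem : ∀ q ∈ cube (n + 1), S ∈ 𝓝 (κ.base q)
  fA : FrameOn EM FA A S
  fE : FrameOn EM FE E S
  fC : FrameOn EM FC C S
  init : Fin fE.N → ℝ
  sum_init : ∑ b, init b • fE.e b x = e
  y : Fin fE.N ⊕ Fin (n + 1) × Fin fC.N → (Fin (n + 1) → ℝ) → ℝ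
  z : Fin (n + 1) → Fin fE.N ⊕ Fin (n + 1) × Fin fC.N → (Fin (n + 1) → ℝ) → ℝ
  y_cont : ∀ b, Continuous (y b)
  z_cont : ∀ k, k ≠ 0 → ∀ b, Continuous (z k b)
  y_inl : ∀ b, ∀ p ∈ cube (n + 1), p 0 = 0 → y (.inl b) p = init b
  y_inr : ∀ b, ∀ p ∈ cube (n + 1), p 0 = 0 → y (.inr b) p = 0
  z_zero : ∀ k, k ≠ 0 → ∀ b, ∀ p ∈ cube (n + 1), p 0 = 0 → z k b p = 0
  y_deriv : ∀ b, ∀ p ∈ cube (n + 1), HasDerivWithinAt (fun r => y b (Function.update p 0 r))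
    (∑ c, liftCoeff R κ fE fC b c p * y c p) (Icc 0 1) (p 0)
  y_partial : ∀ k, k ≠ 0 → ∀ b, ∀ p ∈ cube (n + 1),
    HasDerivWithinAt (fun r => y b (Function.update p k r)) (z k b p) (Icc 0 1) (p k)
  y_mixed : ∀ k, k ≠ 0 → ∀ b, ∀ p ∈ cube (n + 1), ∃ m : ℝ,
    HasDerivWithinAt (fun r => z k b (Function.update p 0 r)) m (Icc 0 1) (p 0) ∧
    HasDerivWithinAt (fun r => ∑ c, liftCoeff R κ fE fC b c (Function.update p k r)
      * y c (Function.update p k r)) m (Icc 0 1) (p k)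

lemma FrameOn.mono {F : Type*} [NormedAddCommGroup F] [NormedSpace ℝ F]
    {V : M → Type*} [TopologicalSpace (TotalSpace F V)]
    [∀ x, AddCommGroup (V x)] [∀ x, Module ℝ (V x)]
    [∀ x, TopologicalSpace (V x)] [FiberBundle F V] [VectorBundle ℝ F V] {T : Set M}
    (h : Nonempty (FrameOn EM F V T)) (hS : S ⊆ T) : Nonempty (FrameOn EM F V S) := by
  obtain ⟨f⟩ := h
  exact ⟨⟨f.N, f.e, f.ξ, fun y hy => f.sum_eq y (hS hy)⟩⟩

lemma nonempty_liftData {x : M} (hx : BdyAt κ 0 x) (e : E x) : Nonempty (LiftData R κ e) := by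
  obtain ⟨S₁, h₁, f₁⟩ := exists_frame_nhds (F := FA) (V := A) κ
  obtain ⟨S₂, h₂, f₂⟩ := exists_frame_nhds (F := FE) (V := E) κ
  obtain ⟨S₃, h₃, f₃⟩ := exists_frame_nhds (F := FC) (V := C) κ
  obtain ⟨fA⟩ := FrameOn.mono (S := S₁ ∩ (S₂ ∩ S₃)) f₁ inter_subset_left
  obtain ⟨fE⟩ := FrameOn.mono (S := S₁ ∩ (S₂ ∩ S₃)) f₂ fun y hy => hy.2.1
  obtain ⟨fC⟩ := FrameOn.mono (S := S₁ ∩ (S₂ ∩ S₃)) f₃ fun y hy => hy.2.2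
  have hS : ∀ q ∈ cube (n + 1), S₁ ∩ (S₂ ∩ S₃) ∈ 𝓝 (κ.base q) := fun q hq =>
    inter_mem (h₁ q hq) (inter_mem (h₂ q hq) (h₃ q hq))
  have h0 : (0 : Fin (n + 1) → ℝ) ∈ cube (n + 1) := mem_cube.2 fun _ => zero_mem_I
  have hxS : x ∈ S₁ ∩ (S₂ ∩ S₃) := by
    rw [← hx.base h0 rfl]
    exact mem_of_mem_nhds (hS 0 h0)
  obtain ⟨y, z, h1, h2, h3, h4, h5, h6, h7, h8⟩ := exists_matrix_ode
    (contDiffOn_liftCoeff R κ fE fC) (Sum.elim (fun b => fE.ξ b x e) fun _ => 0)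
  exact ⟨{
    S := _
    S_mem := hS
    fA := fA
    fE := fE
    fC := fC
    init := fun b => fE.ξ b x e
    sum_init := fE.sum_eq x hxS e
    y := y
    z := z
    y_cont := h1
    z_cont := h2
    y_inl := fun b => h3 (.inl b)
    y_inr := fun b => h3 (.inr b)
    z_zero := h4
    y_deriv := h5
    y_partial := h6
    y_mixed := fun k hk b p hp => ⟨_, h7 k hk b p hp, h8 k hk b p hp⟩ }⟩

end Lift

section LiftEquations

variable {n : ℕ} {R : RepUpToHomotopy L d} {κ : CubeMorphism L (n + 1)} {x : M} {e : E x}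

namespace LiftData

variable (l : LiftData R κ e)

/-- The parallel section of `E`. -/
def u (p : Fin (n + 1) → ℝ) : E (κ.base p) := ∑ b, l.y (.inl b) p • l.fE.e b (κ.base p)

/-- The sections of `C`. -/
def w (i : Fin (n + 1)) (p : Fin (n + 1) → ℝ) : C (κ.base p) :=
  ∑ b, l.y (.inr (i, b)) p • l.fC.e b (κ.base p)

/-- The derivatives of the coordinates in the first direction. -/
def rate (b : Fin l.fE.N ⊕ Fin (n + 1) × Fin l.fC.N) (p : Fin (n + 1) → ℝ) : ℝ :=
  ∑ c, liftCoeff R κ l.fE l.fC b c p * l.y c p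

variable {p : Fin (n + 1) → ℝ}

lemma mem (hp : p ∈ cube (n + 1)) : κ.base p ∈ l.S := mem_of_mem_nhds (l.S_mem p hp)

lemma sum_rate_inl (hp : p ∈ cube (n + 1)) :
    ∑ b, (l.rate (.inl b) p • l.fE.e b (κ.base p)
      + l.y (.inl b) p • R.connE.along (l.fE.e b) (κ.base p) (κ.vec 0 p)) = 0 := by
  have h : ∀ b, l.rate (.inl b) p
      = -l.fE.ξ b (κ.base p) (∑ c, l.y (.inl c) p
        • R.connE.along (l.fE.e c) (κ.base p) (κ.vec 0 p)) := fun b => by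
    simp only [rate, Fintype.sum_sum_type, liftCoeff, zero_mul, Finset.sum_const_zero, add_zero,
      map_sum, map_smul, smul_eq_mul, neg_mul, Finset.sum_neg_distrib]
    exact congrArg _ (Finset.sum_congr rfl fun c _ => mul_comm _ _)
  rw [Finset.sum_add_distrib]
  simp only [h, neg_smul, Finset.sum_neg_distrib]
  rw [l.fE.sum_eq _ (l.mem hp), neg_add_cancel]

lemma sum_rate_inr (hp : p ∈ cube (n + 1)) (i : Fin (n + 1)) :
    ∑ b, (l.rate (.inr (i, b)) p • l.fC.e b (κ.base p)
      + l.y (.inr (i, b)) p • R.connC.along (l.fC.e b) (κ.base p) (κ.vec 0 p))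
      = R.omega.bilin (κ.base p) (l.u p) (κ.vec 0 p) (κ.vec i p) := by
  have h : ∀ b, l.rate (.inr (i, b)) p
      = l.fC.ξ b (κ.base p) (R.omega.bilin (κ.base p) (l.u p) (κ.vec 0 p) (κ.vec i p)
        - ∑ c, l.y (.inr (i, c)) p
          • R.connC.along (l.fC.e c) (κ.base p) (κ.vec 0 p)) := fun b => by
    rw [u, R.omega.bilin_sum]
    simp only [rate, Fintype.sum_sum_type, liftCoeff, Fintype.sum_prod_type, ite_mul, zero_mul,
      map_sub, map_sum, map_smul, smul_eq_mul, neg_mul]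
    rw [sub_eq_add_neg, ← Finset.sum_neg_distrib, Finset.sum_comm]
    refine congrArg₂ _ (Finset.sum_congr rfl fun c _ => mul_comm _ _)
      (Finset.sum_congr rfl fun c _ => ?_)
    rw [Finset.sum_ite_eq, if_pos (Finset.mem_univ _), mul_comm]
  rw [Finset.sum_add_distrib]
  simp only [h]
  rw [l.fC.sum_eq _ (l.mem hp), sub_add_cancel]

lemma cov_u (hp : p ∈ cube (n + 1)) : HasCov κ R.connE 0 l.u p 0 :=
  (HasCov.sum fun b _ => HasCov.smul_sec hp (l.y_deriv (.inl b) p hp) (l.fE.e b)).congr_deriv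
    (l.sum_rate_inl hp)

lemma cov_w (hp : p ∈ cube (n + 1)) (i : Fin (n + 1)) : HasCov κ R.connC 0 (l.w i) p
    (R.omega.bilin (κ.base p) (l.u p) (κ.vec 0 p) (κ.vec i p)) :=
  (HasCov.sum fun b _ => HasCov.smul_sec hp (l.y_deriv (.inr (i, b)) p hp) (l.fC.e b)).congr_deriv
    (l.sum_rate_inr hp i)

/-- The derivative of `u` in another direction. -/
def uk (k : Fin (n + 1)) (p : Fin (n + 1) → ℝ) : E (κ.base p) :=
  ∑ b, (l.z k (.inl b) p • l.fE.e b (κ.base p)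
    + l.y (.inl b) p • R.connE.along (l.fE.e b) (κ.base p) (κ.vec k p))

/-- The derivative of `wᵢ` in another direction. -/
def wk (k i : Fin (n + 1)) (p : Fin (n + 1) → ℝ) : C (κ.base p) :=
  ∑ b, (l.z k (.inr (i, b)) p • l.fC.e b (κ.base p)
    + l.y (.inr (i, b)) p • R.connC.along (l.fC.e b) (κ.base p) (κ.vec k p))

lemma cov_u_uk {k : Fin (n + 1)} (hk : k ≠ 0) (hp : p ∈ cube (n + 1)) :
    HasCov κ R.connE k l.u p (l.uk k p) :=
  HasCov.sum fun b _ => HasCov.smul_sec hp (l.y_partial k hk (.inl b) p hp) (l.fE.e b)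

lemma w_zero (hp : p ∈ cube (n + 1)) (h0 : p 0 = 0) (i : Fin (n + 1)) : l.w i p = 0 := by
  simp only [w, l.y_inr _ p hp h0, zero_smul, Finset.sum_const_zero]

lemma uk_zero (hx : BdyAt κ 0 x) {k : Fin (n + 1)} (hk : k ≠ 0) (hp : p ∈ cube (n + 1))
    (h0 : p 0 = 0) : l.uk k p = 0 := by
  simp only [uk, l.z_zero k hk _ p hp h0, hx.vec hp h0 hk, zero_smul, map_zero, smul_zero,
    add_zero, Finset.sum_const_zero]

lemma wk_zero (hx : BdyAt κ 0 x) {k : Fin (n + 1)} (hk : k ≠ 0) (i : Fin (n + 1))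
    (hp : p ∈ cube (n + 1)) (h0 : p 0 = 0) : l.wk k i p = 0 := by
  simp only [wk, l.z_zero k hk _ p hp h0, hx.vec hp h0 hk, zero_smul, map_zero, smul_zero,
    add_zero, Finset.sum_const_zero]

lemma cov_uk {k : Fin (n + 1)} (hk : k ≠ 0) (hp : p ∈ cube (n + 1)) :
    HasCov κ R.connE 0 (l.uk k) p
      (d (κ.base p) (R.omega.bilin (κ.base p) (l.u p) (κ.vec 0 p) (κ.vec k p))) := by
  choose m hm hm' using fun b => l.y_mixed k hk (.inl b) p hp
  obtain ⟨a, ha, ha'⟩ := exists_hasCov_comm (D := R.connE) (i := 0) (j := k) l.fA l.S_mem hp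
    l.fE.e (yi := fun b => l.rate (.inl b)) (yj := fun b => l.z k (.inl b))
    (fun b => l.y_deriv (.inl b) p hp) (fun b => l.y_partial k hk (.inl b) p hp) hm hm'
  have h0 : a = 0 := ha.unique hp (HasCov.zero.congr hp fun q hq => l.sum_rate_inl hq)
  refine ha'.congr_deriv ?_
  rw [h0, zero_add, u, R.omega.bilin_sum, map_sum]
  refine Finset.sum_congr rfl fun b _ => ?_
  rw [← R.d_omega, map_smul]
  congr 1
  change d (κ.base p) (R.omega.onSec _ _ _ (κ.base p)) = _
  rw [R.omega.onSec_apply, l.fA.ext_apply (l.mem hp), l.fA.ext_apply (l.mem hp)]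

/-- `∇ₖu = ∂wₖ`. -/
lemma uk_eq (hx : BdyAt κ 0 x) {k : Fin (n + 1)} (hk : k ≠ 0) (hp : p ∈ cube (n + 1)) :
    l.uk k p = d (κ.base p) (l.w k p) := by
  rw [← sub_eq_zero]
  refine HasCov.eq_zero (κ := κ) (D := R.connE) (i := 0) (u := fun q => l.uk k q
    - d (κ.base q) (l.w k q)) hp (fun r hr => ?_) ?_
  · have hq := update_mem_cube hp 0 hr
    refine ((l.cov_uk hk hq).sub ((l.cov_w hq k).map d R.chain hq)).congr_deriv (sub_self _)
  · have hq := update_mem_cube hp 0 zero_mem_I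
    have h0 : Function.update p 0 (0 : ℝ) 0 = 0 := Function.update_self ..
    change l.uk k (Function.update p 0 0) - d _ (l.w k (Function.update p 0 0)) = 0
    rw [l.uk_zero hx hk hq h0, l.w_zero hq h0, map_zero, sub_zero]

lemma cov_u_k (hx : BdyAt κ 0 x) {k : Fin (n + 1)} (hk : k ≠ 0) (hp : p ∈ cube (n + 1)) :
    HasCov κ R.connE k l.u p (d (κ.base p) (l.w k p)) :=
  (l.cov_u_uk hk hp).congr_deriv (l.uk_eq hx hk hp)

end LiftData

end LiftEquations

section LiftCommutation

variable {n : ℕ} {R : RepUpToHomotopy L d} {κ : CubeMorphism L (n + 1)} {x : M} {e : E x}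

namespace LiftData

variable (l : LiftData R κ e)

/-- The covariant derivative of the form `ω(vec j, vec k)` in the direction `m`, applied to an element
of the frame of `E`. -/
def covForm (m j k : Fin (n + 1)) (b : Fin l.fE.N) (p : Fin (n + 1) → ℝ) : C (κ.base p) :=
  R.omega.bilin (κ.base p) (l.fE.e b (κ.base p)) (l.fA.partial κ m j p) (κ.vec k p)
    + R.omega.bilin (κ.base p) (l.fE.e b (κ.base p)) (κ.vec j p) (l.fA.partial κ m k p)
    + R.connC.along (R.omega.onSec (l.fA.ext (κ.vec j p)) (l.fA.ext (κ.vec k p)) (l.fE.e b))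
        (κ.base p) (κ.vec m p)
    - R.omega.bilin (κ.base p) (R.connE.along (l.fE.e b) (κ.base p) (κ.vec m p))
        (κ.vec j p) (κ.vec k p)

variable {p : Fin (n + 1) → ℝ}

lemma bilin_add (Ω : HomTwoForm EM FA A FE E FC C) (x : M) (ε ε' : E x) (v w : A x) :
    Ω.bilin x (ε + ε') v w = Ω.bilin x ε v w + Ω.bilin x ε' v w := by
  simp only [Ω.bilin_apply, map_add]

lemma bilin_zero (Ω : HomTwoForm EM FA A FE E FC C) (x : M) (v w : A x) :
    Ω.bilin x (0 : E x) v w = 0 := by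
  simp only [Ω.bilin_apply, map_zero]

lemma cov_omega (hp : p ∈ cube (n + 1)) (m j k : Fin (n + 1)) {y' : Fin l.fE.N → ℝ}
    (hy : ∀ b, HasDerivWithinAt (fun r => l.y (.inl b) (Function.update p m r)) (y' b)
      (Icc 0 1) (p m)) :
    HasCov κ R.connC m
      (fun q => R.omega.bilin (κ.base q) (l.u q) (κ.vec j q) (κ.vec k q)) p
      (R.omega.bilin (κ.base p) (∑ b, (y' b • l.fE.e b (κ.base p)
        + l.y (.inl b) p • R.connE.along (l.fE.e b) (κ.base p) (κ.vec m p)))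
          (κ.vec j p) (κ.vec k p)
        + ∑ b, l.y (.inl b) p • l.covForm m j k b p) := by
  have h := HasCov.sum (κ := κ) (D := R.connC) (i := m) (p := p) (s := Finset.univ) fun b _ =>
    HasCov.smul (hy b) (HasCov.tensor₂ (D := R.connC) (i := m) (j := j) (k := k) l.fA l.S_mem hp
      (fun x => R.omega.bilin x (l.fE.e b x)) (fun α β => R.omega.onSec α β (l.fE.e b))
      fun α β x => R.omega.onSec_apply α β _ x)
  refine (h.congr hp fun q _ => ?_).congr_deriv ?_
  · rw [u, R.omega.bilin_sum]
  · have hs := Finset.sum_add_distrib (s := Finset.univ) (f := fun b => y' b • l.fE.e b (κ.base p))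
      (g := fun b => l.y (.inl b) p • R.connE.along (l.fE.e b) (κ.base p) (κ.vec m p))
    rw [hs, bilin_add, R.omega.bilin_sum, R.omega.bilin_sum,
      ← Finset.sum_add_distrib, ← Finset.sum_add_distrib]
    refine Finset.sum_congr rfl fun b _ => ?_
    rw [covForm]
    module

lemma covForm_cyclic (hp : p ∈ cube (n + 1)) (i j k : Fin (n + 1)) (b : Fin l.fE.N) :
    l.covForm i j k b p + l.covForm j k i b p + l.covForm k i j b p = 0 := by
  have hx := l.mem hp
  have h := congrArg (fun s : Sec EM FC C => s (κ.base p)) (R.closed (l.fA.ext (κ.vec i p))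
    (l.fA.ext (κ.vec j p)) (l.fA.ext (κ.vec k p)) (l.fE.e b))
  simp only [ContMDiffSection.coe_add, ContMDiffSection.coe_sub, ContMDiffSection.coe_zero,
    Pi.add_apply, Pi.sub_apply, Pi.zero_apply, R.omega.onSec_apply, AConnection.toFun_apply,
    l.fA.ext_apply hx] at h
  have h1 := fun i j => neg_eq_iff_eq_neg.2 (l.fA.partial_sub (i := i) (j := j) hp (l.S_mem p hp))
  simp only [← h1, map_neg, map_sub, LinearMap.neg_apply, LinearMap.sub_apply] at h
  have hs := fun v w => R.omega.bilin_swap (κ.base p) (l.fE.e b (κ.base p)) v w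
  rw [← h]
  simp only [covForm]
  rw [hs (κ.vec j p) (l.fA.partial κ i k p), hs (κ.vec k p) (l.fA.partial κ j i p),
    hs (κ.vec i p) (l.fA.partial κ k j p)]
  abel

lemma covForm_swap (i j k : Fin (n + 1)) (b : Fin l.fE.N) :
    l.covForm i j k b p = -l.covForm i k j b p := by
  have hs := fun e v w => R.omega.bilin_swap (κ.base p) e v w
  have h : R.omega.onSec (l.fA.ext (κ.vec j p)) (l.fA.ext (κ.vec k p)) (l.fE.e b)
      = -R.omega.onSec (l.fA.ext (κ.vec k p)) (l.fA.ext (κ.vec j p)) (l.fE.e b) :=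
    ContMDiffSection.ext fun x => by
      rw [ContMDiffSection.coe_neg, Pi.neg_apply, R.omega.onSec_apply, R.omega.onSec_apply,
        R.omega.bilin_swap]
  have h2 : R.connC.along (R.omega.onSec (l.fA.ext (κ.vec j p)) (l.fA.ext (κ.vec k p)) (l.fE.e b))
      (κ.base p) (κ.vec i p) = -R.connC.along (R.omega.onSec (l.fA.ext (κ.vec k p))
        (l.fA.ext (κ.vec j p)) (l.fE.e b)) (κ.base p) (κ.vec i p) := by
    rw [eq_neg_iff_add_eq_zero, ← R.connC.along_add, h, neg_add_cancel]
    have := R.connC.along_add (0 : Sec EM FC C) 0 (κ.base p) (κ.vec i p)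
    rwa [add_zero, left_eq_add] at this
  simp only [covForm]
  rw [h2, hs _ (κ.vec j p) (κ.vec k p), hs _ (κ.vec j p) (l.fA.partial κ i k p),
    hs _ (l.fA.partial κ i j p)]
  abel

lemma cov_wk (hx : BdyAt κ 0 x) {i k : Fin (n + 1)} (hi : i ≠ 0) (hk : k ≠ 0)
    (hp : p ∈ cube (n + 1)) :
    HasCov κ R.connC 0 (l.wk k i) p
      (R.omega.bilin (κ.base p) (l.uk k p) (κ.vec 0 p) (κ.vec i p)
        + R.omega.bilin (κ.base p) (l.uk i p) (κ.vec 0 p) (κ.vec k p)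
        + ∑ b, l.y (.inl b) p • l.covForm k 0 i b p) := by
  choose m hm hm' using fun b => l.y_mixed k hk (.inr (i, b)) p hp
  obtain ⟨a, ha, ha'⟩ := exists_hasCov_comm (D := R.connC) (i := 0) (j := k) l.fA l.S_mem hp
    l.fC.e (yi := fun b => l.rate (.inr (i, b))) (yj := fun b => l.z k (.inr (i, b)))
    (fun b => l.y_deriv (.inr (i, b)) p hp) (fun b => l.y_partial k hk (.inr (i, b)) p hp) hm hm'
  have h0 := ha.unique hp ((l.cov_omega hp k 0 i fun b => l.y_partial k hk (.inl b) p hp).congr hp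
    fun q hq => l.sum_rate_inr hq i)
  refine ha'.congr_deriv ?_
  rw [h0, ← uk, add_right_comm]
  congr 2
  rw [l.uk_eq hx hi hp, w, map_sum]
  simp only [map_smul]
  rw [R.omega.bilin_sum]
  refine Finset.sum_congr rfl fun b _ => ?_
  rw [← R.omega_d, R.omega.onSec_apply, l.fA.ext_apply (l.mem hp), l.fA.ext_apply (l.mem hp)]
  rfl

/-- `∇ₖwᵢ - ∇ᵢwₖ + ω(vec i, vec k)u = 0`. -/
lemma wk_sub_wk (hx : BdyAt κ 0 x) {i k : Fin (n + 1)} (hi : i ≠ 0) (hk : k ≠ 0)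
    (hp : p ∈ cube (n + 1)) :
    l.wk k i p - l.wk i k p + R.omega.bilin (κ.base p) (l.u p) (κ.vec i p) (κ.vec k p) = 0 := by
  refine HasCov.eq_zero (κ := κ) (D := R.connC) (i := 0) (u := fun q => l.wk k i q - l.wk i k q
    + R.omega.bilin (κ.base q) (l.u q) (κ.vec i q) (κ.vec k q)) hp (fun r hr => ?_) ?_
  · have hq := update_mem_cube hp 0 hr
    refine (((l.cov_wk hx hi hk hq).sub (l.cov_wk hx hk hi hq)).add
      (l.cov_omega hq 0 i k fun b => l.y_deriv (.inl b) _ hq)).congr_deriv ?_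
    have h := l.sum_rate_inl hq
    simp only [rate] at h
    rw [h, bilin_zero, zero_add, add_comm (R.omega.bilin _ (l.uk k _) _ _), add_sub_add_left_eq_sub,
      ← Finset.sum_sub_distrib, ← Finset.sum_add_distrib]
    refine Finset.sum_eq_zero fun b _ => ?_
    rw [← smul_sub, ← smul_add, l.covForm_swap i, sub_neg_eq_add]
    have := l.covForm_cyclic hq k 0 i b
    rw [add_right_comm] at this
    rw [this, smul_zero]
  · have hq := update_mem_cube hp 0 zero_mem_I
    have h0 : Function.update p 0 (0 : ℝ) 0 = 0 := Function.update_self ..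
    change l.wk k i (Function.update p 0 0) - l.wk i k (Function.update p 0 0)
      + R.omega.bilin _ _ (κ.vec i (Function.update p 0 0)) _ = 0
    rw [l.wk_zero hx hk i hq h0, l.wk_zero hx hi k hq h0, hx.vec hq h0 hi, map_zero,
      LinearMap.zero_apply, sub_zero, add_zero]

end LiftData

end LiftCommutation

section Transport

variable {F : Type*} [NormedAddCommGroup F] [NormedSpace ℝ F] [FiniteDimensional ℝ F]
  {V : M → Type*} [TopologicalSpace (TotalSpace F V)]
  [∀ x, AddCommGroup (V x)] [∀ x, Module ℝ (V x)]
  [∀ x, TopologicalSpace (V x)] [FiberBundle F V] [VectorBundle ℝ F V]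
  [ContMDiffVectorBundle ∞ F V 𝓘(ℝ, EM)]
  {L : LieAlgebroid EM FA A} {n : ℕ}

lemma fiberAt_self (x : M) (v : V x) : fiberAt x (⟨x, v⟩ : TotalSpace F V) = v := by
  simp [fiberAt]

lemma mk_fiberAt {x : M} {P : TotalSpace F V} (h : P.proj = x) :
    (⟨x, fiberAt x P⟩ : TotalSpace F V) = P := by
  subst h
  exact congrArg _ (fiberAt_self P.proj P.snd)

lemma fiberAt_eq {x : M} {P : TotalSpace F V} {v : V x} (h : P = ⟨x, v⟩) : fiberAt x P = v := by
  rw [h, fiberAt_self]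

lemma dual_fiberAt (ξ : DualSec EM F V) {x : M} {P : TotalSpace F V} (h : P.proj = x) :
    ξ x (fiberAt x P) = ξ P.proj P.snd := by
  subst h
  exact congrArg _ (fiberAt_self P.proj P.snd)

section Fundamental

variable {S : Set M} (f : FrameOn EM F V S) (κ : CubeMorphism L (n + 1)) (D : AConnection L F V)

/-- The coefficients, in a frame, of the equation of parallel transport. -/
def transportCoeff (b c : Fin f.N) (q : Fin (n + 1) → ℝ) : ℝ :=
  -f.ξ b (κ.base q) (D.along (f.e c) (κ.base q) (κ.vec 0 q))

lemma contDiffOn_transportCoeff (b c : Fin f.N) :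
    ContDiffOn ℝ ∞ (transportCoeff f κ D b c) (cube (n + 1)) :=
  (contDiffOn_along κ D (f.ξ b) (f.e c) 0).neg

/-- A fundamental matrix of the equation of parallel transport, and its inverse. -/
structure Fundamental where
  mat : Fin f.N → Fin f.N → (Fin (n + 1) → ℝ) → ℝ
  inv : Fin f.N → Fin f.N → (Fin (n + 1) → ℝ) → ℝ
  continuous_inv : ∀ b c, Continuous (inv b c)
  deriv : ∀ b c, ∀ p ∈ cube (n + 1), HasDerivWithinAt (fun r => mat b c (Function.update p 0 r))
    (∑ j, transportCoeff f κ D b j p * mat j c p) (Icc 0 1) (p 0)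
  mat_inv : ∀ p ∈ cube (n + 1), ∀ b c, ∑ j, mat b j p * inv j c p = if b = c then 1 else 0

lemma nonempty_fundamental : Nonempty (Fundamental f κ D) := by
  choose Φ _ _ _ h0 _ hd _ using fun c => exists_matrix_ode (contDiffOn_transportCoeff f κ D)
    (Pi.single c 1)
  choose Γ _ hc _ h0' _ hd' _ using fun b => exists_matrix_ode
    (a := fun b c q => -transportCoeff f κ D c b q)
    (fun b c => (contDiffOn_transportCoeff f κ D c b).neg) (Pi.single b 1)
  have key : ∀ p ∈ cube (n + 1), ∀ b c, ∑ j, Γ b j p * Φ c j p = if b = c then 1 else 0 := by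
    intro p hp b c
    have hder : ∀ r ∈ Icc (0 : ℝ) 1, HasDerivWithinAt (fun r => ∑ j, Γ b j (Function.update p 0 r)
        * Φ c j (Function.update p 0 r)) 0 (Icc 0 1) r := fun r hr => by
      have hq := update_mem_cube hp 0 hr
      have h1 := fun j => hd' b j _ hq
      have h2 := fun j => hd c j _ hq
      simp only [Function.update_idem, Function.update_self] at h1 h2
      refine (HasDerivWithinAt.fun_sum fun j _ => (h1 j).mul (h2 j)).congr_deriv ?_
      rw [Finset.sum_add_distrib]
      simp only [Finset.sum_mul, Finset.mul_sum]
      rw [Finset.sum_comm, ← Finset.sum_add_distrib]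
      refine Finset.sum_eq_zero fun j _ => ?_
      rw [← Finset.sum_add_distrib]
      exact Finset.sum_eq_zero fun k _ => by ring
    have hconst := constant_of_derivWithin_zero
      (fun r hr => (hder r hr).differentiableWithinAt)
      (fun r hr => (hder r ⟨hr.1, hr.2.le⟩).derivWithin
        (uniqueDiffOn_Icc zero_lt_one r ⟨hr.1, hr.2.le⟩)) (p 0) (mem_cube.1 hp 0)
    rw [Function.update_eq_self] at hconst
    rw [hconst]
    have hq := update_mem_cube hp 0 zero_mem_I
    simp only [h0' b _ _ hq (Function.update_self ..), h0 c _ _ hq (Function.update_self ..),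
      Pi.single_apply, ite_mul, one_mul, zero_mul, Finset.sum_ite_eq', Finset.mem_univ, if_true]
  refine ⟨⟨fun b c => Φ c b, Γ, hc, fun b c => hd c b, fun p hp b c => ?_⟩⟩
  have h1 : (Matrix.of fun b c => Γ b c p) * (Matrix.of fun b c => Φ c b p) = 1 := by
    ext i j
    simpa [Matrix.mul_apply, Matrix.one_apply] using key p hp i j
  have h2 := congrArg (fun m => m b c) (mul_eq_one_comm.1 h1)
  simpa [Matrix.mul_apply, Matrix.one_apply] using h2

variable {f κ D} (Φ : Fundamental f κ D) {p : Fin (n + 1) → ℝ}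

/-- Variation of constants. -/
lemma Fundamental.hasCov (hS : ∀ q ∈ cube (n + 1), κ.base q ∈ S) (hp : p ∈ cube (n + 1))
    {m : Fin f.N → (Fin (n + 1) → ℝ) → ℝ} {m' : Fin f.N → ℝ}
    (hm : ∀ c, HasDerivWithinAt (fun r => m c (Function.update p 0 r)) (m' c) (Icc 0 1) (p 0)) :
    HasCov κ D 0 (fun q => ∑ b, (∑ c, Φ.mat b c q * m c q) • f.e b (κ.base q)) p
      (∑ b, (∑ c, Φ.mat b c p * m' c) • f.e b (κ.base p)) := by
  refine (HasCov.sum fun b _ => HasCov.smul_sec (f := fun q => ∑ c, Φ.mat b c q * m c q) hp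
    (HasDerivWithinAt.fun_sum fun c _ => (Φ.deriv b c p hp).mul (hm c)) (f.e b)).congr_deriv ?_
  simp only [Function.update_eq_self]
  have h : ∀ b, ∑ c, ((∑ j, transportCoeff f κ D b j p * Φ.mat j c p) * m c p
      + Φ.mat b c p * m' c)
      = -f.ξ b (κ.base p) (∑ j, (∑ c, Φ.mat j c p * m c p)
        • D.along (f.e j) (κ.base p) (κ.vec 0 p)) + ∑ c, Φ.mat b c p * m' c := fun b => by
    rw [Finset.sum_add_distrib]
    congr 1
    simp only [map_sum, map_smul, smul_eq_mul, Finset.sum_mul]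
    rw [Finset.sum_comm, ← Finset.sum_neg_distrib]
    refine Finset.sum_congr rfl fun j _ => ?_
    rw [← Finset.sum_neg_distrib]
    refine Finset.sum_congr rfl fun c _ => ?_
    rw [transportCoeff]
    ring
  simp only [h, add_smul, neg_smul, Finset.sum_add_distrib, Finset.sum_neg_distrib]
  rw [f.sum_eq _ (hS p hp)]
  abel

lemma Fundamental.sum_inv (hp : p ∈ cube (n + 1)) (y : Fin f.N → ℝ) (b : Fin f.N) :
    ∑ c, Φ.mat b c p * ∑ j, Φ.inv c j p * y j = y b := by
  simp only [Finset.mul_sum]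
  rw [Finset.sum_comm]
  simp only [← mul_assoc, ← Finset.sum_mul, Φ.mat_inv p hp, ite_mul, one_mul, zero_mul,
    Finset.sum_ite_eq, Finset.mem_univ, if_true]

end Fundamental

variable {κ : CubeMorphism L (n + 1)} {D : AConnection L F V} {p : Fin (n + 1) → ℝ}
  {a : ℝ → TotalSpace FA A}

lemma IsParallel.hasCov {u : ℝ → TotalSpace F V} (hu : IsParallel D a u)
    (ha : ∀ r ∈ Icc (0 : ℝ) 1, a r = κ.comp 0 (Function.update p 0 r)) {r : ℝ}
    (hr : r ∈ Icc (0 : ℝ) 1) :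
    HasCov κ D 0 (fun q => fiberAt (κ.base q) (u (q 0))) (Function.update p 0 r) 0 := by
  intro ξ
  simp only [Function.update_self, map_zero, add_zero]
  have hproj : ∀ r ∈ Icc (0 : ℝ) 1, (u r).proj = κ.base (Function.update p 0 r) := fun r hr => by
    rw [hu.proj_eq r hr, ha r hr]
    rfl
  have hb : ContMDiffOn 𝓘(ℝ, ℝ) 𝓘(ℝ, EM) ∞ (fun r => (u r).proj) (Icc 0 1) :=
    (contMDiff_proj V).comp_contMDiffOn hu.smooth
  have hd := (contMDiffOn_dual_apply (v := fun r => (u r).snd) ξ hb hu.smooth).contDiffOn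
    |>.differentiableOn (by simp) r hr |>.hasDerivWithinAt
  obtain ⟨α, hα⟩ := exists_section_eq (EM := EM) FA (a r).snd
  obtain ⟨e, he⟩ := exists_section_eq (EM := EM) F (u r).snd
  rw [hu.parallel r hr ξ α e hα he] at hd
  refine (hd.congr (fun r' hr' => ?_) ?_).congr_deriv ?_
  · exact dual_fiberAt ξ (by rw [Function.update_idem, hproj r' hr'])
  · exact dual_fiberAt ξ (by rw [Function.update_idem, hproj r hr])
  · have hur : u r = ⟨κ.base (Function.update p 0 r), fiberAt (κ.base (Function.update p 0 r)) (u r)⟩ :=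
      (mk_fiberAt (hproj r hr)).symm
    rw [ha r hr] at hα ⊢
    rw [hur] at he
    change e (κ.base (Function.update p 0 r)) = fiberAt (κ.base (Function.update p 0 r)) (u r) at he
    change α (κ.base (Function.update p 0 r)) = κ.vec 0 (Function.update p 0 r) at hα
    rw [← he, D.dualAlong_apply]
    change _ - ξ (κ.base (Function.update p 0 r)) (D.toFun α e (κ.base (Function.update p 0 r))) = _
    rw [D.toFun_apply, hα]
    rfl

lemma exists_isParallel (hp : p ∈ cube (n + 1))
    (ha : ∀ r ∈ Icc (0 : ℝ) 1, a r = κ.comp 0 (Function.update p 0 r)) {t₀ : ℝ}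
    (ht₀ : t₀ ∈ Icc (0 : ℝ) 1) (v : V (κ.base (Function.update p 0 t₀))) :
    ∃ u, IsParallel D a u ∧ u t₀ = ⟨κ.base (Function.update p 0 t₀), v⟩ := by
  obtain ⟨S, hS, ⟨f⟩⟩ := exists_frame_nhds (F := F) (V := V) κ
  have hS' : ∀ q ∈ cube (n + 1), κ.base q ∈ S := fun q hq => mem_of_mem_nhds (hS q hq)
  obtain ⟨Φ⟩ := nonempty_fundamental f κ D
  let μ : Fin f.N → ℝ := fun c => ∑ j, Φ.inv c j (Function.update p 0 t₀)
    * f.ξ j (κ.base (Function.update p 0 t₀)) v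
  let y : Fin f.N → ℝ → ℝ := fun b r => ∑ c, Φ.mat b c (Function.update p 0 r) * μ c
  have hl : ContDiff ℝ ∞ (Function.update p 0) := contDiff_update ∞ p 0
  have hlm : MapsTo (Function.update p 0) (Icc (0 : ℝ) 1) (cube (n + 1)) := fun r hr =>
    update_mem_cube hp 0 hr
  have hy : ∀ b, ContDiffOn ℝ ∞ (y b) (Icc 0 1) := contDiffOn_of_matrix_ode
    (a := fun b c r => transportCoeff f κ D b c (Function.update p 0 r))
    (fun b c => (contDiffOn_transportCoeff f κ D b c).comp hl.contDiffOn hlm) fun b r hr => by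
      have h := fun c => Φ.deriv b c _ (hlm hr)
      simp only [Function.update_idem, Function.update_self] at h
      refine (HasDerivWithinAt.fun_sum fun c _ => (h c).mul_const (μ c)).congr_deriv ?_
      simp only [y, Finset.sum_mul, Finset.mul_sum]
      rw [Finset.sum_comm]
      exact Finset.sum_congr rfl fun j _ => Finset.sum_congr rfl fun c _ => by ring
  have hb : ContMDiffOn 𝓘(ℝ, ℝ) 𝓘(ℝ, EM) ∞ (fun r => κ.base (Function.update p 0 r)) (Icc 0 1) :=
    κ.base_smooth.comp hl.contMDiff.contMDiffOn hlm
  refine ⟨fun r => ⟨κ.base (Function.update p 0 r), ∑ b, y b r • f.e b _⟩, ⟨fun r hr => ?_, ?_, ?_⟩,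
    ?_⟩
  · rw [ha r hr]
    rfl
  · exact contMDiffOn_sum_smul (v := fun b r => f.e b (κ.base (Function.update p 0 r))) hb
      (fun b => (hy b).contMDiffOn) fun b => (f.e b).contMDiff.comp_contMDiffOn hb
  · intro r hr ξ α e hα he
    let g : (Fin (n + 1) → ℝ) → ℝ := fun q =>
      ξ (κ.base q) (∑ b, (∑ c, Φ.mat b c q * μ c) • f.e b (κ.base q))
    have h : HasDerivWithinAt (fun r' => g (Function.update (Function.update p 0 r) 0 r')) _ _ _ :=
      Φ.hasCov (m := fun c _ => μ c) (m' := 0) hS' (hlm hr) (fun c => hasDerivWithinAt_const ..) ξ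
    simp only [Function.update_idem, Function.update_self, Pi.zero_apply, mul_zero,
      Finset.sum_const_zero, zero_smul, map_zero, add_zero] at h
    refine (h.derivWithin (uniqueDiffOn_Icc zero_lt_one r hr)).trans ?_
    rw [ha r hr] at hα ⊢
    change α (κ.base (Function.update p 0 r)) = κ.vec 0 (Function.update p 0 r) at hα
    change e (κ.base (Function.update p 0 r)) = ∑ b, y b r • f.e b (κ.base (Function.update p 0 r)) at he
    rw [← he, D.dualAlong_apply]
    change _ = _ - ξ (κ.base (Function.update p 0 r)) (D.toFun α e (κ.base (Function.update p 0 r)))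
    rw [D.toFun_apply, hα]
    rfl
  · refine congrArg _ ?_
    simp only [y, μ, Φ.sum_inv (hlm ht₀)]
    exact f.sum_eq _ (hS' _ (hlm ht₀)) v

/-- Parallel transport is given by any parallel section. -/
lemma transport_eq (hp : p ∈ cube (n + 1))
    (ha : ∀ r ∈ Icc (0 : ℝ) 1, a r = κ.comp 0 (Function.update p 0 r))
    {U : ∀ q, V (κ.base q)}
    (hU : ∀ r ∈ Icc (0 : ℝ) 1, HasCov κ D 0 U (Function.update p 0 r) 0) {t₀ t₁ : ℝ}
    (ht₀ : t₀ ∈ Icc (0 : ℝ) 1) (ht₁ : t₁ ∈ Icc (0 : ℝ) 1) :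
    transport D a t₀ t₁ ⟨κ.base (Function.update p 0 t₀), U (Function.update p 0 t₀)⟩
      = ⟨κ.base (Function.update p 0 t₁), U (Function.update p 0 t₁)⟩ := by
  have h := exists_isParallel (D := D) hp ha ht₀ (U (Function.update p 0 t₀))
  rw [transport, dif_pos h]
  obtain ⟨hu, hu₀⟩ := h.choose_spec
  set u := h.choose
  have hz := HasCov.eq_zero_of_eq_zero (κ := κ) (D := D) (i := 0) (u := fun q =>
    fiberAt (κ.base q) (u (q 0)) - U q) (update_mem_cube hp 0 ht₁) (fun r hr => by
      rw [Function.update_idem]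
      exact ((hu.hasCov ha hr).sub (hU r hr)).congr_deriv (sub_zero _)) ht₀ (by
      rw [Function.update_idem, Function.update_self, fiberAt_eq hu₀, sub_self])
  rw [sub_eq_zero, Function.update_self] at hz
  rw [← hz, mk_fiberAt]
  rw [hu.proj_eq t₁ ht₁, ha t₁ ht₁]
  rfl

end Transport

section LineLift

variable {F : Type*} [NormedAddCommGroup F] [NormedSpace ℝ F] [FiniteDimensional ℝ F]
  {V : M → Type*} [TopologicalSpace (TotalSpace F V)]
  [∀ x, AddCommGroup (V x)] [∀ x, Module ℝ (V x)]
  [∀ x, TopologicalSpace (V x)] [FiberBundle F V] [VectorBundle ℝ F V]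
  [ContMDiffVectorBundle ∞ F V 𝓘(ℝ, EM)]
  {n : ℕ}

lemma snd_eq_of_mk_eq {x : M} {v w : V x}
    (h : (⟨x, v⟩ : TotalSpace F V) = ⟨x, w⟩) : v = w := by
  rw [← fiberAt_self (F := F) x v, h, fiberAt_self]

section Lines

variable {κ : CubeMorphism L (n + 1)} {D : AConnection L F V} {p : Fin (n + 1) → ℝ} {x y : M}
  {a : ℝ → TotalSpace FA A}

lemma HasCov.eq_on_line {u v : ∀ q, V (κ.base q)} {g : ∀ q, V (κ.base q)} (hp : p ∈ cube (n + 1))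
    (hu : ∀ r ∈ Icc (0 : ℝ) 1, HasCov κ D 0 u (Function.update p 0 r) (g (Function.update p 0 r)))
    (hv : ∀ r ∈ Icc (0 : ℝ) 1, HasCov κ D 0 v (Function.update p 0 r) (g (Function.update p 0 r)))
    (h0 : u (Function.update p 0 0) = v (Function.update p 0 0)) {r : ℝ} (hr : r ∈ Icc (0 : ℝ) 1) :
    u (Function.update p 0 r) = v (Function.update p 0 r) := by
  rw [← sub_eq_zero]
  refine HasCov.eq_zero (κ := κ) (D := D) (i := 0) (u := fun q => u q - v q)
    (update_mem_cube hp 0 hr) (fun r' hr' => ?_) ?_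
  · rw [Function.update_idem]
    exact ((hu r' hr').sub (hv r' hr')).congr_deriv (sub_self _)
  · rw [Function.update_idem, h0, sub_self]

lemma exists_hasCov_hol (hp : p ∈ cube (n + 1)) (b : APath L x y)
    (ha : ∀ r ∈ Icc (0 : ℝ) 1, b.curve r = κ.comp 0 (Function.update p 0 r)) (v : V x) :
    ∃ U : ∀ q, V (κ.base q), (∀ r ∈ Icc (0 : ℝ) 1, HasCov κ D 0 U (Function.update p 0 r) 0) ∧
      (⟨_, U (Function.update p 0 0)⟩ : TotalSpace F V) = ⟨x, v⟩ ∧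
      (⟨_, U (Function.update p 0 1)⟩ : TotalSpace F V) = ⟨y, hol D b v⟩ := by
  have h0 : κ.base (Function.update p 0 0) = x := by
    rw [← b.source]
    refine (congrArg TotalSpace.proj (ha 0 zero_mem_I)).symm.trans (congrArg b.mor.base ?_)
    funext k
    fin_cases k
    rfl
  have h1 : κ.base (Function.update p 0 1) = y := by
    rw [← b.target]
    refine (congrArg TotalSpace.proj (ha 1 one_mem_I)).symm.trans (congrArg b.mor.base ?_)
    funext k
    fin_cases k
    rfl
  subst h0 h1
  obtain ⟨u, hu, hu0⟩ := exists_isParallel (D := D) hp ha zero_mem_I v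
  have hU := fun r hr => hu.hasCov ha (r := r) hr
  have hv : fiberAt (κ.base (Function.update p 0 0)) (u (Function.update p 0 (0 : ℝ) 0)) = v := by
    rw [Function.update_self, hu0, fiberAt_self]
  refine ⟨_, hU, ?_, ?_⟩
  · rw [hv]
  · have h := transport_eq hp ha hU zero_mem_I one_mem_I
    rw [hv] at h
    rw [hol, h, fiberAt_self]

lemma mk_eq_hol (hp : p ∈ cube (n + 1)) (b : APath L x y)
    (ha : ∀ r ∈ Icc (0 : ℝ) 1, b.curve r = κ.comp 0 (Function.update p 0 r)) {v : V x}
    {U : ∀ q, V (κ.base q)} (hU : ∀ r ∈ Icc (0 : ℝ) 1, HasCov κ D 0 U (Function.update p 0 r) 0)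
    (h0 : (⟨_, U (Function.update p 0 0)⟩ : TotalSpace F V) = ⟨x, v⟩) :
    (⟨_, U (Function.update p 0 1)⟩ : TotalSpace F V) = ⟨y, hol D b v⟩ := by
  obtain ⟨U', hU', h0', h1'⟩ := exists_hasCov_hol (D := D) hp b ha v
  rw [← h1', HasCov.eq_on_line (g := fun _ => 0) hp hU hU'
    (snd_eq_of_mk_eq (h0.trans h0'.symm)) one_mem_I]

/-- Duhamel's formula. -/
lemma integral_transport (hp : p ∈ cube (n + 1))
    (ha : ∀ r ∈ Icc (0 : ℝ) 1, a r = κ.comp 0 (Function.update p 0 r)) {w g : ∀ q, V (κ.base q)}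
    (hw : ∀ r ∈ Icc (0 : ℝ) 1, HasCov κ D 0 w (Function.update p 0 r) (g (Function.update p 0 r)))
    (hw0 : w (Function.update p 0 0) = 0)
    (hg : ∀ ξ : DualSec EM F V, ContinuousOn (fun r => ξ (κ.base (Function.update p 0 r))
      (g (Function.update p 0 r))) (Icc 0 1))
    {G : Type*} [NormedAddCommGroup G] [NormedSpace ℝ G] [CompleteSpace G]
    (T : V (κ.base (Function.update p 0 1)) →ₗ[ℝ] G) :
    ∫ t in (0 : ℝ)..1, T (fiberAt _ (transport D a t 1 ⟨_, g (Function.update p 0 t)⟩))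
      = T (w (Function.update p 0 1)) := by
  obtain ⟨S, hS, ⟨f⟩⟩ := exists_frame_nhds (F := F) (V := V) κ
  have hS' : ∀ q ∈ cube (n + 1), κ.base q ∈ S := fun q hq => mem_of_mem_nhds (hS q hq)
  obtain ⟨Φ⟩ := nonempty_fundamental f κ D
  have hl : Continuous (Function.update p 0 : ℝ → _) := (contDiff_update (𝕜 := ℝ) 0 p 0).continuous
  have hlm : ∀ r ∈ Icc (0 : ℝ) 1, Function.update p 0 r ∈ cube (n + 1) := fun r hr =>
    update_mem_cube hp 0 hr
  let h : Fin f.N → ℝ → ℝ := fun c t => ∑ j, Φ.inv c j (Function.update p 0 t)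
    * f.ξ j (κ.base (Function.update p 0 t)) (g (Function.update p 0 t))
  have hh : ∀ c, ContinuousOn (h c) (Icc 0 1) := fun c => continuousOn_finsetSum _ fun j _ =>
    ((Φ.continuous_inv c j).comp hl).continuousOn.mul (hg _)
  have hgb : ∀ r ∈ Icc (0 : ℝ) 1, ∑ b, (∑ c, Φ.mat b c (Function.update p 0 r) * h c r)
      • f.e b (κ.base (Function.update p 0 r)) = g (Function.update p 0 r) := fun r hr => by
    simp only [h, Φ.sum_inv (hlm r hr)]
    exact f.sum_eq _ (hS' _ (hlm r hr)) _
  have h1 := HasCov.eq_on_line hp hw (v := fun q => ∑ b, (∑ c, Φ.mat b c q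
      * ∫ t in (0 : ℝ)..q 0, h c t) • f.e b (κ.base q)) (fun r hr => by
    refine (Φ.hasCov (m := fun c q => ∫ t in (0 : ℝ)..q 0, h c t) (m' := fun c => h c r) hS'
      (hlm r hr) fun c => ?_).congr_deriv (hgb r hr)
    simp only [Function.update_self]
    have hi : IntervalIntegrable (h c) MeasureTheory.volume 0 r :=
      ((hh c).mono (by rw [uIcc_of_le hr.1]; exact Icc_subset_Icc_right hr.2)).intervalIntegrable
    have : Fact (r ∈ Icc (0 : ℝ) 1) := ⟨hr⟩
    exact intervalIntegral.integral_hasDerivWithinAt_right hi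
      ((hh c).stronglyMeasurableAtFilter_nhdsWithin measurableSet_Icc r) (hh c r hr)) (by
    rw [hw0]
    simp only [Function.update_self, intervalIntegral.integral_same, mul_zero,
      Finset.sum_const_zero, zero_smul]) one_mem_I
  let K : Fin f.N → G := fun c => ∑ b, Φ.mat b c (Function.update p 0 1) • T (f.e b _)
  have hT : ∀ m : Fin f.N → ℝ, T (∑ b, (∑ c, Φ.mat b c (Function.update p 0 1) * m c) • f.e b _)
      = ∑ c, m c • K c := fun m => by
    simp only [K, map_sum, map_smul, Finset.sum_smul, Finset.smul_sum, smul_smul]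
    rw [Finset.sum_comm]
    simp only [mul_comm]
  have h2 : ∀ t ∈ Icc (0 : ℝ) 1,
      T (fiberAt _ (transport D a t 1 ⟨_, g (Function.update p 0 t)⟩))
        = ∑ c, h c t • K c := fun t ht => by
    have hU : ∀ r ∈ Icc (0 : ℝ) 1, HasCov κ D 0 (fun q => ∑ b, (∑ c, Φ.mat b c q * h c t)
        • f.e b (κ.base q)) (Function.update p 0 r) 0 := fun r hr =>
      (Φ.hasCov (m := fun c _ => h c t) (m' := 0) hS' (hlm r hr)
        (fun c => hasDerivWithinAt_const ..)).congr_deriv (by simp)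
    have := transport_eq hp ha hU ht one_mem_I
    rw [hgb t ht] at this
    rw [this, fiberAt_self, hT]
  rw [intervalIntegral.integral_congr (g := fun t => ∑ c, h c t • K c) fun t ht =>
    h2 t (by rwa [uIcc_of_le zero_le_one] at ht), h1, hT, Function.update_self,
    intervalIntegral.integral_finsetSum (f := fun c t => h c t • K c) fun c _ =>
      ((hh c).smul continuousOn_const).intervalIntegrable_of_Icc zero_le_one]
  exact Finset.sum_congr rfl fun c _ => intervalIntegral.integral_smul_const ..

end Lines

end LineLift

section LineLift

variable {n : ℕ} {R : RepUpToHomotopy L d}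

/-- Along the line through `p` in the first direction, the solution of `∇₀u = 0`,
`∇₀w = ω(vec 0, vec i)u` which starts at `(e, c)` ends at `(e', c')`. -/
def LineLift (R : RepUpToHomotopy L d) (κ : CubeMorphism L (n + 1)) (i : Fin (n + 1))
    (p : Fin (n + 1) → ℝ) {x y : M} (e : E x) (c : C x) (e' : E y) (c' : C y) : Prop :=
  ∃ (u : ∀ q, E (κ.base q)) (w : ∀ q, C (κ.base q)),
    (∀ r ∈ Icc (0 : ℝ) 1, HasCov κ R.connE 0 u (Function.update p 0 r) 0) ∧
    (∀ r ∈ Icc (0 : ℝ) 1, HasCov κ R.connC 0 w (Function.update p 0 r)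
      (R.omega.bilin _ (u (Function.update p 0 r)) (κ.vec 0 (Function.update p 0 r))
        (κ.vec i (Function.update p 0 r)))) ∧
    (⟨_, u (Function.update p 0 0)⟩ : TotalSpace FE E) = ⟨x, e⟩ ∧
    (⟨_, w (Function.update p 0 0)⟩ : TotalSpace FC C) = ⟨x, c⟩ ∧
    (⟨_, u (Function.update p 0 1)⟩ : TotalSpace FE E) = ⟨y, e'⟩ ∧
    (⟨_, w (Function.update p 0 1)⟩ : TotalSpace FC C) = ⟨y, c'⟩

variable {κ : CubeMorphism L (n + 1)} {i : Fin (n + 1)} {p : Fin (n + 1) → ℝ} {x y : M}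
  {e e₁ : E x} {c c₁ : C x} {e' e₁' : E y} {c' c₁' : C y}

lemma LineLift.unique (hp : p ∈ cube (n + 1)) (h : LineLift R κ i p e c e' c')
    (h₁ : LineLift R κ i p e c e₁' c₁') : e' = e₁' ∧ c' = c₁' := by
  obtain ⟨u, w, hu, hw, hu0, hw0, hu1, hw1⟩ := h
  obtain ⟨u', w', hu', hw', hu0', hw0', hu1', hw1'⟩ := h₁
  have h1 : ∀ r ∈ Icc (0 : ℝ) 1, u (Function.update p 0 r) = u' (Function.update p 0 r) :=
    fun r hr => HasCov.eq_on_line (g := fun _ => 0) hp hu hu'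
      (snd_eq_of_mk_eq (hu0.trans hu0'.symm)) hr
  have h2 := HasCov.eq_on_line
    (g := fun q => R.omega.bilin (κ.base q) (u q) (κ.vec 0 q) (κ.vec i q)) hp hw
    (fun r hr => (hw' r hr).congr_deriv (by rw [h1 r hr]))
    (snd_eq_of_mk_eq (hw0.trans hw0'.symm)) one_mem_I
  exact ⟨snd_eq_of_mk_eq (hu1.symm.trans ((congrArg _ (h1 1 one_mem_I)).trans hu1')),
    snd_eq_of_mk_eq (hw1.symm.trans ((congrArg _ h2).trans hw1'))⟩

lemma mk_add_eq {F : Type*} {V : M → Type*} [∀ x, AddCommGroup (V x)] {x z : M} {v v' : V x}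
    {w w' : V z} (h : (⟨x, v⟩ : TotalSpace F V) = ⟨z, w⟩)
    (h' : (⟨x, v'⟩ : TotalSpace F V) = ⟨z, w'⟩) :
    (⟨x, v + v'⟩ : TotalSpace F V) = ⟨z, w + w'⟩ := by
  obtain rfl : x = z := congrArg TotalSpace.proj h
  cases h
  cases h'
  rfl

lemma mk_zero_eq {F : Type*} {V : M → Type*} [∀ x, AddCommGroup (V x)] {x z : M} (h : x = z) :
    (⟨x, 0⟩ : TotalSpace F V) = ⟨z, 0⟩ := by
  rw [h]

lemma LineLift.add (h : LineLift R κ i p e c e' c') (h₁ : LineLift R κ i p e₁ c₁ e₁' c₁') :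
    LineLift R κ i p (e + e₁) (c + c₁) (e' + e₁') (c' + c₁') := by
  obtain ⟨u, w, hu, hw, hu0, hw0, hu1, hw1⟩ := h
  obtain ⟨u', w', hu', hw', hu0', hw0', hu1', hw1'⟩ := h₁
  exact ⟨fun q => u q + u' q, fun q => w q + w' q,
    fun r hr => ((hu r hr).add (hu' r hr)).congr_deriv (add_zero 0),
    fun r hr => ((hw r hr).add (hw' r hr)).congr_deriv (LiftData.bilin_add ..).symm,
    mk_add_eq hu0 hu0', mk_add_eq hw0 hw0', mk_add_eq hu1 hu1', mk_add_eq hw1 hw1'⟩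

lemma LineLift.eq_hol (hp : p ∈ cube (n + 1)) (h : LineLift R κ i p e c e' c') (b : APath L x y)
    (hb : ∀ r ∈ Icc (0 : ℝ) 1, b.curve r = κ.comp 0 (Function.update p 0 r)) :
    e' = hol R.connE b e := by
  obtain ⟨u, w, hu, hw, hu0, hw0, hu1, hw1⟩ := h
  exact snd_eq_of_mk_eq (hu1.symm.trans (mk_eq_hol hp b hb hu hu0))

/-- Parallel sections of `C` are solutions. -/
lemma lineLift_zero (hp : p ∈ cube (n + 1)) (b : APath L x y)
    (hb : ∀ r ∈ Icc (0 : ℝ) 1, b.curve r = κ.comp 0 (Function.update p 0 r)) (c : C x) :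
    LineLift R κ i p 0 c (0 : E y) (hol R.connC b c) := by
  obtain ⟨w, hw, hw0, hw1⟩ := exists_hasCov_hol (D := R.connC) hp b hb c
  exact ⟨fun q => 0, w, fun r hr => HasCov.zero, fun r hr => (hw r hr).congr_deriv
    (LiftData.bilin_zero ..).symm, mk_zero_eq (congrArg TotalSpace.proj hw0), hw0,
    mk_zero_eq (congrArg TotalSpace.proj hw1), hw1⟩

/-- Where `ω(vec 0, vec i)` vanishes, the two equations decouple. -/
lemma LineLift.eq_zero (hp : p ∈ cube (n + 1)) (h : LineLift R κ i p e 0 e' c')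
    (h0 : ∀ r ∈ Icc (0 : ℝ) 1, ∀ ε, R.omega.bilin _ ε (κ.vec 0 (Function.update p 0 r))
      (κ.vec i (Function.update p 0 r)) = 0) : c' = 0 := by
  obtain ⟨u, w, hu, hw, hu0, hw0, hu1, hw1⟩ := h
  have h2 := HasCov.eq_on_line (v := fun _ => 0) (g := fun _ => 0) hp
    (fun r hr => (hw r hr).congr_deriv (h0 r hr _)) (fun r hr => HasCov.zero)
    (snd_eq_of_mk_eq (hw0.trans (mk_zero_eq (congrArg TotalSpace.proj hw0).symm))) one_mem_I
  rw [h2] at hw1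
  exact snd_eq_of_mk_eq (hw1.symm.trans (mk_zero_eq (congrArg TotalSpace.proj hw1)))

lemma HasCov.transfer {F : Type*} [NormedAddCommGroup F] [NormedSpace ℝ F] [FiniteDimensional ℝ F]
    {V : M → Type*} [TopologicalSpace (TotalSpace F V)]
    [∀ x, AddCommGroup (V x)] [∀ x, Module ℝ (V x)]
    [∀ x, TopologicalSpace (V x)] [FiberBundle F V] [VectorBundle ℝ F V]
    [ContMDiffVectorBundle ∞ F V 𝓘(ℝ, EM)] {D : AConnection L F V} {m : ℕ}
    {κ' : CubeMorphism L (m + 1)} {p' : Fin (m + 1) → ℝ}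
    (h : ∀ r ∈ Icc (0 : ℝ) 1,
      κ.comp 0 (Function.update p 0 r) = κ'.comp 0 (Function.update p' 0 r))
    {u : ∀ q, V (κ.base q)} {r : ℝ} (hr : r ∈ Icc (0 : ℝ) 1) {g : V (κ.base (Function.update p 0 r))}
    (hu : HasCov κ D 0 u (Function.update p 0 r) g) :
    HasCov κ' D 0 (fun q => fiberAt (κ'.base q)
      (⟨_, u (Function.update p 0 (q 0))⟩ : TotalSpace F V)) (Function.update p' 0 r)
      (fiberAt _ (⟨_, g⟩ : TotalSpace F V)) := fun ξ => by
  let φ : (Fin (n + 1) → ℝ) → ℝ := fun q => ξ (κ.base q) (u q)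
  have h1 : HasDerivWithinAt (fun r' => φ (Function.update (Function.update p 0 r) 0 r')) _ _ _ :=
    hu ξ
  simp only [Function.update_idem, Function.update_self] at h1 ⊢
  have hb : ∀ r ∈ Icc (0 : ℝ) 1, κ.base (Function.update p 0 r) = κ'.base (Function.update p' 0 r) :=
    fun r hr => congrArg TotalSpace.proj (h r hr)
  refine (h1.congr (fun r' hr' => ?_) ?_).congr_deriv ?_
  · exact dual_fiberAt ξ (by rw [Function.update_idem]; exact hb r' hr')
  · exact dual_fiberAt ξ (by rw [Function.update_idem]; exact hb r hr)
  · have key : ∀ {P Q : TotalSpace FA A} (hPQ : P = Q) (v w : V P.proj),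
        D.dualAlong ξ P.proj P.snd v + ξ P.proj w
          = D.dualAlong ξ Q.proj Q.snd (fiberAt _ (⟨_, v⟩ : TotalSpace F V))
            + ξ Q.proj (fiberAt _ (⟨_, w⟩ : TotalSpace F V)) := by
      rintro P _ rfl v w
      rw [fiberAt_self, fiberAt_self]
    exact key (h r hr) _ _

lemma LineLift.transfer {m : ℕ} {κ' : CubeMorphism L (m + 1)} {i' : Fin (m + 1)}
    {p' : Fin (m + 1) → ℝ}
    (h0 : ∀ r ∈ Icc (0 : ℝ) 1,
      κ.comp 0 (Function.update p 0 r) = κ'.comp 0 (Function.update p' 0 r))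
    (hi : ∀ r ∈ Icc (0 : ℝ) 1,
      κ.comp i (Function.update p 0 r) = κ'.comp i' (Function.update p' 0 r))
    (h : LineLift R κ i p e c e' c') : LineLift R κ' i' p' e c e' c' := by
  obtain ⟨u, w, hu, hw, hu0, hw0, hu1, hw1⟩ := h
  have hb : ∀ r ∈ Icc (0 : ℝ) 1, κ.base (Function.update p 0 r) = κ'.base (Function.update p' 0 r) :=
    fun r hr => congrArg TotalSpace.proj (h0 r hr)
  refine ⟨_, _, fun r hr => ((hu r hr).transfer h0 hr).congr_deriv ?_,
    fun r hr => ((hw r hr).transfer h0 hr).congr_deriv ?_, ?_, ?_, ?_, ?_⟩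
  · exact fiberAt_eq (mk_zero_eq (hb r hr))
  · rw [Function.update_self]
    have key : ∀ {P Q P' Q' : TotalSpace FA A} (hP : P = P') (hQ : Q = Q') (hPQ : Q.proj = P.proj)
        (hPQ' : Q'.proj = P'.proj) (v : E P.proj),
        fiberAt P'.proj (⟨P.proj, R.omega.bilin _ v P.snd (fiberAt _ Q)⟩ : TotalSpace FC C)
          = R.omega.bilin _ (fiberAt _ (⟨_, v⟩ : TotalSpace FE E)) P'.snd (fiberAt _ Q') := by
      rintro P Q _ _ rfl rfl hPQ _ v
      rw [fiberAt_self, fiberAt_self]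
    have h2 := key (h0 r hr) (hi r hr) rfl rfl (u (Function.update p 0 r))
    have h3 : fiberAt (κ.base (Function.update p 0 r)) (κ.comp i (Function.update p 0 r))
      = κ.vec i (Function.update p 0 r) := fiberAt_self ..
    have h4 : fiberAt (κ'.base (Function.update p' 0 r)) (κ'.comp i' (Function.update p' 0 r))
      = κ'.vec i' (Function.update p' 0 r) := fiberAt_self ..
    exact (congrArg (fun t => fiberAt _ (⟨_, R.omega.bilin _ _ _ t⟩ : TotalSpace FC C)) h3.symm).trans
      (h2.trans (congrArg _ h4))
  all_goals
    rw [Function.update_self]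
  · exact (mk_fiberAt (hb 0 zero_mem_I)).trans hu0
  · exact (mk_fiberAt (hb 0 zero_mem_I)).trans hw0
  · exact (mk_fiberAt (hb 1 one_mem_I)).trans hu1
  · exact (mk_fiberAt (hb 1 one_mem_I)).trans hw1

lemma LiftData.lineLift (l : LiftData R κ e) (hx : BdyAt κ 0 x) (hy : BdyAt κ 1 y)
    (hp : p ∈ cube (n + 1)) (i : Fin (n + 1)) :
    LineLift R κ i p e 0 (∑ b, l.y (.inl b) (Function.update p 0 1) • l.fE.e b y)
      (∑ b, l.y (.inr (i, b)) (Function.update p 0 1) • l.fC.e b y) := by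
  have h0 := update_mem_cube hp 0 zero_mem_I
  have h0' : Function.update p 0 (0 : ℝ) 0 = 0 := Function.update_self ..
  have hb0 := hx.base h0 h0'
  have hb1 := hy.base (update_mem_cube hp 0 one_mem_I) (Function.update_self ..)
  refine ⟨l.u, l.w i, fun r hr => l.cov_u (update_mem_cube hp 0 hr),
    fun r hr => l.cov_w (update_mem_cube hp 0 hr) i, ?_, ?_, ?_, ?_⟩
  · have : l.u (Function.update p 0 0) = ∑ b, l.init b • l.fE.e b (κ.base (Function.update p 0 0)) :=
      Finset.sum_congr rfl fun b _ => by rw [l.y_inl b _ h0 h0']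
    rw [this]
    exact (congrArg (fun z => (⟨z, ∑ b, l.init b • l.fE.e b z⟩ : TotalSpace FE E)) hb0).trans
      (congrArg _ l.sum_init)
  · rw [l.w_zero h0 h0']
    exact mk_zero_eq hb0
  · exact congrArg (fun z => (⟨z, ∑ b, l.y (.inl b) (Function.update p 0 1) • l.fE.e b z⟩ :
      TotalSpace FE E)) hb1
  · exact congrArg (fun z => (⟨z, ∑ b, l.y (.inr (i, b)) (Function.update p 0 1) • l.fC.e b z⟩ :
      TotalSpace FC C)) hb1

end LineLift

section TwoHolonomy

variable {n : ℕ} {R : RepUpToHomotopy L d} {x y : M}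

lemma LineLift.integral {κ : CubeMorphism L (n + 1)} {i : Fin (n + 1)} {p : Fin (n + 1) → ℝ}
    {e : E x} {e' : E y} {c' : C y} {a : ℝ → TotalSpace FA A} (hp : p ∈ cube (n + 1))
    (ha : ∀ r ∈ Icc (0 : ℝ) 1, a r = κ.comp 0 (Function.update p 0 r))
    (h : LineLift R κ i p e 0 e' c') {G : Type*} [NormedAddCommGroup G] [NormedSpace ℝ G]
    [CompleteSpace G] (T : C y →ₗ[ℝ] G) :
    ∫ t in (0 : ℝ)..1, T (fiberAt y (transport R.connC a t 1 ⟨_, R.omega.bilin _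
      (fiberAt (κ.base (Function.update p 0 t)) (transport R.connE a 0 t ⟨x, e⟩))
      (κ.vec 0 (Function.update p 0 t)) (κ.vec i (Function.update p 0 t))⟩)) = T c' := by
  obtain ⟨u, w, hu, hw, hu0, hw0, hu1, hw1⟩ := h
  have hw0' : w (Function.update p 0 0) = 0 :=
    snd_eq_of_mk_eq (hw0.trans (mk_zero_eq (congrArg TotalSpace.proj hw0).symm))
  have hlm : ∀ r ∈ Icc (0 : ℝ) 1, Function.update p 0 r ∈ cube (n + 1) := fun r hr =>
    update_mem_cube hp 0 hr
  have hl : Continuous (Function.update p 0 : ℝ → _) := (contDiff_update (𝕜 := ℝ) 0 p 0).continuous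
  cases hw1
  have hE : ∀ t ∈ Icc (0 : ℝ) 1, fiberAt (κ.base (Function.update p 0 t))
      (transport R.connE a 0 t ⟨x, e⟩) = u (Function.update p 0 t) := fun t ht => by
    rw [← hu0]
    exact fiberAt_eq (transport_eq hp ha hu zero_mem_I ht)
  rw [← integral_transport hp ha
    (g := fun q => R.omega.bilin (κ.base q) (u q) (κ.vec 0 q) (κ.vec i q)) hw hw0' ?_ T]
  · refine intervalIntegral.integral_congr fun t ht => ?_
    rw [uIcc_of_le zero_le_one] at ht
    rw [hE t ht]
  · intro ξ
    obtain ⟨S, hS, ⟨f⟩⟩ := exists_frame_nhds (F := FE) (V := E) κ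
    let φ : Fin f.N → (Fin (n + 1) → ℝ) → ℝ := fun b q => f.ξ b (κ.base q) (u q)
    have hφ : ∀ b, ContinuousOn (fun r => φ b (Function.update p 0 r)) (Icc 0 1) := fun b r hr => by
      have h : HasDerivWithinAt (fun r' => φ b (Function.update (Function.update p 0 r) 0 r'))
        _ _ _ := hu r hr (f.ξ b)
      simp only [Function.update_idem, Function.update_self] at h
      exact h.continuousWithinAt
    have h : ContinuousOn (fun r => ∑ b, φ b (Function.update p 0 r)
        * (fun q => ξ (κ.base q) (R.omega.bilin (κ.base q) (f.e b (κ.base q)) (κ.vec 0 q)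
          (κ.vec i q))) (Function.update p 0 r)) (Icc 0 1) :=
      continuousOn_finsetSum _ fun b _ => (hφ b).mul
        ((contDiffOn_bilin R.omega κ ξ (f.e b) 0 i).continuousOn.comp hl.continuousOn hlm)
    refine h.congr fun r hr => ?_
    conv_lhs => rw [← f.sum_eq _ (mem_of_mem_nhds (hS _ (hlm r hr))) (u (Function.update p 0 r))]
    rw [R.omega.bilin_sum, map_sum]
    simp only [map_smul, smul_eq_mul, φ]

lemma integral_sum_smul {ι G : Type*} [Fintype ι] [NormedAddCommGroup G] [NormedSpace ℝ G]
    [CompleteSpace G] {f : ι → ℝ → ℝ} (hf : ∀ b, Continuous (f b)) (v : ι → G) :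
    ∫ s in (0 : ℝ)..1, ∑ b, f b s • v b = ∑ b, (∫ s in (0 : ℝ)..1, f b s) • v b := by
  rw [intervalIntegral.integral_finsetSum (f := fun b s => f b s • v b) fun b _ =>
    ((hf b).smul continuous_const).intervalIntegrable _ _]
  exact Finset.sum_congr rfl fun b _ => intervalIntegral.integral_smul_const ..

variable {a₀ a₁ : APath L x y} (σ : AHomotopy a₀ a₁) (e : E x)

lemma exists_lineLift {s : ℝ} (hs : s ∈ Icc (0 : ℝ) 1) :
    ∃ (e' : E y) (c' : C y), LineLift R σ.mor 1 ![0, s] e 0 e' c' := by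
  obtain ⟨l⟩ := nonempty_liftData R σ.mor σ.bdy.1 e
  exact ⟨_, _, l.lineLift σ.bdy.1 σ.bdy.2 (vec2_mem_cube zero_mem_I hs) 1⟩

/-- The 2-holonomy is the integral of the endpoints of the solutions along lines. -/
lemma dual_hol₂ {W : ℝ → C y}
    (hW : ∀ s ∈ Icc (0 : ℝ) 1, ∃ e' : E y, LineLift R σ.mor 1 ![0, s] e 0 e' (W s))
    (ξ : C y →ₗ[ℝ] ℝ) :
    ContinuousOn (fun s => ξ (W s)) (Icc 0 1) ∧
      ξ (hol₂ R σ e) = ∫ s in (0 : ℝ)..1, ξ (W s) := by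
  have : CompleteSpace FC := FiniteDimensional.complete ℝ FC
  obtain ⟨l⟩ := nonempty_liftData R σ.mor σ.bdy.1 e
  have hy : ∀ b, Continuous fun s : ℝ => l.y (.inr (1, b)) ![1, s] := fun b =>
    (l.y_cont _).comp (by fun_prop)
  have hW' : ∀ s ∈ Icc (0 : ℝ) 1, W s = ∑ b, l.y (.inr (1, b)) ![1, s] • l.fC.e b y := fun s hs => by
    obtain ⟨e', he'⟩ := hW s hs
    have h := l.lineLift σ.bdy.1 σ.bdy.2 (vec2_mem_cube zero_mem_I hs) 1
    exact (he'.unique (vec2_mem_cube zero_mem_I hs) h).2.trans (congrArg (fun q =>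
      ∑ b, l.y (.inr (1, b)) q • l.fC.e b y) (update_vec2_zero 0 s 1))
  have hmem : ∀ s ∈ uIcc (0 : ℝ) 1, s ∈ Icc (0 : ℝ) 1 := fun s hs => by
    rwa [uIcc_of_le zero_le_one] at hs
  have hol_eq : hol₂ R σ e
      = ∑ b, (∫ s in (0 : ℝ)..1, l.y (.inr (1, b)) ![1, s]) • l.fC.e b y := by
    rw [hol₂, fiberIntegral]
    set T := (trivializationAt FC C y).continuousLinearEquivAt ℝ y
      (mem_baseSet_trivializationAt FC C y)
    refine (T.symm_apply_eq).2 ?_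
    simp only [map_sum, map_smul]
    rw [← integral_sum_smul hy]
    refine intervalIntegral.integral_congr fun s hs => ?_
    obtain ⟨e', he'⟩ := hW s (hmem s hs)
    have h := he'.integral (a := fun r => σ.a r s) (vec2_mem_cube zero_mem_I (hmem s hs))
      (fun r _ => congrArg _ (update_vec2_zero 0 s r).symm) (T : C y →L[ℝ] FC).toLinearMap
    let φ : ℝ → (Fin 2 → ℝ) → FC := fun t q => T (fiberAt y (transport R.connC (fun r => σ.a r s)
      t 1 ⟨_, R.omega.bilin (σ.mor.base q) (fiberAt (σ.mor.base q)
        (transport R.connE (fun r => σ.a r s) 0 t ⟨x, e⟩)) (σ.mor.vec 0 q) (σ.mor.vec 1 q)⟩))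
    have h' : ∫ t in (0 : ℝ)..1, φ t (Function.update ![0, s] 0 t) = T (W s) := h
    have hu : ∀ t, (Function.update ![0, s] 0 t : Fin 2 → ℝ) = ![t, s] := update_vec2_zero 0 s
    simp only [hu] at h'
    refine h'.trans ?_
    rw [hW' s (hmem s hs), map_sum]
    simp only [map_smul]
  have hξ : ∀ s ∈ Icc (0 : ℝ) 1, ξ (W s)
      = ∑ b, l.y (.inr (1, b)) ![1, s] • ξ (l.fC.e b y) := fun s hs => by
    rw [hW' s hs, map_sum]
    simp only [map_smul]
  constructor
  · have h : Continuous fun s => ∑ b, l.y (.inr (1, b)) ![1, s] • ξ (l.fC.e b y) :=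
      continuous_finsetSum _ fun b _ => (hy b).smul continuous_const
    exact h.continuousOn.congr hξ
  · rw [hol_eq, intervalIntegral.integral_congr fun s hs => hξ s (hmem s hs),
      integral_sum_smul hy, map_sum]
    simp only [map_smul]

end TwoHolonomy

section ChainHomotopy

variable {F : Type*} [NormedAddCommGroup F] [NormedSpace ℝ F] [FiniteDimensional ℝ F]
  {V : M → Type*} [TopologicalSpace (TotalSpace F V)]
  [∀ x, AddCommGroup (V x)] [∀ x, Module ℝ (V x)]
  [∀ x, TopologicalSpace (V x)] [FiberBundle F V] [VectorBundle ℝ F V]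
  [ContMDiffVectorBundle ∞ F V 𝓘(ℝ, EM)]
  {n : ℕ} {R : RepUpToHomotopy L d} {x y : M}

lemma integral_eq_sub_Icc {f f' : ℝ → ℝ}
    (h : ∀ s ∈ Icc (0 : ℝ) 1, HasDerivWithinAt f (f' s) (Icc 0 1) s)
    (hc : ContinuousOn f' (Icc 0 1)) : ∫ s in (0 : ℝ)..1, f' s = f 1 - f 0 :=
  intervalIntegral.integral_eq_sub_of_hasDeriv_right_of_le zero_le_one
    (fun s hs => (h s hs).continuousWithinAt)
    (fun s hs => ((h s ⟨hs.1.le, hs.2.le⟩).hasDerivAt (Icc_mem_nhds hs.1 hs.2)).hasDerivWithinAt)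
    (hc.intervalIntegrable_of_Icc zero_le_one)

lemma HasCov.deriv_end {κ : CubeMorphism L (n + 1)} {D : AConnection L F V}
    {p : Fin (n + 1) → ℝ} {k : Fin (n + 1)} (hy : BdyAt κ 1 y) (hp : p ∈ cube (n + 1))
    (h1 : p 0 = 1) (hk : k ≠ 0) {ι : Type*} [Fintype ι] {c : ι → (Fin (n + 1) → ℝ) → ℝ}
    {e : ι → Sec EM F V} {u' : V (κ.base p)} {v : V y}
    (h : HasCov κ D k (fun q => ∑ b, c b q • e b (κ.base q)) p u')
    (hv : (⟨_, u'⟩ : TotalSpace F V) = ⟨y, v⟩) (ξ : DualSec EM F V) :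
    HasDerivWithinAt (fun r => ξ y (∑ b, c b (Function.update p k r) • e b y)) (ξ y v)
      (Icc 0 1) (p k) := by
  have hb : ∀ r ∈ Icc (0 : ℝ) 1, κ.base (Function.update p k r) = y := fun r hr =>
    hy.base (update_mem_cube hp k hr) (by rw [Function.update_of_ne hk.symm, h1])
  let φ : M → (Fin (n + 1) → ℝ) → ℝ := fun z q => ξ z (∑ b, c b q • e b z)
  refine ((h ξ).congr (fun r hr => ?_) ?_).congr_deriv ?_
  · exact congrArg (fun z => φ z _) (hb r hr).symm
  · exact congrArg (fun z => φ z _) (hb _ (mem_cube.1 hp k)).symm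
  · rw [hy.vec hp h1 hk, D.dualAlong_zero, zero_add]
    exact congrArg (fun P : TotalSpace F V => ξ P.proj P.snd) hv

variable {a₀ a₁ : APath L x y} (σ : AHomotopy a₀ a₁)

lemma AHomotopy.line₀ : ∀ r ∈ Icc (0 : ℝ) 1,
    a₀.curve r = σ.mor.comp 0 (Function.update ![0, 0] 0 r) := fun r hr =>
  (σ.source r hr).symm.trans (congrArg _ (update_vec2_zero 0 0 r).symm)

lemma AHomotopy.line₁ : ∀ r ∈ Icc (0 : ℝ) 1,
    a₁.curve r = σ.mor.comp 0 (Function.update ![0, 1] 0 r) := fun r hr =>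
  (σ.target r hr).symm.trans (congrArg _ (update_vec2_zero 0 1 r).symm)

/-- `∂ ∘ hol(σ)` is the difference of the holonomies of the target and the source in `E`. -/
theorem map_hol₂ (e : E x) :
    d y (hol₂ R σ e) = hol R.connE a₁ e - hol R.connE a₀ e := by
  obtain ⟨l⟩ := nonempty_liftData R σ.mor σ.bdy.1 e
  have hL : ∀ s ∈ Icc (0 : ℝ) 1, LineLift R σ.mor 1 ![0, s] e 0
      (∑ b, l.y (.inl b) ![1, s] • l.fE.e b y) (∑ b, l.y (.inr (1, b)) ![1, s] • l.fC.e b y) :=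
    fun s hs => by
      have h := l.lineLift σ.bdy.1 σ.bdy.2 (vec2_mem_cube zero_mem_I hs) 1
      rwa [show (Function.update ![0, s] 0 1 : Fin (1 + 1) → ℝ) = ![1, s] from
        update_vec2_zero 0 s 1] at h
  rw [← (hL 1 one_mem_I).eq_hol (vec2_mem_cube zero_mem_I one_mem_I) a₁ σ.line₁,
    ← (hL 0 zero_mem_I).eq_hol (vec2_mem_cube zero_mem_I zero_mem_I) a₀ σ.line₀]
  refine eq_of_forall_dual (EM := EM) FE fun ζ => ?_
  obtain ⟨hc, hI⟩ := dual_hol₂ σ e (fun s hs => ⟨_, hL s hs⟩)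
    ((ζ y : E y →L[ℝ] ℝ).toLinearMap ∘ₗ (d y : C y →L[ℝ] E y).toLinearMap)
  refine hI.trans ?_
  rw [map_sub]
  refine integral_eq_sub_Icc (f := fun s => ζ y (∑ b, l.y (.inl b) ![1, s] • l.fE.e b y))
    (fun s hs => ?_) hc
  have hp := vec2_mem_cube one_mem_I hs
  have h := HasCov.deriv_end (p := ![1, s]) σ.bdy.2 hp rfl one_ne_zero
    (l.cov_u_k σ.bdy.1 one_ne_zero hp) (congrArg (fun z => (⟨z, d z (∑ b,
      l.y (.inr (1, b)) ![1, s] • l.fC.e b z)⟩ : TotalSpace FE E)) (σ.bdy.2.base hp rfl)) ζ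
  exact h.congr (fun r _ => congrArg (fun q => ζ y (∑ b, l.y (.inl b) q • l.fE.e b y))
    (update_vec2_one 1 s r).symm) (congrArg (fun q => ζ y (∑ b, l.y (.inl b) q • l.fE.e b y))
    (update_vec2_one 1 s s).symm)

/-- `hol(σ) ∘ ∂` is the difference of the holonomies of the target and the source in `C`. -/
theorem hol₂_map (c : C x) :
    hol₂ R σ (d x c) = hol R.connC a₁ c - hol R.connC a₀ c := by
  obtain ⟨S₁, h₁, f₁⟩ := exists_frame_nhds (F := FA) (V := A) σ.mor
  obtain ⟨S₂, h₂, f₂⟩ := exists_frame_nhds (F := FC) (V := C) σ.mor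
  obtain ⟨fA⟩ := FrameOn.mono (S := S₁ ∩ S₂) f₁ inter_subset_left
  obtain ⟨f⟩ := FrameOn.mono (S := S₁ ∩ S₂) f₂ inter_subset_right
  have hS : ∀ q ∈ cube 2, S₁ ∩ S₂ ∈ 𝓝 (σ.mor.base q) := fun q hq =>
    inter_mem (h₁ q hq) (h₂ q hq)
  have hm : ∀ q ∈ cube 2, σ.mor.base q ∈ S₁ ∩ S₂ := fun q hq => mem_of_mem_nhds (hS q hq)
  have h00 := vec2_mem_cube zero_mem_I zero_mem_I
  have hx : x ∈ S₁ ∩ S₂ := σ.bdy.1.base h00 rfl ▸ hm _ h00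
  obtain ⟨v, z, -, -, hv0, hz0, hv, hvz, hz, hz'⟩ := exists_matrix_ode
    (contDiffOn_transportCoeff f σ.mor R.connC) fun b => f.ξ b x c
  let Z : ∀ q, C (σ.mor.base q) := fun q => ∑ b, v b q • f.e b (σ.mor.base q)
  let Z' : ∀ q, C (σ.mor.base q) := fun q => ∑ b, (z 1 b q • f.e b (σ.mor.base q)
    + v b q • R.connC.along (f.e b) (σ.mor.base q) (σ.mor.vec 1 q))
  have hsum : ∀ p ∈ cube 2, ∑ b, ((∑ j, transportCoeff f σ.mor R.connC b j p * v j p)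
      • f.e b (σ.mor.base p) + v b p • R.connC.along (f.e b) (σ.mor.base p) (σ.mor.vec 0 p)) = 0 :=
    fun p hp => by
      have h : ∀ b, ∑ j, transportCoeff f σ.mor R.connC b j p * v j p = -f.ξ b (σ.mor.base p)
          (∑ j, v j p • R.connC.along (f.e j) (σ.mor.base p) (σ.mor.vec 0 p)) := fun b => by
        simp only [transportCoeff, map_sum, map_smul, smul_eq_mul, mul_neg, Finset.sum_neg_distrib,
          mul_comm]
      rw [Finset.sum_add_distrib]
      simp only [h, neg_smul, Finset.sum_neg_distrib]
      rw [f.sum_eq _ (hm p hp), neg_add_cancel]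
  have hZ : ∀ p ∈ cube 2, HasCov σ.mor R.connC 0 Z p 0 := fun p hp =>
    (HasCov.sum fun b _ => HasCov.smul_sec hp (hv b p hp) (f.e b)).congr_deriv (hsum p hp)
  have hZ1 : ∀ p ∈ cube 2, HasCov σ.mor R.connC 1 Z p (Z' p) := fun p hp =>
    HasCov.sum fun b _ => HasCov.smul_sec hp (hvz 1 one_ne_zero b p hp) (f.e b)
  have hZ' : ∀ p ∈ cube 2, HasCov σ.mor R.connC 0 Z' p
      (R.omega.bilin _ (d _ (Z p)) (σ.mor.vec 0 p) (σ.mor.vec 1 p)) := fun p hp => by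
    obtain ⟨a, ha, ha'⟩ := exists_hasCov_comm (D := R.connC) (i := 0) (j := 1) fA hS hp f.e
      (y := v) (yi := fun b q => ∑ j, transportCoeff f σ.mor R.connC b j q * v j q)
      (yj := z 1) (fun b => hv b p hp) (fun b => hvz 1 one_ne_zero b p hp)
      (fun b => hz 1 one_ne_zero b p hp) (fun b => hz' 1 one_ne_zero b p hp)
    have h0 : a = 0 := ha.unique hp (HasCov.zero.congr hp hsum)
    refine ha'.congr_deriv ?_
    rw [h0, zero_add]
    simp only [Z, map_sum, map_smul]
    rw [R.omega.bilin_sum]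
    refine Finset.sum_congr rfl fun b _ => ?_
    rw [← R.omega_d, R.omega.onSec_apply, fA.ext_apply (hm p hp), fA.ext_apply (hm p hp)]
    rfl
  have hu0 : ∀ s, (Function.update ![0, s] 0 0 : Fin (1 + 1) → ℝ) = ![0, s] := fun s =>
    update_vec2_zero 0 s 0
  have hu1 : ∀ s, (Function.update ![0, s] 0 1 : Fin (1 + 1) → ℝ) = ![1, s] := fun s =>
    update_vec2_zero 0 s 1
  have hs0 : ∀ s ∈ Icc (0 : ℝ) 1, (⟨_, Z ![0, s]⟩ : TotalSpace FC C) = ⟨x, c⟩ := fun s hs => by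
    have h := vec2_mem_cube zero_mem_I hs
    have h1 : Z ![0, s] = ∑ b, f.ξ b x c • f.e b (σ.mor.base ![0, s]) :=
      Finset.sum_congr rfl fun b _ => by rw [hv0 b _ h rfl]
    rw [h1]
    exact (congrArg (fun z => (⟨z, ∑ b, f.ξ b x c • f.e b z⟩ : TotalSpace FC C))
      (σ.bdy.1.base h rfl)).trans (congrArg _ (f.sum_eq x hx c))
  have hs1 : ∀ s ∈ Icc (0 : ℝ) 1, (⟨_, Z' ![1, s]⟩ : TotalSpace FC C)
      = ⟨y, ∑ b, z 1 b ![1, s] • f.e b y⟩ := fun s hs => by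
    have h := vec2_mem_cube one_mem_I hs
    have h1 : Z' ![1, s] = ∑ b, z 1 b ![1, s] • f.e b (σ.mor.base ![1, s]) :=
      Finset.sum_congr rfl fun b _ => by
        rw [σ.bdy.2.vec h rfl one_ne_zero, map_zero, smul_zero, add_zero]
    rw [h1]
    exact congrArg (fun w => (⟨w, ∑ b, z 1 b ![1, s] • f.e b w⟩ : TotalSpace FC C))
      (σ.bdy.2.base h rfl)
  have hL : ∀ s ∈ Icc (0 : ℝ) 1, LineLift R σ.mor 1 ![0, s] (d x c) 0
      (d y (∑ b, v b ![1, s] • f.e b y)) (∑ b, z 1 b ![1, s] • f.e b y) := fun s hs => by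
    have hp := fun r hr => update_mem_cube (vec2_mem_cube zero_mem_I hs) 0 (r := r) hr
    refine ⟨fun q => d _ (Z q), Z', fun r hr => ((hZ _ (hp r hr)).map d R.chain
      (hp r hr)).congr_deriv (map_zero _), fun r hr => hZ' _ (hp r hr), ?_, ?_, ?_, ?_⟩
    all_goals first | rw [hu0] | rw [hu1]
    · exact congrArg (fun P : TotalSpace FC C => (⟨P.proj, d P.proj P.snd⟩ : TotalSpace FE E))
        (hs0 s hs)
    · have h := vec2_mem_cube zero_mem_I hs
      have h1 : Z' ![0, s] = 0 := Finset.sum_eq_zero fun b _ => by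
        rw [σ.bdy.1.vec h rfl one_ne_zero, map_zero, smul_zero, add_zero,
          hz0 1 one_ne_zero b _ h rfl, zero_smul]
      rw [h1]
      exact mk_zero_eq (σ.bdy.1.base h rfl)
    · exact congrArg (fun w => (⟨w, d w (∑ b, v b ![1, s] • f.e b w)⟩ : TotalSpace FE E))
        (σ.bdy.2.base (vec2_mem_cube one_mem_I hs) rfl)
    · exact hs1 s hs
  have hend : ∀ s ∈ Icc (0 : ℝ) 1, ∀ b : APath L x y, (∀ r ∈ Icc (0 : ℝ) 1,
      b.curve r = σ.mor.comp 0 (Function.update ![0, s] 0 r)) →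
      hol R.connC b c = ∑ b, v b ![1, s] • f.e b y := fun s hs b hb => by
    have hp := vec2_mem_cube zero_mem_I hs
    have h := mk_eq_hol (D := R.connC) (v := c) hp b hb
      (fun r hr => hZ _ (update_mem_cube hp 0 hr)) (by rw [hu0]; exact hs0 s hs)
    rw [hu1] at h
    exact snd_eq_of_mk_eq (h.symm.trans (congrArg (fun w => (⟨w, ∑ b, v b ![1, s] • f.e b w⟩ :
      TotalSpace FC C)) (σ.bdy.2.base (vec2_mem_cube one_mem_I hs) rfl)))
  rw [hend 1 one_mem_I a₁ σ.line₁, hend 0 zero_mem_I a₀ σ.line₀]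
  refine eq_of_forall_dual (EM := EM) FC fun ξ => ?_
  obtain ⟨hc, hI⟩ := dual_hol₂ σ (d x c) (fun s hs => ⟨_, hL s hs⟩)
    (ξ y : C y →L[ℝ] ℝ).toLinearMap
  refine hI.trans ?_
  rw [map_sub]
  refine integral_eq_sub_Icc (f := fun s => ξ y (∑ b, v b ![1, s] • f.e b y))
    (fun s hs => ?_) hc
  have hp := vec2_mem_cube one_mem_I hs
  have h := HasCov.deriv_end (p := ![1, s]) σ.bdy.2 hp rfl one_ne_zero (hZ1 _ hp) (hs1 s hs) ξ
  exact h.congr (fun r _ => congrArg (fun q => ξ y (∑ b, v b q • f.e b y))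
    (update_vec2_one 1 s r).symm) (congrArg (fun q => ξ y (∑ b, v b q • f.e b y))
    (update_vec2_one 1 s s).symm)

end ChainHomotopy

section Invariance

variable {R : RepUpToHomotopy L d} {x y : M}

lemma HomTwoForm.bilin_eq_zero (Ω : HomTwoForm EM FA A FE E FC C) {x : M} {v w : A x}
    (h : ExteriorAlgebra.ιMulti ℝ 2 ![v, w] = 0) (ε : E x) : Ω.bilin x ε v w = 0 := by
  have h1 := ExteriorAlgebra.liftAlternating_apply_ιMulti (R := ℝ)
    (Pi.single 2 (Ω.form x) : ∀ i, A x [⋀^Fin i]→ₗ[ℝ] (E x →L[ℝ] C x)) ![v, w]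
  rw [h, map_zero, Pi.single_eq_same] at h1
  rw [Ω.bilin_apply, ← h1]
  rfl

variable {a₀ a₁ a₀' a₁' : APath L x y} (σ : AHomotopy a₀ a₁) (σ' : AHomotopy a₀' a₁')

lemma hol₂_of_thin (h : ThinCube σ.mor) (e : E x) : hol₂ R σ e = 0 := by
  refine eq_of_forall_dual (EM := EM) FC fun ξ => ?_
  have hL : ∀ s ∈ Icc (0 : ℝ) 1, ∃ e' : E y, LineLift R σ.mor 1 ![0, s] e 0 e' (0 : C y) :=
    fun s hs => by
      obtain ⟨e', c', hc⟩ := exists_lineLift (R := R) σ e hs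
      have hp := vec2_mem_cube zero_mem_I hs
      obtain rfl := hc.eq_zero hp fun r hr ε =>
        R.omega.bilin_eq_zero (h _ (update_mem_cube hp 0 hr)) ε
      exact ⟨e', hc⟩
  refine (dual_hol₂ σ e hL (ξ y : C y →L[ℝ] ℝ).toLinearMap).2.trans ?_
  simp

lemma update_vec3_zero (t s u r : ℝ) :
    (Function.update ![t, s, u] 0 r : Fin 3 → ℝ) = ![r, s, u] := by
  funext i
  fin_cases i <;> rfl

lemma update_vec3_one (t s u r : ℝ) :
    (Function.update ![t, s, u] 1 r : Fin 3 → ℝ) = ![t, r, u] := by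
  funext i
  fin_cases i <;> rfl

lemma update_vec3_two (t s u r : ℝ) :
    (Function.update ![t, s, u] 2 r : Fin 3 → ℝ) = ![t, s, r] := by
  funext i
  fin_cases i <;> rfl

lemma LiftData.dual_hol₂_face {H : CubeMorphism L 3} {e : E x} (l : LiftData R H e)
    (hB : Bdy H x y) {c : ℝ} (hc : c ∈ Icc (0 : ℝ) 1) (h : SameOn (H.pull (face 2 c hc)) σ.mor)
    (ξ : C y →ₗ[ℝ] ℝ) :
    ξ (hol₂ R σ e) = ∫ s in (0 : ℝ)..1, ∑ b, l.y (.inr (1, b)) ![1, s, c] * ξ (l.fC.e b y) := by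
  have h' := (sameOn_face_iff hc).1 h
  have hL : ∀ s ∈ Icc (0 : ℝ) 1, ∃ e' : E y, LineLift R σ.mor 1 ![0, s] e 0 e'
      (∑ b, l.y (.inr (1, b)) ![1, s, c] • l.fC.e b y) := fun s hs => by
    have hl := l.lineLift hB.1 hB.2 (vec3_mem_cube zero_mem_I hs hc) 1
    rw [show (Function.update ![0, s, c] 0 1 : Fin (2 + 1) → ℝ) = ![1, s, c] from
      update_vec3_zero ..] at hl
    have key : ∀ r ∈ Icc (0 : ℝ) 1, ∀ i : Fin 2, H.comp ((2 : Fin 3).succAbove i)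
        (Function.update ![0, s, c] 0 r) = σ.mor.comp i (Function.update ![0, s] 0 r) :=
      fun r hr i => by
        have h2 := h' _ (vec2_mem_cube hr hs)
        rw [insertNth_two] at h2
        rw [update_vec3_zero, update_vec2_zero]
        fin_cases i
        exacts [h2.1, h2.2]
    exact ⟨_, hl.transfer (fun r hr => key r hr 0) fun r hr => key r hr 1⟩
  refine (dual_hol₂ σ e hL ξ).2.trans ?_
  simp only [map_sum, map_smul, smul_eq_mul]

lemma LiftData.sum_face_eq_zero {H : CubeMorphism L 3} {e : E x} (l : LiftData R H e)
    (hB : Bdy H x y) {c : ℝ} (hc : c ∈ Icc (0 : ℝ) 1) (h : ThinCube (H.pull (face 1 c hc)))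
    (ξ : C y →ₗ[ℝ] ℝ) {u : ℝ} (hu : u ∈ Icc (0 : ℝ) 1) :
    ∑ b, l.y (.inr (2, b)) ![1, c, u] * ξ (l.fC.e b y) = 0 := by
  have hp := vec3_mem_cube zero_mem_I hc hu
  have hl := l.lineLift hB.1 hB.2 hp 2
  rw [show (Function.update ![0, c, u] 0 1 : Fin (2 + 1) → ℝ) = ![1, c, u] from
    update_vec3_zero ..] at hl
  have h0 := hl.eq_zero hp fun r hr ε => by
    have ht := h _ (vec2_mem_cube hr hu)
    rw [ThinJet, pull_face_jet, insertNth_one, ← update_vec3_zero 0 c u r] at ht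
    exact R.omega.bilin_eq_zero ht ε
  have h1 := congrArg ξ h0
  simpa only [map_sum, map_smul, smul_eq_mul, map_zero] using h1

/-- Holonomy is invariant under 3-homotopy. -/
theorem hol₂_eq_of_homotopic (h : Homotopic₃ x y σ.mor σ'.mor) (e : E x) :
    hol₂ R σ e = hol₂ R σ' e := by
  obtain ⟨H, hB, h0, h1, ht0, ht1⟩ := h
  obtain ⟨l⟩ := nonempty_liftData R H hB.1 e
  refine eq_of_forall_dual (EM := EM) FC fun ξ => ?_
  let η : C y →ₗ[ℝ] ℝ := (ξ y : C y →L[ℝ] ℝ).toLinearMap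
  change η _ = η _
  let P : Fin 3 → (Fin 3 → ℝ) → ℝ := fun i q => ∑ b, l.y (.inr (i, b)) q * η (l.fC.e b y)
  let Q : Fin 3 → Fin 3 → (Fin 3 → ℝ) → ℝ := fun k i q =>
    ∑ b, l.z k (.inr (i, b)) q * η (l.fC.e b y)
  have hsym : ∀ s ∈ Icc (0 : ℝ) 1, ∀ u ∈ Icc (0 : ℝ) 1, Q 2 1 ![1, s, u] = Q 1 2 ![1, s, u] :=
    fun s hs u hu => by
      have hp := vec3_mem_cube one_mem_I hs hu
      have h12 := l.wk_sub_wk hB.1 (i := 1) (k := 2) (by decide) (by decide) hp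
      have hv1 := hB.2.vec (k := 1) hp rfl (by decide)
      have hv2 := hB.2.vec (k := 2) hp rfl (by decide)
      simp only [LiftData.wk, hv1, hv2, map_zero, smul_zero, add_zero, sub_eq_zero] at h12
      have h3 : ∑ b, l.z 2 (.inr (1, b)) ![1, s, u] • l.fC.e b y
          = ∑ b, l.z 1 (.inr (2, b)) ![1, s, u] • l.fC.e b y := by
        rw [← hB.2.base hp rfl]
        exact h12
      simpa only [map_sum, map_smul, smul_eq_mul] using congrArg η h3
  have hP : ∀ i, Continuous (P i) := fun i =>
    continuous_finsetSum _ fun b _ => (l.y_cont _).mul continuous_const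
  have hQ : ∀ k, k ≠ 0 → ∀ i, Continuous (Q k i) := fun k hk i =>
    continuous_finsetSum _ fun b _ => (l.z_cont k hk _).mul continuous_const
  have hd : ∀ k, k ≠ 0 → ∀ i, ∀ q ∈ cube 3,
      HasDerivWithinAt (fun r => P i (Function.update q k r)) (Q k i q) (Icc 0 1) (q k) :=
    fun k hk i q hq =>
      HasDerivWithinAt.fun_sum fun b _ => (l.y_partial k hk _ q hq).mul_const _
  have hu : ∀ s ∈ Icc (0 : ℝ) 1,
      ∫ u in (0 : ℝ)..1, Q 2 1 ![1, s, u] = P 1 ![1, s, 1] - P 1 ![1, s, 0] := fun s hs =>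
    integral_eq_sub_Icc (f := fun u => P 1 ![1, s, u]) (fun u hu => by
      have h := hd 2 (by decide) 1 _ (vec3_mem_cube one_mem_I hs hu)
      simp only [update_vec3_two] at h
      exact h) ((hQ 2 (by decide) 1).comp (by fun_prop)).continuousOn
  have hs : ∀ u ∈ Icc (0 : ℝ) 1, ∫ s in (0 : ℝ)..1, Q 1 2 ![1, s, u] = 0 := fun u hu => by
    refine (integral_eq_sub_Icc (f := fun s => P 2 ![1, s, u]) (fun s hs => by
      have h := hd 1 (by decide) 2 _ (vec3_mem_cube one_mem_I hs hu)
      simp only [update_vec3_one] at h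
      exact h) ((hQ 1 (by decide) 2).comp (by fun_prop)).continuousOn).trans ?_
    exact (congrArg₂ _ (l.sum_face_eq_zero hB _ ht1 η hu)
      (l.sum_face_eq_zero hB _ ht0 η hu)).trans (sub_zero 0)
  have hmem : ∀ {s : ℝ}, s ∈ uIcc (0 : ℝ) 1 → s ∈ Icc (0 : ℝ) 1 := fun hs => by
    rwa [uIcc_of_le zero_le_one] at hs
  have hPi : ∀ c : ℝ, IntervalIntegrable (fun s => P 1 ![1, s, c]) MeasureTheory.volume 0 1 :=
    fun c => ((hP 1).comp (by fun_prop : Continuous fun s : ℝ => ![1, s, c])).intervalIntegrable _ _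
  have hσ : η (hol₂ R σ e) = ∫ s in (0 : ℝ)..1, P 1 ![1, s, 0] := l.dual_hol₂_face σ hB _ h0 η
  have hσ' : η (hol₂ R σ' e) = ∫ s in (0 : ℝ)..1, P 1 ![1, s, 1] := l.dual_hol₂_face σ' hB _ h1 η
  have hQc : Continuous (Function.uncurry fun s u : ℝ => Q 1 2 ![1, s, u]) :=
    (hQ 1 (by decide) 2).comp (by fun_prop : Continuous fun q : ℝ × ℝ => ![1, q.1, q.2])
  rw [eq_comm, ← sub_eq_zero, hσ, hσ', ← intervalIntegral.integral_sub (hPi 1) (hPi 0),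
    ← intervalIntegral.integral_congr fun s hs => hu s (hmem hs),
    intervalIntegral.integral_congr fun s hs => intervalIntegral.integral_congr fun u hu =>
      hsym s (hmem hs) u (hmem hu),
    MeasureTheory.intervalIntegral_intervalIntegral_swap
      ((hQc.continuousOn.integrableOn_compact (isCompact_uIcc.prod isCompact_uIcc)).mono_set
        (prod_mono uIoc_subset_uIcc uIoc_subset_uIcc)),
    intervalIntegral.integral_congr fun u hu => hs u (hmem hu), intervalIntegral.integral_zero]

end Invariance

section Classes

variable {R : RepUpToHomotopy L d} {x y z : M}

section Transport

variable
  {F : Type*} [NormedAddCommGroup F] [NormedSpace ℝ F] [FiniteDimensional ℝ F]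
  {V : M → Type*} [TopologicalSpace (TotalSpace F V)]
  [∀ x, AddCommGroup (V x)] [∀ x, Module ℝ (V x)]
  [∀ x, TopologicalSpace (V x)] [FiberBundle F V] [VectorBundle ℝ F V]
  [ContMDiffVectorBundle ∞ F V 𝓘(ℝ, EM)]
  {D : AConnection L F V} (a : APath L x y)

lemma APath.line : ∀ r ∈ Icc (0 : ℝ) 1,
    a.curve r = a.mor.comp 0 (Function.update ![0] 0 r) := fun r _ =>
  congrArg (a.mor.comp 0) (update_vec1 0 r).symm

lemma hol_add (v w : V x) : hol D a (v + w) = hol D a v + hol D a w := by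
  have hp := vec1_mem_cube zero_mem_I
  obtain ⟨U, hU, hU0, hU1⟩ := exists_hasCov_hol (D := D) hp a a.line v
  obtain ⟨W, hW, hW0, hW1⟩ := exists_hasCov_hol (D := D) hp a a.line w
  exact snd_eq_of_mk_eq ((mk_eq_hol hp a a.line
    (fun r hr => ((hU r hr).add (hW r hr)).congr_deriv (add_zero _))
    (mk_add_eq hU0 hW0)).symm.trans (mk_add_eq hU1 hW1))

lemma mk_map_eq {F' : Type*} {V' : M → Type*} (f : ∀ x, V x → V' x) {x z : M} {v : V x} {w : V z}
    (h : (⟨x, v⟩ : TotalSpace F V) = ⟨z, w⟩) :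
    (⟨x, f x v⟩ : TotalSpace F' V') = ⟨z, f z w⟩ := by
  obtain rfl : x = z := congrArg TotalSpace.proj h
  rw [snd_eq_of_mk_eq h]

lemma hol_smul (r : ℝ) (v : V x) : hol D a (r • v) = r • hol D a v := by
  have hp := vec1_mem_cube zero_mem_I
  obtain ⟨U, hU, hU0, hU1⟩ := exists_hasCov_hol (D := D) hp a a.line v
  exact snd_eq_of_mk_eq ((mk_eq_hol hp a a.line
    (fun t ht => ((hU t ht).smul (f := fun _ => r) (hasDerivWithinAt_const _ _ r)).congr_deriv
      (by rw [zero_smul, smul_zero, add_zero]))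
    (mk_map_eq (F := F) (F' := F) (fun _ => (r • ·)) hU0)).symm.trans
      (mk_map_eq (F := F) (F' := F) (fun _ => (r • ·)) hU1))

/-- Parallel transport along an `A`-path as a linear map. -/
def holₗ (D : AConnection L F V) (a : APath L x y) : V x →ₗ[ℝ] V y where
  toFun := hol D a
  map_add' := hol_add a
  map_smul' := hol_smul a

lemma holₗ_injective : Function.Injective (holₗ D a) := by
  refine (injective_iff_map_eq_zero _).2 fun v hv => ?_
  have hp := vec1_mem_cube zero_mem_I
  obtain ⟨U, hU, hU0, hU1⟩ := exists_hasCov_hol (D := D) hp a a.line v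
  have h1 : U (Function.update ![0] 0 1) = 0 := by
    have h1 := hU1.trans (congrArg (fun w => (⟨y, w⟩ : TotalSpace F V)) hv)
    exact snd_eq_of_mk_eq (h1.trans (mk_zero_eq (congrArg TotalSpace.proj h1)).symm)
  have h0 := HasCov.eq_zero_of_eq_zero (update_mem_cube hp 0 zero_mem_I)
    (fun r hr => by rw [Function.update_idem]; exact hU r hr) one_mem_I
    (by rw [Function.update_idem]; exact h1)
  rw [h0] at hU0
  exact snd_eq_of_mk_eq (hU0.symm.trans (mk_zero_eq (congrArg TotalSpace.proj hU0)))

end Transport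

lemma map_hol (a : APath L x y) (c : C x) :
    d y (hol R.connC a c) = hol R.connE a (d x c) := by
  have hp := vec1_mem_cube zero_mem_I
  obtain ⟨U, hU, hU0, hU1⟩ := exists_hasCov_hol (D := R.connC) hp a a.line c
  exact snd_eq_of_mk_eq ((mk_map_eq (F' := FE) (fun z => (d z : C z → E z)) hU1).symm.trans
    (mk_eq_hol hp a a.line (fun r hr => ((hU r hr).map d R.chain
      (update_mem_cube hp 0 hr)).congr_deriv (map_zero _))
      (mk_map_eq (F' := FE) (fun z => (d z : C z → E z)) hU0)))

lemma hol₂_add {a₀ a₁ : APath L x y} (σ : AHomotopy a₀ a₁) (e e' : E x) :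
    hol₂ R σ (e + e') = hol₂ R σ e + hol₂ R σ e' := by
  choose! u W hW using fun s (hs : s ∈ Icc (0 : ℝ) 1) => exists_lineLift (R := R) σ e hs
  choose! u' W' hW' using fun s (hs : s ∈ Icc (0 : ℝ) 1) => exists_lineLift (R := R) σ e' hs
  refine eq_of_forall_dual (EM := EM) FC fun ξ => ?_
  have h := dual_hol₂ σ e (fun s hs => ⟨_, hW s hs⟩) (ξ y : C y →L[ℝ] ℝ).toLinearMap
  have h' := dual_hol₂ σ e' (fun s hs => ⟨_, hW' s hs⟩) (ξ y : C y →L[ℝ] ℝ).toLinearMap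
  have h'' := dual_hol₂ σ (e + e') (W := fun s => W s + W' s)
    (fun s hs => ⟨_, add_zero (0 : C x) ▸ (hW s hs).add (hW' s hs)⟩) (ξ y : C y →L[ℝ] ℝ).toLinearMap
  refine h''.2.trans (Eq.trans ?_ (map_add (ξ y : C y →L[ℝ] ℝ) _ _).symm)
  refine Eq.trans ?_ (congrArg₂ (· + ·) h.2 h'.2).symm
  rw [← intervalIntegral.integral_add (h.1.intervalIntegrable_of_Icc zero_le_one)
    (h'.1.intervalIntegrable_of_Icc zero_le_one)]
  simp only [map_add]

variable (R) in
/-- The holonomy on `E` of a class of `A`-paths. -/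
def P1.holE (g : P1 L x y) : E x →ₗ[ℝ] E y :=
  Quot.lift (fun a => holₗ R.connE a) (fun a a' ⟨σ, hσ⟩ => LinearMap.ext fun e => by
    have h := map_hol₂ (R := R) σ e
    rw [hol₂_of_thin σ hσ, map_zero] at h
    exact (sub_eq_zero.1 h.symm).symm) g

variable (R) in
/-- The holonomy on `C` of a class of `A`-paths. -/
def P1.holC (g : P1 L x y) : C x →ₗ[ℝ] C y :=
  Quot.lift (fun a => holₗ R.connC a) (fun a a' ⟨σ, hσ⟩ => LinearMap.ext fun c => by
    have h := hol₂_map (R := R) σ c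
    rw [hol₂_of_thin σ hσ] at h
    exact (sub_eq_zero.1 h.symm).symm) g

variable (R) in
/-- The holonomy along an `A`-homotopy as an additive map. -/
def hol₂Hom {a₀ a₁ : APath L x y} (σ : AHomotopy a₀ a₁) : E x →+ C y where
  toFun := hol₂ R σ
  map_zero' := by
    have h := hol₂_add (R := R) σ 0 0
    rw [add_zero] at h
    exact left_eq_add.1 h
  map_add' := hol₂_add σ

variable (R) in
/-- The holonomy of a class of `A`-homotopies. -/
def P2.hol₂ (g : P2 L x y) : E x →+ C y :=
  Quot.lift (fun σ : AnyHomotopy L x y => hol₂Hom R σ.htpy)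
    (fun σ σ' h => AddMonoidHom.ext fun e =>
      hol₂_eq_of_homotopic σ.htpy σ'.htpy (threeHomotopic_iff.1 h) e) g

lemma hol₂_cls2 {κ : CubeMorphism L 2} (hB : Bdy κ x y) (e : E x) :
    (cls2 κ hB).hol₂ R e = hol₂ R (toHomotopy κ hB (a₀ := toPath _ hB.edge₀)
      (a₁ := toPath _ hB.edge₁) (SameOn.refl _) (SameOn.refl _)) e := rfl

lemma hol₂_cls2_of_thin {κ : CubeMorphism L 2} (hB : Bdy κ x y) (h : ThinCube κ) (e : E x) :
    (cls2 κ hB).hol₂ R e = 0 := by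
  rw [hol₂_cls2]
  apply hol₂_of_thin
  exact h

lemma P1.holE_injective (g : P1 L x y) : Function.Injective (g.holE R) :=
  Quot.ind (β := fun g : P1 L x y => Function.Injective (g.holE R)) (fun a => holₗ_injective a) g

lemma P1.holC_injective (g : P1 L x y) : Function.Injective (g.holC R) :=
  Quot.ind (β := fun g : P1 L x y => Function.Injective (g.holC R)) (fun a => holₗ_injective a) g

lemma P1.map_holC (g : P1 L x y) (c : C x) : d y (g.holC R c) = g.holE R (d x c) :=
  Quot.ind (β := fun g : P1 L x y => d y (g.holC R c) = g.holE R (d x c))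
    (fun a => map_hol a c) g

lemma P2.map_hol₂ (g : P2 L x y) (e : E x) :
    d y (g.hol₂ R e) = g.tgt.holE R e - g.src.holE R e :=
  Quot.ind (β := fun g : P2 L x y => d y (g.hol₂ R e) = g.tgt.holE R e - g.src.holE R e)
    (fun σ => TwoGroupoid.map_hol₂ σ.htpy e) g

lemma P2.hol₂_map (g : P2 L x y) (c : C x) :
    g.hol₂ R (d x c) = g.tgt.holC R c - g.src.holC R c :=
  Quot.ind (β := fun g : P2 L x y => g.hol₂ R (d x c) = g.tgt.holC R c - g.src.holC R c)
    (fun σ => TwoGroupoid.hol₂_map σ.htpy c) g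

lemma P1.hol₂_id (g : P1 L x y) (e : E x) : g.id.hol₂ R e = 0 := by
  induction g using P1.ind with
  | h κ hB =>
    rw [id_cls1]
    exact hol₂_cls2_of_thin hB.drop_one (thinCube_pull_one κ (drop 1)) e

end Classes

section Multiplicativity

variable {R : RepUpToHomotopy L d} {x y z : M}

section Affine

variable
  {F : Type*} [NormedAddCommGroup F] [NormedSpace ℝ F] [FiniteDimensional ℝ F]
  {V : M → Type*} [TopologicalSpace (TotalSpace F V)]
  [∀ x, AddCommGroup (V x)] [∀ x, Module ℝ (V x)]
  [∀ x, TopologicalSpace (V x)] [FiberBundle F V] [VectorBundle ℝ F V]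
  [ContMDiffVectorBundle ∞ F V 𝓘(ℝ, EM)]
  {D : AConnection L F V}

lemma AConnection.dualAlong_smul_left (ξ : DualSec EM F V) (x : M) (r : ℝ) (v : A x) (w : V x) :
    D.dualAlong ξ x (r • v) w = r * D.dualAlong ξ x v w := by
  have h := D.dualAlong_apply ξ (secExt w) x (r • v)
  have h' := D.dualAlong_apply ξ (secExt w) x v
  rw [secExt_apply] at h h'
  rw [h, h', map_smul, map_smul, map_smul, mul_sub]
  exact congrArg (· - _) (map_smul (mfderiv 𝓘(ℝ, EM) 𝓘(ℝ, ℝ) (pairing ξ (secExt w)) x) _ _)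

lemma pull_aff_vec {n : ℕ} (κ : CubeMorphism L n) (i j : Fin n) {a b : ℝ}
    (ha : a ∈ Icc (0 : ℝ) 1) (hb : b ∈ Icc (0 : ℝ) 1) (p : Fin n → ℝ) :
    (κ.pull (aff i ha hb)).vec j p
      = (if j = i then b - a else 1) • κ.vec j (aff i ha hb p) :=
  snd_eq_of_mk_eq (F := FA) (pull_aff_comp κ i j ha hb p)

lemma HasCov.pull_aff {n : ℕ} {κ : CubeMorphism L n} {i : Fin n} {a b : ℝ}
    (ha : a ∈ Icc (0 : ℝ) 1) (hb : b ∈ Icc (0 : ℝ) 1) {u : ∀ q, V (κ.base q)} {p : Fin n → ℝ}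
    {g : V (κ.base (aff i ha hb p))} (h : HasCov κ D i u (aff i ha hb p) g) :
    HasCov (κ.pull (aff i ha hb)) D i (fun q => u (aff i ha hb q)) p ((b - a) • g) := by
  intro ξ
  let k : (Fin n → ℝ) → ℝ := fun q => ξ (κ.base q) (u q)
  let m : ℝ → ℝ := fun t => (1 - t) * a + t * b
  have hm : HasDerivWithinAt m (b - a) (Icc 0 1) (p i) :=
    (((((hasDerivAt_id (p i)).const_sub 1).mul_const a).add
      ((hasDerivAt_id (p i)).mul_const b)).congr_deriv (by ring)).hasDerivWithinAt
  have hk := h ξ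
  have e1 : (fun r => k (Function.update (aff i ha hb p) i r))
      = fun r => k (Function.update p i r) := by
    funext r
    rw [aff_apply, Function.update_idem]
  have e2 : aff i ha hb p i = m (p i) := by rw [aff_apply, Function.update_self]
  change HasDerivWithinAt (fun r => k (Function.update (aff i ha hb p) i r)) _ _ _ at hk
  rw [e1, e2] at hk
  have hc := hk.scomp (p i) hm fun t ht => affine_mem ha hb ht
  have e3 : (fun r => k (aff i ha hb (Function.update p i r)))
      = (fun r => k (Function.update p i r)) ∘ m := by
    funext r
    rw [aff_apply, Function.update_idem, Function.update_self]
    rfl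
  change HasDerivWithinAt (fun r => k (aff i ha hb (Function.update p i r))) _ _ _
  rw [e3]
  refine hc.congr_deriv ?_
  rw [pull_aff_vec, if_pos rfl, smul_add]
  exact congrArg₂ (· + ·) (D.dualAlong_smul_left ξ (κ.base (aff i ha hb p)) (b - a) _ (u _)).symm
    (map_smul (ξ (κ.base (aff i ha hb p)) : V _ →L[ℝ] ℝ) _ _).symm

end Affine

lemma aff_update {n : ℕ} (i : Fin n) {a b : ℝ} (ha : a ∈ Icc (0 : ℝ) 1) (hb : b ∈ Icc (0 : ℝ) 1)
    (p : Fin n → ℝ) (r : ℝ) :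
    aff i ha hb (Function.update p i r) = Function.update p i ((1 - r) * a + r * b) := by
  rw [aff_apply, Function.update_idem, Function.update_self]

lemma HomTwoForm.bilin_smul_left (Ω : HomTwoForm EM FA A FE E FC C) (x : M) (ε : E x) (r : ℝ)
    (v w : A x) : Ω.bilin x ε (r • v) w = r • Ω.bilin x ε v w := by
  rw [map_smul]
  rfl

lemma LineLift.pull_aff {n : ℕ} {κ : CubeMorphism L (n + 1)} {i : Fin (n + 1)} (hi : i ≠ 0)
    {p : Fin (n + 1) → ℝ} {a b : ℝ}
    (ha : a ∈ Icc (0 : ℝ) 1) (hb : b ∈ Icc (0 : ℝ) 1)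
    {u : ∀ q, E (κ.base q)} {w : ∀ q, C (κ.base q)}
    (hu : ∀ r ∈ Icc (0 : ℝ) 1, HasCov κ R.connE 0 u (Function.update p 0 r) 0)
    (hw : ∀ r ∈ Icc (0 : ℝ) 1, HasCov κ R.connC 0 w (Function.update p 0 r)
      (R.omega.bilin _ (u (Function.update p 0 r)) (κ.vec 0 (Function.update p 0 r))
        (κ.vec i (Function.update p 0 r)))) {e : E x} {c : C x} {e' : E y} {c' : C y}
    (he : (⟨_, u (Function.update p 0 a)⟩ : TotalSpace FE E) = ⟨x, e⟩)
    (hc : (⟨_, w (Function.update p 0 a)⟩ : TotalSpace FC C) = ⟨x, c⟩)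
    (he' : (⟨_, u (Function.update p 0 b)⟩ : TotalSpace FE E) = ⟨y, e'⟩)
    (hc' : (⟨_, w (Function.update p 0 b)⟩ : TotalSpace FC C) = ⟨y, c'⟩) :
    LineLift R (κ.pull (aff 0 ha hb)) i p e c e' c' := by
  have h0 : aff 0 ha hb (Function.update p 0 0) = Function.update p 0 a := by
    rw [aff_update]; congr 1; ring
  have h1 : aff 0 ha hb (Function.update p 0 1) = Function.update p 0 b := by
    rw [aff_update]; congr 1; ring
  refine ⟨fun q => u (aff 0 ha hb q), fun q => w (aff 0 ha hb q), fun r hr => ?_, fun r hr => ?_,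
    (congrArg (fun q => (⟨κ.base q, u q⟩ : TotalSpace FE E)) h0).trans he,
    (congrArg (fun q => (⟨κ.base q, w q⟩ : TotalSpace FC C)) h0).trans hc,
    (congrArg (fun q => (⟨κ.base q, u q⟩ : TotalSpace FE E)) h1).trans he',
    (congrArg (fun q => (⟨κ.base q, w q⟩ : TotalSpace FC C)) h1).trans hc'⟩
  · have h : ∀ q, q = Function.update p 0 ((1 - r) * a + r * b) → HasCov κ R.connE 0 u q 0 := by
      rintro _ rfl
      exact hu _ (affine_mem ha hb hr)
    exact (HasCov.pull_aff ha hb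
      (h _ (aff_update 0 ha hb p r))).congr_deriv (smul_zero (A := E (κ.base (aff 0 ha hb (Function.update p 0 r)))) _)
  · refine (HasCov.pull_aff ha hb
      (g := R.omega.bilin _ (u (aff 0 ha hb (Function.update p 0 r)))
        (κ.vec 0 (aff 0 ha hb (Function.update p 0 r)))
        (κ.vec i (aff 0 ha hb (Function.update p 0 r)))) ?_).congr_deriv ?_
    · rw [aff_update]
      exact hw _ (affine_mem ha hb hr)
    · rw [pull_aff_vec, pull_aff_vec, if_pos rfl, if_neg hi, one_smul]
      exact (R.omega.bilin_smul_left (κ.base (aff 0 ha hb (Function.update p 0 r))) _ _ _ _).symm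

section Halves

variable {n : ℕ} {κ₁ κ₂ : CubeMorphism L (n + 1)}

lemma sameOn_glue_fst (h : Match 0 κ₁ κ₂) :
    SameOn ((glue 0 κ₁ κ₂ h).pull (aff 0 zero_mem_I half_mem_I))
      (κ₁.pull (reparam 0 cut contDiff_cut fun _ _ => cut_mem _)) := by
  refine (sameOn_pull_glue_lo _ _ fun p hp => ?_).trans (sameOn_pull_congr _ fun p _ => ?_)
  · rw [aff_apply, Function.update_self]
    linarith [(mem_cube.1 hp 0).2]
  · change lo 0 (aff 0 zero_mem_I half_mem_I p) = _
    simp only [aff_apply, lo_apply, reparam_apply, Function.update_self, Function.update_idem]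
    congr 2
    ring

lemma sameOn_glue_snd (h : Match 0 κ₁ κ₂) :
    SameOn ((glue 0 κ₁ κ₂ h).pull (aff 0 half_mem_I one_mem_I))
      (κ₂.pull (reparam 0 cut contDiff_cut fun _ _ => cut_mem _)) := by
  refine (sameOn_pull_glue_hi _ _ fun p hp => ?_).trans (sameOn_pull_congr _ fun p _ => ?_)
  · rw [aff_apply, Function.update_self]
    linarith [(mem_cube.1 hp 0).1]
  · change hi 0 (aff 0 half_mem_I one_mem_I p) = _
    simp only [aff_apply, hi_apply, reparam_apply, Function.update_self, Function.update_idem]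
    congr 2
    ring

lemma SameOn.comp_eq {κ κ' : CubeMorphism L n} (h : SameOn κ κ') (i : Fin n) {p : Fin n → ℝ}
    (hp : p ∈ cube n) : κ.comp i p = κ'.comp i p :=
  congrArg (fun J : Σ x : M, Fin n → A x => (⟨J.1, J.2 i⟩ : TotalSpace FA A)) (h p hp)

lemma LineLift.congr {κ κ' : CubeMorphism L (n + 1)} {i : Fin (n + 1)} {p : Fin (n + 1) → ℝ}
    {e : E x} {c : C x} {e' : E y} {c' : C y} (h : LineLift R κ i p e c e' c') (hs : SameOn κ κ')
    (hp : p ∈ cube (n + 1)) : LineLift R κ' i p e c e' c' :=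
  h.transfer (fun _ hr => hs.comp_eq 0 (update_mem_cube hp 0 hr))
    fun _ hr => hs.comp_eq i (update_mem_cube hp 0 hr)

lemma LineLift.split (h1 : Bdy κ₁ x y) (h2 : Bdy κ₂ y z) {i : Fin (n + 1)} (hi : i ≠ 0)
    {p : Fin (n + 1) → ℝ} (hp : p ∈ cube (n + 1)) {e : E x} {c : C x} {e'' : E z} {c'' : C z}
    (h : LineLift R (glue 0 κ₁ κ₂ (h1.match_zero h2)) i p e c e'' c'') :
    ∃ (e' : E y) (c' : C y),
      LineLift R (κ₁.pull (reparam 0 cut contDiff_cut fun _ _ => cut_mem _)) i p e c e' c' ∧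
      LineLift R (κ₂.pull (reparam 0 cut contDiff_cut fun _ _ => cut_mem _)) i p e' c' e'' c'' := by
  obtain ⟨u, w, hu, hw, he, hc, he', hc'⟩ := h
  have hb : BdyAt (glue 0 κ₁ κ₂ (h1.match_zero h2)) (1 / 2) y :=
    BdyAt.glue_lo le_rfl (by rw [cut_eq_one (by norm_num)]; exact h1.2) _
  have hy := hb.base (update_mem_cube hp 0 half_mem_I) (Function.update_self ..)
  obtain ⟨e', he1⟩ : ∃ e' : E y, (⟨_, u (Function.update p 0 (1 / 2))⟩ : TotalSpace FE E)
    = ⟨y, e'⟩ := ⟨_, (mk_fiberAt hy).symm⟩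
  obtain ⟨c', hc1⟩ : ∃ c' : C y, (⟨_, w (Function.update p 0 (1 / 2))⟩ : TotalSpace FC C)
    = ⟨y, c'⟩ := ⟨_, (mk_fiberAt hy).symm⟩
  exact ⟨e', c', (LineLift.pull_aff hi zero_mem_I half_mem_I hu hw he hc he1 hc1).congr
    (sameOn_glue_fst _) hp, (LineLift.pull_aff hi half_mem_I one_mem_I hu hw he1 hc1 he' hc').congr
    (sameOn_glue_snd _) hp⟩

end Halves

section Squares

variable {κ : CubeMorphism L 2}

lemma src_line (hB : Bdy κ x y) {s : ℝ}
    (hs : ∀ r ∈ Icc (0 : ℝ) 1, κ.comp 0 ![r, s] = κ.comp 0 ![r, 0]) : ∀ r ∈ Icc (0 : ℝ) 1,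
    (toPath (κ.pull edge₀) hB.edge₀).curve r = κ.comp 0 (Function.update ![0, s] 0 r) :=
  fun r hr => by
    rw [update_vec2_zero, hs r hr, ← update_vec2_zero 0 0 r]
    exact (toHomotopy κ hB (a₀ := toPath _ hB.edge₀) (a₁ := toPath _ hB.edge₁) (SameOn.refl _)
      (SameOn.refl _)).line₀ r hr

lemma tgt_line (hB : Bdy κ x y) {s : ℝ}
    (hs : ∀ r ∈ Icc (0 : ℝ) 1, κ.comp 0 ![r, s] = κ.comp 0 ![r, 1]) : ∀ r ∈ Icc (0 : ℝ) 1,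
    (toPath (κ.pull edge₁) hB.edge₁).curve r = κ.comp 0 (Function.update ![0, s] 0 r) :=
  fun r hr => by
    rw [update_vec2_zero, hs r hr, ← update_vec2_zero 0 1 r]
    exact (toHomotopy κ hB (a₀ := toPath _ hB.edge₀) (a₁ := toPath _ hB.edge₁) (SameOn.refl _)
      (SameOn.refl _)).line₁ r hr

lemma exists_lineLift_cls2 (hB : Bdy κ x y) (e : E x) {s : ℝ} (hs : s ∈ Icc (0 : ℝ) 1) :
    ∃ (e' : E y) (c' : C y), LineLift R κ 1 ![0, s] e 0 e' c' :=
  exists_lineLift (R := R) (toHomotopy κ hB (a₀ := toPath _ hB.edge₀) (a₁ := toPath _ hB.edge₁)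
    (SameOn.refl _) (SameOn.refl _)) e hs

lemma dual_hol₂_cls2 (hB : Bdy κ x y) {e : E x} {W : ℝ → C y}
    (hW : ∀ s ∈ Icc (0 : ℝ) 1, ∃ e' : E y, LineLift R κ 1 ![0, s] e 0 e' (W s))
    (ξ : C y →ₗ[ℝ] ℝ) :
    ContinuousOn (fun s => ξ (W s)) (Icc 0 1) ∧
      ξ ((cls2 κ hB).hol₂ R e) = ∫ s in (0 : ℝ)..1, ξ (W s) :=
  dual_hol₂ (toHomotopy κ hB (a₀ := toPath _ hB.edge₀) (a₁ := toPath _ hB.edge₁)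
    (SameOn.refl _) (SameOn.refl _)) e hW ξ

end Squares

section Products

variable {κ₁ κ₂ : CubeMorphism L 2}

lemma cls2_reparam_cut {κ : CubeMorphism L 2} (hB : Bdy κ x y)
    (hB' : Bdy (κ.pull (reparam 0 cut contDiff_cut fun _ _ => cut_mem _)) x y) :
    cls2 (κ.pull (reparam 0 cut contDiff_cut fun _ _ => cut_mem _)) hB' = cls2 κ hB :=
  cls2_reparam_zero_id hB contDiff_cut _ (cut_eq_zero (by norm_num)) (cut_eq_one (by norm_num)) _

lemma Bdy.reparam_cut {κ : CubeMorphism L 2} (hB : Bdy κ x y) :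
    Bdy (κ.pull (TwoGroupoid.reparam 0 cut contDiff_cut fun _ _ => cut_mem _)) x y :=
  Bdy.reparam (by rw [cut_eq_zero (by norm_num)]; exact hB.1)
    (by rw [cut_eq_one (by norm_num)]; exact hB.2) _ _

lemma P2.holE_src_mul (g : P2 L y z) (h : P2 L x y) (e : E x) :
    (P2.mul g h).src.holE R e = g.src.holE R (h.src.holE R e) := by
  induction g using P2.ind with | _ κ₂ h2
  induction h using P2.ind with | _ κ₁ h1
  obtain ⟨e'', c'', hl⟩ := exists_lineLift_cls2 (R := R) (h1.glue_zero h2) e zero_mem_I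
  have hp := vec2_mem_cube zero_mem_I zero_mem_I
  obtain ⟨e', c', hl1, hl2⟩ := hl.split h1 h2 (by decide) hp
  rw [mul_cls2, ← cls2_reparam_cut h1 h1.reparam_cut, ← cls2_reparam_cut h2 h2.reparam_cut]
  refine (hl.eq_hol hp _ (src_line (h1.glue_zero h2) fun _ _ => rfl)).symm.trans ?_
  rw [hl2.eq_hol hp _ (src_line h2.reparam_cut fun _ _ => rfl),
    hl1.eq_hol hp _ (src_line h1.reparam_cut fun _ _ => rfl)]
  rfl

lemma P2.holC_src_mul (g : P2 L y z) (h : P2 L x y) (c : C x) :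
    (P2.mul g h).src.holC R c = g.src.holC R (h.src.holC R c) := by
  induction g using P2.ind with | _ κ₂ h2
  induction h using P2.ind with | _ κ₁ h1
  have hp := vec2_mem_cube zero_mem_I zero_mem_I
  have hl := lineLift_zero (R := R) (i := 1) hp _ (src_line (h1.glue_zero h2) fun _ _ => rfl) c
  obtain ⟨e', c', hl1, hl2⟩ := hl.split h1 h2 (by decide) hp
  rw [mul_cls2, ← cls2_reparam_cut h1 h1.reparam_cut, ← cls2_reparam_cut h2 h2.reparam_cut]
  obtain ⟨rfl, rfl⟩ := hl1.unique hp
    (lineLift_zero hp _ (src_line h1.reparam_cut fun _ _ => rfl) c)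
  exact (hl2.unique hp (lineLift_zero hp _ (src_line h2.reparam_cut fun _ _ => rfl) _)).2

end Products

end Multiplicativity

section Holonomy

variable {R : RepUpToHomotopy L d} {x y z : M}

lemma snd_eq_zero_of_scale {p q : TotalSpace FA A} (h : p = scale 0 q) : p.snd = 0 := by
  subst h
  exact zero_smul ℝ q.snd

/-- Reparametrization of a square in `s` by `f` and in `t` by `cut`. -/
def stagger (κ : CubeMorphism L 2) (f : ℝ → ℝ) (hf : ContDiff ℝ ∞ f)
    (hm : ∀ t, f t ∈ Icc (0 : ℝ) 1) : CubeMorphism L 2 :=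
  (κ.pull (reparam 1 f hf fun t _ => hm t)).pull
    (reparam 0 cut contDiff_cut fun _ _ => cut_mem _)

section Stagger

variable {κ : CubeMorphism L 2} {f : ℝ → ℝ} (hf : ContDiff ℝ ∞ f) (hm : ∀ t, f t ∈ Icc (0 : ℝ) 1)

lemma stagger_comp_zero (t s : ℝ) : (stagger κ f hf hm).comp 0 ![t, s]
    = scale (deriv cut t) (κ.comp 0 ![cut t, f s]) := by
  rw [stagger, pull_reparam_comp, pull_reparam_comp, if_pos rfl, if_neg (by decide), scale_one,
    update_vec2_zero, update_vec2_one]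
  rfl

lemma stagger_vec_one {s : ℝ} (h : deriv f s = 0) (t : ℝ) :
    (stagger κ f hf hm).vec 1 (Function.update ![0, s] 0 t) = 0 := by
  refine snd_eq_zero_of_scale (p := (stagger κ f hf hm).comp 1 (Function.update ![0, s] 0 t))
    (q := κ.comp 1 ![cut t, f s]) ?_
  rw [update_vec2_zero, stagger, pull_reparam_comp, pull_reparam_comp, if_pos rfl,
    if_neg (by decide), scale_one, update_vec2_zero, update_vec2_one]
  exact congrArg (scale · _) h

lemma LineLift.stagger_eq_zero {s : ℝ} (hs : s ∈ Icc (0 : ℝ) 1) (h : deriv f s = 0) {e : E x}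
    {e' : E y} {c' : C y} (hl : LineLift R (stagger κ f hf hm) 1 ![0, s] e 0 e' c') : c' = 0 :=
  hl.eq_zero (vec2_mem_cube zero_mem_I hs) fun r _ ε => by
    rw [stagger_vec_one hf hm h, map_zero]

end Stagger

lemma deriv_lf {s : ℝ} (hs : 1 / 2 ≤ s) : deriv lf s = 0 :=
  (Filter.EventuallyEq.deriv_eq (f := fun _ => 1)
    (lf_eventually (f := id) continuousAt_id hs)).trans (deriv_const _ _)

lemma deriv_hf {s : ℝ} (hs : s ≤ 1 / 2) : deriv hf s = 0 :=
  (Filter.EventuallyEq.deriv_eq (f := fun _ => 0)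
    (hf_eventually (f := id) continuousAt_id hs)).trans (deriv_const _ _)

lemma P2.hol₂_mul (g : P2 L y z) (h : P2 L x y) (e : E x) :
    (P2.mul g h).hol₂ R e = g.hol₂ R (h.src.holE R e) + g.tgt.holC R (h.hol₂ R e) := by
  induction g using P2.ind with | _ κ₂ h2
  induction h using P2.ind with | _ κ₁ h1
  rw [← cls2_reparam_one_id h1 contDiff_hf (fun t _ => hf_mem t) hf_zero hf_one,
    ← cls2_reparam_one_id h2 contDiff_lf (fun t _ => lf_mem t) lf_zero lf_one, mul_cls2,
    ← cls2_reparam_cut _ (h1.reparam_one _ _).reparam_cut,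
    ← cls2_reparam_cut _ (h2.reparam_one _ _).reparam_cut]
  have hB1 : Bdy (stagger κ₁ hf contDiff_hf hf_mem) x y := (h1.reparam_one _ _).reparam_cut
  have hB2 : Bdy (stagger κ₂ lf contDiff_lf lf_mem) y z := (h2.reparam_one _ _).reparam_cut
  change _ = (cls2 (stagger κ₂ lf contDiff_lf lf_mem) hB2).hol₂ R
      ((cls2 (stagger κ₁ hf contDiff_hf hf_mem) hB1).src.holE R e)
    + (cls2 (stagger κ₂ lf contDiff_lf lf_mem) hB2).tgt.holC R
      ((cls2 (stagger κ₁ hf contDiff_hf hf_mem) hB1).hol₂ R e)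
  set ē := (cls2 (stagger κ₁ hf contDiff_hf hf_mem) hB1).src.holE R e
  set Φ := (cls2 (stagger κ₂ lf contDiff_lf lf_mem) hB2).tgt.holC R
  have k1 := h1.reparam_one contDiff_hf fun t _ => hf_mem t
  have k2 := h2.reparam_one contDiff_lf fun t _ => lf_mem t
  have hB := k1.glue_zero k2
  choose! u c hc using fun s (hs : s ∈ Icc (0 : ℝ) 1) => exists_lineLift_cls2 (R := R) hB1 e hs
  choose! v T hT using fun s (hs : s ∈ Icc (0 : ℝ) 1) => exists_lineLift_cls2 (R := R) hB2 ē hs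
  have key : ∀ s ∈ Icc (0 : ℝ) 1, ∃ e' : E z,
      LineLift R (glue 0 _ _ (k1.match_zero k2)) 1 ![0, s] e 0 e' (T s + Φ (c s)) := by
    intro s hs
    have hp := vec2_mem_cube zero_mem_I hs
    obtain ⟨e'', c'', hl⟩ := exists_lineLift_cls2 (R := R) hB e hs
    obtain ⟨e', c', hl1, hl2⟩ := hl.split k1 k2 (by decide) hp
    obtain ⟨rfl, rfl⟩ := hl1.unique hp (hc s hs)
    suffices h : c'' = T s + Φ (c s) from ⟨e'', h ▸ hl⟩
    rcases le_total s (1 / 2) with h | h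
    · have h0 : c s = 0 := LineLift.stagger_eq_zero _ _ hs (deriv_hf h) (hc s hs)
      have h1 : u s = ē := (hc s hs).eq_hol hp _ (src_line hB1 fun r _ => by
        rw [stagger_comp_zero, stagger_comp_zero, hf_eq_zero h, hf_zero])
      rw [h0, h1] at hl2
      rw [h0, map_zero, add_zero]
      exact (hl2.unique hp (hT s hs)).2
    · have h0 : T s = 0 := LineLift.stagger_eq_zero _ _ hs (deriv_lf h) (hT s hs)
      obtain ⟨e₂, c₂, h₂⟩ := exists_lineLift_cls2 (R := R) hB2 (u s) hs
      obtain rfl := LineLift.stagger_eq_zero _ _ hs (deriv_lf h) h₂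
      have h₃ := h₂.add (lineLift_zero hp _ (tgt_line hB2 fun r _ => by
        rw [stagger_comp_zero, stagger_comp_zero, lf_eq_one h, lf_one]) (c s))
      rw [add_zero, zero_add] at h₃
      rw [h0]
      exact (hl2.unique hp h₃).2
  refine eq_of_forall_dual (EM := EM) FC fun ξ => ?_
  have i1 := dual_hol₂_cls2 hB2 (fun s hs => ⟨_, hT s hs⟩) (ξ z : C z →L[ℝ] ℝ).toLinearMap
  have i2 := dual_hol₂_cls2 hB1 (fun s hs => ⟨_, hc s hs⟩)
    ((ξ z : C z →L[ℝ] ℝ).toLinearMap ∘ₗ Φ)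
  refine (dual_hol₂_cls2 hB key (ξ z : C z →L[ℝ] ℝ).toLinearMap).2.trans
    (Eq.trans ?_ (map_add (ξ z : C z →L[ℝ] ℝ) _ _).symm)
  refine Eq.trans ?_ (congrArg₂ (· + ·) i1.2 i2.2).symm
  rw [← intervalIntegral.integral_add (i1.1.intervalIntegrable_of_Icc zero_le_one)
    (i2.1.intervalIntegrable_of_Icc zero_le_one)]
  simp only [map_add]
  rfl

lemma P1.holE_mul (g : P1 L y z) (h : P1 L x y) (e : E x) :
    (P1.mul g h).holE R e = g.holE R (h.holE R e) := by
  rw [P1.mul, P2.holE_src_mul, P1.src_id, P1.src_id]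

lemma P1.holC_mul (g : P1 L y z) (h : P1 L x y) (c : C x) :
    (P1.mul g h).holC R c = g.holC R (h.holC R c) := by
  rw [P1.mul, P2.holC_src_mul, P1.src_id, P1.src_id]

lemma P1.holE_unit (e : E x) : (P1.unit L x).holE R e = e :=
  P1.holE_injective (P1.unit L x) (by rw [← P1.holE_mul, P1.unit_mul])

lemma P1.holC_unit (c : C x) : (P1.unit L x).holC R c = c :=
  P1.holC_injective (P1.unit L x) (by rw [← P1.holC_mul, P1.unit_mul])

lemma P1.holE_inv_apply (g : P1 L x y) (e : E x) : (P1.inv g).holE R (g.holE R e) = e := by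
  rw [← P1.holE_mul, P1.inv_mul, P1.holE_unit]

lemma P1.holC_apply_inv (g : P1 L x y) (c : C y) : g.holC R ((P1.inv g).holC R c) = c := by
  rw [← P1.holC_mul, P1.mul_inv, P1.holC_unit]

lemma P2.hol₂_vmul {g h : P2 L x y} (hgh : g.src = h.tgt) (e : E x) :
    (P2.vmul g h).hol₂ R e = g.hol₂ R e + h.hol₂ R e := by
  have hc : (P2.mul (P2.inv h.tgt.id) h).hol₂ R e = (P1.inv h.tgt).holC R (h.hol₂ R e) := by
    rw [← P1.id_inv, P2.hol₂_mul, P1.hol₂_id, P1.tgt_id, zero_add]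
  have he : (P2.mul (P2.inv h.tgt.id) h).src.holE R e
      = e - d x ((P1.inv h.tgt).holC R (h.hol₂ R e)) := by
    rw [← P1.id_inv, P2.holE_src_mul, P1.src_id, P1.map_holC, P2.map_hol₂, map_sub,
      P1.holE_inv_apply, sub_sub_cancel]
  rw [P2.vmul, P2.hol₂_mul, hc, he, map_sub, P2.hol₂_map, hgh, P1.holC_apply_inv]
  abel

lemma P2.hol₂_vinv (g : P2 L x y) (e : E x) : (P2.vinv g).hol₂ R e = -g.hol₂ R e := by
  have h := P2.hol₂_vmul (R := R) (P2.tgt_vinv g).symm e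
  rw [P2.vmul_vinv, P1.hol₂_id] at h
  exact (neg_eq_of_add_eq_zero_right h.symm).symm

end Holonomy

section Concatenations

variable {L : LieAlgebroid EM FA A} {x y z : M}

theorem isVertConcat_halves {W : CubeMorphism L 2} {a₀ a₁ a₂ : APath L x y}
    {σ' : AHomotopy a₁ a₂} {σ : AHomotopy a₀ a₁} {ρ : AHomotopy a₀ a₂}
    (hσ' : σ'.mor = W.pull (aff 1 half_mem_I one_mem_I))
    (hσ : σ.mor = W.pull (aff 1 zero_mem_I half_mem_I)) (hρ : ρ.mor = W) :
    IsVertConcat σ' σ ρ := by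
  constructor <;> intro t _ s _ <;>
    simp only [AHomotopy.a, AHomotopy.b, hσ, hσ', hρ, pull_aff_comp, scale_scale,
      update_vec2_one, if_neg (show (0 : Fin 2) ≠ 1 by decide), if_true, scale_one]
  · have e : (1 - ![t, 2 * s] 1) * 0 + ![t, 2 * s] 1 * (1 / 2) = s := by
      simp
      ring
    rw [e, show (2 * (1 / 2 - 0) : ℝ) = 1 by norm_num, scale_one]
    exact ⟨rfl, rfl⟩
  · have e : (1 - ![t, 2 * s - 1] 1) * (1 / 2) + ![t, 2 * s - 1] 1 * 1 = s := by
      simp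
      ring
    rw [e, show (2 * (1 - 1 / 2) : ℝ) = 1 by norm_num, scale_one]
    exact ⟨rfl, rfl⟩

theorem isHorizConcat_halves {W : CubeMorphism L 2} {a₀ a₁ : APath L x y} {b₀ b₁ : APath L y z}
    {c₀ c₁ : APath L x z} {σ : AHomotopy b₀ b₁} {τ : AHomotopy a₀ a₁} {ρ : AHomotopy c₀ c₁}
    (hσ : σ.mor = W.pull (aff 0 half_mem_I one_mem_I))
    (hτ : τ.mor = W.pull (aff 0 zero_mem_I half_mem_I)) (hρ : ρ.mor = W) :
    IsHorizConcat σ τ ρ := by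
  constructor <;> intro t _ s _ <;>
    simp only [AHomotopy.a, AHomotopy.b, hσ, hτ, hρ, pull_aff_comp, scale_scale,
      update_vec2_zero, if_neg (show (1 : Fin 2) ≠ 0 by decide), if_true, scale_one]
  · have e : (1 - ![2 * t, s] 0) * 0 + ![2 * t, s] 0 * (1 / 2) = t := by
      simp
      ring
    rw [e, show (2 * (1 / 2 - 0) : ℝ) = 1 by norm_num, scale_one]
    exact ⟨rfl, rfl⟩
  · have e : (1 - ![2 * t - 1, s] 0) * (1 / 2) + ![2 * t - 1, s] 0 * 1 = t := by
      simp
      ring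
    rw [e, show (2 * (1 - 1 / 2) : ℝ) = 1 by norm_num, scale_one]
    exact ⟨rfl, rfl⟩

theorem exists_isVertConcat {g h : P2 L x y} (hgh : g.src = h.tgt) :
    ∃ (a₀ a₁ a₂ : APath L x y) (σ' : AHomotopy a₁ a₂) (σ : AHomotopy a₀ a₁) (ρ : AHomotopy a₀ a₂),
      σ'.cls = g ∧ σ.cls = h ∧ IsVertConcat σ' σ ρ := by
  obtain ⟨W, hB, -, e1, e0⟩ := exists_shift h (P2.mul (P2.inv h.tgt.id) g)
  rw [P2.mul_inv_cancel_left] at e1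
  rw [P2.src_mul, P2.src_inv, P1.src_id, hgh, P1.inv_mul, P1.id_unit, P2.mul_unit] at e0
  have hl := hB.aff_one zero_mem_I half_mem_I
  have hu := hB.aff_one half_mem_I one_mem_I
  refine ⟨toPath _ hB.edge₀, toPath _ hl.edge₁, toPath _ hB.edge₁,
    toHomotopy _ hu (((sameOn_pull_pull _ _ _).trans (sameOn_pull_congr _ fun p _ => ?_)).trans
      (sameOn_pull_pull _ _ _).symm)
      ((sameOn_pull_pull _ _ _).trans (sameOn_pull_congr _ fun p _ => ?_)),
    toHomotopy _ hl ((sameOn_pull_pull _ _ _).trans (sameOn_pull_congr _ fun p _ => ?_))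
      (SameOn.refl _),
    toHomotopy _ hB (SameOn.refl _) (SameOn.refl _), ?_, ?_, isVertConcat_halves rfl rfl rfl⟩
  · change aff 1 half_mem_I one_mem_I (edge₀ p) = aff 1 zero_mem_I half_mem_I (edge₁ p)
    rw [aff_apply, aff_apply, edge₀_apply, edge₁_apply, update_vec2_one, update_vec2_one]
    simp
  · change aff 1 half_mem_I one_mem_I (edge₁ p) = edge₁ p
    rw [aff_apply, edge₁_apply, update_vec2_one]
    simp
  · change aff 1 zero_mem_I half_mem_I (edge₀ p) = edge₀ p
    rw [aff_apply, edge₀_apply, update_vec2_one]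
    simp
  · rw [AHomotopy.cls_eq]
    exact e1
  · rw [AHomotopy.cls_eq]
    exact e0

theorem exists_isHorizConcat (g : P2 L y z) (h : P2 L x y) :
    ∃ (b₀ b₁ : APath L y z) (a₀ a₁ : APath L x y) (c₀ c₁ : APath L x z) (σ : AHomotopy b₀ b₁)
      (τ : AHomotopy a₀ a₁) (ρ : AHomotopy c₀ c₁),
      σ.cls = g ∧ τ.cls = h ∧ IsHorizConcat σ τ ρ := by
  induction g using P2.ind with | _ κ₂ h2
  induction h using P2.ind with | _ κ₁ h1
  have hm := h1.match_zero h2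
  have h1' := h1.reparam_cut.congr (sameOn_glue_fst hm).symm
  have h2' := h2.reparam_cut.congr (sameOn_glue_snd hm).symm
  refine ⟨_, _, _, _, _, _, toHomotopy _ h2' (a₀ := toPath _ h2'.edge₀) (a₁ := toPath _ h2'.edge₁)
      (SameOn.refl _) (SameOn.refl _),
    toHomotopy _ h1' (a₀ := toPath _ h1'.edge₀) (a₁ := toPath _ h1'.edge₁)
      (SameOn.refl _) (SameOn.refl _),
    toHomotopy _ (h1.glue_zero h2) (a₀ := toPath _ (h1.glue_zero h2).edge₀)
      (a₁ := toPath _ (h1.glue_zero h2).edge₁) (SameOn.refl _) (SameOn.refl _), ?_, ?_,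
    isHorizConcat_halves rfl rfl rfl⟩
  · exact ((sameOn_glue_snd hm).cls_eq h2' h2.reparam_cut).trans (cls2_reparam_cut h2 _)
  · exact ((sameOn_glue_fst hm).cls_eq h1' h1.reparam_cut).trans (cls2_reparam_cut h1 _)

theorem IsHorizConcat.isConcat {a₀ a₁ : APath L x y} {b₀ b₁ : APath L y z} {c₀ c₁ : APath L x z}
    {σ : AHomotopy b₀ b₁} {τ : AHomotopy a₀ a₁} {ρ : AHomotopy c₀ c₁} (h : IsHorizConcat σ τ ρ) :
    IsConcat b₀ a₀ c₀ := by
  constructor <;> intro t ht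
  · rw [← ρ.source t ⟨ht.1, by linarith [ht.2]⟩,
      ← τ.source (2 * t) ⟨by linarith [ht.1], by linarith [ht.2]⟩]
    exact (h.1 t ht 0 zero_mem_I).1
  · rw [← ρ.source t ⟨by linarith [ht.1], ht.2⟩,
      ← σ.source (2 * t - 1) ⟨by linarith [ht.1], by linarith [ht.2]⟩]
    exact (h.2 t ht 0 zero_mem_I).1

theorem exists_isConcat (g : P1 L y z) (h : P1 L x y) :
    ∃ (b : APath L y z) (a : APath L x y) (c : APath L x z),
      b.cls = g ∧ a.cls = h ∧ IsConcat b a c := by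
  obtain ⟨b, _, a, _, c, _, σ, τ, ρ, hσ, hτ, hc⟩ := exists_isHorizConcat g.id h.id
  refine ⟨b, a, c, ?_, ?_, hc.isConcat⟩
  · rw [← src_cls σ, hσ, P1.src_id]
  · rw [← src_cls τ, hτ, P1.src_id]

theorem exists_isUnitPath (x : M) : ∃ a : APath L x x, IsUnitPath a :=
  ⟨toPath _ (unitCube_bdy 0 x), fun _ _ => rfl⟩

theorem exists_isHorizUnit (x : M) :
    ∃ (a₀ a₁ : APath L x x) (θ : AHomotopy a₀ a₁), IsHorizUnit θ :=
  ⟨_, _, toHomotopy _ (unitCube_bdy (L := L) 1 x) (a₀ := toPath _ (unitCube_bdy 1 x).edge₀)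
    (a₁ := toPath _ (unitCube_bdy 1 x).edge₁) (SameOn.refl _) (SameOn.refl _),
    fun _ _ _ _ => ⟨rfl, rfl⟩⟩

theorem exists_isInvPath (a : APath L x y) : ∃ a' : APath L y x, IsInvPath a a' :=
  ⟨toPath _ a.bdy.flip, fun t _ => by
    refine (pull_flip_comp a.mor 0 0 ![t]).trans ?_
    rw [if_pos rfl, update_vec1]
    rfl⟩

theorem exists_isHorizInv {a₀ a₁ : APath L x y} (σ : AHomotopy a₀ a₁) :
    ∃ (a₀' a₁' : APath L y x) (σ' : AHomotopy a₀' a₁'), IsHorizInv σ σ' :=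
  ⟨_, _, toHomotopy _ σ.bdy.flip (a₀ := toPath _ σ.bdy.flip.edge₀)
    (a₁ := toPath _ σ.bdy.flip.edge₁) (SameOn.refl _) (SameOn.refl _), fun t _ s _ => by
    refine ⟨(pull_flip_comp σ.mor 0 0 ![t, s]).trans ?_,
      (pull_flip_comp σ.mor 0 1 ![t, s]).trans ?_⟩
    · rw [if_pos rfl, update_vec2_zero]
      rfl
    · rw [if_neg (by decide), update_vec2_zero, scale_one]
      rfl⟩

theorem exists_isVertInv {a₀ a₁ : APath L x y} (σ : AHomotopy a₀ a₁) :
    ∃ σ' : AHomotopy a₁ a₀, IsVertInv σ σ' := by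
  refine ⟨toHomotopy (σ.mor.pull (flip 1)) (σ.bdy.reparam_one _ _)
    ((((sameOn_pull_pull _ _ _).trans (sameOn_pull_congr _ fun p _ => ?_))).trans σ.sameOn_edge₁)
    ((((sameOn_pull_pull _ _ _).trans (sameOn_pull_congr _ fun p _ => ?_))).trans σ.sameOn_edge₀),
    fun t _ s _ => ⟨(pull_flip_comp σ.mor 1 0 ![t, s]).trans ?_,
      (pull_flip_comp σ.mor 1 1 ![t, s]).trans ?_⟩⟩
  · change flip 1 (edge₀ p) = edge₁ p
    rw [flip_apply, edge₀_apply, edge₁_apply, update_vec2_one]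
    simp
  · change flip 1 (edge₁ p) = edge₀ p
    rw [flip_apply, edge₀_apply, edge₁_apply, update_vec2_one]
    simp
  · rw [if_neg (by decide), update_vec2_one, scale_one]
    rfl
  · rw [if_pos rfl, update_vec2_one]
    rfl

end Concatenations

section Transformation

variable (R : RepUpToHomotopy L d)

lemma Trans1.ext' {x y : M} {c c' : C y} {a a' : P1 L x y} {e e' : E x} (hc : c = c') (ha : a = a')
    (he : e = e') : (⟨x, y, c, a, e⟩ : Trans1 L C E) = ⟨x, y, c', a', e'⟩ := by
  subst hc ha he
  rfl

lemma Trans2.ext' {x y : M} {c c' : C y} {a a' : P2 L x y} {e e' : E x} (hc : c = c') (ha : a = a')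
    (he : e = e') : (⟨x, y, c, a, e⟩ : Trans2 L C E) = ⟨x, y, c', a', e'⟩ := by
  subst hc ha he
  rfl

/-- The groupoid of triples `(c, a, e)` with `a` in `P₁(A)`. -/
def transCells : GroupoidOn (TotalSpace FE E) (Trans1 L C E) where
  src g := ⟨g.x, g.e⟩
  tgt g := ⟨g.y, g.a.holE R g.e + d g.y g.c⟩
  one p := ⟨p.proj, p.proj, 0, P1.unit L p.proj, p.snd⟩
  inv g := ⟨g.y, g.x, -(P1.inv g.a).holC R g.c, P1.inv g.a, g.a.holE R g.e + d g.y g.c⟩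
  comp g h p :=
    have hxy : g.x = h.y := congrArg TotalSpace.proj p
    ⟨h.x, g.y, g.c + P1.holC R (hxy ▸ g.a) h.c, P1.mul (hxy ▸ g.a) h.a, h.e⟩
  src_one _ := rfl
  tgt_one p := by
    obtain ⟨x, e⟩ := p
    simp only [P1.holE_unit, map_zero, add_zero]
  src_comp _ _ _ := rfl
  tgt_comp := by
    rintro ⟨y, z, c, g, e⟩ ⟨x, y', b, h, f⟩ p
    obtain rfl : y = y' := congrArg TotalSpace.proj p
    obtain rfl : e = _ := snd_eq_of_mk_eq p
    simp only [P1.holE_mul, map_add, P1.map_holC]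
    congr 1
    abel
  src_inv _ := rfl
  tgt_inv := by
    rintro ⟨x, y, c, g, e⟩
    simp only [map_add, map_neg, P1.holE_inv_apply, P1.map_holC, add_neg_cancel_right]
  assoc := by
    rintro ⟨z, w, c₃, g₃, e₃⟩ ⟨y, z', c₂, g₂, e₂⟩ ⟨x, y', c₁, g₁, e₁⟩ p q p' q'
    obtain rfl : z = z' := congrArg TotalSpace.proj p
    obtain rfl : y = y' := congrArg TotalSpace.proj p'
    exact Trans1.ext' (by simp only [map_add, P1.holC_mul, add_assoc]) (P1.mul_assoc ..) rfl
  one_comp := by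
    rintro ⟨x, y, c, g, e⟩ p
    exact Trans1.ext' (by simp only [P1.holC_unit, zero_add]) (P1.unit_mul g) rfl
  comp_one := by
    rintro ⟨x, y, c, g, e⟩ p
    exact Trans1.ext' (by simp only [map_zero, add_zero]) (P1.mul_unit g) rfl
  inv_comp := by
    rintro ⟨x, y, c, g, e⟩ p
    exact Trans1.ext' (neg_add_cancel _) (P1.inv_mul g) rfl
  comp_inv := by
    rintro ⟨x, y, c, g, e⟩ p
    exact Trans1.ext' (by simp only [map_neg, P1.holC_apply_inv, add_neg_cancel])
      (P1.mul_inv g) rfl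

/-- The horizontal groupoid of triples `(c, σ, e)` with `σ` in `P₂(A)`. -/
def transHoriz : GroupoidOn (TotalSpace FE E) (Trans2 L C E) where
  src g := ⟨g.x, g.e⟩
  tgt g := ⟨g.y, g.σ.src.holE R g.e + d g.y g.c⟩
  one p := ⟨p.proj, p.proj, 0, P2.unit L p.proj, p.snd⟩
  inv g := ⟨g.y, g.x, -(P1.inv g.σ.src).holC R g.c, P2.inv g.σ,
    g.σ.src.holE R g.e + d g.y g.c⟩
  comp g h p :=
    have hxy : g.x = h.y := congrArg TotalSpace.proj p
    ⟨h.x, g.y, g.c + P1.holC R (P2.src (hxy ▸ g.σ)) h.c, P2.mul (hxy ▸ g.σ) h.σ, h.e⟩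
  src_one _ := rfl
  tgt_one p := (transCells R).tgt_one p
  src_comp _ _ _ := rfl
  tgt_comp := by
    rintro ⟨y, z, c, g, e⟩ ⟨x, y', b, h, f⟩ p
    obtain rfl : y = y' := congrArg TotalSpace.proj p
    simp only [P2.src_mul]
    exact (transCells R).tgt_comp ⟨y, z, c, g.src, e⟩ ⟨x, y, b, h.src, f⟩ p
  src_inv _ := rfl
  tgt_inv := by
    rintro ⟨x, y, c, g, e⟩
    simp only [P2.src_inv]
    exact (transCells R).tgt_inv ⟨x, y, c, g.src, e⟩
  assoc := by
    rintro ⟨z, w, c₃, g₃, e₃⟩ ⟨y, z', c₂, g₂, e₂⟩ ⟨x, y', c₁, g₁, e₁⟩ p q p' q'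
    obtain rfl : z = z' := congrArg TotalSpace.proj p
    obtain rfl : y = y' := congrArg TotalSpace.proj p'
    exact Trans2.ext' (by simp only [P2.src_mul, map_add, P1.holC_mul, add_assoc])
      (P2.mul_assoc ..) rfl
  one_comp := by
    rintro ⟨x, y, c, g, e⟩ p
    refine Trans2.ext' ?_ (P2.unit_mul g) rfl
    exact (zero_add _).trans (P1.holC_unit c)
  comp_one := by
    rintro ⟨x, y, c, g, e⟩ p
    exact Trans2.ext' (by simp only [map_zero, add_zero]) (P2.mul_unit g) rfl
  inv_comp := by
    rintro ⟨x, y, c, g, e⟩ p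
    exact Trans2.ext' (by simp only [P2.src_inv, neg_add_cancel]) (P2.inv_mul g) rfl
  comp_inv := by
    rintro ⟨x, y, c, g, e⟩ p
    exact Trans2.ext' (by simp only [map_neg, P1.holC_apply_inv, add_neg_cancel])
      (P2.mul_inv g) rfl

lemma Trans1.eq_of_mk_eq {x y : M} {c c' : C y} {a a' : P1 L x y} {e e' : E x}
    (h : (⟨x, y, c, a, e⟩ : Trans1 L C E) = ⟨x, y, c', a', e'⟩) : c = c' ∧ a = a' ∧ e = e' := by
  simpa only [Trans1.mk.injEq, heq_eq_eq, true_and] using h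

/-- The vertical groupoid of triples `(c, σ, e)` with `σ` in `P₂(A)`. -/
def transVert : GroupoidOn (Trans1 L C E) (Trans2 L C E) where
  src g := ⟨g.x, g.y, g.c, g.σ.src, g.e⟩
  tgt g := ⟨g.x, g.y, g.c - g.σ.hol₂ R g.e, g.σ.tgt, g.e⟩
  one g := ⟨g.x, g.y, g.c, g.a.id, g.e⟩
  inv g := ⟨g.x, g.y, g.c - g.σ.hol₂ R g.e, P2.vinv g.σ, g.e⟩
  comp g h p :=
    have hx : g.x = h.x := congrArg Trans1.x p
    have hy : g.y = h.y := congrArg Trans1.y p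
    ⟨h.x, h.y, h.c, P2.vmul (hx ▸ hy ▸ g.σ) h.σ, h.e⟩
  src_one g := Trans1.ext' rfl (P1.src_id g.a) rfl
  tgt_one g := Trans1.ext' (by rw [P1.hol₂_id, sub_zero]) (P1.tgt_id g.a) rfl
  src_comp := by
    rintro ⟨x, y, c, g, e⟩ ⟨x', y', c', h, e'⟩ p
    obtain rfl : x = x' := congrArg Trans1.x p
    obtain rfl : y = y' := congrArg Trans1.y p
    exact Trans1.ext' rfl (P2.src_vmul (Trans1.eq_of_mk_eq p).2.1) rfl
  tgt_comp := by
    rintro ⟨x, y, c, g, e⟩ ⟨x', y', c', h, e'⟩ p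
    obtain rfl : x = x' := congrArg Trans1.x p
    obtain rfl : y = y' := congrArg Trans1.y p
    obtain ⟨hc, hgh, he⟩ := Trans1.eq_of_mk_eq p
    refine Trans1.ext' ?_ (P2.tgt_vmul g h) he.symm
    change c = c' - h.hol₂ R e' at hc
    change e = e' at he
    change c' - (P2.vmul g h).hol₂ R e' = c - g.hol₂ R e
    rw [P2.hol₂_vmul hgh, hc, he]
    abel
  src_inv g := Trans1.ext' rfl (P2.src_vinv g.σ) rfl
  tgt_inv g := Trans1.ext' (by rw [P2.hol₂_vinv, sub_neg_eq_add, sub_add_cancel]) (P2.tgt_vinv g.σ) rfl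
  assoc := by
    rintro ⟨x, y, c, g, e⟩ ⟨x', y', c', h, e'⟩ ⟨x'', y'', c'', k, e''⟩ p q p' q'
    obtain rfl : x = x' := congrArg Trans1.x p
    obtain rfl : y = y' := congrArg Trans1.y p
    obtain rfl : x = x'' := congrArg Trans1.x q
    obtain rfl : y = y'' := congrArg Trans1.y q
    exact Trans2.ext' rfl (P2.vmul_assoc ..) rfl
  one_comp g _ := Trans2.ext' rfl (P2.id_vmul g.σ) rfl
  comp_one g _ := Trans2.ext' rfl (P2.vmul_id g.σ) rfl
  inv_comp g _ := Trans2.ext' rfl (P2.vinv_vmul g.σ) rfl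
  comp_inv g _ := Trans2.ext' rfl (P2.vmul_vinv g.σ) rfl

/-- The transformation 2-groupoid `2-P(A) ⋉ ℰ`. -/
def transformation : Strict2Groupoid (TotalSpace FE E) (Trans1 L C E) (Trans2 L C E) where
  cells := transCells R
  vert := transVert R
  horiz := transHoriz R
  horiz_src _ := rfl
  horiz_src' _ := rfl
  horiz_tgt _ := rfl
  horiz_tgt' := by
    rintro ⟨x, y, c, g, e⟩
    refine congrArg (TotalSpace.mk y) ?_
    change g.src.holE R e + d y c = g.tgt.holE R e + d y (c - g.hol₂ R e)
    rw [map_sub, P2.map_hol₂]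
    abel
  vert_src_comp := by
    rintro ⟨y, z, c, g, e⟩ ⟨x, y', b, h, f⟩ p q
    obtain rfl : y = y' := congrArg TotalSpace.proj p
    exact Trans1.ext' rfl (P2.src_mul g h) rfl
  vert_tgt_comp := by
    rintro ⟨y, z, c, g, e⟩ ⟨x, y', b, h, f⟩ p q
    obtain rfl : y = y' := congrArg TotalSpace.proj p
    obtain rfl : e = _ := snd_eq_of_mk_eq p
    refine Trans1.ext' ?_ (P2.tgt_mul g h) rfl
    change c + g.src.holC R b - (P2.mul g h).hol₂ R f
      = c - g.hol₂ R (h.src.holE R f + d y b) + g.tgt.holC R (b - h.hol₂ R f)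
    rw [P2.hol₂_mul, map_add, map_sub, P2.hol₂_map]
    abel
  horiz_one p := Trans2.ext' rfl P1.id_unit.symm rfl
  horiz_comp_one := by
    rintro ⟨y, z, c, g, e⟩ ⟨x, y', b, h, f⟩ p q
    obtain rfl : y = y' := congrArg TotalSpace.proj p
    refine Trans2.ext' ?_ (P1.id_mul g h).symm rfl
    change c + g.id.src.holC R b = c + g.holC R b
    rw [P1.src_id]
  interchange := by
    rintro ⟨y₄, z₄, c₄, g₄, e₄⟩ ⟨y₃, z₃, c₃, g₃, e₃⟩ ⟨x₂, y₂, c₂, g₂, e₂⟩ ⟨x₁, y₁, c₁, g₁, e₁⟩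
      p q r p' q' r'
    obtain rfl : y₄ = y₃ := congrArg Trans1.x p
    obtain rfl : z₄ = z₃ := congrArg Trans1.y p
    obtain rfl : x₂ = x₁ := congrArg Trans1.x q
    obtain rfl : y₂ = y₁ := congrArg Trans1.y q
    obtain rfl : y₄ = y₂ := congrArg TotalSpace.proj r
    refine Trans2.ext' ?_ (P2.interchange g₄ g₃ g₂ g₁ (Trans1.eq_of_mk_eq q).2.1) rfl
    change c₃ + (P2.vmul g₄ g₃).src.holC R c₁ = c₃ + g₃.src.holC R c₁
    rw [P2.src_vmul (Trans1.eq_of_mk_eq p).2.1]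

theorem isTransformation_transformation : IsTransformation R (transformation R) where
  src _ _ _ := rfl
  tgt _ _ _ := rfl
  one _ _ h := Trans1.ext' rfl h.cls_eq.symm rfl
  inv c _ a' _ h := Trans1.ext' (congrArg (fun g => -P1.holC R g c) h.cls_eq.symm)
    h.cls_eq.symm rfl
  comp _ _ _ _ _ _ _ h _ := Trans1.ext' rfl h.cls_eq.symm rfl
  vert_src _ _ _ := rfl
  vert_tgt _ _ _ := rfl
  vert_one _ _ _ _ h := Trans2.ext' rfl h.cls_eq.symm rfl
  vert_inv _ _ _ _ h := Trans2.ext' rfl h.cls_eq.symm rfl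
  vert_comp _ _ _ _ _ _ _ h _ := Trans2.ext' rfl h.cls_eq.symm rfl
  horiz_src _ _ _ := rfl
  horiz_tgt _ _ _ := rfl
  horiz_one _ _ h := Trans2.ext' rfl h.cls_eq.symm rfl
  horiz_inv {_ _ a₀ _ a₀' _} c σ σ' _ h := Trans2.ext' (congrArg (fun g => -P1.holC R g c)
    (show P1.inv a₀.cls = a₀'.cls by
      rw [← src_cls σ, ← src_cls σ', h.cls_eq, P2.src_inv])) h.cls_eq.symm rfl
  horiz_comp _ _ _ _ _ _ _ h _ := Trans2.ext' rfl h.cls_eq.symm rfl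

end Transformation

lemma GroupoidOn.ext_of {X G : Type*} {g g' : GroupoidOn X G} (hs : ∀ a, g.src a = g'.src a)
    (ht : ∀ a, g.tgt a = g'.tgt a) (ho : ∀ x, g.one x = g'.one x) (hi : ∀ a, g.inv a = g'.inv a)
    (hc : ∀ a b p p', g.comp a b p = g'.comp a b p') : g = g' := by
  obtain ⟨s, t, o, i, c⟩ := g
  obtain ⟨s', t', o', i', c'⟩ := g'
  obtain rfl : s = s' := funext hs
  obtain rfl : t = t' := funext ht
  obtain rfl : o = o' := funext ho
  obtain rfl : i = i' := funext hi
  obtain rfl : c = c' := funext fun a => funext fun b => funext fun p => hc a b p p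
  rfl

lemma Strict2Groupoid.ext_of {X Y Z : Type*} {G G' : Strict2Groupoid X Y Z}
    (h1 : G.cells = G'.cells) (h2 : G.vert = G'.vert) (h3 : G.horiz = G'.horiz) : G = G' := by
  obtain ⟨c, v, h⟩ := G
  obtain ⟨c', v', h'⟩ := G'
  obtain rfl : c = c' := h1
  obtain rfl : v = v' := h2
  obtain rfl : h = h' := h3
  rfl

section Uniqueness

variable {R : RepUpToHomotopy L d}
  {G G' : Strict2Groupoid (TotalSpace FE E) (Trans1 L C E) (Trans2 L C E)}

lemma Trans1.ind {P : Trans1 L C E → Prop}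
    (h : ∀ (x y : M) (c : C y) (a : APath L x y) (e : E x), P (tri1 c a e)) (g : Trans1 L C E) :
    P g := by
  obtain ⟨x, y, c, a, e⟩ := g
  obtain ⟨a, rfl⟩ := Quot.exists_rep a
  exact h x y c a e

lemma Trans2.ind {P : Trans2 L C E → Prop}
    (h : ∀ (x y : M) (a₀ a₁ : APath L x y) (c : C y) (σ : AHomotopy a₀ a₁) (e : E x),
      P (tri2 c σ e)) (g : Trans2 L C E) : P g := by
  obtain ⟨x, y, c, σ, e⟩ := g
  obtain ⟨⟨a₀, a₁, σ⟩, rfl⟩ := Quot.exists_rep σ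
  exact h x y a₀ a₁ c σ e

lemma IsTransformation.cells_eq (h : IsTransformation R G) (h' : IsTransformation R G') :
    G.cells = G'.cells := by
  have hs : ∀ g, G.cells.src g = G'.cells.src g := fun g => by
    induction g using Trans1.ind with | _ x y c a e
    rw [h.src, h'.src]
  have ht : ∀ g, G.cells.tgt g = G'.cells.tgt g := fun g => by
    induction g using Trans1.ind with | _ x y c a e
    rw [h.tgt, h'.tgt]
  refine GroupoidOn.ext_of hs ht (fun p => ?_) (fun g => ?_) fun g k p p' => ?_
  · obtain ⟨x, e⟩ := p
    obtain ⟨a, ha⟩ := exists_isUnitPath (L := L) x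
    rw [h.one a e ha, h'.one a e ha]
  · induction g using Trans1.ind with | _ x y c a e
    obtain ⟨a', ha⟩ := exists_isInvPath a
    rw [h.inv c a a' e ha, h'.inv c a a' e ha]
  · obtain ⟨y, z, c, g, e⟩ := g
    obtain ⟨x, y', b, k, f⟩ := k
    obtain rfl : y = y' := by
      obtain ⟨a, rfl⟩ := Quot.exists_rep g
      obtain ⟨a', rfl⟩ := Quot.exists_rep k
      exact congrArg TotalSpace.proj ((h.src c a e).symm.trans (p.trans (h.tgt b a' f)))
    obtain ⟨a, a', a'', rfl, rfl, hc⟩ := exists_isConcat g k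
    exact (h.comp c a e b a' f a'' hc p).trans (h'.comp c a e b a' f a'' hc p').symm

lemma IsTransformation.vert_eq (h : IsTransformation R G) (h' : IsTransformation R G') :
    G.vert = G'.vert := by
  have hs : ∀ g, G.vert.src g = G'.vert.src g := fun g => by
    induction g using Trans2.ind with | _ x y a₀ a₁ c σ e
    rw [h.vert_src, h'.vert_src]
  have ht : ∀ g, G.vert.tgt g = G'.vert.tgt g := fun g => by
    induction g using Trans2.ind with | _ x y a₀ a₁ c σ e
    rw [h.vert_tgt, h'.vert_tgt]
  refine GroupoidOn.ext_of hs ht (fun g => ?_) (fun g => ?_) fun g k p p' => ?_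
  · induction g using Trans1.ind with | _ x y c a e
    have ha : IsVertUnit a a.one := fun t _ s _ => ⟨a.one_a t s, a.one_b t s⟩
    rw [h.vert_one c a e _ ha, h'.vert_one c a e _ ha]
  · induction g using Trans2.ind with | _ x y a₀ a₁ c σ e
    obtain ⟨σ', hσ⟩ := exists_isVertInv σ
    rw [h.vert_inv c σ σ' e hσ, h'.vert_inv c σ σ' e hσ]
  · obtain ⟨x, y, c, g, e⟩ := g
    obtain ⟨x', y', b, k, f⟩ := k
    have q : (⟨x, y, c, g.src, e⟩ : Trans1 L C E) = ⟨x', y', b - k.hol₂ R f, k.tgt, f⟩ := by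
      obtain ⟨σ, rfl⟩ := Quot.exists_rep g
      obtain ⟨τ, rfl⟩ := Quot.exists_rep k
      exact (h.vert_src c σ.htpy e).symm.trans (p.trans (h.vert_tgt b τ.htpy f))
    obtain rfl : x = x' := congrArg Trans1.x q
    obtain rfl : y = y' := congrArg Trans1.y q
    obtain ⟨a₀, a₁, a₂, σ', σ, ρ, rfl, rfl, hc⟩ :=
      exists_isVertConcat (Trans1.eq_of_mk_eq q).2.1
    exact (h.vert_comp c σ' e b σ f ρ hc p).trans (h'.vert_comp c σ' e b σ f ρ hc p').symm

lemma IsTransformation.horiz_eq (h : IsTransformation R G) (h' : IsTransformation R G') :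
    G.horiz = G'.horiz := by
  have hs : ∀ g, G.horiz.src g = G'.horiz.src g := fun g => by
    induction g using Trans2.ind with | _ x y a₀ a₁ c σ e
    rw [h.horiz_src, h'.horiz_src]
  have ht : ∀ g, G.horiz.tgt g = G'.horiz.tgt g := fun g => by
    induction g using Trans2.ind with | _ x y a₀ a₁ c σ e
    rw [h.horiz_tgt, h'.horiz_tgt]
  refine GroupoidOn.ext_of hs ht (fun p => ?_) (fun g => ?_) fun g k p p' => ?_
  · obtain ⟨x, e⟩ := p
    obtain ⟨a₀, a₁, θ, hθ⟩ := exists_isHorizUnit (L := L) x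
    rw [h.horiz_one θ e hθ, h'.horiz_one θ e hθ]
  · induction g using Trans2.ind with | _ x y a₀ a₁ c σ e
    obtain ⟨a₀', a₁', σ', hσ⟩ := exists_isHorizInv σ
    rw [h.horiz_inv c σ σ' e hσ, h'.horiz_inv c σ σ' e hσ]
  · obtain ⟨y, z, c, g, e⟩ := g
    obtain ⟨x, y', b, k, f⟩ := k
    obtain rfl : y = y' := by
      obtain ⟨σ, rfl⟩ := Quot.exists_rep g
      obtain ⟨τ, rfl⟩ := Quot.exists_rep k
      exact congrArg TotalSpace.proj
        ((h.horiz_src c σ.htpy e).symm.trans (p.trans (h.horiz_tgt b τ.htpy f)))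
    obtain ⟨b₀, b₁, a₀, a₁, c₀, c₁, σ, τ, ρ, rfl, rfl, hc⟩ := exists_isHorizConcat g k
    exact (h.horiz_comp c σ e b τ f ρ hc p).trans (h'.horiz_comp c σ e b τ f ρ hc p').symm

theorem IsTransformation.unique (h : IsTransformation R G) (h' : IsTransformation R G') : G = G' :=
  Strict2Groupoid.ext_of (h.cells_eq h') (h.vert_eq h') (h.horiz_eq h')

end Uniqueness

end Representation

end Algebroid

end TwoGroupoid

end

theorem theorem4
    {EM : Type*} [NormedAddCommGroup EM] [NormedSpace ℝ EM] [FiniteDimensional ℝ EM]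
    {M : Type*} [TopologicalSpace M] [ChartedSpace EM M] [IsManifold 𝓘(ℝ, EM) ∞ M]
    [T2Space M] [SecondCountableTopology M]
    {FA : Type*} [NormedAddCommGroup FA] [NormedSpace ℝ FA] [FiniteDimensional ℝ FA]
    {A : M → Type*} [TopologicalSpace (TotalSpace FA A)]
    [∀ x, AddCommGroup (A x)] [∀ x, Module ℝ (A x)] [∀ x, TopologicalSpace (A x)]
    [FiberBundle FA A] [VectorBundle ℝ FA A] [ContMDiffVectorBundle ∞ FA A 𝓘(ℝ, EM)]
    {FE : Type*} [NormedAddCommGroup FE] [NormedSpace ℝ FE] [FiniteDimensional ℝ FE]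
    {E : M → Type*} [TopologicalSpace (TotalSpace FE E)]
    [∀ x, AddCommGroup (E x)] [∀ x, Module ℝ (E x)] [∀ x, TopologicalSpace (E x)]
    [∀ x, IsTopologicalAddGroup (E x)] [∀ x, ContinuousSMul ℝ (E x)]
    [FiberBundle FE E] [VectorBundle ℝ FE E] [ContMDiffVectorBundle ∞ FE E 𝓘(ℝ, EM)]
    {FC : Type*} [NormedAddCommGroup FC] [NormedSpace ℝ FC] [FiniteDimensional ℝ FC]
    {C : M → Type*} [TopologicalSpace (TotalSpace FC C)]
    [∀ x, AddCommGroup (C x)] [∀ x, Module ℝ (C x)] [∀ x, TopologicalSpace (C x)]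
    [∀ x, IsTopologicalAddGroup (C x)] [∀ x, ContinuousSMul ℝ (C x)]
    [FiberBundle FC C] [VectorBundle ℝ FC C] [ContMDiffVectorBundle ∞ FC C 𝓘(ℝ, EM)]
    (L : TwoGroupoid.LieAlgebroid EM FA A) (d : TwoGroupoid.BundleMap EM FC C FE E)
    (R : TwoGroupoid.RepUpToHomotopy L d) :
    ∃! G : TwoGroupoid.Strict2Groupoid (TotalSpace FE E)
        (TwoGroupoid.Trans1 L C E) (TwoGroupoid.Trans2 L C E),
      TwoGroupoid.IsTransformation R G :=
  ⟨TwoGroupoid.transformation R, TwoGroupoid.isTransformation_transformation R,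
    fun _ h => h.unique (TwoGroupoid.isTransformation_transformation R)⟩
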